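/- **Setting.** Let $\mathcal{P}$ be a finite set of marked unit squares (the prototiles), with a base point chosen in the interior of each of them, and let $\mathcal{T}_0$ be an aperiodic and repetitive tiling of $\mathbb{R}^2$ by translates of elements of $\mathcal{P}$ touching face-to-face. Use the max-distance on $\mathbb{R}^2$. For a tiling $\mathcal{T}$ let $D_\mathcal{T}$ be the set of base points of its tiles. Let $\mathbb{X}$ be the continuous hull of $\mathcal{T}_0$, i.e. the closure of its translation orbit in the Gromov-Hausdorff topology, let $X=\{\mathcal{T}\in\mathbb{X} : 0\in D_{\mathcal{T}}\}$ be the total transversal, and let $\mathcal{R}=\{(\mathcal{T},\mathcal{T}-v) : \mathcal{T}\in X,\ v\in D_{\mathcal{T}}\}$ with its étale topology, which has the sets $\{(\mathcal{T},\mathcal{T}-v): \mathcal{T}\in A,\ v\in D_\mathcal{T}\}$ ($A\subset X$ open, $v$ fixed) as a basis. A *CEER* is an equivalence subrelation $\mathcal{E}\subset\mathcal{R}$ which is open in $\mathcal{R}$ and such that $\mathcal{E}-\Delta_X$ is compact; a relation is *AF* if it is the union of an increasing sequence of CEERs. The tile $\tau$ of $\mathcal{T}\in X$ with base point $v$ corresponds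 to $\mathcal{T}-v\in X$, so a subrelation $\mathcal{E}$ of $\mathcal{R}$ induces an equivalence relation on the tiles of $\mathcal{T}$; the *plaques* of $\mathcal{E}$ in $\mathcal{T}$ are the unions of the equivalence classes of tiles. **Tiles $\mathbb{P}'$.** Consider a set of non-overlapping squares of side $N$, with vertices at vertices of $\mathcal{T}$, such that there is no space for another one. * A square $\mathbb{Q}$ is a *neighbor* of $\mathbb{P}$ if, for some edge of $\mathbb{P}$, it is at minimal orthogonal distance from this edge among the squares lying over it (i.e. beyond the edge, with a segment of positive length as overlap in the direction of the edge). If $\mathbb{Q}$ is a neighbor of $\mathbb{P}$ or $\mathbb{P}$ is a neighbor of $\mathbb{Q}$, the union of the orthogonal segments between both edges is an *arm*, divided into two half-arms by its *axis*, the set of its points equidistant from $\mathbb{P}$ and $\mathbb{Q}$. If two squares meet just at a common corner, this point is also regarded as a (degenerate) arm. * A *cross* is a connected component $K$ of the complement of the union of all squares and arms. The middle points of the intersections of $\overline{K}$ with the arms are the *exit points* of $K$. Join the center of the bounding rectangle of $K$ with the exit points. This graph separates the interior of the bounding rectangle into *sectors*. A sector belongs to the square $\mathbb{P}$ if its closure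 meets $\mathbb{P}$ at a point of the boundary of the bounding rectangle which is not an exit point, or if its closure contains two distinct exit points given by arms of $\mathbb{P}$. * $\mathbb{P}'$ is the union of $\mathbb{P}$, of its half-arms, and of the closures of the intersections $\sigma\cap K$, where $\sigma$ is a sector of a cross $K$ which belongs to $\mathbb{P}$. **Robinson inflation.** Let $1=N_0<N_1<N_2<\cdots$ be integers with $N_{n+1}\ge N_n^3$. For each $n\ge 1$ let $C_n\subset X$ be a clopen set such that for every $\mathcal{T}\in X$ the squares of side $N_n$ whose lower left unit tile corresponds to a point of $C_n$ do not overlap and leave no space in $\mathcal{T}$ for another square of side $N_n$ made of tiles; let $\mathbb{P}'$ run through the tiles of level $n$ defined above by these squares. A *Robinson inflation sequence* is a sequence of CEERs $\mathcal{R}_n\subset\mathcal{R}$ such that $\mathcal{R}_0=\Delta_X$ and, for all $n\ge 0$ and $\mathcal{T}\in X$, each plaque of $\mathcal{R}_n$ in $\mathcal{T}$ can be attributed to one of the tiles $\mathbb{P}'$ of level $n+1$ whose interior it meets, in such a way that the plaques of $\mathcal{R}_{n+1}$ in $\mathcal{T}$ are the unions of the plaques of $\mathcal{R}_n$ attributed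 to the same $\mathbb{P}'$. Put $\mathcal{R}_\infty=\bigcup_n\mathcal{R}_n$. Let $\partial\mathcal{R}_n$ be the set of all $\mathcal{T}\in X$ whose tile with base point $0$ meets the topological boundary of its $\mathcal{R}_n$-plaque, and $\partial\mathcal{R}_\infty=\bigcap_n\partial\mathcal{R}_n$. **Proposition.** For every Robinson inflation sequence, $\mathcal{R}_\infty$ is a minimal (all classes are dense in $X$) open AF equivalence subrelation of $\mathcal{R}$, and its boundary $\partial\mathcal{R}_\infty$ is an $\mathcal{R}_\infty$-thin (i.e. $\mu(\partial\mathcal{R}_\infty)=0$ for every $\mathcal{R}_\infty$-invariant Borel probability measure $\mu$ on $X$), meager, closed subset of $X$ such that for every $\mathcal{T}\in\partial\mathcal{R}_\infty$ the $\mathcal{R}$-equivalence class of $\mathcal{T}$ separates into at most four $\mathcal{R}_\infty$-equivalence classes. -/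

import Mathlib

open Set Topology MeasureTheory

/-! ### Tilings of the plane by marked unit squares -/

/-- The plane; the norm of `ℝ × ℝ` is the max-norm. -/
abbrev Plane : Type := ℝ × ℝ

/-- The closed axis-parallel square of side `N` with lower left corner `s`. -/
def squareAt (N : ℝ) (s : Plane) : Set Plane := Icc s (s + (N, N))

/-- A planar tiling by translates of unit squares carrying marks in `P`, touching face-to-face. The
pair `(p, m)` stands for the unit square with lower left corner `p` and mark `m`. Two distinct unit
squares which meet have in common exactly a vertex or an edge iff their corners differ by a nonzero
integer vector. -/
@[ext]
structure SquareTiling (P : Type*) where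
  tiles : Set (Plane × P)
  covers : ∀ x : Plane, ∃ τ ∈ tiles, x ∈ squareAt 1 τ.1
  face_to_face : ∀ τ ∈ tiles, ∀ τ' ∈ tiles, τ ≠ τ' →
    (squareAt 1 τ.1 ∩ squareAt 1 τ'.1).Nonempty →
      τ.1 ≠ τ'.1 ∧ ∃ i j : ℤ, τ'.1 - τ.1 = ((i : ℝ), (j : ℝ))

theorem squareAt_add_iff (N : ℝ) (s v x : Plane) :
    x ∈ squareAt N (s + v) ↔ x - v ∈ squareAt N s := by
  simp only [squareAt, mem_Icc, Prod.le_def, Prod.fst_add, Prod.snd_add, Prod.fst_sub,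
    Prod.snd_sub]
  constructor
  · rintro ⟨⟨h1, h2⟩, h3, h4⟩
    refine ⟨⟨?_, ?_⟩, ?_, ?_⟩ <;> linarith
  · rintro ⟨⟨h1, h2⟩, h3, h4⟩
    refine ⟨⟨?_, ?_⟩, ?_, ?_⟩ <;> linarith

namespace SquareTiling

variable {P : Type*}

/-- The translated tiling `T + v`. -/
def translate (T : SquareTiling P) (v : Plane) : SquareTiling P where
  tiles := (fun τ : Plane × P => (τ.1 + v, τ.2)) '' T.tiles
  covers := by
    intro x
    obtain ⟨τ, hτ, hx⟩ := T.covers (x - v)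
    exact ⟨_, ⟨τ, hτ, rfl⟩, (squareAt_add_iff 1 τ.1 v x).2 hx⟩
  face_to_face := by
    rintro _ ⟨τ, hτ, rfl⟩ _ ⟨τ', hτ', rfl⟩ hne ⟨x, hx, hx'⟩
    have h := T.face_to_face τ hτ τ' hτ' (fun h => hne (by rw [h]))
      ⟨x - v, (squareAt_add_iff 1 τ.1 v x).1 hx, (squareAt_add_iff 1 τ'.1 v x).1 hx'⟩
    refine ⟨fun h' => h.1 (add_right_cancel h'), ?_⟩
    obtain ⟨i, j, hij⟩ := h.2
    exact ⟨i, j, by simpa using hij⟩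

/-- The tiles of `T` meeting the open max-ball `B(0, r)`. -/
def tilesMeetingBall (T : SquareTiling P) (r : ℝ) : Set (Plane × P) :=
  {τ ∈ T.tiles | (squareAt 1 τ.1 ∩ Metric.ball 0 r).Nonempty}

/-- The set of tilings `T'` such that `T + v` and `T' + v'` coincide on a ball `B(0, R)` with
`R > r`, for some `‖v‖ < ε` and `‖v'‖ < ε'`. -/
def basicNhd (T : SquareTiling P) (r ε ε' : ℝ) : Set (SquareTiling P) :=
  {T' | ∃ v v' : Plane, ‖v‖ < ε ∧ ‖v'‖ < ε' ∧ ∃ R > r,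
    (T.translate v).tilesMeetingBall R = (T'.translate v').tilesMeetingBall R}

/-- The Gromov-Hausdorff topology on the space of tilings. -/
instance : TopologicalSpace (SquareTiling P) :=
  TopologicalSpace.generateFrom
    {U | ∃ (T : SquareTiling P) (r ε ε' : ℝ), 0 < r ∧ 0 < ε ∧ 0 < ε' ∧ U = T.basicNhd r ε ε'}

instance : MeasurableSpace (SquareTiling P) := borel _

instance : BorelSpace (SquareTiling P) := ⟨rfl⟩

/-- No translation symmetries. -/
def Aperiodic (T : SquareTiling P) : Prop := ∀ v : Plane, T.translate v = T → v = 0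

/-- For any patch `M` there is `R > 0` such that any ball of radius `R` contains a translated copy
of `M`. -/
def Repetitive (T : SquareTiling P) : Prop :=
  ∀ M : Set (Plane × P), M.Finite → M ⊆ T.tiles → ∃ R > 0, ∀ x : Plane, ∃ v : Plane,
    ∀ τ ∈ M, (τ.1 + v, τ.2) ∈ T.tiles ∧ squareAt 1 (τ.1 + v) ⊆ Metric.ball x R

/-- The continuous hull, the closure of the orbit of `T` under translations. -/
def hull (T : SquareTiling P) : Set (SquareTiling P) := closure (range T.translate)

end SquareTiling

/-! ### The transversal and its étale equivalence relation

`base m` is the base point of the prototile `m`, in the unit square with lower left corner `0`. -/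

section Transversal

variable {P : Type*} (base : P → Plane)

/-- The base point of a tile. -/
def tileBase (τ : Plane × P) : Plane := τ.1 + base τ.2

/-- The Delone set `D_T` of base points of the tiles of `T`. -/
def delone (T : SquareTiling P) : Set Plane := tileBase base '' T.tiles

/-- The total transversal `X` of the hull of `T₀`: the tilings with the origin as a base point. -/
def transversal (T₀ : SquareTiling P) : Set (SquareTiling P) :=
  {T | T ∈ T₀.hull ∧ (0 : Plane) ∈ delone base T}

variable (T₀ : SquareTiling P)

/-- The equivalence relation `R = {(T, T - v) | v ∈ D_T}` on `X`. -/
def orbitRel (T T' : transversal base T₀) : Prop :=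
  ∃ v ∈ delone base T.1, T'.1 = T.1.translate (-v)

/-- The graph of `R` as a type. -/
def OrbitPairs : Type _ :=
  {p : transversal base T₀ × transversal base T₀ // orbitRel base T₀ p.1 p.2}

/-- The étale topology of `R`, with the bisections `{(T, T - v) | T ∈ A, v ∈ D_T}`,
`A ⊆ X` open and `v` fixed, as a basis. -/
instance : TopologicalSpace (OrbitPairs base T₀) :=
  TopologicalSpace.generateFrom
    {W | ∃ (v : Plane) (A : Set (transversal base T₀)), IsOpen A ∧
      W = {p | p.1.1 ∈ A ∧ v ∈ delone base p.1.1.1 ∧ p.1.2.1 = p.1.1.1.translate (-v)}}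

variable {base T₀}

/-- `E` is an open equivalence subrelation of `R`. -/
def IsOpenSubrelation (E : transversal base T₀ → transversal base T₀ → Prop) : Prop :=
  Equivalence E ∧ (∀ T T', E T T' → orbitRel base T₀ T T') ∧
    IsOpen {p : OrbitPairs base T₀ | E p.1.1 p.1.2}

/-- `E` is a compact étale equivalence subrelation (CEER) of `R`: it is open in `R`, and
compact off the diagonal. -/
def IsCEER (E : transversal base T₀ → transversal base T₀ → Prop) : Prop :=
  IsOpenSubrelation E ∧ IsCompact {p : OrbitPairs base T₀ | E p.1.1 p.1.2 ∧ p.1.1 ≠ p.1.2}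

/-- `E` is an increasing union of CEERs. -/
def IsAF (E : transversal base T₀ → transversal base T₀ → Prop) : Prop :=
  ∃ F : ℕ → transversal base T₀ → transversal base T₀ → Prop,
    (∀ n, IsCEER (F n)) ∧ (∀ n T T', F n T T' → F (n + 1) T T') ∧
      ∀ T T', E T T' ↔ ∃ n, F n T T'

/-- All equivalence classes are dense. -/
def IsMinimalRel (E : transversal base T₀ → transversal base T₀ → Prop) : Prop :=
  ∀ T, Dense {T' | E T T'}

/-- `μ` is `E`-invariant: it is preserved by all Borel partial transformations of `E`. -/
def IsInvariantMeasure (E : transversal base T₀ → transversal base T₀ → Prop)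
    (μ : Measure (transversal base T₀)) : Prop :=
  ∀ A B : Set (transversal base T₀), MeasurableSet A → MeasurableSet B →
    ∀ φ : A ≃ᵐ B, (∀ x : A, E x (φ x)) → μ A = μ B

/-- `Y` is null for all `E`-invariant probability measures. -/
def IsThin (E : transversal base T₀ → transversal base T₀ → Prop)
    (Y : Set (transversal base T₀)) : Prop :=
  ∀ μ : Measure (transversal base T₀), IsProbabilityMeasure μ → IsInvariantMeasure E μ → μ Y = 0

/-- The relation induced by `E` on the tiles of `T`, through the correspondence of a tile `τ` with
the element `T - tileBase τ` of the transversal. -/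
def tileRel (E : transversal base T₀ → transversal base T₀ → Prop) (T : SquareTiling P)
    (τ τ' : Plane × P) : Prop :=
  ∃ U U' : transversal base T₀, U.1 = T.translate (-tileBase base τ) ∧
    U'.1 = T.translate (-tileBase base τ') ∧ E U U'

/-- The plaque of `E` through the tile `τ` of `T`: the union of the tiles equivalent to `τ`. -/
def relPlaque (E : transversal base T₀ → transversal base T₀ → Prop) (T : SquareTiling P)
    (τ : Plane × P) : Set Plane :=
  ⋃ τ' ∈ {τ' ∈ T.tiles | tileRel E T τ τ'}, squareAt 1 τ'.1

/-- The discrete boundary of `E`: the tilings in `X` whose tile with base point `0` meets the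
boundary of its plaque. -/
def relBoundary (E : transversal base T₀ → transversal base T₀ → Prop) :
    Set (transversal base T₀) :=
  {T | ∃ τ ∈ T.1.tiles, tileBase base τ = 0 ∧
    (squareAt 1 τ.1 ∩ frontier (relPlaque E T.1 τ)).Nonempty}

end Transversal

/-! ### Arms, crosses, and the planar tiling they define

`S` is the set of the lower left corners of a packing of the plane by squares of side `N`. -/

section Geometry

/-- The square at `t` lies over the top edge of the square at `s`. -/
def IsAbove (N : ℝ) (s t : Plane) : Prop := s.2 + N ≤ t.2 ∧ |t.1 - s.1| < N

/-- `A` is the arm joining the top edge of the square at `s` to the bottom edge of the square at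
`t`, where one of the two is a nearest square to that edge of the other one. The arm is the union
of the orthogonal segments between both edges (of length `0` if the squares touch). -/
def IsVerticalArm (S : Set Plane) (N : ℝ) (s t : Plane) (A : Set Plane) : Prop :=
  s ∈ S ∧ t ∈ S ∧ IsAbove N s t ∧
    ((∀ u ∈ S, IsAbove N s u → t.2 ≤ u.2) ∨ (∀ u ∈ S, IsAbove N u t → u.2 ≤ s.2)) ∧
    A = Icc (max s.1 t.1, s.2 + N) (min s.1 t.1 + N, t.2)

/-- The same with left and right edges. -/
def IsHorizontalArm (S : Set Plane) (N : ℝ) (s t : Plane) (A : Set Plane) : Prop :=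
  IsVerticalArm (Prod.swap '' S) N s.swap t.swap (Prod.swap '' A)

/-- A totally degenerate arm: the common corner of two squares which only touch there. -/
def IsCornerArm (S : Set Plane) (N : ℝ) (s t : Plane) (A : Set Plane) : Prop :=
  s ∈ S ∧ t ∈ S ∧ |t.1 - s.1| = N ∧ |t.2 - s.2| = N ∧ A = squareAt N s ∩ squareAt N t

/-- `A` is an arm between the squares at `s` and `t`. -/
def IsArm (S : Set Plane) (N : ℝ) (s t : Plane) (A : Set Plane) : Prop :=
  IsVerticalArm S N s t A ∨ IsVerticalArm S N t s A ∨
    IsHorizontalArm S N s t A ∨ IsHorizontalArm S N t s A ∨ IsCornerArm S N s t A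

/-- The half-arms of the square at `s`: the axis of an arm is the set of points which are
equidistant from both squares. -/
def halfArms (S : Set Plane) (N : ℝ) (s : Plane) : Set Plane :=
  {x | ∃ t A, IsArm S N s t A ∧ x ∈ A ∧
    Metric.infDist x (squareAt N s) ≤ Metric.infDist x (squareAt N t)}

/-- The complement of the union of all squares and arms. -/
def uncovered (S : Set Plane) (N : ℝ) : Set Plane :=
  {x | (∀ s ∈ S, x ∉ squareAt N s) ∧ ∀ s t A, IsArm S N s t A → x ∉ A}

/-- A (non-degenerate) cross: a connected component of the complement. -/
def IsCross (S : Set Plane) (N : ℝ) (K : Set Plane) : Prop :=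
  ∃ x ∈ uncovered S N, K = connectedComponentIn (uncovered S N) x

/-- The exit points of the cross `K` given by the arms of the square at `s`: the middle points of
the intersections of these arms with `K`. -/
def exitPoints (S : Set Plane) (N : ℝ) (K : Set Plane) (s : Plane) : Set Plane :=
  {e | ∃ t A p q, IsArm S N s t A ∧ A ∩ closure K = segment ℝ p q ∧ e = midpoint ℝ p q}

/-- All exit points of the cross `K`. -/
def allExitPoints (S : Set Plane) (N : ℝ) (K : Set Plane) : Set Plane :=
  {e | ∃ s ∈ S, e ∈ exitPoints S N K s}

/-- The decoration of a cross with center `c`: the graph joining `c` with the exit points. -/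
def decoration (S : Set Plane) (N : ℝ) (K : Set Plane) (c : Plane) : Set Plane :=
  {x | ∃ e ∈ allExitPoints S N K, x ∈ segment ℝ c e}

/-- `σ` is one of the sectors into which the decoration separates the cross `K`, and it belongs to
the square at `s`: either it meets this square at a boundary point which is not an exit point, or
it lies between two exit points given by arms of this square. Here `Icc a b` is the bounding
rectangle of `K`, and `midpoint ℝ a b` its center of mass; `K` is the interior of this rectangle,
or what remains of it after removing the corners of some squares of the packing. -/
def IsSectorOf (S : Set Plane) (N : ℝ) (K : Set Plane) (s : Plane) (σ : Set Plane) : Prop :=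
  ∃ a b : Plane, IsGLB K a ∧ IsLUB K b ∧
    (∃ x ∈ interior (Icc a b) \ decoration S N K (midpoint ℝ a b),
      σ = connectedComponentIn (interior (Icc a b) \ decoration S N K (midpoint ℝ a b)) x) ∧
    ((∃ y ∈ closure σ ∩ frontier (Icc a b) ∩ squareAt N s, y ∉ allExitPoints S N K) ∨
      ∃ e ∈ exitPoints S N K s ∩ closure σ, ∃ e' ∈ exitPoints S N K s ∩ closure σ, e ≠ e')

/-- The cross-sectors of the square at `s`. -/
def crossSectors (S : Set Plane) (N : ℝ) (s : Plane) : Set Plane :=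
  {x | ∃ K σ, IsCross S N K ∧ IsSectorOf S N K s σ ∧ x ∈ closure (σ ∩ K)}

/-- The tile `P'` which is the union of the square at `s` with its half-arms and cross-sectors. -/
def robinsonTile (S : Set Plane) (N : ℝ) (s : Plane) : Set Plane :=
  squareAt N s ∪ halfArms S N s ∪ crossSectors S N s

end Geometry

/-! ### Robinson inflation -/

section Inflation

variable {P : Type*} {base : P → Plane} {T₀ : SquareTiling P}

/-- The lower left corners of the squares of the partial box decomposition with transversal `C` in
the leaf of `T`: the square starts at the corner of a tile `τ` of `T` iff `T - tileBase τ ∈ C`. -/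
def packingOf (C : Set (transversal base T₀)) (T : SquareTiling P) : Set Plane :=
  {p | ∃ m, (p, m) ∈ T.tiles ∧ ∃ U ∈ C, U.1 = T.translate (-tileBase base (p, m))}

/-- The squares of side `N` at the points of `S` do not overlap, and there is no space in `T` for
any other square of side `N`. -/
def IsMaximalPacking (T : SquareTiling P) (N : ℝ) (S : Set Plane) : Prop :=
  (∀ s ∈ S, ∀ t ∈ S, s ≠ t → N ≤ dist s t) ∧ ∀ τ ∈ T.tiles, ∃ s ∈ S, dist τ.1 s < N

/-- A sequence of box decompositions obtained by iterating Robinson inflation, given by the CEERs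
`rel n` whose classes are the discrete plaques of the `n`-th decomposition. -/
structure RobinsonInflation (base : P → Plane) (T₀ : SquareTiling P) where
  /-- The sides `N_n` of the squares of the partial decompositions (unit squares for `n = 0`). -/
  side : ℕ → ℕ
  side_zero : side 0 = 1
  side_strictMono : StrictMono side
  side_growth : ∀ n, side n ^ 3 ≤ side (n + 1)
  /-- The transversals of the partial decompositions, for `n ≥ 1`. -/
  marker : ℕ → Set (transversal base T₀)
  isClopen_marker : ∀ n, IsClopen (marker n)
  isMaximalPacking : ∀ n ≥ 1, ∀ T : transversal base T₀,
    IsMaximalPacking T.1 (side n) (packingOf (marker n) T.1)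
  rel : ℕ → transversal base T₀ → transversal base T₀ → Prop
  isCEER_rel : ∀ n, IsCEER (rel n)
  /-- The initial plaques are the tiles. -/
  rel_zero : ∀ T T', rel 0 T T' ↔ T = T'
  /-- In each leaf, every plaque of the `n`-th decomposition is included in one of the tiles `P'` of
  level `n + 1` whose interior it meets, and the plaques of the next decomposition are formed by
  the plaques included in the same tile `P'`. -/
  inflation : ∀ n, ∀ T : transversal base T₀, ∃ a : Plane × P → Plane, ∀ τ ∈ T.1.tiles,
    a τ ∈ packingOf (marker (n + 1)) T.1 ∧
    (relPlaque (rel n) T.1 τ ∩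
      interior (robinsonTile (packingOf (marker (n + 1)) T.1) (side (n + 1)) (a τ))).Nonempty ∧
    ∀ τ' ∈ T.1.tiles, (tileRel (rel n) T.1 τ τ' → a τ = a τ') ∧
      (tileRel (rel (n + 1)) T.1 τ τ' ↔ a τ = a τ')

/-- `R_∞`, the union of the increasing sequence `rel n`. -/
def RobinsonInflation.limitRel (I : RobinsonInflation base T₀)
    (T T' : transversal base T₀) : Prop := ∃ n, I.rel n T T'

/-- The boundary of `R_∞`, the intersection of the boundaries of the relations `rel n`. -/
def RobinsonInflation.boundary (I : RobinsonInflation base T₀) : Set (transversal base T₀) :=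
  ⋂ n, relBoundary (I.rel n)

end Inflation

/-!
Openness, the AF property and closedness of the boundary follow from the definitions once the
topologies are made explicit: neighbourhoods in the transversal are given by the coincidence of
tilings on large balls (`SquareTiling.isOpen_transversal_iff`), and an equivalence of an open
subrelation persists under such a coincidence
(`SquareTiling.exists_agree_of_isOpenSubrelation`). The rest depends on three facts about the tile
`P'` of a square of side `N` in a saturated packing.

* It lies within distance `6 * N` of the corner of its square (`SatPack.tile_within`), so that the
  plaques of level `n` are small compared with the squares of level `n + 1`
  (`RobinsonInflation.within_diam`, `RobinsonInflation.exists_side_ge`).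
* Its interior does not meet the other squares (`SatPack.eq_of_mem_interior`), so that the plaques
  inside of a square are attributed to this square, and they are off the boundary of the next level
  if they are not close to the boundary of the square.
* At most four of the tiles `P'` meet a small square (`SatPack.card_near_le`).

Minimality and meagerness follow from the first two facts, since by repetitivity each patch occurs in
the middle of all large squares (`RobinsonInflation.exists_rel_agree`). The boundary is thin since
the middle of a square of level `n + 1` is a fixed proportion of its plaque. By mass transport
(`lintegral_tsum_class`) this proportion holds for every invariant measure, level
after level, and the measure of the boundary decreases geometrically. Five classes of the limit
relation in an orbit class would provide five tiles `P'` of a high level close to the origin, which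
the third fact excludes.

The third fact is the geometric core. A vertical curve (`VCurve`) is a bi-infinite chain of squares
joined by vertical arms; it separates the plane, and neither the crosses nor the other squares
cross it, so that a tile whose square is on the left of the curve stays on its left
(`VCurve.piece_left`). Every cross is a rectangle with some corners cut out by squares
(`SatPack.exists_face`): the free vertical segment through a generic point ends at squares or at
horizontal arms, and in all cases a ring of squares surrounds it. The boundary of the rectangle is
divided at the exit points into parts owned by single squares, and the radial projection of a sector
from the center lies in one of these parts (`Face.sector_own`).

Consider the tiles near a point `x`. If they are on both sides of a vertical curve, then this curve
has a narrow arm near `x` (`VCurve.exists_narrow`), and then the squares of these tiles reach close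
to this arm (`VCurve.reach_up`). If there is no narrow horizontal arm near `x`, then for each tile
the other ones are all on the lower or all on the upper side of the horizontal curve through its
square. Three squares of the same kind would form a chain of horizontal arms, whose ends are too far
from each other to be both near `x`, so that there are at most two of each kind
(`SatPack.card_near_le_of_not_narrow`). The case without narrow vertical arms is symmetric. If there
are narrow arms of both directions near `x`, then all the squares reach close to `x`
(`SatPack.le_of_narrow`), and at most four disjoint squares do.
-/

/-! ### Saturated packings and nearest squares -/

/-- `S` is the set of lower left corners of a packing of the plane by squares of side `N` which
leaves no space for another square of side `N`. -/
structure SatPack (S : Set Plane) (N : ℝ) : Prop where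
  pos : 0 < N
  sep : ∀ s ∈ S, ∀ t ∈ S, s ≠ t →
    s.1 + N ≤ t.1 ∨ t.1 + N ≤ s.1 ∨ s.2 + N ≤ t.2 ∨ t.2 + N ≤ s.2
  sat : ∀ x y : ℝ, ∃ s ∈ S, x < s.1 + N ∧ s.1 < x + N ∧ y < s.2 + N ∧ s.2 < y + N

/-- The square at `t` lies over the square at `s`. -/
def Abv (N : ℝ) (s t : Plane) : Prop := s.2 + N ≤ t.2 ∧ s.1 < t.1 + N ∧ t.1 < s.1 + N

/-- The square at `t` lies on the right of the square at `s`. -/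
def Rgt (N : ℝ) (s t : Plane) : Prop := s.1 + N ≤ t.1 ∧ s.2 < t.2 + N ∧ t.2 < s.2 + N

/-- A vertical arm joins the squares at `s` (below) and `t` (above). -/
structure VArm (S : Set Plane) (N : ℝ) (s t : Plane) : Prop where
  ms : s ∈ S
  mt : t ∈ S
  ab : Abv N s t
  nr : (∀ u ∈ S, Abv N s u → t.2 ≤ u.2) ∨ (∀ u ∈ S, Abv N u t → u.2 ≤ s.2)

/-- A horizontal arm joins the squares at `s` (left) and `t` (right). -/
structure HArm (S : Set Plane) (N : ℝ) (s t : Plane) : Prop where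
  ms : s ∈ S
  mt : t ∈ S
  ab : Rgt N s t
  nr : (∀ u ∈ S, Rgt N s u → t.1 ≤ u.1) ∨ (∀ u ∈ S, Rgt N u t → u.1 ≤ s.1)

/-- The mirror image of a packing in the diagonal. -/
def swapS (S : Set Plane) : Set Plane := {s | (s.2, s.1) ∈ S}

/-- The mirror image of a packing of squares of side `N` in the vertical axis. -/
def negS (S : Set Plane) (N : ℝ) : Set Plane := {s | (-s.1 - N, s.2) ∈ S}

variable {S : Set Plane} {N : ℝ} {s t u p q : Plane}

theorem swapS_swapS (S : Set Plane) : swapS (swapS S) = S := rfl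

theorem negS_negS (S : Set Plane) (N : ℝ) : negS (negS S N) N = S := by
  ext s; simp [negS]

theorem SatPack.swap (h : SatPack S N) : SatPack (swapS S) N where
  pos := h.pos
  sep s hs t ht hst := by
    rcases h.sep _ hs _ ht (fun e => hst (by
      rw [Prod.ext_iff] at e ⊢; exact ⟨e.2, e.1⟩)) with h | h | h | h <;> dsimp only at h <;> tauto
  sat x y := by
    obtain ⟨s, hs, h1, h2, h3, h4⟩ := h.sat y x
    exact ⟨(s.2, s.1), hs, h3, h4, h1, h2⟩

theorem SatPack.neg (h : SatPack S N) : SatPack (negS S N) N where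
  pos := h.pos
  sep s hs t ht hst := by
    rcases h.sep _ hs _ ht (fun e => hst (by
      rw [Prod.ext_iff] at e ⊢; dsimp only at e; exact ⟨by linarith [e.1], e.2⟩)) with h | h | h | h
      <;> dsimp only at h
    · right; left; linarith
    · left; linarith
    · tauto
    · tauto
  sat x y := by
    obtain ⟨s, hs, h1, h2, h3, h4⟩ := h.sat (-x - N) y
    refine ⟨(-s.1 - N, s.2), ?_, ?_, ?_, h3, h4⟩
    · simpa [negS] using hs
    · dsimp only; linarith
    · dsimp only; linarith

theorem mem_swapS : s ∈ swapS S ↔ (s.2, s.1) ∈ S := Iff.rfl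
theorem mem_negS : s ∈ negS S N ↔ (-s.1 - N, s.2) ∈ S := Iff.rfl
theorem negS_mk (h : s ∈ S) : (-s.1 - N, s.2) ∈ negS S N := by simpa [negS] using h

theorem VArm.swap (h : VArm S N s t) : HArm (swapS S) N (s.2, s.1) (t.2, t.1) :=
  ⟨h.ms, h.mt, h.ab, h.nr.imp (fun h _ hu hs => h _ hu hs) (fun h _ hu hs => h _ hu hs)⟩

theorem HArm.swap (h : HArm S N s t) : VArm (swapS S) N (s.2, s.1) (t.2, t.1) :=
  ⟨h.ms, h.mt, h.ab, h.nr.imp (fun h _ hu hs => h _ hu hs) (fun h _ hu hs => h _ hu hs)⟩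

theorem VArm.neg (h : VArm S N s t) : VArm (negS S N) N (-s.1 - N, s.2) (-t.1 - N, t.2) := by
  obtain ⟨h1, h2, ⟨h3, h4, h5⟩, h6⟩ := h
  refine ⟨negS_mk h1, negS_mk h2, ⟨h3, by dsimp only; linarith, by dsimp only; linarith⟩,
    h6.imp ?_ ?_⟩ <;>
  · intro h u hu hs
    obtain ⟨a, b, c⟩ := hs
    dsimp only at a b c
    exact h (-u.1 - N, u.2) hu ⟨a, by dsimp only; linarith, by dsimp only; linarith⟩

theorem HArm.neg (h : HArm S N s t) : HArm (negS S N) N (-t.1 - N, t.2) (-s.1 - N, s.2) := by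
  obtain ⟨h1, h2, ⟨h3, h4, h5⟩, h6⟩ := h
  refine ⟨negS_mk h2, negS_mk h1, ⟨by dsimp only; linarith, by dsimp only; linarith,
    by dsimp only; linarith⟩, h6.symm.imp ?_ ?_⟩ <;>
  · intro h u hu hs
    obtain ⟨a, b, c⟩ := hs
    dsimp only at a b c
    have := h (-u.1 - N, u.2) hu ⟨by dsimp only; linarith, by dsimp only; linarith, by dsimp only; linarith⟩
    dsimp only at this ⊢; linarith

theorem min_add_le {a b c N : ℝ} : min a b + N ≤ c ↔ a + N ≤ c ∨ b + N ≤ c := by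
  rw [← le_sub_iff_add_le, min_le_iff, le_sub_iff_add_le, le_sub_iff_add_le]

namespace SatPack

variable (h : SatPack S N)
include h

theorem eq_of_lt (hs : s ∈ S) (ht : t ∈ S) (h1 : s.1 < t.1 + N) (h2 : t.1 < s.1 + N)
    (h3 : s.2 < t.2 + N) (h4 : t.2 < s.2 + N) : s = t := by
  by_contra hne
  rcases h.sep s hs t ht hne with h | h | h | h <;> linarith

/-- The packing is locally finite. -/
theorem finite_box (a b c d : ℝ) :
    {s | s ∈ S ∧ a ≤ s.1 ∧ s.1 ≤ b ∧ c ≤ s.2 ∧ s.2 ≤ d}.Finite := by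
  have hN := h.pos
  refine Set.Finite.of_finite_image (f := fun s : Plane => (⌊s.1 / N⌋, ⌊s.2 / N⌋)) ?_ ?_
  · refine ((Set.finite_Icc ⌊a / N⌋ ⌊b / N⌋).prod (Set.finite_Icc ⌊c / N⌋ ⌊d / N⌋)).subset ?_
    rintro _ ⟨s, ⟨-, h1, h2, h3, h4⟩, rfl⟩
    exact ⟨⟨Int.floor_le_floor (by gcongr), Int.floor_le_floor (by gcongr)⟩,
      ⟨Int.floor_le_floor (by gcongr), Int.floor_le_floor (by gcongr)⟩⟩
  · rintro s ⟨hs, -⟩ t ⟨ht, -⟩ hst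
    simp only [Prod.mk.injEq] at hst
    have key : ∀ x y : ℝ, ⌊x / N⌋ = ⌊y / N⌋ → x < y + N := fun x y e => by
      have h1 := Int.lt_floor_add_one (x / N)
      have h2 := Int.floor_le (y / N)
      rw [e] at h1
      have : x / N < y / N + 1 := by linarith
      have := (div_lt_iff₀ hN).1 this
      rwa [add_mul, div_mul_cancel₀ _ hN.ne', one_mul] at this
    exact h.eq_of_lt hs ht (key _ _ hst.1) (key _ _ hst.1.symm) (key _ _ hst.2) (key _ _ hst.2.symm)

theorem exists_up (hs : s ∈ S) :
    ∃ t ∈ S, Abv N s t ∧ t.2 < s.2 + 2 * N ∧ ∀ u ∈ S, Abv N s u → t.2 ≤ u.2 := by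
  have hN := h.pos
  obtain ⟨t, ht, h1, h2, h3, h4⟩ := h.sat s.1 (s.2 + N)
  have hst : Abv N s t := by
    rcases h.sep s hs t ht (by rintro rfl; linarith) with h | h | h | h
    · linarith
    · linarith
    · exact ⟨h, h1, h2⟩
    · linarith
  obtain ⟨v, ⟨hv, hsv⟩, hmin⟩ := Set.exists_min_image {u | u ∈ S ∧ Abv N s u ∧ u.2 ≤ t.2}
    (fun u => u.2) ((h.finite_box (s.1 - N) (s.1 + N) s.2 t.2).subset (by
      rintro u ⟨hu, ⟨a, b, c⟩, d⟩
      exact ⟨hu, by linarith, by linarith, by linarith, by linarith⟩)) ⟨t, ht, hst, le_rfl⟩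
  refine ⟨v, hv, hsv.1, by linarith [hsv.2], fun u hu hsu => ?_⟩
  rcases le_total u.2 t.2 with h' | h'
  · exact hmin u ⟨hu, hsu, h'⟩
  · linarith [hsv.2]

theorem exists_right (hs : s ∈ S) :
    ∃ t ∈ S, Rgt N s t ∧ t.1 < s.1 + 2 * N ∧ ∀ u ∈ S, Rgt N s u → t.1 ≤ u.1 := by
  obtain ⟨t, ht, h1, h2, h3⟩ := h.swap.exists_up (s := (s.2, s.1)) hs
  exact ⟨(t.2, t.1), ht, h1, h2, fun u hu hsu => h3 (u.2, u.1) hu hsu⟩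

theorem exists_left (hs : s ∈ S) :
    ∃ t ∈ S, Rgt N t s ∧ s.1 < t.1 + 2 * N ∧ ∀ u ∈ S, Rgt N u s → u.1 ≤ t.1 := by
  obtain ⟨t, ht, h1, h2, h3⟩ := h.neg.exists_right (negS_mk hs)
  obtain ⟨a, b, c⟩ := h1
  dsimp only at *
  refine ⟨(-t.1 - N, t.2), ht, ⟨by dsimp only; linarith, by dsimp only; linarith,
    by dsimp only; linarith⟩, by dsimp only; linarith, fun u hu ⟨d, e, f⟩ => ?_⟩
  have := h3 _ (negS_mk hu) ⟨by dsimp only; linarith, by dsimp only; linarith,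
    by dsimp only; linarith⟩
  dsimp only at *; linarith

theorem exists_down (hs : s ∈ S) :
    ∃ t ∈ S, Abv N t s ∧ s.2 < t.2 + 2 * N ∧ ∀ u ∈ S, Abv N u s → u.2 ≤ t.2 := by
  obtain ⟨t, ht, h1, h2, h3⟩ := h.swap.exists_left (s := (s.2, s.1)) hs
  exact ⟨(t.2, t.1), ht, h1, h2, fun u hu hsu => h3 (u.2, u.1) hu hsu⟩

theorem varm_gap (a : VArm S N s t) : t.2 < s.2 + 2 * N := by
  rcases a.nr with h' | h'
  · obtain ⟨u, hu, h1, h2, -⟩ := h.exists_up a.ms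
    linarith [h' u hu h1]
  · obtain ⟨u, hu, h1, h2, -⟩ := h.exists_down a.mt
    linarith [h' u hu h1]

theorem harm_gap (a : HArm S N s t) : t.1 < s.1 + 2 * N := h.swap.varm_gap a.swap

theorem varm_ne (a : VArm S N s t) : s ≠ t := by
  rintro rfl; have := a.ab.1; linarith [h.pos]

/-- No other square meets the interior of the union of the arm with the strips of both squares
which prolong it. -/
theorem varm_disj (a : VArm S N s t) (hu : u ∈ S) (h1 : u ≠ s) (h2 : u ≠ t) :
    u.1 + N ≤ max s.1 t.1 ∨ min s.1 t.1 + N ≤ u.1 ∨ u.2 + N ≤ s.2 ∨ t.2 + N ≤ u.2 := by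
  by_contra! hc
  obtain ⟨c1, c2, c3, c4⟩ := hc
  rw [max_lt_iff] at c1
  rw [← sub_lt_iff_lt_add, lt_min_iff, sub_lt_iff_lt_add, sub_lt_iff_lt_add] at c2
  have k1 : s.2 + N ≤ u.2 := by
    rcases h.sep u hu s a.ms h1 with h | h | h | h <;> linarith
  have k2 : u.2 + N ≤ t.2 := by
    rcases h.sep u hu t a.mt h2 with h | h | h | h <;> linarith
  have hN := h.pos
  rcases a.nr with h' | h'
  · linarith [h' u hu ⟨k1, by linarith, by linarith⟩]
  · linarith [h' u hu ⟨k2, by linarith, by linarith⟩]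

theorem harm_disj (a : HArm S N s t) (hu : u ∈ S) (h1 : u ≠ s) (h2 : u ≠ t) :
    u.2 + N ≤ max s.2 t.2 ∨ min s.2 t.2 + N ≤ u.2 ∨ u.1 + N ≤ s.1 ∨ t.1 + N ≤ u.1 :=
  h.swap.varm_disj a.swap (u := (u.2, u.1)) hu
    (fun e => h1 (by simp only [Prod.mk.injEq] at e; exact Prod.ext e.2 e.1))
    (fun e => h2 (by simp only [Prod.mk.injEq] at e; exact Prod.ext e.2 e.1))

/-- Vertical and horizontal arms do not cross. -/
theorem varm_harm (a : VArm S N s t) (b : HArm S N p q) {x y : ℝ} (h1 : s.1 < x) (h2 : t.1 < x)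
    (h3 : x < s.1 + N) (h4 : x < t.1 + N) (h5 : s.2 + N ≤ y) (h6 : y ≤ t.2)
    (k1 : p.2 < y) (k2 : q.2 < y) (k3 : y < p.2 + N) (k4 : y < q.2 + N) (k5 : p.1 + N ≤ x)
    (k6 : x ≤ q.1) : False := by
  have hN := h.pos
  have np : p ≠ s := by rintro rfl; linarith
  have np' : p ≠ t := by rintro rfl; linarith
  have nq : q ≠ s := by rintro rfl; linarith
  have nq' : q ≠ t := by rintro rfl; linarith
  have sp := h.sep p b.ms s a.ms np
  have tp := h.sep p b.ms t a.mt np'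
  have sq := h.sep q b.mt s a.ms nq
  have tq := h.sep q b.mt t a.mt nq'
  have sp' : p.1 + N ≤ s.1 ∨ s.2 + N ≤ p.2 := by
    rcases sp with h | h | h | h <;> first | (left; linarith) | (right; linarith)
  have tp' : p.1 + N ≤ t.1 ∨ p.2 + N ≤ t.2 := by
    rcases tp with h | h | h | h <;> first | (left; linarith) | (right; linarith)
  have sq' : s.1 + N ≤ q.1 ∨ s.2 + N ≤ q.2 := by
    rcases sq with h | h | h | h <;> first | (left; linarith) | (right; linarith)
  have tq' : t.1 + N ≤ q.1 ∨ q.2 + N ≤ t.2 := by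
    rcases tq with h | h | h | h <;> first | (left; linarith) | (right; linarith)
  clear sp tp sq tq
  have g1 := h.varm_gap a
  have g2 := h.harm_gap b
  obtain ⟨-, -, ⟨a1, a2, a3⟩, an⟩ := id a
  obtain ⟨-, -, ⟨b1, b2, b3⟩, bn⟩ := id b
  -- The minimality of the length of each arm, tested on the ends of the other one, is contradicted
  -- whichever end of each arm is the one from which it is minimal.
  rcases an with an | an <;> rcases bn with bn | bn
  · have e1 := an p b.ms; have e2 := an q b.mt; have e3 := bn s a.ms; have e4 := bn t a.mt
    simp only [Abv, Rgt, and_imp] at e1 e2 e3 e4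
    clear an bn a b
    grind
  · have e1 := an p b.ms; have e2 := an q b.mt; have e3 := bn s a.ms; have e4 := bn t a.mt
    simp only [Abv, Rgt, and_imp] at e1 e2 e3 e4
    clear an bn a b
    grind
  · have e1 := an p b.ms; have e2 := an q b.mt; have e3 := bn s a.ms; have e4 := bn t a.mt
    simp only [Abv, Rgt, and_imp] at e1 e2 e3 e4
    clear an bn a b
    grind
  · have e1 := an p b.ms; have e2 := an q b.mt; have e3 := bn s a.ms; have e4 := bn t a.mt
    simp only [Abv, Rgt, and_imp] at e1 e2 e3 e4
    clear an bn a b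
    grind

end SatPack

/-! ### Rings of squares -/

/-- The squares at `l`, `s`, `t`, `u` (lower left, lower right, upper right, upper left) and the
arms joining consecutive ones surround the rectangle `Icc A B`. Two consecutive squares may
coincide, or meet just at a corner. -/
structure SquareRing (S : Set Plane) (N : ℝ) (l s t u A B : Plane) : Prop where
  ml : l ∈ S
  ms : s ∈ S
  mt : t ∈ S
  mu : u ∈ S
  cl : l = u ∨ VArm S N l u ∨ (l = s ∧ l.2 + N = u.2 ∧ l.1 = u.1 + N)
  cr : s = t ∨ VArm S N s t
  cb : l = s ∨ HArm S N l s ∨ (l = u ∧ l.1 + N = s.1 ∧ l.2 = s.2 + N)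
  ct : u = t ∨ HArm S N u t
  /-- The sides of the rectangle are those of the squares which bound the larger region. -/
  a1 : A.1 ≤ l.1 + N ∧ A.1 ≤ u.1 + N ∧ (A.1 = l.1 + N ∨ A.1 = u.1 + N)
  a2 : A.2 ≤ l.2 + N ∧ A.2 ≤ s.2 + N ∧ (A.2 = l.2 + N ∨ A.2 = s.2 + N)
  b1 : s.1 ≤ B.1 ∧ t.1 ≤ B.1 ∧ (B.1 = s.1 ∨ B.1 = t.1)
  b2 : u.2 ≤ B.2 ∧ t.2 ≤ B.2 ∧ (B.2 = u.2 ∨ B.2 = t.2)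
  lt1 : A.1 < B.1
  lt2 : A.2 < B.2
  /-- The arms do not join opposite squares, unless the ring has only three squares. -/
  nv1 : VArm S N s u → l = s ∨ u = t
  nv2 : VArm S N l t → l = s ∨ u = t
  nh1 : HArm S N u s → l = u ∨ s = t
  nh2 : HArm S N l t → l = u ∨ s = t
  /-- No square lies inside of the rectangle. -/
  nobox : ∀ c ∈ S, A.1 ≤ c.1 → c.1 + N ≤ B.1 → A.2 ≤ c.2 → c.2 + N ≤ B.2 → False

namespace SquareRing

variable {l A B : Plane} {c : Plane}

theorem swap (r : SquareRing S N l s t u A B) :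
    SquareRing (swapS S) N (l.2, l.1) (u.2, u.1) (t.2, t.1) (s.2, s.1) (A.2, A.1) (B.2, B.1) where
  ml := r.ml
  ms := r.mu
  mt := r.mt
  mu := r.ms
  cl := by
    rcases r.cb with h | h | ⟨h, h1, h2⟩
    · left; rw [h]
    · right; left; exact h.swap
    · right; right; exact ⟨by rw [h], h1, h2⟩
  cr := by
    rcases r.ct with h | h
    · left; rw [h]
    · right; exact h.swap
  cb := by
    rcases r.cl with h | h | ⟨h, h1, h2⟩
    · left; rw [h]
    · right; left; exact h.swap
    · right; right; exact ⟨by rw [h], h1, h2⟩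
  ct := by
    rcases r.cr with h | h
    · left; rw [h]
    · right; exact h.swap
  a1 := r.a2
  a2 := r.a1
  b1 := r.b2
  b2 := r.b1
  lt1 := r.lt2
  lt2 := r.lt1
  nv1 h := by rcases r.nh1 h.swap with h | h <;> simp [h]
  nv2 h := by rcases r.nh2 h.swap with h | h <;> simp [h]
  nh1 h := by rcases r.nv1 h.swap with h | h <;> simp [h]
  nh2 h := by rcases r.nv2 h.swap with h | h <;> simp [h]
  nobox c hc h1 h2 h3 h4 := r.nobox _ hc h3 h4 h1 h2

theorem bounds (h : SatPack S N) (r : SquareRing S N l s t u A B) :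
    l.1 ≤ A.1 ∧ u.1 ≤ A.1 ∧ B.1 ≤ s.1 + N ∧ B.1 ≤ t.1 + N ∧
    l.2 ≤ A.2 ∧ s.2 ≤ A.2 ∧ B.2 ≤ u.2 + N ∧ B.2 ≤ t.2 + N := by
  have hN := h.pos
  obtain ⟨-, -, -, -, cl, cr, cb, ct, a1, a2, b1, b2, -⟩ := r
  have e1 : ∀ a b, VArm S N a b → a.2 + N ≤ b.2 ∧ a.1 < b.1 + N ∧ b.1 < a.1 + N :=
    fun a b h => h.ab
  have e2 : ∀ a b, HArm S N a b → a.1 + N ≤ b.1 ∧ a.2 < b.2 + N ∧ b.2 < a.2 + N :=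
    fun a b h => h.ab
  replace cl := cl.imp_right (Or.imp_left (e1 _ _))
  replace cr := cr.imp_right (e1 _ _)
  replace cb := cb.imp_right (Or.imp_left (e2 _ _))
  replace ct := ct.imp_right (e2 _ _)
  clear e1 e2
  refine ⟨?_, ?_, ?_, ?_, ?_, ?_, ?_, ?_⟩ <;> grind

/-- A square which crosses the upper side of the rectangle is one of the upper squares. -/
theorem cross_top (h : SatPack S N) (r : SquareRing S N l s t u A B) (hc : c ∈ S)
    (h1 : c.1 < B.1) (h2 : A.1 < c.1 + N) (h3 : c.2 ≤ B.2) (h4 : B.2 < c.2 + N) :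
    c = u ∨ c = t := by
  by_contra! hne
  obtain ⟨-, b2, -, b4, -, -, b7, b8⟩ := r.bounds h
  have hN := h.pos
  have k1 := h.sep c hc u r.mu hne.1
  have k2 := h.sep c hc t r.mt hne.2
  have b := r.b2
  rcases r.ct with e | e
  · grind
  · have k := h.harm_disj e hc hne.1 hne.2
    obtain ⟨e1, e2, e3⟩ := e.ab
    rw [le_max_iff, min_add_le] at k
    grind

theorem cross_right (h : SatPack S N) (r : SquareRing S N l s t u A B) (hc : c ∈ S)
    (h1 : c.2 < B.2) (h2 : A.2 < c.2 + N) (h3 : c.1 ≤ B.1) (h4 : B.1 < c.1 + N) :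
    c = s ∨ c = t := by
  rcases r.swap.cross_top h.swap (c := (c.2, c.1)) hc h1 h2 h3 h4 with h | h
  · left; simp only [Prod.mk.injEq] at h; exact Prod.ext h.2 h.1
  · right; simp only [Prod.mk.injEq] at h; exact Prod.ext h.2 h.1

/-- A square which crosses the lower side of the rectangle is one of the lower squares. -/
theorem cross_bot (h : SatPack S N) (r : SquareRing S N l s t u A B) (hc : c ∈ S)
    (h1 : c.1 < B.1) (h2 : A.1 < c.1 + N) (h3 : c.2 < A.2) (h4 : A.2 ≤ c.2 + N) :
    c = l ∨ c = s := by
  by_contra! hne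
  obtain ⟨b1, -, b3, -, b5, b6, -, -⟩ := r.bounds h
  have hN := h.pos
  have k1 := h.sep c hc l r.ml hne.1
  have k2 := h.sep c hc s r.ms hne.2
  have b := r.a2
  have b' := r.a1
  rcases r.cb with e | e | e
  · grind
  · have k := h.harm_disj e hc hne.1 hne.2
    obtain ⟨e1, e2, e3⟩ := e.ab
    rw [le_max_iff, min_add_le] at k
    grind
  · grind

theorem cross_left (h : SatPack S N) (r : SquareRing S N l s t u A B) (hc : c ∈ S)
    (h1 : c.2 < B.2) (h2 : A.2 < c.2 + N) (h3 : c.1 < A.1) (h4 : A.1 ≤ c.1 + N) :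
    c = l ∨ c = u := by
  rcases r.swap.cross_bot h.swap (c := (c.2, c.1)) hc h1 h2 h3 h4 with h | h
  · left; simp only [Prod.mk.injEq] at h; exact Prod.ext h.2 h.1
  · right; simp only [Prod.mk.injEq] at h; exact Prod.ext h.2 h.1

theorem mem_of_meets (h : SatPack S N) (r : SquareRing S N l s t u A B) (hc : c ∈ S)
    (h1 : c.1 < B.1) (h2 : A.1 < c.1 + N) (h3 : c.2 < B.2) (h4 : A.2 < c.2 + N) :
    c = l ∨ c = s ∨ c = t ∨ c = u := by
  have k1 := r.cross_top h hc h1 h2 h3.le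
  have k2 := r.cross_bot h hc h1 h2
  have k3 := r.cross_right h hc h3 h4 h1.le
  have k4 := r.cross_left h hc h3 h4
  have k5 := r.nobox c hc
  by_contra! hne
  exact k5 (by by_contra! hh; have := k4 hh h2.le; tauto)
    (by by_contra! hh; have := k3 hh; tauto)
    (by by_contra! hh; have := k2 hh h4.le; tauto)
    (by by_contra! hh; have := k1 hh; tauto)

/-- A square which meets the interior of the rectangle only covers one of its corners. -/
theorem poke (h : SatPack S N) (r : SquareRing S N l s t u A B) (hc : c ∈ S)
    (h1 : c.1 < B.1) (h2 : A.1 < c.1 + N) (h3 : c.2 < B.2) (h4 : A.2 < c.2 + N) :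
    (c = l ∧ c.1 < A.1 ∧ c.1 + N ≤ B.1 ∧ c.2 < A.2 ∧ c.2 + N ≤ B.2) ∨
    (c = s ∧ A.1 ≤ c.1 ∧ B.1 < c.1 + N ∧ c.2 < A.2 ∧ c.2 + N ≤ B.2) ∨
    (c = t ∧ A.1 ≤ c.1 ∧ B.1 < c.1 + N ∧ A.2 ≤ c.2 ∧ B.2 < c.2 + N) ∨
    (c = u ∧ c.1 < A.1 ∧ c.1 + N ≤ B.1 ∧ A.2 ≤ c.2 ∧ B.2 < c.2 + N) := by
  have hb := r.bounds h
  have hm := r.mem_of_meets h hc h1 h2 h3 h4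
  have hN := h.pos
  obtain ⟨-, -, -, -, cl, cr, cb, ct, a1, a2, b1, b2, -⟩ := r
  have e1 : ∀ a b, VArm S N a b → a.2 + N ≤ b.2 ∧ a.1 < b.1 + N ∧ b.1 < a.1 + N :=
    fun a b h => h.ab
  have e2 : ∀ a b, HArm S N a b → a.1 + N ≤ b.1 ∧ a.2 < b.2 + N ∧ b.2 < a.2 + N :=
    fun a b h => h.ab
  replace cl := cl.imp_right (Or.imp_left (e1 _ _))
  replace cr := cr.imp_right (e1 _ _)
  replace cb := cb.imp_right (Or.imp_left (e2 _ _))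
  replace ct := ct.imp_right (e2 _ _)
  clear e1 e2 h hc
  rcases hm with rfl | rfl | rfl | rfl
  · left; grind (splits := 20)
  · right; left; grind (splits := 20)
  · right; right; left; grind (splits := 20)
  · right; right; right; grind (splits := 20)

/-- The upper end of a vertical arm which meets the rectangle is one of its upper squares. -/
theorem varm_top (h : SatPack S N) (r : SquareRing S N l s t u A B) (a : VArm S N p q) {x y : ℝ}
    (x1 : A.1 < x) (x2 : x < B.1) (y2 : y < B.2)
    (h1 : p.1 < x) (h2 : q.1 < x) (h3 : x < p.1 + N) (h4 : x < q.1 + N)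
    (h5 : p.2 + N ≤ y) : q.2 ≤ B.2 := by
  by_contra! hq
  obtain ⟨-, b2, -, b4, -, -, b7, b8⟩ := r.bounds h
  have hN := h.pos
  have b := r.b2
  have c1 : u ≠ q := by rintro rfl; linarith
  have c2 : u ≠ p := by rintro rfl; linarith
  have c3 : t ≠ q := by rintro rfl; linarith
  have c4 : t ≠ p := by rintro rfl; linarith
  have k1 := h.varm_disj a r.mu c2 c1
  have k2 := h.varm_disj a r.mt c4 c3
  rw [le_max_iff, min_add_le] at k1 k2
  rcases r.ct with e | e
  · subst e; grind
  · obtain ⟨e1, e2, e3⟩ := e.ab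
    have m1 : u.1 + N < x := by grind
    have m2 : x < t.1 := by grind
    have : ∃ z, B.2 < z ∧ z ≤ q.2 ∧ z < u.2 + N ∧ z < t.2 + N := by
      have : B.2 < min q.2 (min (u.2 + N) (t.2 + N)) := by
        simp only [lt_min_iff]; grind
      obtain ⟨z, z1, z2⟩ := exists_between this
      simp only [lt_min_iff] at z2
      exact ⟨z, z1, z2.1.le, z2.2⟩
    obtain ⟨z, z1, z2, z3, z4⟩ := this
    exact h.varm_harm a e h1 h2 h3 h4 (by linarith) z2 (by linarith) (by linarith) z3 z4 m1.le m2.le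

theorem varm_bot (h : SatPack S N) (r : SquareRing S N l s t u A B) (a : VArm S N p q) {x y : ℝ}
    (x1 : A.1 < x) (x2 : x < B.1) (y1 : A.2 < y)
    (h1 : p.1 < x) (h2 : q.1 < x) (h3 : x < p.1 + N) (h4 : x < q.1 + N)
    (h6 : y ≤ q.2) : A.2 ≤ p.2 + N := by
  by_contra! hq
  obtain ⟨b1, b2, b3, b4, b5, b6, b7, b8⟩ := r.bounds h
  have hN := h.pos
  have b := r.a2
  have b' := r.a1
  have c1 : l ≠ q := by rintro rfl; linarith
  have c2 : l ≠ p := by rintro rfl; linarith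
  have c3 : s ≠ q := by rintro rfl; linarith
  have c4 : s ≠ p := by rintro rfl; linarith
  have k1 := h.varm_disj a r.ml c2 c1
  have k2 := h.varm_disj a r.ms c4 c3
  rw [le_max_iff, min_add_le] at k1 k2
  rcases r.cb with e | e | e
  · subst e; grind
  · obtain ⟨e1, e2, e3⟩ := e.ab
    have m1 : l.1 + N < x := by grind
    have m2 : x < s.1 := by grind
    have : ∃ z, z < A.2 ∧ p.2 + N ≤ z ∧ l.2 < z ∧ s.2 < z := by
      have : max (p.2 + N) (max l.2 s.2) < A.2 := by
        simp only [max_lt_iff]; grind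
      obtain ⟨z, z1, z2⟩ := exists_between this
      simp only [max_lt_iff] at z1
      exact ⟨z, z2, z1.1.le, z1.2⟩
    obtain ⟨z, z1, z2, z3, z4⟩ := this
    exact h.varm_harm a e h1 h2 h3 h4 z2 (by linarith) z3 z4 (by linarith) (by linarith)
      m1.le m2.le
  · grind

/-- No vertical arm meets the interior of the rectangle, except inside squares. -/
theorem varm_free (h : SatPack S N) (r : SquareRing S N l s t u A B) (a : VArm S N p q) {x y : ℝ}
    (x1 : A.1 < x) (x2 : x < B.1) (y1 : A.2 < y) (y2 : y < B.2)
    (h1 : p.1 < x) (h2 : q.1 < x) (h3 : x < p.1 + N) (h4 : x < q.1 + N)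
    (h5 : p.2 + N ≤ y) (h6 : y ≤ q.2) : False := by
  have t1 := r.varm_top h a x1 x2 y2 h1 h2 h3 h4 h5
  have t2 := r.varm_bot h a x1 x2 y1 h1 h2 h3 h4 h6
  have hN := h.pos
  have hq : q = l ∨ q = s ∨ q = t ∨ q = u := by
    rcases t1.lt_or_eq with e | e
    · exact r.mem_of_meets h a.mt (by linarith) (by linarith) e (by linarith)
    · have := r.cross_top h a.mt (by linarith) (by linarith) t1 (by linarith)
      tauto
  have hp : p = l ∨ p = s ∨ p = t ∨ p = u := by
    rcases t2.lt_or_eq with e | e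
    · exact r.mem_of_meets h a.ms (by linarith) (by linarith) (by linarith) e
    · have := r.cross_bot h a.ms (by linarith) (by linarith) (by linarith) t2
      tauto
  have hb := r.bounds h
  obtain ⟨ml, ms, mt, mu, cl, cr, cb, ct, a1, a2, b1, b2, -, -, n1, n2, -⟩ := r
  have e1 : ∀ a b, VArm S N a b → a.2 + N ≤ b.2 ∧ a.1 < b.1 + N ∧ b.1 < a.1 + N :=
    fun a b h => h.ab
  have e2 : ∀ a b, HArm S N a b → a.1 + N ≤ b.1 ∧ a.2 < b.2 + N ∧ b.2 < a.2 + N :=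
    fun a b h => h.ab
  replace cl := cl.imp_right (Or.imp_left (e1 _ _))
  replace cr := cr.imp_right (e1 _ _)
  replace cb := cb.imp_right (Or.imp_left (e2 _ _))
  replace ct := ct.imp_right (e2 _ _)
  have e3 := e1 _ _ a
  clear e1 e2 h
  rcases hp with rfl | rfl | rfl | rfl <;> rcases hq with rfl | rfl | rfl | rfl <;>
  first
  | linarith
  | grind

end SquareRing

/-! ### Faces -/

/-- `z` is a point of the square at `c`. -/
def InSq (N : ℝ) (c z : Plane) : Prop :=
  c.1 ≤ z.1 ∧ z.1 ≤ c.1 + N ∧ c.2 ≤ z.2 ∧ z.2 ≤ c.2 + N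

/-- `z` is a point of the arm joining `p` to the square `q` above. -/
def InV (N : ℝ) (p q z : Plane) : Prop :=
  p.1 ≤ z.1 ∧ q.1 ≤ z.1 ∧ z.1 ≤ p.1 + N ∧ z.1 ≤ q.1 + N ∧ p.2 + N ≤ z.2 ∧ z.2 ≤ q.2

/-- `z` is a point of the arm joining `p` to the square `q` on its right. -/
def InH (N : ℝ) (p q z : Plane) : Prop :=
  p.2 ≤ z.2 ∧ q.2 ≤ z.2 ∧ z.2 ≤ p.2 + N ∧ z.2 ≤ q.2 + N ∧ p.1 + N ≤ z.1 ∧ z.1 ≤ q.1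

/-- `z` belongs to no square and to no arm of the packing. -/
structure FreePt (S : Set Plane) (N : ℝ) (z : Plane) : Prop where
  sq : ∀ c ∈ S, ¬InSq N c z
  va : ∀ p q, VArm S N p q → ¬InV N p q z
  ha : ∀ p q, HArm S N p q → ¬InH N p q z

theorem InSq.swap {c z : Plane} (h : InSq N c z) : InSq N (c.2, c.1) (z.2, z.1) :=
  ⟨h.2.2.1, h.2.2.2, h.1, h.2.1⟩

theorem FreePt.swap {z : Plane} (h : FreePt S N z) : FreePt (swapS S) N (z.2, z.1) :=
  ⟨fun _ hc hz => h.sq _ hc hz.swap, fun _ _ a hz => h.ha _ _ a.swap hz,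
    fun _ _ a hz => h.va _ _ a.swap hz⟩

theorem FreePt.neg {z : Plane} (h : FreePt S N z) : FreePt (negS S N) N (-z.1, z.2) := by
  refine ⟨fun c hc hz => h.sq _ hc ?_, fun p q a hz => ?_, fun p q a hz => ?_⟩
  · unfold InSq at *; dsimp only at *; grind
  · have a' := a.neg; rw [negS_negS] at a'
    refine h.va _ _ a' ?_
    unfold InV at *; dsimp only at *; grind
  · have a' := a.neg; rw [negS_negS] at a'
    refine h.ha _ _ a' ?_
    unfold InH at *; dsimp only at *; grind

/-- `z` lies in the interior of the rectangle `Icc A B`. -/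
def InBox (A B z : Plane) : Prop := A.1 < z.1 ∧ z.1 < B.1 ∧ A.2 < z.2 ∧ z.2 < B.2

/-- The square at `c` meets the interior of the rectangle `Icc A B`. -/
def Meets (N : ℝ) (A B c : Plane) : Prop :=
  c.1 < B.1 ∧ A.1 < c.1 + N ∧ c.2 < B.2 ∧ A.2 < c.2 + N

/-- `K` is a cross with bounding rectangle `Icc A B`: the interior of this rectangle with some of
its corners cut out by squares of the packing, limited by squares and arms. -/
structure Face (S : Set Plane) (N : ℝ) (A B : Plane) (K : Set Plane) : Prop where
  glb : IsGLB K A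
  lub : IsLUB K B
  mem : ∀ z, z ∈ K ↔ InBox A B z ∧ ∀ c ∈ S, ¬InSq N c z
  conn : IsPreconnected K
  free : ∀ z ∈ K, FreePt S N z
  /-- The squares and arms cover the remaining points of the closed rectangle. -/
  wall : ∀ z, A.1 ≤ z.1 → z.1 ≤ B.1 → A.2 ≤ z.2 → z.2 ≤ B.2 → FreePt S N z → z ∈ K
  /-- A square which meets the interior covers exactly one corner, and sticks out strictly. -/
  poke : ∀ c ∈ S, Meets N A B c →
    ((c.1 < A.1 ∧ c.1 + N < B.1) ∨ (A.1 < c.1 ∧ B.1 < c.1 + N)) ∧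
    ((c.2 < A.2 ∧ c.2 + N < B.2) ∨ (A.2 < c.2 ∧ B.2 < c.2 + N))
  /-- The squares which meet the interior do not touch. -/
  disj : ∀ c ∈ S, ∀ c' ∈ S, Meets N A B c → Meets N A B c' → c ≠ c' →
    c.1 + N < c'.1 ∨ c'.1 + N < c.1 ∨ c.2 + N < c'.2 ∨ c'.2 + N < c.2
  size : B.1 < A.1 + 3 * N ∧ B.2 < A.2 + 3 * N

/-- The point `x` belongs to a set which has the properties of a cross in `Face`. -/
def FaceAt (S : Set Plane) (N : ℝ) (x : Plane) : Prop := ∃ A B K, Face S N A B K ∧ x ∈ K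

theorem swap_ne {a b : Plane} (h : a ≠ b) : ((a.2, a.1) : Plane) ≠ (b.2, b.1) := fun e => h (by
  rw [Prod.mk.injEq] at e; exact Prod.ext e.2 e.1)

theorem Face.swap {A B : Plane} {K : Set Plane} (h : Face S N A B K) :
    Face (swapS S) N (A.2, A.1) (B.2, B.1) {z | (z.2, z.1) ∈ K} := by
  have e : {z : Plane | (z.2, z.1) ∈ K} = Prod.swap '' K := by
    rw [Set.image_swap_eq_preimage_swap]; rfl
  have e1 : (Prod.fst '' {z : Plane | (z.2, z.1) ∈ K}) = Prod.snd '' K := by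
    rw [e, image_image]; rfl
  have e2 : (Prod.snd '' {z : Plane | (z.2, z.1) ∈ K}) = Prod.fst '' K := by
    rw [e, image_image]; rfl
  have g := isGLB_prod.1 h.glb
  have l := isLUB_prod.1 h.lub
  refine ⟨isGLB_prod.2 ?_, isLUB_prod.2 ?_, fun z => ?_, ?_, fun z hz => (h.free _ hz).swap,
    fun z h1 h2 h3 h4 hz => h.wall _ h3 h4 h1 h2 hz.swap, fun c hc hm => ?_,
    fun c hc c' hc' hm hm' hne => ?_, h.size.symm⟩
  · rw [e1, e2]; exact g.symm
  · rw [e1, e2]; exact l.symm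
  · refine (h.mem (z.2, z.1)).trans (and_congr ?_ ⟨fun k c hc hz => k _ hc hz.swap,
      fun k c hc hz => k (c.2, c.1) hc hz.swap⟩)
    unfold InBox; tauto
  · rw [e]; exact h.conn.image _ continuous_swap.continuousOn
  · exact (h.poke _ hc (by unfold Meets at *; tauto)).symm
  · have := h.disj _ hc _ hc' (by unfold Meets at *; tauto) (by unfold Meets at *; tauto)
      (swap_ne hne)
    tauto

theorem FaceAt.of_swap {x : Plane} (h : FaceAt (swapS S) N (x.2, x.1)) : FaceAt S N x := by
  obtain ⟨A, B, K, hK, hx⟩ := h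
  exact ⟨_, _, _, hK.swap, hx⟩

theorem Face.neg {A B : Plane} {K : Set Plane} (h : Face S N A B K) :
    Face (negS S N) N (-B.1, A.2) (-A.1, B.2) {z | (-z.1, z.2) ∈ K} := by
  have e : {z : Plane | (-z.1, z.2) ∈ K} = (fun z : Plane => (-z.1, z.2)) '' K := by
    ext z; constructor
    · intro hz; exact ⟨_, hz, by simp⟩
    · rintro ⟨w, hw, rfl⟩; simpa using hw
  have e1 : (Prod.fst '' {z : Plane | (-z.1, z.2) ∈ K}) = -(Prod.fst '' K) := by
    rw [e, image_image, ← Set.image_neg_eq_neg, image_image]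
  have e2 : (Prod.snd '' {z : Plane | (-z.1, z.2) ∈ K}) = Prod.snd '' K := by
    rw [e, image_image]
  have g := isGLB_prod.1 h.glb
  have l := isLUB_prod.1 h.lub
  refine ⟨isGLB_prod.2 ?_, isLUB_prod.2 ?_, fun z => ?_, ?_, fun z hz => ?_,
    fun z h1 h2 h3 h4 hz => ?_, fun c hc hm => ?_,
    fun c hc c' hc' hm hm' hne => ?_, ?_⟩
  · rw [e1, e2]; exact ⟨l.1.neg, g.2⟩
  · rw [e1, e2]; exact ⟨g.1.neg, l.2⟩
  · refine (h.mem (-z.1, z.2)).trans (and_congr ?_ ⟨fun k c hc hz => k _ hc ?_,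
      fun k c hc hz => k _ (negS_mk hc) ?_⟩)
    · unfold InBox; grind
    · unfold InSq at *; dsimp only at *; grind
    · unfold InSq at *; dsimp only at *; grind
  · rw [e]
    exact h.conn.image _ (by fun_prop)
  · have := (h.free _ hz).neg; simpa using this
  · have := hz.neg; rw [negS_negS] at this
    refine h.wall (-z.1, z.2) ?_ ?_ h3 h4 this <;> dsimp only at * <;> linarith
  · have := h.poke (-c.1 - N, c.2) hc (by unfold Meets at *; dsimp only at *; grind)
    dsimp only at *; grind
  · have := h.disj (-c.1 - N, c.2) hc (-c'.1 - N, c'.2) hc'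
      (by unfold Meets at *; dsimp only at *; grind) (by unfold Meets at *; dsimp only at *; grind)
      (fun e => hne (by
        rw [Prod.mk.injEq] at e; exact Prod.ext (by linarith [e.1]) e.2))
    dsimp only at *; grind
  · have := h.size; dsimp only; constructor <;> linarith

theorem FaceAt.of_neg {x : Plane} (h : FaceAt (negS S N) N (-x.1, x.2)) : FaceAt S N x := by
  obtain ⟨A, B, K, hK, hx⟩ := h
  have := hK.neg
  rw [negS_negS] at this
  exact ⟨_, _, _, this, hx⟩

namespace SquareRing

variable {l A B : Plane} {c z : Plane}

theorem varm_free' (h : SatPack S N) (r : SquareRing S N l s t u A B) (hz : InBox A B z)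
    (a : VArm S N p q) : ¬InV N p q z := by
  rintro ⟨h1, h2, h3, h4, h5, h6⟩
  obtain ⟨x1, x2, y1, y2⟩ := hz
  have hN := h.pos
  obtain ⟨-, e1, e2⟩ := a.ab
  have : max A.1 (max p.1 q.1) < min B.1 (min (p.1 + N) (q.1 + N)) := by
    simp only [max_lt_iff, lt_min_iff]
    refine ⟨⟨?_, ?_, ?_⟩, ⟨?_, ?_, ?_⟩, ?_, ?_, ?_⟩ <;> linarith
  obtain ⟨x, k1, k2⟩ := exists_between this
  simp only [max_lt_iff, lt_min_iff] at k1 k2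
  exact r.varm_free h a k1.1 k2.1 y1 y2 k1.2.1 k1.2.2 k2.2.1 k2.2.2 h5 h6

theorem free (h : SatPack S N) (r : SquareRing S N l s t u A B) (hz : InBox A B z)
    (hc : ∀ c ∈ S, ¬InSq N c z) : FreePt S N z :=
  ⟨hc, fun _ _ a => r.varm_free' h hz a, fun _ _ a =>
    r.swap.varm_free' h.swap (z := (z.2, z.1)) ⟨hz.2.2.1, hz.2.2.2, hz.1, hz.2.1⟩ a.swap⟩

theorem wall_top (h : SatPack S N) (r : SquareRing S N l s t u A B) (h1 : A.1 ≤ z.1)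
    (h2 : z.1 ≤ B.1) (h3 : z.2 = B.2) : ¬FreePt S N z := by
  intro hz
  obtain ⟨-, b2, -, b4, -, -, b7, b8⟩ := r.bounds h
  have b := r.b2
  have k1 := hz.sq _ r.mu
  have k2 := hz.sq _ r.mt
  unfold InSq at k1 k2
  rcases r.ct with e | e
  · subst e; grind
  · have k3 := hz.ha _ _ e
    obtain ⟨e1, e2, e3⟩ := e.ab
    unfold InH at k3; grind

theorem wall_bot (h : SatPack S N) (r : SquareRing S N l s t u A B) (h1 : A.1 ≤ z.1)
    (h2 : z.1 ≤ B.1) (h3 : z.2 = A.2) : ¬FreePt S N z := by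
  intro hz
  obtain ⟨b1, -, b3, -, b5, b6, -, -⟩ := r.bounds h
  have b := r.a2
  have b' := r.a1
  have k1 := hz.sq _ r.ml
  have k2 := hz.sq _ r.ms
  unfold InSq at k1 k2
  rcases r.cb with e | e | e
  · subst e; grind
  · have k3 := hz.ha _ _ e
    obtain ⟨e1, e2, e3⟩ := e.ab
    unfold InH at k3; grind
  · grind

/-- The free points of the closed rectangle lie in its interior. -/
theorem wall (h : SatPack S N) (r : SquareRing S N l s t u A B) (h1 : A.1 ≤ z.1)
    (h2 : z.1 ≤ B.1) (h3 : A.2 ≤ z.2) (h4 : z.2 ≤ B.2) (hz : FreePt S N z) : InBox A B z := by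
  have k1 := fun e => r.wall_top h h1 h2 e hz
  have k2 := fun e => r.wall_bot h h1 h2 e hz
  have k3 := fun e => r.swap.wall_top h.swap (z := (z.2, z.1)) h3 h4 e hz.swap
  have k4 := fun e => r.swap.wall_bot h.swap (z := (z.2, z.1)) h3 h4 e hz.swap
  dsimp only at k3 k4
  exact ⟨lt_of_le_of_ne h1 (Ne.symm k4), lt_of_le_of_ne h2 k3, lt_of_le_of_ne h3 (Ne.symm k2),
    lt_of_le_of_ne h4 k1⟩

theorem size (h : SatPack S N) (r : SquareRing S N l s t u A B) : B.1 < A.1 + 3 * N := by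
  obtain ⟨b1, b2, b3, b4, b5, b6, b7, b8⟩ := r.bounds h
  have hN := h.pos
  rcases r.ct with e | e
  · subst e; linarith
  · linarith [h.harm_gap e]

/-- A ring surrounds a cross, if some vertical line separates the squares which cover the left
corners of the rectangle from those which cover the right corners. -/
theorem faceAt (h : SatPack S N) (r : SquareRing S N l s t u A B) {x : ℝ} (x1 : A.1 < x)
    (x2 : x < B.1) (hx : ∀ c ∈ S, Meets N A B c → c.1 + N < x ∨ x < c.1)
    (hz : FreePt S N z) (h1 : A.1 ≤ z.1) (h2 : z.1 ≤ B.1) (h3 : A.2 ≤ z.2) (h4 : z.2 ≤ B.2) :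
    FaceAt S N z := by
  have hN := h.pos
  have hlt2 := r.lt2
  -- The cross is the rectangle without the squares. It is connected: each of its points is joined
  -- along its row to the column at `x`, which meets no square.
  set K : Set Plane := {z | InBox A B z ∧ ∀ c ∈ S, ¬InSq N c z} with hK
  have hpoke : ∀ c ∈ S, Meets N A B c → (c.1 < A.1 ∧ c.1 + N < x ∨ x < c.1 ∧ B.1 < c.1 + N) ∧
      (c.2 < A.2 ∧ c.2 + N ≤ B.2 ∨ A.2 ≤ c.2 ∧ B.2 < c.2 + N) := by
    intro c hc hm
    have k1 := hx c hc hm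
    obtain ⟨m1, m2, m3, m4⟩ := hm
    have k2 := r.poke h hc m1 m2 m3 m4
    have b := r.bounds h
    grind
  have hm : ∀ c z, InBox A B z → InSq N c z → Meets N A B c := by
    rintro c z ⟨a1, a2, a3, a4⟩ ⟨b1, b2, b3, b4⟩
    exact ⟨by linarith, by linarith, by linarith, by linarith⟩
  have hcol : ∀ y, A.2 < y → y < B.2 → ((x, y) : Plane) ∈ K := by
    intro y y1 y2
    have hb : InBox A B (x, y) := ⟨x1, x2, y1, y2⟩
    refine ⟨hb, fun c hc hz => ?_⟩
    have := hx c hc (hm _ _ hb hz)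
    obtain ⟨b1, b2, b3, b4⟩ := hz
    dsimp only at *
    rcases this with h | h <;> linarith
  have hrow : ∀ z ∈ K, ∀ w ∈ uIcc z.1 x, ((w, z.2) : Plane) ∈ K := by
    rintro z ⟨hz, hzc⟩ w hw
    rw [mem_uIcc] at hw
    have hz' := id hz
    obtain ⟨z1, z2, z3, z4⟩ := hz'
    have hb : InBox A B (w, z.2) := ⟨by dsimp only; grind, by dsimp only; grind, z3, z4⟩
    refine ⟨hb, fun c hc hcz => ?_⟩
    have k := (hpoke c hc (hm _ _ hb hcz)).1
    have k' := hzc c hc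
    unfold InSq at hcz k'
    dsimp only at hcz
    grind
  obtain ⟨y0, hy0⟩ : ∃ y0, A.2 < y0 ∧ y0 < B.2 := exists_between hlt2
  have hx0 := hcol y0 hy0.1 hy0.2
  have hconn : IsPreconnected K := by
    refine isPreconnected_of_forall ((x, y0) : Plane) fun z hz => ?_
    refine ⟨(uIcc z.1 x) ×ˢ {z.2} ∪ {x} ×ˢ (uIcc z.2 y0), ?_, ?_, ?_, ?_⟩
    · rintro w (⟨w1, w2⟩ | ⟨w1, w2⟩)
      · have := hrow z hz w.1 w1
        rw [mem_singleton_iff] at w2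
        rwa [← w2] at this
      · rw [mem_singleton_iff] at w1
        have hz1 := hz.1
        obtain ⟨-, -, z3, z4⟩ := hz1
        rw [mem_uIcc] at w2
        have := hcol w.2 (by grind) (by grind)
        rwa [← w1] at this
    · right; exact ⟨rfl, right_mem_uIcc⟩
    · left; exact ⟨left_mem_uIcc, rfl⟩
    · refine IsPreconnected.union (x, z.2) ?_ ?_ ?_ ?_
      · exact ⟨right_mem_uIcc, rfl⟩
      · exact ⟨rfl, left_mem_uIcc⟩
      · exact isPreconnected_uIcc.prod isPreconnected_singleton
      · exact isPreconnected_singleton.prod isPreconnected_uIcc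
  have hne : (Prod.fst '' K).Nonempty := ⟨_, _, hx0, rfl⟩
  have hbb : BddBelow (Prod.fst '' K) := ⟨A.1, by rintro _ ⟨w, hw, rfl⟩; exact hw.1.1.le⟩
  have hba : BddAbove (Prod.fst '' K) := ⟨B.1, by rintro _ ⟨w, hw, rfl⟩; exact hw.1.2.1.le⟩
  have hopen : IsOpen K := by
    have hfin : {c | c ∈ S ∧ Meets N A B c}.Finite := by
      refine (h.finite_box (A.1 - N) B.1 (A.2 - N) B.2).subset ?_
      rintro c ⟨hc, m1, m2, m3, m4⟩
      exact ⟨hc, by linarith, by linarith, by linarith, by linarith⟩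
    have : K = (Ioo A.1 B.1 ×ˢ Ioo A.2 B.2) \
        ⋃ c ∈ {c | c ∈ S ∧ Meets N A B c}, Icc c (c + (N, N)) := by
      ext w
      simp only [hK, mem_ofPred_eq, mem_sdiff, mem_prod, mem_Ioo, mem_iUnion, not_exists]
      constructor
      · rintro ⟨hw, hwc⟩
        refine ⟨⟨⟨hw.1, hw.2.1⟩, hw.2.2⟩, fun c hc hcw => hwc c hc.1 ?_⟩
        exact ⟨hcw.1.1, hcw.2.1, hcw.1.2, hcw.2.2⟩
      · rintro ⟨⟨⟨a1, a2⟩, a3, a4⟩, hwc⟩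
        have hb : InBox A B w := ⟨a1, a2, a3, a4⟩
        exact ⟨hb, fun c hc hcw => hwc c ⟨hc, hm _ _ hb hcw⟩
          ⟨⟨hcw.1, hcw.2.2.1⟩, hcw.2.1, hcw.2.2.2⟩⟩
    rw [this]
    exact (isOpen_Ioo.prod isOpen_Ioo).sdiff (hfin.isClosed_biUnion fun c _ => isClosed_Icc)
  -- The least rectangle around the cross has the same height, but it is narrower if a square covers
  -- the full height of an end.
  set a := sInf (Prod.fst '' K) with ha
  set b := sSup (Prod.fst '' K) with hb
  have hglb : IsGLB (Prod.fst '' K) a := isGLB_csInf hne hbb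
  have hlub : IsLUB (Prod.fst '' K) b := isLUB_csSup hne hba
  have hlt : ∀ w ∈ K, a < w.1 ∧ w.1 < b := by
    intro w hw
    obtain ⟨ε, hε, hball⟩ := Metric.isOpen_iff.1 hopen w hw
    have m1 : ((w.1 - ε / 2, w.2) : Plane) ∈ K := hball (by
      rw [Metric.mem_ball, Prod.dist_eq, Real.dist_eq, Real.dist_eq]
      dsimp only; rw [sub_self, abs_zero, sub_sub_cancel_left, abs_neg, abs_of_pos (by linarith)]
      simp; linarith)
    have m2 : ((w.1 + ε / 2, w.2) : Plane) ∈ K := hball (by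
      rw [Metric.mem_ball, Prod.dist_eq, Real.dist_eq, Real.dist_eq]
      dsimp only; rw [sub_self, abs_zero, add_sub_cancel_left, abs_of_pos (by linarith)]
      simp; linarith)
    have l1 := hglb.1 ⟨_, m1, rfl⟩
    have l2 := hlub.1 ⟨_, m2, rfl⟩
    dsimp only at l1 l2
    constructor <;> linarith
  have haA : A.1 ≤ a := hglb.2 (by rintro _ ⟨w, hw, rfl⟩; exact hw.1.1.le)
  have hbB : b ≤ B.1 := hlub.2 (by rintro _ ⟨w, hw, rfl⟩; exact hw.1.2.1.le)
  have hax := hlt _ hx0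
  dsimp only at hax
  have hmm : ∀ c, Meets N (a, A.2) (b, B.2) c → Meets N A B c := by
    rintro c ⟨m1, m2, m3, m4⟩
    exact ⟨m1.trans_le hbB, haA.trans_lt m2, m3, m4⟩
  -- A square covering the full height at the left end of the rectangle would shift this end.
  have hleft : ∀ v, (∀ w ∈ K, w.1 ≤ x → v ≤ w.1) → v ≤ x → v ≤ a := by
    intro v hv hvx
    refine hglb.2 ?_
    rintro _ ⟨w, hw, rfl⟩
    rcases le_total w.1 x with h' | h'
    · exact hv w hw h'
    · linarith
  have hright : ∀ v, (∀ w ∈ K, x ≤ w.1 → w.1 ≤ v) → x ≤ v → b ≤ v := by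
    intro v hv hvx
    refine hlub.2 ?_
    rintro _ ⟨w, hw, rfl⟩
    rcases le_total w.1 x with h' | h'
    · linarith
    · exact hv w hw h'
  refine ⟨(a, A.2), (b, B.2), K, ⟨isGLB_prod.2 ⟨hglb, ?_⟩, isLUB_prod.2 ⟨hlub, ?_⟩, ?_, hconn,
    fun w hw => r.free h hw.1 hw.2, ?_, ?_, ?_, ?_⟩, r.wall h h1 h2 h3 h4 hz, hz.sq⟩
  · refine ⟨?_, fun v hv => ?_⟩
    · rintro _ ⟨w, hw, rfl⟩; exact hw.1.2.2.1.le
    · refine le_of_forall_gt_imp_ge_of_dense fun y (hy : A.2 < y) => ?_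
      obtain ⟨y', k1, k2⟩ := exists_between (lt_min hy hlt2)
      rw [lt_min_iff] at k2
      exact (hv ⟨_, hcol y' k1 k2.2, rfl⟩).trans k2.1.le
  · refine ⟨?_, fun v hv => ?_⟩
    · rintro _ ⟨w, hw, rfl⟩; exact hw.1.2.2.2.le
    · refine le_of_forall_lt_imp_le_of_dense fun y (hy : y < B.2) => ?_
      obtain ⟨y', k1, k2⟩ := exists_between (max_lt hy hlt2)
      rw [max_lt_iff] at k1
      exact k1.1.le.trans (hv ⟨_, hcol y' k1.2 k2, rfl⟩)
  · intro w
    constructor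
    · intro hw
      exact ⟨⟨(hlt w hw).1, (hlt w hw).2, hw.1.2.2.1, hw.1.2.2.2⟩, hw.2⟩
    · rintro ⟨⟨k1, k2, k3, k4⟩, hw⟩
      exact ⟨⟨haA.trans_lt k1, k2.trans_le hbB, k3, k4⟩, hw⟩
  · intro w k1 k2 k3 k4 hw
    exact ⟨r.wall h (haA.trans k1) (k2.trans hbB) k3 k4 hw, hw.sq⟩
  · intro c hc hcm
    obtain ⟨p1, p2⟩ := hpoke c hc (hmm c hcm)
    obtain ⟨m1, m2, m3, m4⟩ := hcm
    dsimp only at *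
    have hK2 : ∀ w ∈ K, A.1 < w.1 ∧ w.1 < B.1 ∧ A.2 < w.2 ∧ w.2 < B.2 ∧ ¬InSq N c w :=
      fun w hw => ⟨hw.1.1, hw.1.2.1, hw.1.2.2.1, hw.1.2.2.2, hw.2 c hc⟩
    simp only [InSq] at hK2
    have q1 : c.1 < A.1 ∧ c.1 + N < x → ¬(c.2 ≤ A.2 ∧ B.2 ≤ c.2 + N) := by
      rintro ⟨e1, e2⟩ ⟨e3, e4⟩
      have := hleft (c.1 + N) (fun w hw hwx => by
        have := hK2 w hw; grind) e2.le
      linarith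
    have q2 : x < c.1 ∧ B.1 < c.1 + N → ¬(c.2 ≤ A.2 ∧ B.2 ≤ c.2 + N) := by
      rintro ⟨e1, e2⟩ ⟨e3, e4⟩
      have := hright c.1 (fun w hw hwx => by
        have := hK2 w hw; grind) e1.le
      linarith
    clear hK2 hleft hright
    grind
  · intro c hc c' hc' hcm hcm' hne
    obtain ⟨p1, p2⟩ := hpoke c hc (hmm c hcm)
    obtain ⟨p1', p2'⟩ := hpoke c' hc' (hmm c' hcm')
    obtain ⟨m1, m2, m3, m4⟩ := hcm
    obtain ⟨m1', m2', m3', m4'⟩ := hcm'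
    dsimp only at *
    have hK2 : ∀ w ∈ K, A.1 < w.1 ∧ w.1 < B.1 ∧ A.2 < w.2 ∧ w.2 < B.2 ∧ ¬InSq N c w ∧
        ¬InSq N c' w :=
      fun w hw => ⟨hw.1.1, hw.1.2.1, hw.1.2.2.1, hw.1.2.2.2, hw.2 c hc, hw.2 c' hc'⟩
    simp only [InSq] at hK2
    have sp := h.sep c hc c' hc' hne
    by_contra! hcon
    have q1 : c.1 < A.1 ∧ c.1 + N < x → c'.1 < A.1 ∧ c'.1 + N < x → False := by
      rintro ⟨e1, e2⟩ ⟨e3, e4⟩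
      have := hleft (min c.1 c'.1 + N) (fun w hw hwx => by
        have := hK2 w hw
        rw [min_add_le]; grind) (by rw [min_add_le]; left; linarith)
      rw [min_add_le] at this
      rcases this with h | h <;> linarith
    have q2 : x < c.1 ∧ B.1 < c.1 + N → x < c'.1 ∧ B.1 < c'.1 + N → False := by
      rintro ⟨e1, e2⟩ ⟨e3, e4⟩
      have := hright (max c.1 c'.1) (fun w hw hwx => by
        have := hK2 w hw
        rw [le_max_iff]; grind) (by rw [le_max_iff]; left; linarith)
      rw [le_max_iff] at this
      rcases this with h | h <;> linarith
    clear hK2 hleft hright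
    grind
  · have h1 := r.size h
    have h2 := r.swap.size h.swap
    dsimp only at *
    constructor <;> linarith

end SquareRing

/-! ### Free columns -/

/-- The open vertical segment from `(x, c)` to `(x, d)` meets no square and no arm, and is not
aligned with a vertical side of a square. -/
structure Col (S : Set Plane) (N x c d : ℝ) : Prop where
  lt : c < d
  gen : ∀ z ∈ S, z.1 ≠ x ∧ z.1 + N ≠ x
  free : ∀ y, c < y → y < d → FreePt S N (x, y)

namespace Col

variable {x c d : ℝ} {z D U V W : Plane}

theorem sq (k : Col S N x c d) (hz : z ∈ S) (h1 : z.1 ≤ x) (h2 : x ≤ z.1 + N) :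
    z.2 + N ≤ c ∨ d ≤ z.2 := by
  by_contra! hc
  have hlt := k.lt
  by_cases h : z.2 ≤ z.2 + N
  · obtain ⟨y, y1, y2⟩ : ∃ y, max c z.2 ≤ y ∧ y ≤ min d (z.2 + N) ∧ c < y ∧ y < d := by
      have : max c z.2 < min d (z.2 + N) ∨ z.2 = z.2 + N := by
        rcases h.lt_or_eq with h | h
        · left; simp only [max_lt_iff, lt_min_iff]; tauto
        · tauto
      rcases this with h | h
      · obtain ⟨y, y1, y2⟩ := exists_between h
        exact ⟨y, y1.le, y2.le, (le_max_left _ _).trans_lt y1, y2.trans_le (min_le_left _ _)⟩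
      · exact ⟨z.2, by simp; linarith, by simp; constructor <;> linarith, by linarith, hc.2⟩
    simp only [max_le_iff, le_min_iff] at y1 y2
    exact (k.free y y2.2.1 y2.2.2).sq z hz ⟨h1, h2, y1.2, y2.1.2⟩
  · linarith

theorem ha (k : Col S N x c d) (a : HArm S N p q) (h1 : p.1 + N ≤ x) (h2 : x ≤ q.1) :
    p.2 + N ≤ c ∨ q.2 + N ≤ c ∨ d ≤ p.2 ∨ d ≤ q.2 := by
  by_contra! hc
  have hlt := k.lt
  obtain ⟨-, e1, e2⟩ := a.ab
  have : max c (max p.2 q.2) < min d (min (p.2 + N) (q.2 + N)) := by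
    simp only [max_lt_iff, lt_min_iff]
    refine ⟨⟨?_, ?_, ?_⟩, ⟨?_, ?_, ?_⟩, ?_, ?_, ?_⟩ <;> linarith
  obtain ⟨y, k1, k2⟩ := exists_between this
  simp only [max_lt_iff, lt_min_iff] at k1 k2
  exact (k.free y k1.1 k2.1).ha p q a
    ⟨k1.2.1.le, k1.2.2.le, k2.2.1.le, k2.2.2.le, h1, h2⟩

theorem va (k : Col S N x c d) (a : VArm S N p q) (h1 : p.1 ≤ x) (h2 : x ≤ p.1 + N)
    (h3 : q.1 ≤ x) (h4 : x ≤ q.1 + N) : q.2 ≤ c ∨ d ≤ p.2 + N := by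
  by_contra! hc
  have hlt := k.lt
  have e := a.ab.1
  rcases lt_or_ge (p.2 + N) d with h' | h'
  · have : ∃ y, c < y ∧ y < d ∧ p.2 + N ≤ y ∧ y ≤ q.2 := by
      rcases le_or_gt (p.2 + N) c with g | g
      · obtain ⟨y, y1, y2⟩ := exists_between (lt_min hlt hc.1)
        rw [lt_min_iff] at y2
        exact ⟨y, y1, y2.1, by linarith, y2.2.le⟩
      · exact ⟨p.2 + N, g, h', le_rfl, e⟩
    obtain ⟨y, y1, y2, y3, y4⟩ := this
    exact (k.free y y1 y2).va p q a ⟨h1, h3, h2, h4, y3, y4⟩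
  · linarith

theorem neg (k : Col S N x c d) : Col (negS S N) N (-x) c d where
  lt := k.lt
  gen z hz := by
    have := k.gen _ hz
    dsimp only at this
    exact ⟨fun e => this.2 (by linarith), fun e => this.1 (by linarith)⟩
  free y y1 y2 := (k.free y y1 y2).neg

/-- No square fits in the height of the column and next to it. -/
theorem ns (h : SatPack S N) (k : Col S N x c d) (hz : z ∈ S) (h1 : c ≤ z.2) (h2 : z.2 + N ≤ d)
    (h3 : x < z.1) (h4 : z.1 < x + N) : False := by
  obtain ⟨l, hl, ⟨r1, r2, r3⟩, r4, r5⟩ := h.exists_left hz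
  have a : HArm S N l z := ⟨hl, hz, ⟨r1, r2, r3⟩, Or.inr r5⟩
  have hN := h.pos
  rcases le_or_gt (l.1 + N) x with e | e
  · rcases k.ha a e h3.le with g | g | g | g <;> linarith
  · rcases k.sq hl (by linarith) e.le with g | g <;> linarith

theorem ns' (h : SatPack S N) (k : Col S N x c d) (hz : z ∈ S) (h1 : c ≤ z.2) (h2 : z.2 + N ≤ d)
    (h3 : z.1 + N < x) (h4 : x < z.1 + 2 * N) : False :=
  k.neg.ns h.neg (negS_mk hz) h1 h2 (by dsimp only; linarith) (by dsimp only; linarith)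

/-- All that is used of a free column, in the form of inequalities. -/
theorem facts (h : SatPack S N) (k : Col S N x c d) : ∀ z ∈ S, (z.1 + N < x ∨ x < z.1 ∨
    z.2 + N ≤ c ∨ d ≤ z.2) ∧ z.1 ≠ x ∧ z.1 + N ≠ x ∧ (c ≤ z.2 → z.2 + N ≤ d →
      z.1 + 2 * N ≤ x ∨ x + N ≤ z.1) := by
  intro z hz
  obtain ⟨g1, g2⟩ := k.gen z hz
  refine ⟨?_, g1, g2, fun h1 h2 => ?_⟩
  · by_contra! hc
    rcases k.sq hz hc.2.1 hc.1 with h | h <;> linarith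
  · by_contra! hc
    have hN := h.pos
    have : z.1 + N < x ∨ x < z.1 := by
      by_contra! hc'
      rcases k.sq hz hc'.2 hc'.1 with h | h <;> linarith [k.lt]
    rcases this with e | e
    · exact k.ns' h hz h1 h2 e (by linarith)
    · exact k.ns h hz h1 h2 e (by linarith)

/-- A free column with a square at both ends, the nearest square above the lower one being on the
right. -/
theorem faceAt_ss_right (h : SatPack S N) (k : Col S N x c d) (hD : D ∈ S) (hU : U ∈ S)
    (d1 : D.1 < x) (d2 : x < D.1 + N) (d3 : D.2 + N = c) (u1 : U.1 < x) (u2 : x < U.1 + N)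
    (u3 : U.2 = d) (hDU : ¬VArm S N D U) (hV : V ∈ S) (hDV : Abv N D V)
    (hV' : ∀ w ∈ S, Abv N D w → V.2 ≤ w.2) (hx : x < V.1) {y : ℝ} (y1 : c < y) (y2 : y < d) :
    FaceAt S N (x, y) := by
  have hN := h.pos
  have hlt := k.lt
  have F := k.facts h
  obtain ⟨W, hW, hWU, hW2, hW'⟩ := h.exists_down hU
  have aDU : Abv N D U := ⟨by linarith, by linarith, by linarith⟩
  have v1 : V.2 < U.2 := lt_of_le_of_ne (hV' U hU aDU) fun e => hDU
    ⟨hD, hU, aDU, Or.inl fun w hw hDw => e ▸ hV' w hw hDw⟩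
  have w1 : D.2 < W.2 := lt_of_le_of_ne (hW' D hD aDU) fun e => hDU
    ⟨hD, hU, aDU, Or.inr fun w hw hwU => e ▸ hW' w hw hwU⟩
  have a1 : VArm S N D V := ⟨hD, hV, hDV, Or.inl hV'⟩
  have a2 : VArm S N W U := ⟨hW, hU, hWU, Or.inr hW'⟩
  obtain ⟨e1, e2, e3⟩ := id hDV
  obtain ⟨f1, f2, f3⟩ := id hWU
  have FV := F V hV
  have FW := F W hW
  have sVU := h.sep V hV U hU (by rintro rfl; linarith)
  have sWD := h.sep W hW D hD (by rintro rfl; linarith)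
  -- `W`, `D`, `V`, `U` form a pinwheel around the column: `V` lies on its right, next to `U`, and
  -- `W` on its left, next to `D`.
  have w2 : W.1 + N < x := by
    have sVW : V = W ∨ _ := or_iff_not_imp_left.2 (h.sep V hV W hW)
    grind
  have v2 : U.1 + N ≤ V.1 := by grind
  have w3 : W.1 + N ≤ D.1 := by grind
  have v3 : U.2 < V.2 + N := by grind
  have w4 : W.2 < D.2 + N := by grind
  have b1 : HArm S N U V := by
    refine ⟨hU, hV, ⟨v2, v3, by linarith⟩, Or.inr ?_⟩
    rintro z hz ⟨z1, z2, z3⟩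
    have Fz := F z hz
    have szU : z = U ∨ _ := or_iff_not_imp_left.2 (h.sep z hz U hU)
    grind
  have b2 : HArm S N W D := by
    refine ⟨hW, hD, ⟨w3, w4, by linarith⟩, Or.inl ?_⟩
    rintro z hz ⟨z1, z2, z3⟩
    have Fz := F z hz
    have szD : z = D ∨ _ := or_iff_not_imp_left.2 (h.sep z hz D hD)
    grind
  have r : SquareRing S N W D V U (min W.1 U.1 + N, c) (V.1, d) := by
    refine ⟨hW, hD, hV, hU, Or.inr (Or.inl a2), Or.inr a1, Or.inr (Or.inl b2), Or.inr b1,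
      ?_, ?_, ?_, ?_, ?_, hlt, fun a => (hDU a).elim, ?_, ?_, ?_, ?_⟩
    · dsimp only; grind
    · dsimp only; grind
    · dsimp only; grind
    · dsimp only; grind
    · dsimp only; grind
    · intro a; have := a.ab.2; grind
    · intro a; have := a.ab.2; grind
    · intro a; have := k.ha a (by linarith) (by linarith); grind
    · intro z hz; have Fz := F z hz
      dsimp only; grind
  refine r.faceAt h (x := x) (by dsimp only; grind) hx ?_ (k.free y y1 y2) ?_ ?_ y1.le y2.le
  · rintro z hz ⟨z1, z2, z3, z4⟩
    have Fz := F z hz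
    dsimp only at *; grind
  · dsimp only; grind
  · dsimp only; grind

/-- A free column with a square at both ends. -/
theorem faceAt_ss (h : SatPack S N) (k : Col S N x c d) (hD : D ∈ S) (hU : U ∈ S)
    (d1 : D.1 < x) (d2 : x < D.1 + N) (d3 : D.2 + N = c) (u1 : U.1 < x) (u2 : x < U.1 + N)
    (u3 : U.2 = d) {y : ℝ} (y1 : c < y) (y2 : y < d) : FaceAt S N (x, y) := by
  have hN := h.pos
  have hlt := k.lt
  have hDU : ¬VArm S N D U := fun a => by
    rcases k.va a d1.le d2.le u1.le u2.le with h | h <;> linarith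
  obtain ⟨V, hV, hDV, -, hV'⟩ := h.exists_up hD
  have aDU : Abv N D U := ⟨by linarith, by linarith, by linarith⟩
  have v1 : V.2 < U.2 := lt_of_le_of_ne (hV' U hU aDU) fun e => hDU
    ⟨hD, hU, aDU, Or.inl fun w hw hDw => e ▸ hV' w hw hDw⟩
  obtain ⟨e1, e2, e3⟩ := id hDV
  have FV := k.facts h V hV
  have : x < V.1 ∨ V.1 + N < x := by grind
  rcases this with hx | hx
  · exact k.faceAt_ss_right h hD hU d1 d2 d3 u1 u2 u3 hDU hV hDV hV' hx y1 y2
  · refine FaceAt.of_neg (k.neg.faceAt_ss_right h.neg (negS_mk hD) (negS_mk hU) (V := (-V.1 - N, V.2))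
      ?_ ?_ d3 ?_ ?_ u3 ?_ (negS_mk hV) ?_ ?_ ?_ y1 y2) <;> try dsimp only
    · linarith
    · linarith
    · linarith
    · linarith
    · intro a; have := a.neg; rw [negS_negS] at this; simp at this; exact hDU this
    · exact ⟨e1, by linarith, by linarith⟩
    · rintro w hw ⟨w1, w2, w3⟩
      exact hV' (-w.1 - N, w.2) hw ⟨w1, by dsimp only; linarith, by dsimp only; linarith⟩
    · linarith

/-- Two horizontal arms which bound a free column: their left squares are joined by an arm. -/
theorem hh_left (h : SatPack S N) (k : Col S N x c d) {l : Plane} (a : HArm S N l s)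
    (b : HArm S N u t) (l1 : l.1 + N < x) (s1 : x < s.1) (u1 : u.1 + N < x) (t1 : x < t.1)
    (hc : c ≤ l.2 + N ∧ c ≤ s.2 + N ∧ (c = l.2 + N ∨ c = s.2 + N))
    (hd : u.2 ≤ d ∧ t.2 ≤ d ∧ (d = u.2 ∨ d = t.2)) : l = u ∨ VArm S N l u := by
  have hN := h.pos
  have hlt := k.lt
  have F := k.facts h
  have ga := h.harm_gap a
  have gb := h.harm_gap b
  obtain ⟨-, a1, a2⟩ := id a.ab
  obtain ⟨-, b1, b2⟩ := id b.ab
  refine or_iff_not_imp_left.2 fun hne => ?_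
  have slu := h.sep l a.ms u b.ms hne
  have hlu : Abv N l u := ⟨by grind, by linarith, by linarith⟩
  refine ⟨a.ms, b.ms, hlu, ?_⟩
  by_contra! hcon
  obtain ⟨⟨z, hz, ⟨z1, z2, z3⟩, z4⟩, w, hw, ⟨w1, w2, w3⟩, w4⟩ := hcon
  obtain ⟨e1, e2, e3⟩ := hlu
  -- The arm on the right of a square between the levels of `l` and `u` would cross the column.
  have key : ∀ z ∈ S, l.2 + N ≤ z.2 → z.2 + N ≤ u.2 → l.1 < z.1 + N → z.1 < l.1 + N →
      z.1 + 2 * N ≤ x → False := by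
    intro z hz h1 h2 h3 h4 h5
    obtain ⟨r, hr, ⟨r1, r2, r3⟩, r4, r5⟩ := h.exists_right hz
    have az : HArm S N z r := ⟨hz, hr, ⟨r1, r2, r3⟩, Or.inl r5⟩
    have Fr := F r hr
    have kr := k.ha az (by linarith)
    have su : r = u ∨ _ := or_iff_not_imp_left.2 (h.sep r hr u b.ms)
    have sl : r = l ∨ _ := or_iff_not_imp_left.2 (h.sep r hr l a.ms)
    grind
  -- A square seen from `l` below `u` lies on the left of `u`, and conversely.
  have c1 : z.1 + N ≤ u.1 := by
    have Fz := F z hz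
    have kz := key z hz z1
    have sz := h.sep z hz u b.ms (by rintro rfl; linarith)
    grind
  have c2 : w.1 + N ≤ l.1 := by
    have Fw := F w hw
    have sw := h.sep w hw l a.ms (by rintro rfl; linarith)
    have kw := key w hw
    grind
  linarith

/-- A free column between two horizontal arms: their four ends form a ring. -/
theorem faceAt_hh (h : SatPack S N) (k : Col S N x c d) {l : Plane} (a : HArm S N l s)
    (b : HArm S N u t) (l1 : l.1 + N < x) (s1 : x < s.1) (u1 : u.1 + N < x) (t1 : x < t.1)
    (hc : c ≤ l.2 + N ∧ c ≤ s.2 + N ∧ (c = l.2 + N ∨ c = s.2 + N))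
    (hd : u.2 ≤ d ∧ t.2 ≤ d ∧ (d = u.2 ∨ d = t.2)) {y : ℝ} (y1 : c < y) (y2 : y < d) :
    FaceAt S N (x, y) := by
  have hN := h.pos
  have hlt := k.lt
  have F := k.facts h
  have cl := k.hh_left h a b l1 s1 u1 t1 hc hd
  have cr : s = t ∨ VArm S N s t := by
    have := k.neg.hh_left h.neg a.neg b.neg (by dsimp only; linarith) (by dsimp only; linarith)
      (by dsimp only; linarith) (by dsimp only; linarith) ⟨hc.2.1, hc.1, hc.2.2.symm⟩
      ⟨hd.2.1, hd.1, hd.2.2.symm⟩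
    rcases this with e | e
    · left; rw [Prod.mk.injEq] at e; exact Prod.ext (by linarith [e.1]) e.2
    · right; have := e.neg; rw [negS_negS] at this; simpa using this
  have ga := h.harm_gap a
  have gb := h.harm_gap b
  obtain ⟨a0, a1, a2⟩ := id a.ab
  obtain ⟨b0, b1, b2⟩ := id b.ab
  have cl' : l = u ∨ l.2 + N ≤ u.2 := cl.imp_right fun a => a.ab.1
  have cr' : s = t ∨ s.2 + N ≤ t.2 := cr.imp_right fun a => a.ab.1
  have r : SquareRing S N l s t u (min l.1 u.1 + N, c) (max s.1 t.1, d) := by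
    refine ⟨a.ms, a.mt, b.mt, b.ms, cl.imp_right Or.inl, cr, Or.inr (Or.inl a), Or.inr b,
      ?_, hc, ?_, hd, ?_, hlt, fun a => ?_, fun a => ?_, fun a => ?_, fun a => ?_, ?_⟩
    · dsimp only; grind
    · dsimp only; grind
    · dsimp only; grind
    · have := a.ab.2; grind
    · have := a.ab.2; grind
    · have := k.ha a (by linarith) (by linarith); have := a.ab.2; grind
    · have := k.ha a (by linarith) (by linarith); have := a.ab.2; grind
    · intro z hz; have Fz := F z hz
      dsimp only; grind
  refine r.faceAt h (x := x) (by dsimp only; grind) (by dsimp only; grind) ?_ (k.free y y1 y2)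
    ?_ ?_ y1.le y2.le
  · rintro z hz ⟨z1, z2, z3, z4⟩
    have Fz := F z hz
    dsimp only at *; grind
  · dsimp only; grind
  · dsimp only; grind

end Col

namespace Col

variable {x c d : ℝ} {z D U V W : Plane}

/-- The nearest square above the lower end of a free column bounded above by a horizontal arm is
at one of the ends of this arm. -/
theorem sh_nearest (h : SatPack S N) (k : Col S N x c d) (hD : D ∈ S) (d1 : D.1 < x)
    (d2 : x < D.1 + N) (d3 : D.2 + N = c) (b : HArm S N u t) (u1 : u.1 + N < x) (t1 : x < t.1)
    (hd : u.2 ≤ d ∧ t.2 ≤ d ∧ (d = u.2 ∨ d = t.2)) :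
    (Abv N D t ∧ ∀ w ∈ S, Abv N D w → t.2 ≤ w.2) ∨
    (Abv N D u ∧ ∀ w ∈ S, Abv N D w → u.2 ≤ w.2) := by
  have hN := h.pos
  have hlt := k.lt
  have F := k.facts h
  have gb := h.harm_gap b
  obtain ⟨-, b1, b2⟩ := id b.ab
  obtain ⟨v, hv, hDv, -, hv'⟩ := h.exists_up hD
  by_cases e1 : v = t
  · subst e1; exact Or.inl ⟨hDv, hv'⟩
  by_cases e2 : v = u
  · subst e2; exact Or.inr ⟨hDv, hv'⟩
  exfalso
  have ku := hv' u b.ms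
  have kt := hv' t b.mt
  obtain ⟨f1, f2, f3⟩ := hDv
  have Fv := F v hv
  have sv := h.harm_disj b hv e2 e1
  rw [le_max_iff, min_add_le] at sv
  have su := h.sep v hv u b.ms e2
  have st := h.sep v hv t b.mt e1
  have sDu := h.sep D hD u b.ms (by rintro rfl; linarith)
  have sDt := h.sep D hD t b.mt (by rintro rfl; linarith)
  have key : v.2 ≤ u.2 ∨ v.2 ≤ t.2 := by
    rcases lt_or_ge D.1 (u.1 + N) with g | g
    · left; exact ku ⟨by grind, g, by linarith⟩
    · right; exact kt ⟨by grind, by linarith, by linarith⟩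
  clear ku kt sDu sDt
  grind

/-- The two pinwheels in which the arm at the upper end of the column is seen from the square at
its lower end. -/
theorem faceAt_sh_near (h : SatPack S N) (k : Col S N x c d) (hD : D ∈ S) (d1 : D.1 < x)
    (d2 : x < D.1 + N) (d3 : D.2 + N = c) (b : HArm S N u t) (u1 : u.1 + N < x) (t1 : x < t.1)
    (hd : u.2 ≤ d ∧ t.2 ≤ d ∧ (d = u.2 ∨ d = t.2)) (a : VArm S N D t) (hDu : Abv N D u)
    {y : ℝ} (y1 : c < y) (y2 : y < d) : FaceAt S N (x, y) := by
  have hN := h.pos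
  have hlt := k.lt
  have F := k.facts h
  have gb := h.harm_gap b
  obtain ⟨b0, b1, b2⟩ := id b.ab
  obtain ⟨a0, a1, a2⟩ := id a.ab
  obtain ⟨e1, e2, e3⟩ := id hDu
  -- Either `D`, `t`, `u` surround the column, or the nearest square `l` below `u` completes the
  -- ring.
  by_cases a' : VArm S N D u
  · have r : SquareRing S N D D t u (u.1 + N, c) (t.1, d) := by
      refine ⟨hD, hD, b.mt, b.ms, Or.inr (Or.inl a'), Or.inr a, Or.inl rfl, Or.inr b,
        ?_, ?_, ?_, hd, ?_, hlt, fun a => Or.inl rfl, fun a => Or.inl rfl, fun a => ?_,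
        fun a => ?_, ?_⟩
      · dsimp only; grind
      · dsimp only; grind
      · dsimp only; grind
      · dsimp only; grind
      · have := a.ab.2; grind
      · have := a.ab.2; grind
      · intro z hz; have Fz := F z hz
        dsimp only; grind
    refine r.faceAt h (x := x) u1 t1 ?_ (k.free y y1 y2) u1.le t1.le y1.le y2.le
    rintro z hz ⟨z1, z2, z3, z4⟩
    have Fz := F z hz
    dsimp only at *; grind
  · obtain ⟨l, hl, hlu, l1, l2⟩ := h.exists_down b.ms
    have w1 : D.2 < l.2 := lt_of_le_of_ne (l2 D hD hDu) fun e => a'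
      ⟨hD, b.ms, hDu, Or.inr fun w hw hwU => e ▸ l2 w hw hwU⟩
    have al : VArm S N l u := ⟨hl, b.ms, hlu, Or.inr l2⟩
    obtain ⟨f1, f2, f3⟩ := id hlu
    have Fl := F l hl
    have sl := h.sep l hl D hD (by rintro rfl; linarith)
    have l3 : l.1 + N < x := by grind
    have l4 : l.2 < c := by
      by_contra! hc
      obtain ⟨r, hr, ⟨r1, r2, r3⟩, r4, r5⟩ := h.exists_right hl
      have az : HArm S N l r := ⟨hl, hr, ⟨r1, r2, r3⟩, Or.inl r5⟩
      have Fr := F r hr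
      have kr := k.ha az l3.le
      have su : r = u ∨ _ := or_iff_not_imp_left.2 (h.sep r hr u b.ms)
      have sD : r = D ∨ _ := or_iff_not_imp_left.2 (h.sep r hr D hD)
      have lr := l2 r hr
      simp only [Abv, and_imp] at lr
      grind
    have l5 : l.1 + N ≤ D.1 := by grind
    have al' : HArm S N l D := by
      refine ⟨hl, hD, ⟨l5, by linarith, by linarith⟩, Or.inl ?_⟩
      rintro z hz ⟨z1, z2, z3⟩
      have Fz := F z hz
      have szD : z = D ∨ _ := or_iff_not_imp_left.2 (h.sep z hz D hD)
      have szu : z = u ∨ _ := or_iff_not_imp_left.2 (h.sep z hz u b.ms)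
      grind
    have r : SquareRing S N l D t u (min l.1 u.1 + N, c) (t.1, d) := by
      refine ⟨hl, hD, b.mt, b.ms, Or.inr (Or.inl al), Or.inr a, Or.inr (Or.inl al'), Or.inr b,
        ?_, ?_, ?_, hd, ?_, hlt, fun a => (a' a).elim, fun a => ?_, fun a => ?_,
        fun a => ?_, ?_⟩
      · dsimp only; grind
      · dsimp only; grind
      · dsimp only; grind
      · dsimp only; grind
      · have := a.ab.2; grind
      · have := a.ab.2; grind
      · have := k.ha a (by linarith) (by linarith); have := a.ab.2; grind
      · intro z hz; have Fz := F z hz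
        dsimp only; grind
    refine r.faceAt h (x := x) (by dsimp only; grind) t1 ?_ (k.free y y1 y2)
      (by dsimp only; grind) t1.le y1.le y2.le
    rintro z hz ⟨z1, z2, z3, z4⟩
    have Fz := F z hz
    dsimp only at *; grind

/-- The three squares surrounding the column, when the left end of the upper arm lies on the left
of the lower square and low enough to touch it or to be joined to it. -/
theorem faceAt_sh_side (h : SatPack S N) (k : Col S N x c d) (hD : D ∈ S) (d1 : D.1 < x)
    (d2 : x < D.1 + N) (d3 : D.2 + N = c) (b : HArm S N u t) (u1 : u.1 + N < x) (t1 : x < t.1)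
    (hd : u.2 ≤ d ∧ t.2 ≤ d ∧ (d = u.2 ∨ d = t.2)) (a : VArm S N D t)
    (hu : (u.1 + N ≤ D.1 ∧ u.2 < c) ∨ (u.1 + N = D.1 ∧ u.2 = c))
    {y : ℝ} (y1 : c < y) (y2 : y < d) : FaceAt S N (x, y) := by
  have hN := h.pos
  have hlt := k.lt
  have F := k.facts h
  have gb := h.harm_gap b
  obtain ⟨b0, b1, b2⟩ := id b.ab
  obtain ⟨a0, a1, a2⟩ := id a.ab
  have cb : HArm S N u D ∨ (u.1 + N = D.1 ∧ u.2 = c) := by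
    rcases hu with hu | hu
    · left
      refine ⟨b.ms, hD, ⟨hu.1, by linarith, by grind⟩, Or.inl ?_⟩
      rintro z hz ⟨z1, z2, z3⟩
      by_contra! hzD
      have Fz := F z hz
      have szD := h.sep z hz D hD (by rintro rfl; linarith)
      have szu := h.harm_disj b hz (by rintro rfl; linarith) (by rintro rfl; linarith)
      rw [le_max_iff, min_add_le] at szu
      grind
    · exact Or.inr hu
  have r : SquareRing S N u D t u (u.1 + N, c) (t.1, d) := by
    refine ⟨b.ms, hD, b.mt, b.ms, Or.inl rfl, Or.inr a, Or.inr (cb.imp_right fun e =>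
      ⟨rfl, e.1, by linarith [e.2]⟩), Or.inr b,
      ?_, ?_, ?_, hd, ?_, hlt, fun a => ?_, fun a => ?_, fun a => Or.inl rfl, fun a => Or.inl rfl,
      ?_⟩
    · dsimp only; grind
    · dsimp only; grind
    · dsimp only; grind
    · dsimp only; grind
    · have := a.ab; unfold Abv at this; grind
    · have := a.ab; unfold Abv at this; grind
    · intro z hz; have Fz := F z hz
      dsimp only; grind
  refine r.faceAt h (x := x) u1 t1 ?_ (k.free y y1 y2) u1.le t1.le y1.le y2.le
  rintro z hz ⟨z1, z2, z3, z4⟩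
  have Fz := F z hz
  dsimp only at *; grind

/-- The fourth square of the ring, when the left end of the upper arm lies above and on the left
of the lower square: a square which is both below `u` and on the left of `D`. -/
theorem exists_fourth (h : SatPack S N) (k : Col S N x c d) (hD : D ∈ S) (d1 : D.1 < x)
    (d2 : x < D.1 + N) (d3 : D.2 + N = c) (b : HArm S N u t) (u1 : u.1 + N < x) (t1 : x < t.1)
    (hd : u.2 ≤ d ∧ t.2 ≤ d ∧ (d = u.2 ∨ d = t.2)) (a : VArm S N D t)
    (hu : u.1 + N ≤ D.1) (hu' : c ≤ u.2) :
    ∃ l, VArm S N l u ∧ HArm S N l D := by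
  have hN := h.pos
  have hlt := k.lt
  have F := k.facts h
  have gb := h.harm_gap b
  obtain ⟨b0, b1, b2⟩ := id b.ab
  obtain ⟨a0, a1, a2⟩ := id a.ab
  -- No square over `D` and on the left of the column is lower than the arm.
  have N1 : ∀ z ∈ S, D.1 < z.1 + N → z.1 < D.1 + N → z.1 < x → z.2 < u.2 → z.2 < t.2 + N →
      D.2 < z.2 + N → D ≠ z → False := by
    intro z hz h1 h2 h3 h4 h5 h6 h7
    have Fz := F z hz
    have szD := h.sep z hz D hD h7.symm
    have szu := h.harm_disj b hz (by rintro rfl; linarith) (by rintro rfl; linarith)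
    have szu' := h.sep z hz u b.ms (by rintro rfl; linarith)
    rw [le_max_iff, min_add_le] at szu
    grind
  -- No square next to the column on its left lies between the levels of `D` and `u`: its arm to the
  -- right would cross the column.
  have N2 : ∀ z ∈ S, z.1 + N ≤ D.1 → D.1 < z.1 + 2 * N → c ≤ z.2 → z.2 + N ≤ u.2 → False := by
    intro z hz h1 h2 h3 h4
    obtain ⟨r, hr, ⟨r1, r2, r3⟩, r4, r5⟩ := h.exists_right hz
    have az : HArm S N z r := ⟨hz, hr, ⟨r1, r2, r3⟩, Or.inl r5⟩
    have Fr := F r hr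
    have kr := k.ha az (by linarith)
    have n1 := N1 r hr
    grind
  -- Among the squares which are both below `u` and on the left of `D`, the one which is extremal in
  -- the diagonal direction is joined to both.
  set Q : Set Plane := {z | z ∈ S ∧ z.1 + N ≤ D.1 ∧ z.2 < D.2 + N ∧ D.2 < z.2 + N ∧
    z.2 + N ≤ u.2 ∧ z.1 < u.1 + N ∧ u.1 < z.1 + N} with hQ
  have hQf : Q.Finite := (h.finite_box (u.1 - N) (u.1 + N) (D.2 - N) (D.2 + N)).subset (by
    rintro z ⟨hz, h1, h2, h3, h4, h5, h6⟩
    exact ⟨hz, by linarith, by linarith, by linarith, by linarith⟩)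
  have hQn : Q.Nonempty := by
    obtain ⟨z, hz, z1, z2, z3, z4⟩ := h.sat (D.1 - N) (min u.2 t.2 - N)
    have Fz := F z hz
    have m1 : min u.2 t.2 ≤ u.2 := min_le_left _ _
    have m2 : min u.2 t.2 ≤ t.2 := min_le_right _ _
    have m3 : c ≤ min u.2 t.2 := le_min hu' (by linarith)
    have n1 := N1 z hz
    have zD : z.1 + N ≤ D.1 := by
      by_contra! hc
      exact n1 hc (by linarith) (by linarith) (by linarith) (by linarith) (by linarith)
        (by rintro rfl; linarith)
    have szu := h.sep z hz u b.ms (by rintro rfl; linarith)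
    have n2 := N2 z hz
    refine ⟨z, hz, zD, ?_, ?_, ?_, ?_, ?_⟩ <;> grind
  obtain ⟨l, hl, hmax⟩ := Set.exists_max_image Q (fun z => z.1 + z.2) hQf hQn
  obtain ⟨l0, l1, l2, l3, l4, l5, l6⟩ := hl
  have hm : ∀ z ∈ S, z.1 + N ≤ D.1 → z.2 < D.2 + N → D.2 < z.2 + N →
    z.2 + N ≤ u.2 → z.1 < u.1 + N → u.1 < z.1 + N → z.1 + z.2 ≤ l.1 + l.2 :=
    fun z h0 h1 h2 h3 h4 h5 h6 => hmax z ⟨h0, h1, h2, h3, h4, h5, h6⟩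
  clear_value Q
  clear hQ hQf hQn hmax
  refine ⟨l, ⟨l0, b.ms, ⟨l4, l5, l6⟩, ?_⟩, ⟨l0, hD, ⟨l1, l2, l3⟩, ?_⟩⟩
  · by_contra! hcon
    obtain ⟨⟨z, hz, ⟨z1, z2, z3⟩, z4⟩, w, hw, ⟨w1, w2, w3⟩, w4⟩ := hcon
    have c1 : z.1 + N ≤ u.1 := by
      by_contra! hc
      have n1 := N1 z hz
      have zD : z.1 + N ≤ D.1 := by
        by_contra! hc
        exact n1 hc (by linarith) (by linarith) (by linarith) (by linarith) (by linarith)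
          (by rintro rfl; linarith)
      have szu := h.sep z hz u b.ms (by rintro rfl; linarith)
      have m1 := hm z hz
      have zc : c ≤ z.2 ∧ z.2 + N ≤ u.2 := by grind
      obtain ⟨r, hr, ⟨r1, r2, r3⟩, r4, r5⟩ := h.exists_right hz
      have az : HArm S N z r := ⟨hz, hr, ⟨r1, r2, r3⟩, Or.inl r5⟩
      have Fr := F r hr
      have kr := k.ha az (by linarith)
      have nr := N1 r hr
      have nr' := N2 r hr
      have m2 := hm r hr
      have sru : r = u ∨ _ := or_iff_not_imp_left.2 (h.sep r hr u b.ms)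
      grind
    have c2 : w.1 + N ≤ l.1 := by
      by_contra! hc
      have n1 := N1 w hw
      have wD : w.1 + N ≤ D.1 := by
        by_contra! hc
        exact n1 hc (by linarith) (by linarith) (by linarith) (by linarith) (by linarith)
          (by rintro rfl; linarith)
      have m1 := hm w hw
      have swl := h.sep w hw l l0 (by rintro rfl; linarith)
      have wc : c ≤ w.2 := by grind
      obtain ⟨r, hr, ⟨r1, r2, r3⟩, r4, r5⟩ := h.exists_right hw
      have az : HArm S N w r := ⟨hw, hr, ⟨r1, r2, r3⟩, Or.inl r5⟩
      have Fr := F r hr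
      have kr := k.ha az (by linarith)
      have nr := N1 r hr
      have nr' := N2 r hr
      have m2 := hm r hr
      have sru : r = u ∨ _ := or_iff_not_imp_left.2 (h.sep r hr u b.ms)
      have srl : r = l ∨ _ := or_iff_not_imp_left.2 (h.sep r hr l l0)
      grind
    linarith
  · by_contra! hcon
    obtain ⟨⟨z, hz, ⟨z1, z2, z3⟩, z4⟩, w, hw, ⟨w1, w2, w3⟩, w4⟩ := hcon
    have c1 : z.2 + N ≤ D.2 := by
      by_contra! hc
      have n1 := N1 z hz
      have zD : z.1 + N ≤ D.1 := by
        by_contra! hc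
        exact n1 hc (by linarith) (by linarith) (by linarith) (by linarith) (by linarith)
          (by rintro rfl; linarith)
      have szu := h.sep z hz u b.ms (by rintro rfl; linarith)
      have n2 := N2 z hz
      have m1 := hm z hz
      grind
    have c2 : w.2 + N ≤ l.2 := by
      have szu := h.sep w hw u b.ms (by rintro rfl; linarith)
      have swl := h.sep w hw l l0 (by rintro rfl; linarith)
      have m1 := hm w hw
      grind
    linarith

/-- The ring of the four squares `l`, `D`, `t`, `u`, when the left end of the upper arm lies above
and on the left of the lower square. -/
theorem faceAt_sh_far (h : SatPack S N) (k : Col S N x c d) (hD : D ∈ S) (d1 : D.1 < x)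
    (d2 : x < D.1 + N) (d3 : D.2 + N = c) (b : HArm S N u t) (u1 : u.1 + N < x) (t1 : x < t.1)
    (hd : u.2 ≤ d ∧ t.2 ≤ d ∧ (d = u.2 ∨ d = t.2)) (a : VArm S N D t)
    (hu : u.1 + N ≤ D.1) (hu' : c ≤ u.2) (hne : u.1 + N = D.1 → u.2 ≠ c)
    {y : ℝ} (y1 : c < y) (y2 : y < d) : FaceAt S N (x, y) := by
  have hN := h.pos
  have hlt := k.lt
  have F := k.facts h
  have gb := h.harm_gap b
  obtain ⟨b0, b1, b2⟩ := id b.ab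
  obtain ⟨a0, a1, a2⟩ := id a.ab
  obtain ⟨l, al, al'⟩ := k.exists_fourth h hD d1 d2 d3 b u1 t1 hd a hu hu'
  obtain ⟨l0, l1, l2⟩ := id al.ab
  obtain ⟨l3, l4, l5⟩ := id al'.ab
  have gl := h.harm_gap al'
  have r : SquareRing S N l D t u (min l.1 u.1 + N, min l.2 D.2 + N) (t.1, d) := by
    refine ⟨al.ms, hD, b.mt, b.ms, Or.inr (Or.inl al), Or.inr a, Or.inr (Or.inl al'), Or.inr b,
      ?_, ?_, ?_, hd, ?_, ?_, fun a => ?_, fun a => ?_, fun a => ?_, fun a => ?_, ?_⟩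
    · dsimp only; grind
    · dsimp only; grind
    · dsimp only; grind
    · dsimp only; grind
    · dsimp only; grind
    · have := a.ab.2; grind
    · have := a.ab.2; grind
    · have := a.ab.2; grind
    · have := k.ha a (by linarith) (by linarith); have := a.ab.2; grind
    · intro z hz; have Fz := F z hz
      have sz : z = D ∨ _ := or_iff_not_imp_left.2 (h.sep z hz D hD)
      dsimp only; grind
  have hA1 : min l.1 u.1 + N ≤ u.1 + N := by gcongr; exact min_le_right _ _
  have hA2 : min l.2 D.2 + N ≤ c := by rw [← d3]; gcongr; exact min_le_right _ _
  -- If `l` is lower than `D`, then the column of `x` runs into `D` inside of the rectangle, and it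
  -- is replaced by a row between `D` and `u`, or a column between `u` and `D`.
  rcases le_or_gt D.2 l.2 with hl | hl
  · refine r.faceAt h (x := x) (by dsimp only; linarith) t1 ?_ (k.free y y1 y2)
      (by dsimp only; linarith) t1.le (by dsimp only; linarith) y2.le
    rintro z hz ⟨z1, z2, z3, z4⟩
    have Fz := F z hz
    dsimp only at *; grind
  have hA2' : min l.2 D.2 + N = l.2 + N := by rw [min_eq_left hl.le]
  rcases hu'.lt_or_eq with hu' | hu'
  · obtain ⟨y', k1, k2⟩ := exists_between hu'
    refine FaceAt.of_swap (r.swap.faceAt h.swap (x := y') (by dsimp only; linarith)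
      (by dsimp only; linarith) ?_ (k.free y y1 y2).swap
      (by dsimp only; linarith) y2.le (by dsimp only; linarith) t1.le)
    rintro z hz ⟨z1, z2, z3, z4⟩
    have := r.mem_of_meets h hz z3 z4 z1 z2
    dsimp only at *
    simp only [Prod.ext_iff] at this
    grind
  · have hne' : u.1 + N < D.1 := lt_of_le_of_ne hu fun e => hne e hu'.symm
    obtain ⟨x', k1, k2⟩ := exists_between hne'
    refine r.faceAt h (x := x') (by dsimp only; linarith)
      (by dsimp only; linarith) ?_ (k.free y y1 y2)
      (by dsimp only; linarith) t1.le (by dsimp only; linarith) y2.le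
    rintro z hz ⟨z1, z2, z3, z4⟩
    have := r.mem_of_meets h hz z1 z2 z3 z4
    dsimp only at *
    grind

end Col

/-- The mirror image of a packing of squares of side `N` in the horizontal axis. -/
abbrev flipS (S : Set Plane) (N : ℝ) : Set Plane := swapS (negS (swapS S) N)

theorem flipS_mk (h : s ∈ S) : (s.1, -s.2 - N) ∈ flipS S N := by
  simpa [mem_swapS, mem_negS] using h

theorem flipS_flipS : flipS (flipS S N) N = S := by
  rw [flipS, flipS, swapS_swapS, negS_negS, swapS_swapS]

theorem SatPack.flip (h : SatPack S N) : SatPack (flipS S N) N := h.swap.neg.swap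

theorem HArm.flip (h : HArm S N s t) : HArm (flipS S N) N (s.1, -s.2 - N) (t.1, -t.2 - N) :=
  h.swap.neg.swap

theorem HArm.unflip (h : HArm (flipS S N) N s t) : HArm S N (s.1, -s.2 - N) (t.1, -t.2 - N) := by
  have := h.flip; rwa [flipS_flipS] at this

theorem VArm.flip (h : VArm S N s t) : VArm (flipS S N) N (t.1, -t.2 - N) (s.1, -s.2 - N) :=
  h.swap.neg.swap

theorem FreePt.flip {z : Plane} (h : FreePt S N z) : FreePt (flipS S N) N (z.1, -z.2) :=
  h.swap.neg.swap

theorem FreePt.unflip {z : Plane} (h : FreePt (flipS S N) N z) : FreePt S N (z.1, -z.2) := by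
  have := h.flip; rwa [flipS_flipS] at this

theorem FaceAt.of_flip {x : Plane} (h : FaceAt (flipS S N) N (x.1, -x.2)) : FaceAt S N x :=
  FaceAt.of_swap (FaceAt.of_neg (FaceAt.of_swap h))

namespace Col

variable {x c d : ℝ} {z D U V W : Plane}

theorem flip (k : Col S N x c d) : Col (flipS S N) N x (-d) (-c) where
  lt := by linarith [k.lt]
  gen z hz := k.gen (z.1, -z.2 - N) hz
  free y y1 y2 := by
    have := (k.free (-y) (by linarith) (by linarith)).flip
    simpa using this

/-- A free column between a square and a horizontal arm above it. -/
theorem faceAt_sh (h : SatPack S N) (k : Col S N x c d) (hD : D ∈ S) (d1 : D.1 < x)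
    (d2 : x < D.1 + N) (d3 : D.2 + N = c) (b : HArm S N u t) (u1 : u.1 + N < x) (t1 : x < t.1)
    (hd : u.2 ≤ d ∧ t.2 ≤ d ∧ (d = u.2 ∨ d = t.2))
    {y : ℝ} (y1 : c < y) (y2 : y < d) : FaceAt S N (x, y) := by
  have main : ∀ {S : Set Plane} {x : ℝ} {D u t : Plane}, SatPack S N → Col S N x c d → D ∈ S →
      D.1 < x → x < D.1 + N → D.2 + N = c → HArm S N u t → u.1 + N < x → x < t.1 →
      (u.2 ≤ d ∧ t.2 ≤ d ∧ (d = u.2 ∨ d = t.2)) → VArm S N D t → FaceAt S N (x, y) := by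
    intro S x D u t h k hD d1 d2 d3 b u1 t1 hd a
    have hN := h.pos
    have hlt := k.lt
    obtain ⟨b0, b1, b2⟩ := id b.ab
    have hDu : D ≠ u := by rintro rfl; linarith
    have sDu := h.sep D hD u b.ms hDu
    have h1 : u.2 + N ≤ D.2 → False := by grind
    by_cases e : Abv N D u
    · exact k.faceAt_sh_near h hD d1 d2 d3 b u1 t1 hd a e y1 y2
    have h2 : u.1 + N ≤ D.1 := by unfold Abv at e; grind
    by_cases e' : u.2 < c ∨ (u.1 + N = D.1 ∧ u.2 = c)
    · exact k.faceAt_sh_side h hD d1 d2 d3 b u1 t1 hd a (e'.imp_left fun h => ⟨h2, h⟩) y1 y2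
    · push Not at e'
      exact k.faceAt_sh_far h hD d1 d2 d3 b u1 t1 hd a h2 e'.1 e'.2 y1 y2
  rcases k.sh_nearest h hD d1 d2 d3 b u1 t1 hd with ⟨e1, e2⟩ | ⟨e1, e2⟩
  · exact main h k hD d1 d2 d3 b u1 t1 hd ⟨hD, b.mt, e1, Or.inl e2⟩
  · refine FaceAt.of_neg (main h.neg k.neg (negS_mk hD) (by dsimp only; linarith)
      (by dsimp only; linarith) d3 b.neg (by dsimp only; linarith) (by dsimp only; linarith)
      ⟨hd.2.1, hd.1, hd.2.2.symm⟩ (VArm.neg ⟨hD, b.ms, e1, Or.inl e2⟩))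

/-- What lies at the upper end of a free column. -/
def TopEnd (S : Set Plane) (N x d : ℝ) : Prop :=
  (∃ U ∈ S, U.1 < x ∧ x < U.1 + N ∧ U.2 = d) ∨
  ∃ u t, HArm S N u t ∧ u.1 + N < x ∧ x < t.1 ∧ u.2 ≤ d ∧ t.2 ≤ d ∧ (d = u.2 ∨ d = t.2)

/-- A free column above a point ends at a square or at a horizontal arm. -/
theorem exists_top (h : SatPack S N) (hg : ∀ c ∈ S, c.1 ≠ z.1 ∧ c.1 + N ≠ z.1)
    (hz : FreePt S N z) :
    ∃ d, z.2 < d ∧ (∀ y, z.2 ≤ y → y < d → FreePt S N (z.1, y)) ∧ TopEnd S N z.1 d := by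
  have hN := h.pos
  -- Saturation provides an obstacle above `z`, and the lowest one is reached first.
  have hex : ∃ d, z.2 < d ∧ TopEnd S N z.1 d := by
    obtain ⟨s, hs, s1, s2, s3, s4⟩ := h.sat (z.1 - N / 2) (z.2 + 2 * N)
    have gs := hg s hs
    rcases lt_or_gt_of_ne gs.1 with g | g
    · rcases lt_or_gt_of_ne gs.2 with g' | g'
      · obtain ⟨r, hr, ⟨r1, r2, r3⟩, r4, r5⟩ := h.exists_right hs
        rcases lt_or_gt_of_ne (hg r hr).1 with g'' | g''
        · exact ⟨r.2, by linarith, Or.inl ⟨r, hr, g'', by linarith, rfl⟩⟩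
        · refine ⟨max s.2 r.2, lt_max_of_lt_left (by linarith), Or.inr ⟨s, r,
            ⟨hs, hr, ⟨r1, r2, r3⟩, Or.inl r5⟩, g', g'', le_max_left _ _, le_max_right _ _,
            max_choice _ _⟩⟩
      · exact ⟨s.2, by linarith, Or.inl ⟨s, hs, g, g', rfl⟩⟩
    · obtain ⟨r, hr, ⟨r1, r2, r3⟩, r4, r5⟩ := h.exists_left hs
      rcases lt_or_gt_of_ne (hg r hr).2 with g'' | g''
      · refine ⟨max r.2 s.2, lt_max_of_lt_right (by linarith), Or.inr ⟨r, s,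
            ⟨hr, hs, ⟨r1, r2, r3⟩, Or.inr r5⟩, g'', g, le_max_left _ _, le_max_right _ _,
            max_choice _ _⟩⟩
      · exact ⟨r.2, by linarith, Or.inl ⟨r, hr, by linarith, g'', rfl⟩⟩
  obtain ⟨d0, hd0, hT0⟩ := hex
  obtain ⟨d, ⟨⟨hd, hdd⟩, hT⟩, hmin⟩ := Set.exists_min_image
    {d | (z.2 < d ∧ d ≤ d0) ∧ TopEnd S N z.1 d} id
    (((h.finite_box (z.1 - 2 * N) (z.1 + 2 * N) z.2 d0).image Prod.snd).subset (by
      rintro d ⟨⟨k1, k2⟩, ⟨U, hU, u1, u2, rfl⟩ | ⟨u, t, a, u1, t1, l1, l2, l3⟩⟩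
      · exact ⟨U, ⟨hU, by linarith, by linarith, by linarith, by linarith⟩, rfl⟩
      · have := h.harm_gap a
        rcases l3 with rfl | rfl
        · exact ⟨u, ⟨a.ms, by linarith, by linarith, by linarith, by linarith⟩, rfl⟩
        · exact ⟨t, ⟨a.mt, by linarith, by linarith, by linarith, by linarith⟩, rfl⟩))
    ⟨d0, ⟨hd0, le_rfl⟩, hT0⟩
  have hmin' : ∀ d', z.2 < d' → d' < d → ¬TopEnd S N z.1 d' := fun d' k1 k2 hT' => by
    have := hmin d' ⟨⟨k1, by linarith⟩, hT'⟩
    simp only [id] at this; linarith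
  refine ⟨d, hd, fun y y1 y2 => ⟨fun c hc hcz => ?_, fun p q a haz => ?_, fun p q a haz => ?_⟩, hT⟩
  · obtain ⟨k1, k2, k3, k4⟩ := hcz
    have g := hg c hc
    dsimp only at *
    rcases lt_or_ge z.2 c.2 with e | e
    · exact hmin' c.2 e (by linarith) (Or.inl ⟨c, hc, lt_of_le_of_ne k1 g.1,
        lt_of_le_of_ne k2 (Ne.symm g.2), rfl⟩)
    · exact hz.sq c hc ⟨k1, k2, e, by linarith⟩
  · obtain ⟨k1, k2, k3, k4, k5, k6⟩ := haz
    have g := hg p a.ms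
    dsimp only at *
    rcases lt_or_ge z.2 p.2 with e | e
    · exact hmin' p.2 e (by linarith) (Or.inl ⟨p, a.ms, lt_of_le_of_ne k1 g.1,
        lt_of_le_of_ne k3 (Ne.symm g.2), rfl⟩)
    · rcases le_or_gt z.2 (p.2 + N) with e' | e'
      · exact hz.sq p a.ms ⟨k1, k3, e, e'⟩
      · exact hz.va p q a ⟨k1, k2, k3, k4, e'.le, by linarith⟩
  · obtain ⟨k1, k2, k3, k4, k5, k6⟩ := haz
    dsimp only at *
    rcases lt_or_ge z.2 (max p.2 q.2) with e | e
    · exact hmin' _ e (by rw [max_lt_iff]; constructor <;> linarith) (Or.inr ⟨p, q, a,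
        lt_of_le_of_ne k5 (hg p a.ms).2, lt_of_le_of_ne k6 (Ne.symm (hg q a.mt).1),
        le_max_left _ _, le_max_right _ _, max_choice _ _⟩)
    · rw [max_le_iff] at e
      exact hz.ha p q a ⟨e.1, e.2, by linarith, by linarith, k5, k6⟩

end Col

/-- Every free point not aligned with the sides of the squares lies in a cross: the free column
through it ends at squares or at horizontal arms, and in each case a ring of squares surrounds it.
-/
theorem SatPack.faceAt_of_generic (h : SatPack S N) {z : Plane}
    (hg : ∀ c ∈ S, c.1 ≠ z.1 ∧ c.1 + N ≠ z.1) (hz : FreePt S N z) : FaceAt S N z := by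
  obtain ⟨d, d1, d2, dT⟩ := Col.exists_top h hg hz
  obtain ⟨c, c1, c2, cT⟩ := Col.exists_top h.flip (z := (z.1, -z.2)) (fun c hc => hg (c.1, -c.2 - N) hc) hz.flip
  dsimp only at c1 c2 cT
  have k : Col S N z.1 (-c) d := by
    refine ⟨by linarith, hg, fun y y1 y2 => ?_⟩
    rcases le_total z.2 y with e | e
    · exact d2 y e y2
    · have := (c2 (-y) (by linarith) (by linarith)).unflip
      simpa using this
  have y1 : -c < z.2 := by linarith
  rcases dT with ⟨U, hU, u1, u2, u3⟩ | ⟨u, t, a, u1, t1, hd⟩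
  · rcases cT with ⟨D, hD, e1, e2, e3⟩ | ⟨l, s, b, l1, s1, hc⟩
    · exact k.faceAt_ss h (D := (D.1, -D.2 - N)) hD hU e1 e2 (by dsimp only; linarith) u1 u2 u3
        y1 d1
    · have k' := k.flip
      rw [neg_neg] at k'
      exact FaceAt.of_flip (k'.faceAt_sh h.flip (flipS_mk hU) u1 u2 (by dsimp only; linarith) b
        l1 s1 hc (by linarith) (by linarith))
  · rcases cT with ⟨D, hD, e1, e2, e3⟩ | ⟨l, s, b, l1, s1, hc⟩
    · exact k.faceAt_sh h (D := (D.1, -D.2 - N)) hD e1 e2 (by dsimp only; linarith) a u1 t1 hd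
        y1 d1
    · refine k.faceAt_hh h b.unflip a l1 s1 u1 t1 ?_ hd y1 d1
      dsimp only; grind

/-! ### Arms and crosses in coordinates -/

theorem isAbove_iff : IsAbove N s t ↔ Abv N s t := by
  unfold IsAbove Abv
  rw [abs_lt]
  constructor
  · rintro ⟨h1, h2, h3⟩; exact ⟨h1, by linarith, by linarith⟩
  · rintro ⟨h1, h2, h3⟩; exact ⟨h1, by linarith, by linarith⟩

theorem isVerticalArm_iff {A : Set Plane} : IsVerticalArm S N s t A ↔
    VArm S N s t ∧ A = {z | InV N s t z} := by
  have hA : {z | InV N s t z} = Icc (max s.1 t.1, s.2 + N) (min s.1 t.1 + N, t.2) := by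
    ext z
    simp only [InV, mem_ofPred_eq, mem_Icc, Prod.le_def, max_le_iff, ← min_add_add_right,
      le_min_iff]
    tauto
  rw [hA]
  unfold IsVerticalArm
  simp only [isAbove_iff]
  constructor
  · rintro ⟨h1, h2, h3, h4, h5⟩; exact ⟨⟨h1, h2, h3, h4⟩, h5⟩
  · rintro ⟨⟨h1, h2, h3, h4⟩, h5⟩; exact ⟨h1, h2, h3, h4, h5⟩

theorem isHorizontalArm_iff {A : Set Plane} : IsHorizontalArm S N s t A ↔
    HArm S N s t ∧ A = {z | InH N s t z} := by
  have hS : Prod.swap '' S = swapS S := by rw [Set.image_swap_eq_preimage_swap]; rfl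
  unfold IsHorizontalArm
  rw [isVerticalArm_iff, hS]
  refine and_congr ⟨fun a => a.swap, fun a => a.swap⟩ ?_
  rw [Set.image_swap_eq_preimage_swap]
  constructor
  · intro e
    ext z
    have := Set.ext_iff.1 e z.swap
    exact this
  · rintro rfl; rfl

theorem mem_squareAt {c z : Plane} : z ∈ squareAt N c ↔ InSq N c z := by
  simp only [squareAt, mem_Icc, Prod.le_def, InSq, Prod.fst_add, Prod.snd_add]
  tauto

theorem mem_uncovered_iff {z : Plane} : z ∈ uncovered S N ↔ FreePt S N z := by
  constructor
  · rintro ⟨h1, h2⟩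
    refine ⟨fun c hc hz => h1 c hc (mem_squareAt.2 hz), fun p q a hz => ?_, fun p q a hz => ?_⟩
    · exact h2 p q _ (Or.inl (isVerticalArm_iff.2 ⟨a, rfl⟩)) hz
    · exact h2 p q _ (Or.inr (Or.inr (Or.inl (isHorizontalArm_iff.2 ⟨a, rfl⟩)))) hz
  · rintro ⟨h1, h2, h3⟩
    refine ⟨fun c hc hz => h1 c hc (mem_squareAt.1 hz), ?_⟩
    rintro p q A (a | a | a | a | ⟨a1, a2, a3, a4, rfl⟩) hz
    · obtain ⟨a', rfl⟩ := isVerticalArm_iff.1 a; exact h2 _ _ a' hz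
    · obtain ⟨a', rfl⟩ := isVerticalArm_iff.1 a; exact h2 _ _ a' hz
    · obtain ⟨a', rfl⟩ := isHorizontalArm_iff.1 a; exact h3 _ _ a' hz
    · obtain ⟨a', rfl⟩ := isHorizontalArm_iff.1 a; exact h3 _ _ a' hz
    · exact h1 p a1 (mem_squareAt.1 hz.1)

theorem SatPack.isOpen_uncovered (h : SatPack S N) : IsOpen (uncovered S N) := by
  have hN := h.pos
  rw [isOpen_iff_mem_nhds]
  intro z hz
  rw [mem_uncovered_iff] at hz
  -- Only finitely many squares and arms come close to `z`.
  set F : Set Plane := {c | c ∈ S ∧ z.1 - 4 * N ≤ c.1 ∧ c.1 ≤ z.1 + 4 * N ∧ z.2 - 4 * N ≤ c.2 ∧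
    c.2 ≤ z.2 + 4 * N} with hF
  have hFf : F.Finite := h.finite_box _ _ _ _
  have cl1 : ∀ c, IsClosed {w | InSq N c w} := fun c => by
    have : {w | InSq N c w} = squareAt N c := by ext w; exact mem_squareAt.symm
    rw [this]; exact isClosed_Icc
  have cl2 : ∀ c c', IsClosed {w | InV N c c' w} := fun c c' => by
    simp only [InV]
    refine IsClosed.and ?_ (IsClosed.and ?_ (IsClosed.and ?_ (IsClosed.and ?_ (IsClosed.and ?_ ?_))))
      <;> exact isClosed_le (by fun_prop) (by fun_prop)
  have cl3 : ∀ c c', IsClosed {w | InH N c c' w} := fun c c' => by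
    simp only [InH]
    refine IsClosed.and ?_ (IsClosed.and ?_ (IsClosed.and ?_ (IsClosed.and ?_ (IsClosed.and ?_ ?_))))
      <;> exact isClosed_le (by fun_prop) (by fun_prop)
  have e0 : ∀ᶠ w : Plane in 𝓝 z, z.1 - N < w.1 ∧ w.1 < z.1 + N ∧ z.2 - N < w.2 ∧ w.2 < z.2 + N := by
    refine Filter.Eventually.and ?_ (Filter.Eventually.and ?_ (Filter.Eventually.and ?_ ?_))
    · exact (continuous_fst.tendsto z).eventually (lt_mem_nhds (by linarith))
    · exact (continuous_fst.tendsto z).eventually (gt_mem_nhds (by linarith))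
    · exact (continuous_snd.tendsto z).eventually (lt_mem_nhds (by linarith))
    · exact (continuous_snd.tendsto z).eventually (gt_mem_nhds (by linarith))
  have e1 : ∀ᶠ w in 𝓝 z, ∀ c ∈ F, ¬InSq N c w :=
    (Filter.eventually_all_finite hFf).2 fun c hc =>
      (cl1 c).isOpen_compl.mem_nhds (hz.sq c hc.1)
  have e2 : ∀ᶠ w in 𝓝 z, ∀ c ∈ F, ∀ c' ∈ F, VArm S N c c' → ¬InV N c c' w :=
    (Filter.eventually_all_finite hFf).2 fun c _ => (Filter.eventually_all_finite hFf).2 fun c' _ => by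
      by_cases a : VArm S N c c'
      · filter_upwards [(cl2 c c').isOpen_compl.mem_nhds (hz.va c c' a)] with w hw _ using hw
      · exact Filter.Eventually.of_forall fun w a' => (a a').elim
  have e3 : ∀ᶠ w in 𝓝 z, ∀ c ∈ F, ∀ c' ∈ F, HArm S N c c' → ¬InH N c c' w :=
    (Filter.eventually_all_finite hFf).2 fun c _ => (Filter.eventually_all_finite hFf).2 fun c' _ => by
      by_cases a : HArm S N c c'
      · filter_upwards [(cl3 c c').isOpen_compl.mem_nhds (hz.ha c c' a)] with w hw _ using hw
      · exact Filter.Eventually.of_forall fun w a' => (a a').elim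
  filter_upwards [e0, e1, e2, e3] with w w0 w1 w2 w3
  obtain ⟨v1, v2, v3, v4⟩ := w0
  rw [mem_uncovered_iff]
  refine ⟨fun c hc hw => w1 c ⟨hc, ?_⟩ hw, fun p q a hw => w2 p ⟨a.ms, ?_⟩ q ⟨a.mt, ?_⟩ a hw,
    fun p q a hw => w3 p ⟨a.ms, ?_⟩ q ⟨a.mt, ?_⟩ a hw⟩
  · obtain ⟨k1, k2, k3, k4⟩ := hw
    refine ⟨?_, ?_, ?_, ?_⟩ <;> linarith
  · obtain ⟨k1, k2, k3, k4, k5, k6⟩ := hw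
    have := h.varm_gap a
    refine ⟨?_, ?_, ?_, ?_⟩ <;> linarith
  · obtain ⟨k1, k2, k3, k4, k5, k6⟩ := hw
    have := h.varm_gap a
    refine ⟨?_, ?_, ?_, ?_⟩ <;> linarith
  · obtain ⟨k1, k2, k3, k4, k5, k6⟩ := hw
    have := h.harm_gap a
    refine ⟨?_, ?_, ?_, ?_⟩ <;> linarith
  · obtain ⟨k1, k2, k3, k4, k5, k6⟩ := hw
    have := h.harm_gap a
    refine ⟨?_, ?_, ?_, ?_⟩ <;> linarith

theorem SatPack.countable (h : SatPack S N) : S.Countable := by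
  have : S ⊆ ⋃ n : ℕ, {c | c ∈ S ∧ -(n : ℝ) ≤ c.1 ∧ c.1 ≤ n ∧ -(n : ℝ) ≤ c.2 ∧ c.2 ≤ n} := by
    intro c hc
    obtain ⟨n, hn⟩ := exists_nat_ge (max |c.1| |c.2|)
    rw [max_le_iff, abs_le, abs_le] at hn
    exact mem_iUnion.2 ⟨n, hc, hn.1.1, hn.1.2, hn.2.1, hn.2.2⟩
  exact (countable_iUnion fun n => (h.finite_box _ _ _ _).countable).mono this

/-- The face theorem: every cross is the interior of its bounding rectangle, with some corners cut
out by squares of the packing. -/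
theorem SatPack.exists_face (h : SatPack S N) {K : Set Plane} (hK : IsCross S N K) :
    ∃ A B, Face S N A B K := by
  obtain ⟨x, hx, rfl⟩ := hK
  have hop : IsOpen (connectedComponentIn (uncovered S N) x) :=
    h.isOpen_uncovered.connectedComponentIn
  have hxK := mem_connectedComponentIn hx
  -- The lines through the sides of the squares are countably many, so that the cross contains a
  -- point `z` off these lines.
  obtain ⟨z, hzK, hzg⟩ : ∃ z ∈ connectedComponentIn (uncovered S N) x,
      ∀ c ∈ S, c.1 ≠ z.1 ∧ c.1 + N ≠ z.1 := by
    have hc : (Prod.fst '' S ∪ (fun c : Plane => c.1 + N) '' S).Countable :=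
      (h.countable.image _).union (h.countable.image _)
    have hd := hc.dense_compl ℝ
    have ho : IsOpen {a : ℝ | (a, x.2) ∈ connectedComponentIn (uncovered S N) x} :=
      hop.preimage (by fun_prop)
    obtain ⟨a, ha, ha'⟩ := hd.exists_mem_open ho ⟨x.1, hxK⟩
    refine ⟨(a, x.2), ha', fun c hc => ⟨fun e => ha (Or.inl ⟨c, hc, e⟩),
      fun e => ha (Or.inr ⟨c, hc, e⟩)⟩⟩
  have hzf := connectedComponentIn_subset _ _ hzK
  obtain ⟨A, B, K, hF, hz⟩ := h.faceAt_of_generic hzg (mem_uncovered_iff.1 hzf)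
  refine ⟨A, B, ?_⟩
  -- `K` is connected, and it is open and closed among the uncovered points.
  have e : K = connectedComponentIn (uncovered S N) z := by
    refine subset_antisymm (hF.conn.subset_connectedComponentIn hz fun w hw =>
      mem_uncovered_iff.2 (hF.free w hw)) ?_
    have hKe : K = uncovered S N ∩ (Ioo A.1 B.1 ×ˢ Ioo A.2 B.2) := by
      ext w
      constructor
      · intro hw
        obtain ⟨k1, k2, k3, k4⟩ := ((hF.mem w).1 hw).1
        exact ⟨mem_uncovered_iff.2 (hF.free w hw), ⟨k1, k2⟩, k3, k4⟩
      · rintro ⟨hw, ⟨k1, k2⟩, k3, k4⟩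
        exact hF.wall w k1.le k2.le k3.le k4.le (mem_uncovered_iff.1 hw)
    have hcl : closure K ⊆ Icc A B := closure_minimal (fun w hw => ⟨hF.glb.1 hw, hF.lub.1 hw⟩)
      isClosed_Icc
    refine isPreconnected_connectedComponentIn.subset_of_closure_inter_subset ?_
      ⟨z, mem_connectedComponentIn hzf, hz⟩ ?_
    · rw [hKe]; exact h.isOpen_uncovered.inter (isOpen_Ioo.prod isOpen_Ioo)
    · rintro w ⟨hw, hw'⟩
      obtain ⟨⟨k1, k2⟩, k3, k4⟩ := hcl hw
      exact hF.wall w k1 k3 k2 k4 (mem_uncovered_iff.1 (connectedComponentIn_subset _ _ hw'))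
  rw [connectedComponentIn_eq hzK, ← e]
  exact hF

/-! ### Vertical curves -/

namespace SatPack

variable {v z : Plane} (h : SatPack S N)
include h

/-- Two vertical arms between four different squares do not meet, even when one of them is prolonged
through its squares. -/
theorem varm_varm (a : VArm S N u v) (b : VArm S N p q) (h1 : p ≠ u) (h2 : p ≠ v) (h3 : q ≠ u)
    (h4 : q ≠ v) (z1 : u.1 < z.1) (z2 : v.1 < z.1) (z3 : z.1 < u.1 + N) (z4 : z.1 < v.1 + N)
    (z5 : u.2 < z.2) (z6 : z.2 < v.2 + N) : ¬InV N p q z := by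
  rintro ⟨k1, k2, k3, k4, k5, k6⟩
  have hN := h.pos
  have d1 := h.varm_disj a b.ms h1 h2
  have d2 := h.varm_disj a b.mt h3 h4
  have d3 := h.varm_disj b a.ms h1.symm h3.symm
  rw [le_max_iff, min_add_le] at d1 d2 d3
  obtain ⟨-, e1, e2⟩ := a.ab
  obtain ⟨-, f1, f2⟩ := b.ab
  grind

theorem varm_top_share (a : VArm S N u v) (b : VArm S N p v) (hne : p ≠ u)
    (z1 : u.1 < z.1) (z2 : v.1 < z.1) (z3 : z.1 < u.1 + N) (z4 : z.1 < v.1 + N)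
    (k1 : p.1 ≤ z.1) (k3 : z.1 ≤ p.1 + N) : False := by
  have hN := h.pos
  have d1 := h.varm_disj a b.ms hne (h.varm_ne b)
  have d3 := h.varm_disj b a.ms hne.symm (h.varm_ne a)
  rw [le_max_iff, min_add_le] at d1 d3
  obtain ⟨e0, e1, e2⟩ := a.ab
  obtain ⟨f0, f1, f2⟩ := b.ab
  grind

theorem varm_bot_share (a : VArm S N u v) (b : VArm S N u q) (hne : q ≠ v)
    (z1 : u.1 < z.1) (z2 : v.1 < z.1) (z3 : z.1 < u.1 + N) (z4 : z.1 < v.1 + N)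
    (k1 : q.1 ≤ z.1) (k3 : z.1 ≤ q.1 + N) : False := by
  have hN := h.pos
  have d1 := h.varm_disj a b.mt (h.varm_ne b).symm hne
  have d3 := h.varm_disj b a.mt (h.varm_ne a).symm hne.symm
  rw [le_max_iff, min_add_le] at d1 d3
  obtain ⟨e0, e1, e2⟩ := a.ab
  obtain ⟨f0, f1, f2⟩ := b.ab
  grind

/-- A vertical arm does not meet a horizontal arm prolonged through its squares. -/
theorem harm_varm (a : HArm S N u v) (b : VArm S N p q)
    (z1 : u.2 < z.2) (z2 : v.2 < z.2) (z3 : z.2 < u.2 + N) (z4 : z.2 < v.2 + N)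
    (z5 : u.1 < z.1) (z6 : z.1 < v.1 + N) : ¬InV N p q z := by
  rintro ⟨k1, k2, k3, k4, k5, k6⟩
  have hN := h.pos
  obtain ⟨f0, f1, f2⟩ := id b.ab
  obtain ⟨e0, e1, e2⟩ := id a.ab
  -- The abscissa is moved into the interior of the vertical arm.
  have : max u.1 (max p.1 q.1) < min (v.1 + N) (min (p.1 + N) (q.1 + N)) := by
    simp only [max_lt_iff, lt_min_iff]
    refine ⟨⟨?_, ?_, ?_⟩, ⟨?_, ?_, ?_⟩, ?_, ?_, ?_⟩ <;> linarith
  obtain ⟨x, x1, x2⟩ := exists_between this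
  simp only [max_lt_iff, lt_min_iff] at x1 x2
  have d1 : u ≠ p := by rintro rfl; linarith
  have d2 : u ≠ q := by rintro rfl; linarith
  have d3 : v ≠ p := by rintro rfl; linarith
  have d4 : v ≠ q := by rintro rfl; linarith
  have du := h.varm_disj b a.ms d1 d2
  have dv := h.varm_disj b a.mt d3 d4
  rw [le_max_iff, min_add_le] at du dv
  rcases lt_or_ge x (u.1 + N) with g | g
  · grind
  rcases lt_or_ge v.1 x with g' | g'
  · grind
  exact h.varm_harm b a x1.2.1 x1.2.2 x2.2.1 x2.2.2 k5 k6 z1 z2 z3 z4 g g'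

end SatPack

/-- A bi-infinite sequence of squares, each of which is joined to the next one by a vertical arm:
these squares and arms form a curve which separates the plane into a left and a right part. -/
def VCurve (S : Set Plane) (N : ℝ) (g : ℤ → Plane) : Prop := ∀ k, VArm S N (g k) (g (k + 1))

/-- Every vertical arm belongs to a vertical curve. -/
theorem SatPack.exists_vcurve (h : SatPack S N) (a : VArm S N p q) :
    ∃ g, VCurve S N g ∧ g 0 = p ∧ g 1 = q := by
  have hu : ∀ s : S, ∃ t : S, VArm S N s t := fun s => by
    obtain ⟨t, ht, h1, -, h2⟩ := h.exists_up s.2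
    exact ⟨⟨t, ht⟩, s.2, ht, h1, Or.inl h2⟩
  have hd : ∀ s : S, ∃ t : S, VArm S N t s := fun s => by
    obtain ⟨t, ht, h1, -, h2⟩ := h.exists_down s.2
    exact ⟨⟨t, ht⟩, ht, s.2, h1, Or.inr h2⟩
  choose up hup using hu
  choose dn hdn using hd
  refine ⟨fun k => if 0 < k then (up^[(k - 1).toNat] ⟨q, a.mt⟩).1
    else (dn^[(-k).toNat] ⟨p, a.ms⟩).1, fun k => ?_, by simp, by simp⟩
  rcases lt_trichotomy k 0 with hk | rfl | hk
  · obtain ⟨n, rfl⟩ : ∃ n : ℕ, k = -(n + 1 : ℤ) := ⟨(-k - 1).toNat, by omega⟩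
    have e1 : (-(-(n + 1 : ℤ))).toNat = n + 1 := by omega
    have e2 : (-(-(n + 1 : ℤ) + 1)).toNat = n := by omega
    beta_reduce
    rw [if_neg (by omega), if_neg (by omega), e1, e2, Function.iterate_succ_apply']
    exact hdn _
  · simpa using a
  · obtain ⟨n, rfl⟩ : ∃ n : ℕ, k = n + 1 := ⟨(k - 1).toNat, by omega⟩
    have e1 : ((n + 1 : ℤ) - 1).toNat = n := by omega
    have e2 : ((n + 1 : ℤ) + 1 - 1).toNat = n + 1 := by omega
    beta_reduce
    rw [if_pos (by omega), if_pos (by omega), e1, e2, Function.iterate_succ_apply']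
    exact hup _

/-- `z` lies on the left of the `k`-th arm of the curve and of the two squares which it joins. -/
def LeftAt (N : ℝ) (g : ℤ → Plane) (k : ℤ) (z : Plane) : Prop :=
  (g k).2 < z.2 ∧ z.2 < (g (k + 1)).2 + N ∧ ((g k).2 + N < z.2 ∨ z.1 < (g k).1) ∧
    (z.2 < (g (k + 1)).2 ∨ z.1 < (g (k + 1)).1) ∧ (z.1 < (g k).1 ∨ z.1 < (g (k + 1)).1)

/-- `z` lies on the right of the `k`-th arm of the curve and of the two squares which it joins. -/
def RightAt (N : ℝ) (g : ℤ → Plane) (k : ℤ) (z : Plane) : Prop :=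
  (g k).2 < z.2 ∧ z.2 < (g (k + 1)).2 + N ∧ ((g k).2 + N < z.2 ∨ (g k).1 + N < z.1) ∧
    (z.2 < (g (k + 1)).2 ∨ (g (k + 1)).1 + N < z.1) ∧
    ((g k).1 + N < z.1 ∨ (g (k + 1)).1 + N < z.1)

/-- The part of the plane on the left of the curve. -/
def LeftOf (N : ℝ) (g : ℤ → Plane) : Set Plane := {z | ∃ k, LeftAt N g k z}

/-- The part of the plane on the right of the curve. -/
def RightOf (N : ℝ) (g : ℤ → Plane) : Set Plane := {z | ∃ k, RightAt N g k z}

/-- The union of the squares and the arms of the curve. -/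
def OnCurve (N : ℝ) (g : ℤ → Plane) : Set Plane :=
  {z | ∃ k, InSq N (g k) z ∨ InV N (g k) (g (k + 1)) z}

/-- The reflected curve. -/
def negC (N : ℝ) (g : ℤ → Plane) (k : ℤ) : Plane := (-(g k).1 - N, (g k).2)

theorem leftOf_negC {g : ℤ → Plane} {z : Plane} :
    (-z.1, z.2) ∈ LeftOf N (negC N g) ↔ z ∈ RightOf N g := by
  simp only [LeftOf, RightOf, mem_ofPred_eq]
  refine exists_congr fun k => ?_
  simp only [LeftAt, RightAt, negC]
  grind

namespace VCurve

variable {g : ℤ → Plane} {z w a b : Plane} {k j : ℤ}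

theorem neg (c : VCurve S N g) : VCurve (negS S N) N (negC N g) := fun k => (c k).neg

theorem mem (c : VCurve S N g) (k : ℤ) : g k ∈ S := (c k).ms

theorem row_le (h : SatPack S N) (c : VCurve S N g) (hjk : j < k) : (g j).2 + N ≤ (g k).2 := by
  have hN := h.pos
  obtain ⟨n, rfl⟩ : ∃ n : ℕ, k = j + 1 + n := ⟨(k - j - 1).toNat, by omega⟩
  induction n with
  | zero => simpa using (c j).ab.1
  | succ n ih =>
    have := (c (j + 1 + n)).ab.1
    have := ih (by omega)
    push_cast
    rw [← add_assoc]
    linarith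

theorem row_ge (c : VCurve S N g) (n : ℕ) :
    (g 0).2 + n * N ≤ (g n).2 ∧ (g (-n)).2 ≤ (g 0).2 - n * N := by
  induction n with
  | zero => simp
  | succ n ih =>
    have h1 := (c n).ab.1
    have h2 := (c (-(n + 1 : ℤ))).ab.1
    rw [show -(n + 1 : ℤ) + 1 = -n by ring] at h2
    push_cast
    constructor <;> linarith

/-- The index of the part of the curve at the level of a point. -/
theorem exists_level (h : SatPack S N) (c : VCurve S N g) (y : ℝ) :
    ∃ k, (g k).2 + N / 2 ≤ y ∧ y < (g (k + 1)).2 + N / 2 := by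
  have hN := h.pos
  obtain ⟨n, hn⟩ := exists_nat_gt ((y - (g 0).2) / N)
  obtain ⟨m, hm⟩ := exists_nat_gt (((g 0).2 + N / 2 - y) / N)
  rw [div_lt_iff₀ hN] at hn hm
  have h1 := (c.row_ge n).1
  have h2 := (c.row_ge m).2
  obtain ⟨k, hk, hmax⟩ := Int.exists_greatest_of_bdd
    (P := fun k => (g k).2 + N / 2 ≤ y) ⟨n, fun k hk => by
      by_contra! hc
      have := c.row_le h hc
      linarith⟩ ⟨-m, by linarith⟩
  refine ⟨k, hk, ?_⟩
  by_contra! hc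
  have := hmax _ hc
  omega

/-- The left side may be recognized at any arm at the level of the point. -/
theorem leftAt_of_mem (h : SatPack S N) (c : VCurve S N g) (hz : z ∈ LeftOf N g)
    (h1 : (g k).2 < z.2) (h2 : z.2 < (g (k + 1)).2 + N) : LeftAt N g k z := by
  have hN := h.pos
  obtain ⟨j, hj⟩ := hz
  obtain ⟨j1, j2, j3, j4, j5⟩ := id hj
  rcases lt_trichotomy j k with e | rfl | e
  · have e' : j + 1 = k := by
      by_contra hne
      have := c.row_le h (show j + 1 < k by omega)
      linarith
    subst e'
    have := (c (j + 1)).ab.1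
    unfold LeftAt
    grind
  · exact hj
  · have e' : k + 1 = j := by
      by_contra hne
      have := c.row_le h (show k + 1 < j by omega)
      linarith
    subst e'
    have := (c k).ab.1
    unfold LeftAt
    grind

theorem rightAt_of_mem (h : SatPack S N) (c : VCurve S N g) (hz : z ∈ RightOf N g)
    (h1 : (g k).2 < z.2) (h2 : z.2 < (g (k + 1)).2 + N) : RightAt N g k z := by
  rw [← leftOf_negC] at hz
  have := c.neg.leftAt_of_mem h.neg hz (k := k) h1 h2
  unfold LeftAt negC at this
  unfold RightAt
  grind

theorem disjoint (h : SatPack S N) (c : VCurve S N g) (hz : z ∈ LeftOf N g)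
    (hz' : z ∈ RightOf N g) : False := by
  obtain ⟨k, hk⟩ := id hz'
  have := c.leftAt_of_mem h hz hk.1 hk.2.1
  obtain ⟨-, e1, e2⟩ := (c k).ab
  have hN := h.pos
  unfold LeftAt at this
  unfold RightAt at hk
  grind

theorem left_or_right (h : SatPack S N) (c : VCurve S N g) (hz : z ∉ OnCurve N g) :
    z ∈ LeftOf N g ∨ z ∈ RightOf N g := by
  have hN := h.pos
  obtain ⟨k, k1, k2⟩ := c.exists_level h z.2
  have n1 : ¬InSq N (g k) z := fun hk => hz ⟨k, Or.inl hk⟩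
  have n2 : ¬InSq N (g (k + 1)) z := fun hk => hz ⟨k + 1, Or.inl hk⟩
  have n3 : ¬InV N (g k) (g (k + 1)) z := fun hk => hz ⟨k, Or.inr hk⟩
  obtain ⟨e0, e1, e2⟩ := (c k).ab
  unfold InSq at n1 n2
  unfold InV at n3
  -- At the level of `z` the curve is an interval.
  have : LeftAt N g k z ∨ RightAt N g k z := by
    unfold LeftAt RightAt
    grind
  exact this.imp (fun h => ⟨k, h⟩) fun h => ⟨k, h⟩

theorem isOpen_leftOf (g : ℤ → Plane) : IsOpen (LeftOf N g) := by
  have : LeftOf N g = ⋃ k, {z | LeftAt N g k z} := by ext z; simp [LeftOf]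
  rw [this]
  refine isOpen_iUnion fun k => ?_
  unfold LeftAt
  have o : ∀ {f f' : Plane → ℝ}, Continuous f → Continuous f' → IsOpen {z | f z < f' z} :=
    fun hf hf' => isOpen_lt hf hf'
  have o' : ∀ {f f' e e' : Plane → ℝ}, Continuous f → Continuous f' → Continuous e →
      Continuous e' → IsOpen {z | f z < f' z ∨ e z < e' z} :=
    fun hf hf' he he' => (isOpen_lt hf hf').union (isOpen_lt he he')
  refine (o ?_ ?_).inter ((o ?_ ?_).inter ((o' ?_ ?_ ?_ ?_).inter
    ((o' ?_ ?_ ?_ ?_).inter (o' ?_ ?_ ?_ ?_)))) <;> fun_prop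

theorem isOpen_rightOf (g : ℤ → Plane) : IsOpen (RightOf N g) := by
  have : RightOf N g = (fun z : Plane => (-z.1, z.2)) ⁻¹' LeftOf N (negC N g) := by
    ext z; exact leftOf_negC.symm
  rw [this]
  exact (isOpen_leftOf _).preimage (by fun_prop)

theorem subset_or_subset (h : SatPack S N) (c : VCurve S N g) {C : Set Plane}
    (hC : IsPreconnected C) (hd : ∀ z ∈ C, z ∉ OnCurve N g) :
    C ⊆ LeftOf N g ∨ C ⊆ RightOf N g :=
  hC.subset_or_subset (isOpen_leftOf g) (isOpen_rightOf g)
    (Set.disjoint_left.2 fun _ hz hz' => c.disjoint h hz hz')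
    fun z hz => c.left_or_right h (hd z hz)

/-- Points close to each other on both sides of the curve are close to an arm which is narrow. -/
theorem narrow (h : SatPack S N) (c : VCurve S N g) (hz : z ∈ LeftOf N g) (hw : w ∈ RightOf N g)
    {r : ℝ} (hr : 4 * r < N) (h1 : |z.1 - w.1| ≤ 2 * r) (h2 : |z.2 - w.2| ≤ 2 * r) :
    ∃ k, (z.1 < (g k).1 ∨ z.1 < (g (k + 1)).1) ∧ ((g k).1 + N < w.1 ∨ (g (k + 1)).1 + N < w.1) ∧
      (g k).2 + N - 2 * r ≤ z.2 ∧ z.2 ≤ (g (k + 1)).2 + 2 * r := by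
  have hN := h.pos
  obtain ⟨k, k1, k2⟩ := c.exists_level h z.2
  rw [abs_le] at h1 h2
  obtain ⟨a1, a2, a3, a4, a5⟩ := c.leftAt_of_mem h hz (k := k) (by linarith) (by linarith)
  obtain ⟨b1, b2, b3, b4, b5⟩ := c.rightAt_of_mem h hw (k := k) (by linarith) (by linarith)
  refine ⟨k, a5, b5, ?_, ?_⟩ <;> grind

/-- The closures of both sides are disjoint. -/
theorem closure_disjoint (h : SatPack S N) (c : VCurve S N g) (hz : z ∈ closure (LeftOf N g))
    (hz' : z ∈ closure (RightOf N g)) : False := by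
  have hN := h.pos
  obtain ⟨k, k1, k2⟩ := c.exists_level h z.2
  obtain ⟨-, e1, e2⟩ := (c k).ab
  set m : ℝ := min N ((min (g k).1 (g (k + 1)).1 + N) - max (g k).1 (g (k + 1)).1) with hm
  have hm0 : 0 < m := by
    rw [hm, lt_min_iff, sub_pos, max_lt_iff, ← min_add_add_right, lt_min_iff, lt_min_iff]
    refine ⟨hN, ⟨?_, ?_⟩, ?_, ?_⟩ <;> linarith
  obtain ⟨w, hw, hwd⟩ := Metric.mem_closure_iff.1 hz (m / 4) (by linarith)
  obtain ⟨w', hw', hwd'⟩ := Metric.mem_closure_iff.1 hz' (m / 4) (by linarith)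
  rw [Prod.dist_eq, max_lt_iff, Real.dist_eq, Real.dist_eq, abs_lt, abs_lt] at hwd hwd'
  have m1 : m ≤ N := min_le_left _ _
  have m2 : m ≤ _ := min_le_right _ _
  obtain ⟨-, -, -, -, a5⟩ := c.leftAt_of_mem h hw (k := k) (by linarith) (by linarith)
  obtain ⟨-, -, -, -, b5⟩ := c.rightAt_of_mem h hw' (k := k) (by linarith) (by linarith)
  have n1 := min_add_le (N := N) (a := (g k).1) (b := (g (k + 1)).1) (c := w'.1)
  have n2 := le_max_iff (a := w.1) (b := (g k).1) (c := (g (k + 1)).1)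
  grind

end VCurve

/-- The interior of the square at `a`. -/
def openSq (N : ℝ) (a : Plane) : Set Plane := Ioo a.1 (a.1 + N) ×ˢ Ioo a.2 (a.2 + N)

theorem isPreconnected_openSq (a : Plane) : IsPreconnected (openSq N a) :=
  isPreconnected_Ioo.prod isPreconnected_Ioo

namespace VCurve

variable {g : ℤ → Plane} {z w a b : Plane} {k j : ℤ}

/-- The interior of a square which does not belong to the curve misses it. -/
theorem openSq_disj (h : SatPack S N) (c : VCurve S N g) (ha : a ∈ S) (hag : a ∉ range g)
    (hz : z ∈ openSq N a) : z ∉ OnCurve N g := by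
  rintro ⟨k, hk⟩
  obtain ⟨⟨z1, z2⟩, z3, z4⟩ := hz
  have hN := h.pos
  have n1 : a ≠ g k := fun e => hag ⟨k, e.symm⟩
  have n2 : a ≠ g (k + 1) := fun e => hag ⟨_, e.symm⟩
  rcases hk with ⟨k1, k2, k3, k4⟩ | ⟨k1, k2, k3, k4, k5, k6⟩
  · rcases h.sep a ha _ (c.mem k) n1 with e | e | e | e <;> linarith
  · have d := h.varm_disj (c k) ha n1 n2
    obtain ⟨-, e1, e2⟩ := (c k).ab
    rw [le_max_iff, min_add_le] at d
    grind

theorem sq_left_or_right (h : SatPack S N) (c : VCurve S N g) (ha : a ∈ S) (hag : a ∉ range g) :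
    openSq N a ⊆ LeftOf N g ∨ openSq N a ⊆ RightOf N g :=
  c.subset_or_subset h (isPreconnected_openSq a) fun _ hz => c.openSq_disj h ha hag hz

/-- A point of the curve in a vertical arm prolonged through its squares lies in a common square, or
the arm belongs to the curve. -/
theorem varm_disj (h : SatPack S N) (c : VCurve S N g) (e : VArm S N a b)
    (z1 : a.1 < z.1) (z2 : b.1 < z.1) (z3 : z.1 < a.1 + N) (z4 : z.1 < b.1 + N)
    (z5 : a.2 < z.2) (z6 : z.2 < b.2 + N) (hz : z ∈ OnCurve N g) :
    (a ∈ range g ∧ z.2 ≤ a.2 + N) ∨ (b ∈ range g ∧ b.2 ≤ z.2) ∨ (a ∈ range g ∧ b ∈ range g) := by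
  have hN := h.pos
  obtain ⟨k, hk | hk⟩ := hz
  · obtain ⟨k1, k2, k3, k4⟩ := hk
    by_cases e1 : g k = a
    · left; exact ⟨⟨k, e1⟩, by rw [← e1]; exact k4⟩
    by_cases e2 : g k = b
    · right; left; exact ⟨⟨k, e2⟩, by rw [← e2]; exact k3⟩
    have d := h.varm_disj e (c.mem k) e1 e2
    rw [le_max_iff, min_add_le] at d
    grind
  · obtain ⟨k1, k2, k3, k4, k5, k6⟩ := id hk
    by_cases e1 : g k = a
    · by_cases e4 : g (k + 1) = b
      · right; right; exact ⟨⟨k, e1⟩, _, e4⟩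
      · exact (h.varm_bot_share e (e1 ▸ c k) e4 z1 z2 z3 z4 k2 k4).elim
    by_cases e4 : g (k + 1) = b
    · exact (h.varm_top_share e (e4 ▸ c k) e1 z1 z2 z3 z4 k1 k3).elim
    by_cases e2 : g k = b
    · right; left; exact ⟨⟨k, e2⟩, by rw [← e2]; linarith⟩
    by_cases e3 : g (k + 1) = a
    · left; exact ⟨⟨_, e3⟩, by rw [← e3]; linarith⟩
    exact (h.varm_varm e (c k) e1 e2 e3 e4 z1 z2 z3 z4 z5 z6 hk).elim

theorem harm_disj (h : SatPack S N) (c : VCurve S N g) (e : HArm S N a b)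
    (z1 : a.2 < z.2) (z2 : b.2 < z.2) (z3 : z.2 < a.2 + N) (z4 : z.2 < b.2 + N)
    (z5 : a.1 < z.1) (z6 : z.1 < b.1 + N) (hz : z ∈ OnCurve N g) :
    (a ∈ range g ∧ z.1 ≤ a.1 + N) ∨ (b ∈ range g ∧ b.1 ≤ z.1) := by
  have hN := h.pos
  obtain ⟨k, hk | hk⟩ := hz
  · obtain ⟨k1, k2, k3, k4⟩ := hk
    by_cases e1 : g k = a
    · left; exact ⟨⟨k, e1⟩, by rw [← e1]; exact k2⟩
    by_cases e2 : g k = b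
    · right; exact ⟨⟨k, e2⟩, by rw [← e2]; exact k1⟩
    have d := h.harm_disj e (c.mem k) e1 e2
    rw [le_max_iff, min_add_le] at d
    grind
  · exact (h.harm_varm e (c k) z1 z2 z3 z4 z5 z6 hk).elim

end VCurve

/-! ### Squares on the sides of a vertical curve -/

/-- The square at `t` is reached from the square at `s` by a chain of vertical arms upwards. -/
def VLt (S : Set Plane) (N : ℝ) : Plane → Plane → Prop := Relation.TransGen (VArm S N)

/-- The square at `t` is reached from the square at `s` by a chain of horizontal arms to the
right. -/
def HLt (S : Set Plane) (N : ℝ) : Plane → Plane → Prop := Relation.TransGen (HArm S N)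

theorem VLt.lt (h : VLt S N s t) : t.1 - s.1 < t.2 - s.2 ∧ s.1 - t.1 < t.2 - s.2 := by
  induction h with
  | single a => obtain ⟨h1, h2, h3⟩ := a.ab; constructor <;> linarith
  | tail _ a ih => obtain ⟨h1, h2, h3⟩ := a.ab; constructor <;> linarith

theorem HLt.lt (h : HLt S N s t) : t.2 - s.2 < t.1 - s.1 ∧ s.2 - t.2 < t.1 - s.1 := by
  induction h with
  | single a => obtain ⟨h1, h2, h3⟩ := a.ab; constructor <;> linarith
  | tail _ a ih => obtain ⟨h1, h2, h3⟩ := a.ab; constructor <;> linarith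

theorem HLt.le (h : HLt S N s t) : s.1 + N ≤ t.1 := by
  induction h with
  | single a => exact a.ab.1
  | tail _ a ih =>
    obtain ⟨h1, h2, h3⟩ := a.ab
    linarith

theorem VLt.swap (h : VLt (swapS S) N s t) : HLt S N (s.2, s.1) (t.2, t.1) := by
  induction h with
  | single a => exact Relation.TransGen.single a.swap
  | tail _ a ih => exact Relation.TransGen.tail ih a.swap

theorem VLt.neg (h : VLt (negS S N) N s t) : VLt S N (-s.1 - N, s.2) (-t.1 - N, t.2) := by
  induction h with
  | single a => have := a.neg; rw [negS_negS] at this; exact Relation.TransGen.single this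
  | tail _ a ih => have := a.neg; rw [negS_negS] at this; exact Relation.TransGen.tail ih this

namespace VCurve

variable {g g' : ℤ → Plane} {z w a b : Plane} {k j : ℤ}

theorem vlt (c : VCurve S N g) (hjk : j < k) : VLt S N (g j) (g k) := by
  obtain ⟨n, rfl⟩ : ∃ n : ℕ, k = j + 1 + n := ⟨(k - j - 1).toNat, by omega⟩
  clear hjk
  induction n with
  | zero => simpa using! Relation.TransGen.single (c j)
  | succ n ih =>
    have := Relation.TransGen.tail ih (c (j + 1 + n))
    push_cast
    rwa [← add_assoc]

theorem comparable (c : VCurve S N g) (ha : a ∈ range g) (hb : b ∈ range g) :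
    a = b ∨ VLt S N a b ∨ VLt S N b a := by
  obtain ⟨j, rfl⟩ := ha
  obtain ⟨k, rfl⟩ := hb
  rcases lt_trichotomy j k with e | rfl | e
  · exact Or.inr (Or.inl (c.vlt e))
  · exact Or.inl rfl
  · exact Or.inr (Or.inr (c.vlt e))

theorem left_of_meets (h : SatPack S N) (c : VCurve S N g) {C : Set Plane}
    (hC : IsPreconnected C) (hd : ∀ z ∈ C, z ∉ OnCurve N g) (hz : z ∈ C) (hz' : z ∈ LeftOf N g) :
    C ⊆ LeftOf N g :=
  (c.subset_or_subset h hC hd).resolve_right fun e => c.disjoint h hz' (e hz)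

theorem le_of_left (h : SatPack S N) (c : VCurve S N g) (ha : openSq N a ⊆ LeftOf N g)
    (h1 : a.2 < (g k).2 + N) (h2 : (g k).2 < a.2 + N) : a.1 + N ≤ (g k).1 := by
  by_contra! hc
  have hN := h.pos
  obtain ⟨x, x1, x2⟩ := exists_between (max_lt hc (by linarith : a.1 < a.1 + N))
  obtain ⟨y, y1, y2⟩ := exists_between (max_lt (lt_min h1 (by linarith : a.2 < a.2 + N))
    (lt_min (by linarith : (g k).2 < (g k).2 + N) h2))
  rw [max_lt_iff] at x1 y1
  rw [lt_min_iff] at y2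
  have := c.leftAt_of_mem h (ha (show (x, y) ∈ _ from ⟨⟨x1.2, x2⟩, y1.1, y2.2⟩)) (k := k) y1.2
    (lt_of_lt_of_le y2.1 (by linarith [(c k).ab.1]))
  obtain ⟨-, -, this, -⟩ := this
  dsimp only at this
  rcases this with e | e <;> linarith

theorem openSq_neg {C : Set Plane} (ha : openSq N a ⊆ {z : Plane | (-z.1, z.2) ∈ C}) :
    openSq N (-a.1 - N, a.2) ⊆ C := by
  rintro ⟨x, y⟩ ⟨⟨z1, z2⟩, z3⟩
  have := ha (show (-x, y) ∈ openSq N a from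
    ⟨⟨by dsimp only at *; linarith, by dsimp only at *; linarith⟩, z3⟩)
  simpa using this

theorem right_neg (ha : openSq N a ⊆ RightOf N g) :
    openSq N (-a.1 - N, a.2) ⊆ LeftOf N (negC N g) :=
  openSq_neg fun _ hz => leftOf_negC.2 (ha hz)

theorem mem_range_neg (ha : a ∈ range g) : (-a.1 - N, a.2) ∈ range (negC N g) := by
  obtain ⟨k, rfl⟩ := ha
  exact ⟨k, rfl⟩

theorem ge_of_right (h : SatPack S N) (c : VCurve S N g) (ha : openSq N a ⊆ RightOf N g)
    (h1 : a.2 < (g k).2 + N) (h2 : (g k).2 < a.2 + N) : (g k).1 + N ≤ a.1 := by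
  have := c.neg.le_of_left h.neg (right_neg ha) (k := k) h1 h2
  simp only [negC] at this
  linarith

theorem notMem_of_left (h : SatPack S N) (c : VCurve S N g) (ha : openSq N a ⊆ LeftOf N g) :
    a ∉ range g := by
  rintro ⟨k, rfl⟩
  have hN := h.pos
  linarith [c.le_of_left h ha (k := k) (by linarith) (by linarith)]

theorem notMem_of_right (h : SatPack S N) (c : VCurve S N g) (ha : openSq N a ⊆ RightOf N g) :
    a ∉ range g := by
  rintro ⟨k, rfl⟩
  have hN := h.pos
  linarith [c.ge_of_right h ha (k := k) (by linarith) (by linarith)]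

/-- If the square at `a` is on the left of the curve, so is the part of the strip of its arm which
lies in this square or in the arm. -/
theorem varm_left (h : SatPack S N) (c : VCurve S N g) (e : VArm S N a b)
    (ha : openSq N a ⊆ LeftOf N g) :
    Ioo (max a.1 b.1) (min a.1 b.1 + N) ×ˢ Ioo a.2 b.2 ⊆ LeftOf N g := by
  have hN := h.pos
  obtain ⟨e0, e1, e2⟩ := id e.ab
  have hna := c.notMem_of_left h ha
  have hm : max a.1 b.1 < min a.1 b.1 + N := by
    rw [max_lt_iff, ← min_add_add_right, lt_min_iff, lt_min_iff]
    refine ⟨⟨?_, ?_⟩, ?_, ?_⟩ <;> linarith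
  obtain ⟨x, x1, x2⟩ := exists_between hm
  obtain ⟨y, y1, y2⟩ := exists_between (show a.2 < a.2 + N by linarith)
  refine c.left_of_meets h (isPreconnected_Ioo.prod isPreconnected_Ioo) ?_
    (z := (x, y)) ⟨⟨x1, x2⟩, y1, by dsimp only; linarith⟩ (ha ⟨⟨?_, ?_⟩, y1, y2⟩)
  · rintro z ⟨⟨z1, z2⟩, z3, z4⟩ hz
    rw [max_lt_iff] at z1
    rw [← min_add_add_right, lt_min_iff] at z2
    rcases c.varm_disj h e z1.1 z1.2 z2.1 z2.2 z3 (by linarith) hz with e | e | e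
    · exact hna e.1
    · linarith
    · exact hna e.1
  · exact (le_max_left _ _).trans_lt x1
  · exact x2.trans_le (by gcongr; exact min_le_left _ _)

/-- If the square at `b` is on the left of the curve, so is the part of the strip of its arm which
lies in this square or in the arm. -/
theorem varm_left' (h : SatPack S N) (c : VCurve S N g) (e : VArm S N a b)
    (hb : openSq N b ⊆ LeftOf N g) :
    Ioo (max a.1 b.1) (min a.1 b.1 + N) ×ˢ Ioo (a.2 + N) (b.2 + N) ⊆ LeftOf N g := by
  have hN := h.pos
  obtain ⟨e0, e1, e2⟩ := id e.ab
  have hnb := c.notMem_of_left h hb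
  have hm : max a.1 b.1 < min a.1 b.1 + N := by
    rw [max_lt_iff, ← min_add_add_right, lt_min_iff, lt_min_iff]
    refine ⟨⟨?_, ?_⟩, ?_, ?_⟩ <;> linarith
  obtain ⟨x, x1, x2⟩ := exists_between hm
  obtain ⟨y, y1, y2⟩ := exists_between (show b.2 < b.2 + N by linarith)
  refine c.left_of_meets h (isPreconnected_Ioo.prod isPreconnected_Ioo) ?_
    (z := (x, y)) ⟨⟨x1, x2⟩, by dsimp only; linarith, y2⟩ (hb ⟨⟨?_, ?_⟩, y1, y2⟩)
  · rintro z ⟨⟨z1, z2⟩, z3, z4⟩ hz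
    rw [max_lt_iff] at z1
    rw [← min_add_add_right, lt_min_iff] at z2
    rcases c.varm_disj h e z1.1 z1.2 z2.1 z2.2 (by linarith) z4 hz with e | e | e
    · linarith
    · exact hnb e.1
    · exact hnb e.2
  · exact (le_max_right _ _).trans_lt x1
  · exact x2.trans_le (by gcongr; exact min_le_right _ _)

theorem harm_left (h : SatPack S N) (c : VCurve S N g) (e : HArm S N a b)
    (ha : openSq N a ⊆ LeftOf N g) :
    Ioo a.1 b.1 ×ˢ Ioo (max a.2 b.2) (min a.2 b.2 + N) ⊆ LeftOf N g := by
  have hN := h.pos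
  obtain ⟨e0, e1, e2⟩ := id e.ab
  have hna := c.notMem_of_left h ha
  have hm : max a.2 b.2 < min a.2 b.2 + N := by
    rw [max_lt_iff, ← min_add_add_right, lt_min_iff, lt_min_iff]
    refine ⟨⟨?_, ?_⟩, ?_, ?_⟩ <;> linarith
  obtain ⟨x, x1, x2⟩ := exists_between hm
  obtain ⟨y, y1, y2⟩ := exists_between (show a.1 < a.1 + N by linarith)
  refine c.left_of_meets h (isPreconnected_Ioo.prod isPreconnected_Ioo) ?_
    (z := (y, x)) ⟨⟨y1, by dsimp only; linarith⟩, x1, x2⟩ (ha ⟨⟨y1, y2⟩, ?_, ?_⟩)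
  · rintro z ⟨⟨z3, z4⟩, z1, z2⟩ hz
    rw [max_lt_iff] at z1
    rw [← min_add_add_right, lt_min_iff] at z2
    rcases c.harm_disj h e z1.1 z1.2 z2.1 z2.2 z3 (by linarith) hz with e | e
    · exact hna e.1
    · linarith
  · exact (le_max_left _ _).trans_lt x1
  · exact x2.trans_le (by gcongr; exact min_le_left _ _)

theorem harm_left' (h : SatPack S N) (c : VCurve S N g) (e : HArm S N a b)
    (hb : openSq N b ⊆ LeftOf N g) :
    Ioo (a.1 + N) (b.1 + N) ×ˢ Ioo (max a.2 b.2) (min a.2 b.2 + N) ⊆ LeftOf N g := by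
  have hN := h.pos
  obtain ⟨e0, e1, e2⟩ := id e.ab
  have hnb := c.notMem_of_left h hb
  have hm : max a.2 b.2 < min a.2 b.2 + N := by
    rw [max_lt_iff, ← min_add_add_right, lt_min_iff, lt_min_iff]
    refine ⟨⟨?_, ?_⟩, ?_, ?_⟩ <;> linarith
  obtain ⟨x, x1, x2⟩ := exists_between hm
  obtain ⟨y, y1, y2⟩ := exists_between (show b.1 < b.1 + N by linarith)
  refine c.left_of_meets h (isPreconnected_Ioo.prod isPreconnected_Ioo) ?_
    (z := (y, x)) ⟨⟨by dsimp only; linarith, y2⟩, x1, x2⟩ (hb ⟨⟨y1, y2⟩, ?_, ?_⟩)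
  · rintro z ⟨⟨z3, z4⟩, z1, z2⟩ hz
    rw [max_lt_iff] at z1
    rw [← min_add_add_right, lt_min_iff] at z2
    rcases c.harm_disj h e z1.1 z1.2 z2.1 z2.2 (by linarith) z4 hz with e | e
    · linarith
    · exact hnb e.1
  · exact (le_max_right _ _).trans_lt x1
  · exact x2.trans_le (by gcongr; exact min_le_right _ _)

/-- Squares off the curve which are met by a connected set off the curve lie on the same side. -/
theorem left_of_link (h : SatPack S N) (c : VCurve S N g) {C : Set Plane} (hC : IsPreconnected C)
    (hd : ∀ z ∈ C, z ∉ OnCurve N g) (ha : openSq N a ⊆ LeftOf N g) (hb : b ∈ S) (hbg : b ∉ range g)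
    (hz : z ∈ C) (hza : z ∈ openSq N a) (hw : w ∈ C) (hwb : w ∈ openSq N b) :
    openSq N b ⊆ LeftOf N g :=
  c.left_of_meets h (isPreconnected_openSq b) (fun _ => c.openSq_disj h hb hbg) hwb
    (c.left_of_meets h hC hd hz (ha hza) hw)

/-- Squares off the curve which are joined by a vertical arm lie on the same side of it. -/
theorem varm_left_iff (h : SatPack S N) (c : VCurve S N g) (e : VArm S N a b)
    (hag : a ∉ range g) (hbg : b ∉ range g) :
    openSq N a ⊆ LeftOf N g ↔ openSq N b ⊆ LeftOf N g := by
  have hN := h.pos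
  obtain ⟨e0, e1, e2⟩ := id e.ab
  have hm : max a.1 b.1 < min (a.1 + N) (b.1 + N) := by
    rw [max_lt_iff, lt_min_iff, lt_min_iff]
    refine ⟨⟨?_, ?_⟩, ?_, ?_⟩ <;> linarith
  obtain ⟨x, x1, x2⟩ := exists_between hm
  have hC : IsPreconnected (Ioo (max a.1 b.1) (min (a.1 + N) (b.1 + N)) ×ˢ Ioo a.2 (b.2 + N)) :=
    isPreconnected_Ioo.prod isPreconnected_Ioo
  have hd : ∀ z ∈ Ioo (max a.1 b.1) (min (a.1 + N) (b.1 + N)) ×ˢ Ioo a.2 (b.2 + N),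
      z ∉ OnCurve N g := by
    rintro z ⟨⟨z1, z2⟩, z3, z4⟩ hz
    rw [max_lt_iff] at z1
    rw [lt_min_iff] at z2
    rcases c.varm_disj h e z1.1 z1.2 z2.1 z2.2 z3 z4 hz with e | e | e <;> tauto
  obtain ⟨d1, d2⟩ := max_lt_iff.1 x1
  obtain ⟨d3, d4⟩ := lt_min_iff.1 x2
  have m1 : ((x, a.2 + N / 2) : Plane) ∈ openSq N a :=
    ⟨⟨d1, d3⟩, by dsimp only; linarith, by dsimp only; linarith⟩
  have m2 : ((x, b.2 + N / 2) : Plane) ∈ openSq N b :=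
    ⟨⟨d2, d4⟩, by dsimp only; linarith, by dsimp only; linarith⟩
  have m3 : ((x, a.2 + N / 2) : Plane) ∈ Ioo (max a.1 b.1) (min (a.1 + N) (b.1 + N)) ×ˢ
      Ioo a.2 (b.2 + N) := ⟨⟨x1, x2⟩, by dsimp only; linarith, by dsimp only; linarith⟩
  have m4 : ((x, b.2 + N / 2) : Plane) ∈ Ioo (max a.1 b.1) (min (a.1 + N) (b.1 + N)) ×ˢ
      Ioo a.2 (b.2 + N) := ⟨⟨x1, x2⟩, by dsimp only; linarith, by dsimp only; linarith⟩
  exact ⟨fun ha => c.left_of_link h hC hd ha e.mt hbg m3 m1 m4 m2,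
    fun hb => c.left_of_link h hC hd hb e.ms hag m4 m2 m3 m1⟩

/-- Squares off the curve which are joined by a horizontal arm lie on the same side of it. -/
theorem harm_left_iff (h : SatPack S N) (c : VCurve S N g) (e : HArm S N a b)
    (hag : a ∉ range g) (hbg : b ∉ range g) :
    openSq N a ⊆ LeftOf N g ↔ openSq N b ⊆ LeftOf N g := by
  have hN := h.pos
  obtain ⟨e0, e1, e2⟩ := id e.ab
  have hm : max a.2 b.2 < min (a.2 + N) (b.2 + N) := by
    rw [max_lt_iff, lt_min_iff, lt_min_iff]
    refine ⟨⟨?_, ?_⟩, ?_, ?_⟩ <;> linarith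
  obtain ⟨x, x1, x2⟩ := exists_between hm
  have hC : IsPreconnected (Ioo a.1 (b.1 + N) ×ˢ Ioo (max a.2 b.2) (min (a.2 + N) (b.2 + N))) :=
    isPreconnected_Ioo.prod isPreconnected_Ioo
  have hd : ∀ z ∈ Ioo a.1 (b.1 + N) ×ˢ Ioo (max a.2 b.2) (min (a.2 + N) (b.2 + N)),
      z ∉ OnCurve N g := by
    rintro z ⟨⟨z3, z4⟩, z1, z2⟩ hz
    rw [max_lt_iff] at z1
    rw [lt_min_iff] at z2
    rcases c.harm_disj h e z1.1 z1.2 z2.1 z2.2 z3 z4 hz with e | e <;> tauto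
  obtain ⟨d1, d2⟩ := max_lt_iff.1 x1
  obtain ⟨d3, d4⟩ := lt_min_iff.1 x2
  have m1 : ((a.1 + N / 2, x) : Plane) ∈ openSq N a :=
    ⟨⟨by dsimp only; linarith, by dsimp only; linarith⟩, d1, d3⟩
  have m2 : ((b.1 + N / 2, x) : Plane) ∈ openSq N b :=
    ⟨⟨by dsimp only; linarith, by dsimp only; linarith⟩, d2, d4⟩
  have m3 : ((a.1 + N / 2, x) : Plane) ∈ Ioo a.1 (b.1 + N) ×ˢ
      Ioo (max a.2 b.2) (min (a.2 + N) (b.2 + N)) :=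
    ⟨⟨by dsimp only; linarith, by dsimp only; linarith⟩, x1, x2⟩
  have m4 : ((b.1 + N / 2, x) : Plane) ∈ Ioo a.1 (b.1 + N) ×ˢ
      Ioo (max a.2 b.2) (min (a.2 + N) (b.2 + N)) :=
    ⟨⟨by dsimp only; linarith, by dsimp only; linarith⟩, x1, x2⟩
  exact ⟨fun ha => c.left_of_link h hC hd ha e.mt hbg m3 m1 m4 m2,
    fun hb => c.left_of_link h hC hd hb e.ms hag m4 m2 m3 m1⟩

theorem not_hlt (c : VCurve S N g) (ha : a ∈ range g) (hb : b ∈ range g) : ¬HLt S N a b := by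
  intro hab
  have h1 := hab.lt
  rcases c.comparable ha hb with rfl | h2 | h2
  · linarith [h1.1]
  · linarith [h1.1, h1.2, h2.lt.1, h2.lt.2]
  · linarith [h1.1, h1.2, h2.lt.1, h2.lt.2]

/-- A chain of horizontal arms which leads to a vertical curve comes from the left of it. -/
theorem left_of_hlt (h : SatPack S N) (c : VCurve S N g) (hab : HLt S N a b) (hb : b ∈ range g) :
    openSq N a ⊆ LeftOf N g := by
  have hN := h.pos
  induction hab using Relation.TransGen.head_induction_on with
  | single e =>
    have hn : _ ∉ range g := fun ha => c.not_hlt ha hb (Relation.TransGen.single e)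
    obtain ⟨e0, e1, e2⟩ := id e.ab
    refine (c.sq_left_or_right h e.ms hn).resolve_right fun hr => ?_
    obtain ⟨k, rfl⟩ := hb
    linarith [c.ge_of_right h hr (k := k) (by linarith) (by linarith)]
  | head e hcb ih =>
    have hn : _ ∉ range g := fun ha => c.not_hlt ha hb (Relation.TransGen.head e hcb)
    exact (c.harm_left_iff h e hn (c.notMem_of_left h ih)).2 ih

theorem right_of_hlt (h : SatPack S N) (c : VCurve S N g) (hab : HLt S N b a) (hb : b ∈ range g) :
    openSq N a ⊆ RightOf N g := by
  have hN := h.pos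
  induction hab with
  | single e =>
    have hn : _ ∉ range g := fun ha => c.not_hlt hb ha (Relation.TransGen.single e)
    obtain ⟨e0, e1, e2⟩ := id e.ab
    refine (c.sq_left_or_right h e.mt hn).resolve_left fun hr => ?_
    obtain ⟨k, rfl⟩ := hb
    linarith [c.le_of_left h hr (k := k) (by linarith) (by linarith)]
  | tail hcb e ih =>
    have hn : _ ∉ range g := fun ha => c.not_hlt hb ha (Relation.TransGen.tail hcb e)
    refine (c.sq_left_or_right h e.mt hn).resolve_left fun hr => ?_
    have := (c.harm_left_iff h e (c.notMem_of_right h ih) hn).2 hr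
    have m : ∀ a : Plane, ((a.1 + N / 2, a.2 + N / 2) : Plane) ∈ openSq N a := fun a =>
      ⟨⟨by dsimp only; linarith, by dsimp only; linarith⟩, by dsimp only; linarith,
        by dsimp only; linarith⟩
    exact c.disjoint h (this (m _)) (ih (m _))

/-- If each of two squares lies on a vertical curve, and on or to the left of the curve through the
other one, then one of them is reached from the other one by a chain of vertical arms: the curve
through the lower one cannot pass the upper one without meeting its curve. -/
theorem vlt_of_left_of_le (h : SatPack S N) (c : VCurve S N g) (c' : VCurve S N g')
    (hb' : openSq N (g' 0) ⊆ LeftOf N g) (hb : openSq N (g 0) ⊆ LeftOf N g')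
    (hle : (g 0).2 + N ≤ (g' 0).2) : VLt S N (g 0) (g' 0) := by
  have hN := h.pos
  have hex : ∃ n : ℕ, (g' 0).2 - N < (g n).2 := by
    obtain ⟨n, hn⟩ := exists_nat_gt (((g' 0).2 - N - (g 0).2) / N)
    rw [div_lt_iff₀ hN] at hn
    exact ⟨n, by linarith [(c.row_ge n).1]⟩
  classical
  -- `g m` is the first square of the lower curve at the level of the upper square.
  obtain ⟨m, hm, hmin⟩ : ∃ m : ℕ, (g' 0).2 - N < (g m).2 ∧
      ∀ n < m, (g n).2 ≤ (g' 0).2 - N :=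
    ⟨Nat.find hex, Nat.find_spec hex, fun n hn => not_lt.1 (Nat.find_min hex hn)⟩
  have hm' : (g m).2 < (g' 0).2 + N := by
    rcases m with _ | m
    · simp only [Nat.cast_zero]; linarith
    · have h1 := hmin m (by omega)
      have h2 := h.varm_gap (c m)
      push_cast
      linarith
  -- If the squares up to `g m` are not in the other curve, they all lie on the left of it, and then
  -- `g m` and the upper square lie on the left of each other.
  obtain ⟨i, hi, j, hj⟩ : ∃ i ≤ m, g i ∈ range g' := by
    by_contra! hc
    have hl : ∀ i : ℕ, i ≤ m → openSq N (g i) ⊆ LeftOf N g' := by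
      intro i
      induction i with
      | zero => intro _; exact hb
      | succ i ih =>
        intro hi
        have := hc (i + 1) hi
        push_cast at this ⊢
        exact (c'.varm_left_iff h (c i) (hc i (by omega)) this).1 (ih (by omega))
    have h1 := c'.le_of_left h (hl m le_rfl) (k := 0) (by linarith) (by linarith)
    have h2 := c.le_of_left h hb' (k := m) (by linarith) (by linarith)
    linarith
  have hi2 : (g i).2 ≤ (g m).2 := by
    rcases hi.lt_or_eq with e | rfl
    · linarith [c.row_le h (show (i : ℤ) < m by exact_mod_cast e)]
    · rfl
  rcases lt_trichotomy j 0 with e | rfl | e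
  · have h1 := c'.vlt e
    rw [hj] at h1
    rcases Nat.eq_zero_or_pos i with rfl | hi0
    · exact h1
    · exact (c.vlt (show (0 : ℤ) < i by exact_mod_cast hi0)).trans h1
  · exact (c.notMem_of_left h hb' ⟨i, hj.symm⟩).elim
  · have := c'.row_le h e
    rw [hj] at this
    linarith

theorem vlt_of_left (h : SatPack S N) (c : VCurve S N g) (c' : VCurve S N g')
    (hb' : g' 0 ∈ range g ∨ openSq N (g' 0) ⊆ LeftOf N g)
    (hb : g 0 ∈ range g' ∨ openSq N (g 0) ⊆ LeftOf N g') :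
    g 0 = g' 0 ∨ VLt S N (g 0) (g' 0) ∨ VLt S N (g' 0) (g 0) := by
  rcases hb' with hb' | hb'
  · exact c.comparable ⟨0, rfl⟩ hb'
  rcases hb with hb | hb
  · exact c'.comparable hb ⟨0, rfl⟩
  rcases le_or_gt ((g 0).2 + N) (g' 0).2 with e | e
  · exact Or.inr (Or.inl (c.vlt_of_left_of_le h c' hb' hb e))
  rcases le_or_gt ((g' 0).2 + N) (g 0).2 with e' | e'
  · exact Or.inr (Or.inr (c'.vlt_of_left_of_le h c hb hb' e'))
  have h1 := c.le_of_left h hb' (k := 0) e e'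
  have h2 := c'.le_of_left h hb (k := 0) e' e
  linarith [h.pos]

theorem vlt_of_right (h : SatPack S N) (c : VCurve S N g) (c' : VCurve S N g')
    (hb' : g' 0 ∈ range g ∨ openSq N (g' 0) ⊆ RightOf N g)
    (hb : g 0 ∈ range g' ∨ openSq N (g 0) ⊆ RightOf N g') :
    g 0 = g' 0 ∨ VLt S N (g 0) (g' 0) ∨ VLt S N (g' 0) (g 0) := by
  have := c.neg.vlt_of_left h.neg c'.neg (hb'.imp mem_range_neg right_neg)
    (hb.imp mem_range_neg right_neg)
  have hn : ∀ a : Plane, (-(-a.1 - N) - N, a.2) = a := fun a => by ext <;> simp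
  refine this.imp (fun e => ?_) (Or.imp (fun e => ?_) fun e => ?_)
  · simp only [negC, Prod.mk.injEq] at e
    exact Prod.ext (by linarith [e.1]) e.2
  · have := e.neg; simpa [negC] using! this
  · have := e.neg; simpa [negC] using! this

end VCurve

/-! ### Symmetries of packings -/

/-- The linear isometry `f` of the plane maps the squares of the packing `S` to the squares of the
packing `S'`, and the square at `s` to the square at `φ s`. -/
structure PackSym (S S' : Set Plane) (N : ℝ) (f : Plane ≃L[ℝ] Plane) (φ : Plane → Plane) :
    Prop where
  sq : ∀ s, f '' squareAt N s = squareAt N (φ s)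
  mem : ∀ s ∈ S, φ s ∈ S'
  mem' : ∀ s' ∈ S', ∃ s ∈ S, φ s = s'
  isom : Isometry f
  arm : ∀ s t A, IsArm S N s t A → IsArm S' N (φ s) (φ t) (f '' A)
  arm' : ∀ s' t' A', IsArm S' N s' t' A' → ∃ s t A, IsArm S N s t A ∧ φ s = s' ∧ φ t = t' ∧
    f '' A = A'
  inj : Function.Injective φ
  box : ∀ (K : Set Plane) (a b : Plane), K.Nonempty → IsGLB K a → IsLUB K b →
    ∃ a' b', IsGLB (f '' K) a' ∧ IsLUB (f '' K) b' ∧ Icc a' b' = f '' Icc a b ∧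
      midpoint ℝ a' b' = f (midpoint ℝ a b)

namespace PackSym

variable {S' : Set Plane} {f : Plane ≃L[ℝ] Plane} {φ : Plane → Plane} {K σ : Set Plane}

theorem image_component (f : Plane ≃L[ℝ] Plane) {U : Set Plane} {x : Plane} (hx : x ∈ U) :
    f '' connectedComponentIn U x = connectedComponentIn (f '' U) (f x) :=
  f.toHomeomorph.image_connectedComponentIn hx

theorem image_midpoint (f : Plane ≃L[ℝ] Plane) (a b : Plane) :
    f (midpoint ℝ a b) = midpoint ℝ (f a) (f b) := by
  simp [midpoint_eq_smul_add]

theorem image_seg (f : Plane ≃L[ℝ] Plane) (a b : Plane) :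
    f '' segment ℝ a b = segment ℝ (f a) (f b) := by
  simpa using image_segment ℝ (f : Plane →L[ℝ] Plane).toLinearMap.toAffineMap a b

theorem image_clos (f : Plane ≃L[ℝ] Plane) (K : Set Plane) :
    f '' closure K = closure (f '' K) := f.toHomeomorph.image_closure K

theorem image_int (f : Plane ≃L[ℝ] Plane) (K : Set Plane) :
    f '' interior K = interior (f '' K) := f.toHomeomorph.image_interior K

theorem image_front (f : Plane ≃L[ℝ] Plane) (K : Set Plane) :
    f '' frontier K = frontier (f '' K) := f.toHomeomorph.image_frontier K

variable (F : PackSym S S' N f φ)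
include F

theorem image_uncovered : f '' uncovered S N = uncovered S' N := by
  ext z
  constructor
  · rintro ⟨w, ⟨h1, h2⟩, rfl⟩
    constructor
    · intro s' hs' hz
      obtain ⟨s, hs, rfl⟩ := F.mem' s' hs'
      rw [← F.sq] at hz
      exact h1 s hs ((f.injective.mem_set_image).1 hz)
    · intro s' t' A' hA hz
      obtain ⟨s, t, A, hA', rfl, rfl, rfl⟩ := F.arm' s' t' A' hA
      exact h2 s t A hA' ((f.injective.mem_set_image).1 hz)
  · rintro ⟨h1, h2⟩
    refine ⟨f.symm z, ⟨fun s hs hz => h1 _ (F.mem s hs) ?_, fun s t A hA hz =>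
      h2 _ _ _ (F.arm s t A hA) ?_⟩, by simp⟩
    · rw [← F.sq]; exact ⟨_, hz, by simp⟩
    · exact ⟨_, hz, by simp⟩

theorem isCross (hK : IsCross S N K) : IsCross S' N (f '' K) := by
  obtain ⟨x, hx, rfl⟩ := hK
  exact ⟨f x, F.image_uncovered ▸ mem_image_of_mem _ hx, by
    rw [image_component f hx, F.image_uncovered]⟩

theorem exit_iff {e : Plane} :
    f e ∈ exitPoints S' N (f '' K) (φ s) ↔ e ∈ exitPoints S N K s := by
  constructor
  · rintro ⟨t', A', p', q', hA, h1, h2⟩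
    obtain ⟨s₁, t, A, hA', hs, rfl, rfl⟩ := F.arm' _ t' A' hA
    obtain rfl := F.inj hs
    refine ⟨t, A, f.symm p', f.symm q', hA', f.injective.image_injective ?_, f.injective ?_⟩
    · rw [image_inter f.injective, image_clos, h1, image_seg]; simp
    · rw [h2, image_midpoint]; simp
  · rintro ⟨t, A, p, q, hA, h1, h2⟩
    refine ⟨φ t, f '' A, f p, f q, F.arm _ _ _ hA, ?_, ?_⟩
    · rw [← image_clos, ← image_inter f.injective, h1, image_seg]
    · rw [h2, image_midpoint]

theorem allExit_iff {e : Plane} :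
    f e ∈ allExitPoints S' N (f '' K) ↔ e ∈ allExitPoints S N K := by
  constructor
  · rintro ⟨s', hs', h⟩
    obtain ⟨s, hs, rfl⟩ := F.mem' s' hs'
    exact ⟨s, hs, F.exit_iff.1 h⟩
  · rintro ⟨s, hs, h⟩
    exact ⟨_, F.mem s hs, F.exit_iff.2 h⟩

theorem image_decoration (c : Plane) :
    f '' decoration S N K c = decoration S' N (f '' K) (f c) := by
  ext z
  constructor
  · rintro ⟨w, ⟨e, he, hw⟩, rfl⟩
    exact ⟨f e, F.allExit_iff.2 he, image_seg f c e ▸ mem_image_of_mem f hw⟩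
  · rintro ⟨e, he, hw⟩
    obtain ⟨e, rfl⟩ := f.surjective e
    rw [← image_seg] at hw
    obtain ⟨w, hw, rfl⟩ := hw
    exact ⟨w, ⟨e, F.allExit_iff.1 he, hw⟩, rfl⟩

theorem isSectorOf (hK : K.Nonempty) (hσ : IsSectorOf S N K s σ) :
    IsSectorOf S' N (f '' K) (φ s) (f '' σ) := by
  obtain ⟨a, b, ha, hb, ⟨x, hx, hσ⟩, h⟩ := hσ
  obtain ⟨a', b', ha', hb', e1, e2⟩ := F.box K a b hK ha hb
  have e3 : interior (Icc a' b') \ decoration S' N (f '' K) (midpoint ℝ a' b') =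
      f '' (interior (Icc a b) \ decoration S N K (midpoint ℝ a b)) := by
    rw [e1, e2, ← F.image_decoration, ← image_int, image_sdiff f.injective]
  refine ⟨a', b', ha', hb', ⟨f x, ?_, ?_⟩, h.imp ?_ ?_⟩
  · rw [e3]; exact mem_image_of_mem f hx
  · rw [e3, hσ, image_component f hx]
  · rintro ⟨y, ⟨⟨y1, y2⟩, y3⟩, y4⟩
    refine ⟨f y, ⟨⟨?_, ?_⟩, ?_⟩, fun h => y4 (F.allExit_iff.1 h)⟩
    · rw [← image_clos]; exact mem_image_of_mem f y1
    · rw [e1, ← image_front]; exact mem_image_of_mem f y2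
    · rw [← F.sq]; exact mem_image_of_mem f y3
  · rintro ⟨e, ⟨h1, h2⟩, e', ⟨h3, h4⟩, h5⟩
    refine ⟨f e, ⟨F.exit_iff.2 h1, ?_⟩, f e', ⟨F.exit_iff.2 h3, ?_⟩, f.injective.ne h5⟩
    · rw [← image_clos]; exact mem_image_of_mem f h2
    · rw [← image_clos]; exact mem_image_of_mem f h4

theorem robinsonTile {z : Plane} (hz : z ∈ robinsonTile S N s) :
    f z ∈ robinsonTile S' N (φ s) := by
  rcases hz with (hz | hz) | hz
  · exact Or.inl (Or.inl (F.sq s ▸ mem_image_of_mem f hz))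
  · obtain ⟨t, A, hA, hz, hd⟩ := hz
    refine Or.inl (Or.inr ⟨φ t, f '' A, F.arm _ _ _ hA, mem_image_of_mem f hz, ?_⟩)
    rwa [← F.sq, ← F.sq, Metric.infDist_image F.isom, Metric.infDist_image F.isom]
  · obtain ⟨K, σ, hK, hσ, hz⟩ := hz
    have hne : K.Nonempty := by
      obtain ⟨x, hx, rfl⟩ := hK
      exact ⟨x, mem_connectedComponentIn hx⟩
    refine Or.inr ⟨f '' K, f '' σ, F.isCross hK, F.isSectorOf hne hσ, ?_⟩
    rw [← image_inter f.injective, ← image_clos]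
    exact mem_image_of_mem f hz

end PackSym

/-- All arms, in coordinates. -/
theorem isArm_iff {A : Set Plane} : IsArm S N s t A ↔
    (VArm S N s t ∧ A = {z | InV N s t z}) ∨ (VArm S N t s ∧ A = {z | InV N t s z}) ∨
    (HArm S N s t ∧ A = {z | InH N s t z}) ∨ (HArm S N t s ∧ A = {z | InH N t s z}) ∨
    (s ∈ S ∧ t ∈ S ∧ |t.1 - s.1| = N ∧ |t.2 - s.2| = N ∧ A = {z | InSq N s z ∧ InSq N t z}) := by
  have : squareAt N s ∩ squareAt N t = {z | InSq N s z ∧ InSq N t z} := by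
    ext z; exact and_congr mem_squareAt mem_squareAt
  simp only [IsArm, isVerticalArm_iff, isHorizontalArm_iff, IsCornerArm, this]

/-- The reflection in the diagonal. -/
def swapL : Plane ≃L[ℝ] Plane := ContinuousLinearEquiv.prodComm ℝ ℝ ℝ

/-- The reflection in the vertical axis. -/
def negL : Plane ≃L[ℝ] Plane := (ContinuousLinearEquiv.neg ℝ).prodCongr (.refl ℝ ℝ)

@[simp] theorem swapL_apply (z : Plane) : swapL z = (z.2, z.1) := rfl
@[simp] theorem negL_apply (z : Plane) : negL z = (-z.1, z.2) := rfl

theorem swapL_image (A : Set Plane) : swapL '' A = {z | (z.2, z.1) ∈ A} := by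
  ext z
  exact ⟨by rintro ⟨w, hw, rfl⟩; exact hw, fun h => ⟨_, h, rfl⟩⟩

theorem negL_image (A : Set Plane) : negL '' A = {z | (-z.1, z.2) ∈ A} := by
  ext z
  exact ⟨by rintro ⟨w, hw, rfl⟩; simpa using hw, fun h => ⟨_, h, by simp⟩⟩

theorem swap_arm {A : Set Plane} (h : IsArm S N s t A) :
    IsArm (swapS S) N (s.2, s.1) (t.2, t.1) (swapL '' A) := by
  rw [isArm_iff] at h ⊢
  rw [swapL_image]
  rcases h with ⟨h, rfl⟩ | ⟨h, rfl⟩ | ⟨h, rfl⟩ | ⟨h, rfl⟩ | ⟨h1, h2, h3, h4, rfl⟩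
  · exact Or.inr (Or.inr (Or.inl ⟨h.swap, rfl⟩))
  · exact Or.inr (Or.inr (Or.inr (Or.inl ⟨h.swap, rfl⟩)))
  · exact Or.inl ⟨h.swap, rfl⟩
  · exact Or.inr (Or.inl ⟨h.swap, rfl⟩)
  · refine Or.inr (Or.inr (Or.inr (Or.inr ⟨h1, h2, h4, h3, ?_⟩)))
    ext z; simp only [InSq, mem_ofPred_eq]; tauto

theorem neg_arm {A : Set Plane} (h : IsArm S N s t A) :
    IsArm (negS S N) N (-s.1 - N, s.2) (-t.1 - N, t.2) (negL '' A) := by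
  rw [isArm_iff] at h ⊢
  rw [negL_image]
  rcases h with ⟨h, rfl⟩ | ⟨h, rfl⟩ | ⟨h, rfl⟩ | ⟨h, rfl⟩ | ⟨h1, h2, h3, h4, rfl⟩
  · refine Or.inl ⟨h.neg, ?_⟩
    ext z; simp only [InV, mem_ofPred_eq]; grind
  · refine Or.inr (Or.inl ⟨h.neg, ?_⟩)
    ext z; simp only [InV, mem_ofPred_eq]; grind
  · refine Or.inr (Or.inr (Or.inr (Or.inl ⟨h.neg, ?_⟩)))
    ext z; simp only [InH, mem_ofPred_eq]; grind
  · refine Or.inr (Or.inr (Or.inl ⟨h.neg, ?_⟩))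
    ext z; simp only [InH, mem_ofPred_eq]; grind
  · refine Or.inr (Or.inr (Or.inr (Or.inr ⟨negS_mk h1, negS_mk h2, ?_, h4, ?_⟩)))
    · rw [← h3, abs_sub_comm]; dsimp only; congr 1; ring
    · ext z; simp only [InSq, mem_ofPred_eq]; grind

theorem packSym_swap (S : Set Plane) (N : ℝ) :
    PackSym S (swapS S) N swapL fun s => (s.2, s.1) where
  sq s := by
    ext z; rw [swapL_image, mem_squareAt, mem_ofPred_eq, mem_squareAt]
    unfold InSq; dsimp only; tauto
  mem s hs := hs
  mem' s hs := ⟨_, hs, rfl⟩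
  isom := Isometry.of_dist_eq fun x y => by
    simp only [swapL_apply, Prod.dist_eq]; exact max_comm _ _
  arm _ _ _ := swap_arm
  arm' s t A h := ⟨_, _, _, swap_arm h, rfl, rfl, by
    rw [swapL_image, swapL_image]; rfl⟩
  inj s t h := by
    simp only [Prod.mk.injEq] at h; exact Prod.ext h.2 h.1
  box K a b hK ha hb := by
    refine ⟨(a.2, a.1), (b.2, b.1), ?_, ?_, ?_, ?_⟩
    · rw [isGLB_prod] at ha ⊢
      simp only [image_image, swapL_apply]
      exact ⟨ha.2, ha.1⟩
    · rw [isLUB_prod] at hb ⊢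
      simp only [image_image, swapL_apply]
      exact ⟨hb.2, hb.1⟩
    · ext z; rw [swapL_image]
      simp only [mem_Icc, Prod.le_def, mem_ofPred_eq]; tauto
    · ext <;> simp [midpoint_eq_smul_add] <;> ring

theorem packSym_neg (S : Set Plane) (N : ℝ) :
    PackSym S (negS S N) N negL fun s => (-s.1 - N, s.2) where
  sq s := by
    ext z; rw [negL_image, mem_squareAt, mem_ofPred_eq, mem_squareAt]
    unfold InSq; dsimp only; grind
  mem s hs := negS_mk hs
  mem' s hs := ⟨_, hs, by ext <;> simp⟩
  isom := Isometry.of_dist_eq fun x y => by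
    simp only [negL_apply, Prod.dist_eq, dist_neg_neg]
  arm _ _ _ := neg_arm
  arm' s t A h := ⟨_, _, _, (by have := neg_arm h; rwa [negS_negS] at this), by ext <;> simp,
    by ext <;> simp, by rw [negL_image, negL_image]; ext z; simp⟩
  inj s t h := by
    simp only [Prod.mk.injEq] at h; exact Prod.ext (by linarith [h.1]) h.2
  box K a b hK ha hb := by
    refine ⟨(-b.1, a.2), (-a.1, b.2), ?_, ?_, ?_, ?_⟩
    · rw [isGLB_prod] at ha ⊢
      rw [isLUB_prod] at hb
      simp only [image_image, negL_apply]
      refine ⟨?_, ha.2⟩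
      have := hb.1.neg
      rwa [← image_neg_eq_neg, image_image] at this
    · rw [isLUB_prod] at hb ⊢
      rw [isGLB_prod] at ha
      simp only [image_image, negL_apply]
      refine ⟨?_, hb.2⟩
      have := ha.1.neg
      rwa [← image_neg_eq_neg, image_image] at this
    · ext z; rw [negL_image]
      simp only [mem_Icc, Prod.le_def, mem_ofPred_eq]; grind
    · ext
      · simp [midpoint_eq_smul_add]; ring
      · simp [midpoint_eq_smul_add]; ring

/-! ### The boundary of a cross -/

namespace Face

variable {A B a b c y z w : Plane} {K : Set Plane}

theorem nonempty (F : Face S N A B K) : K.Nonempty := by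
  rw [Set.nonempty_iff_ne_empty]
  rintro rfl
  have := F.glb.2 (show A + (1, 1) ∈ lowerBounds ∅ by simp)
  have h1 := this.1
  simp at h1
  linarith

theorem lt (F : Face S N A B K) : A.1 < B.1 ∧ A.2 < B.2 := by
  obtain ⟨z, hz⟩ := F.nonempty
  obtain ⟨h1, h2, h3, h4⟩ := ((F.mem z).1 hz).1
  constructor <;> linarith

theorem mem_openSq : z ∈ openSq N c ↔ c.1 < z.1 ∧ z.1 < c.1 + N ∧ c.2 < z.2 ∧ z.2 < c.2 + N := by
  simp only [openSq, mem_prod, mem_Ioo, and_assoc]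

/-- A square which contains a point is determined by any interior point of it. -/
theorem eq_of_openSq (h : SatPack S N) (ha : a ∈ S) (hb : b ∈ S) (h1 : z ∈ openSq N a)
    (h2 : InSq N b z) : a = b := by
  rw [mem_openSq] at h1
  unfold InSq at h2
  have hN := h.pos
  exact h.eq_of_lt ha hb (by linarith) (by linarith) (by linarith) (by linarith)

theorem meets (hz : InBox A B z) (hc : InSq N c z) : Meets N A B c := by
  unfold InBox at hz
  unfold InSq at hc
  unfold Meets
  refine ⟨?_, ?_, ?_, ?_⟩ <;> linarith

/-- Squares which do not contain a point keep a distance from it. -/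
theorem _root_.SatPack.exists_sep (h : SatPack S N) (y : Plane) :
    ∃ ε > 0, ∀ c ∈ S, ¬InSq N c y → ∀ w : Plane, |w.1 - y.1| < ε → |w.2 - y.2| < ε →
      ¬InSq N c w := by
  have hN := h.pos
  have hf := h.finite_box (y.1 - 2 * N) (y.1 + N) (y.2 - 2 * N) (y.2 + N)
  have key : ∀ c ∈ {s | s ∈ S ∧ y.1 - 2 * N ≤ s.1 ∧ s.1 ≤ y.1 + N ∧ y.2 - 2 * N ≤ s.2 ∧
      s.2 ≤ y.2 + N}, ∃ ε > 0, ¬InSq N c y → ∀ w : Plane, |w.1 - y.1| < ε → |w.2 - y.2| < ε →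
      ¬InSq N c w := by
    intro c _
    by_cases hc : InSq N c y
    · exact ⟨1, one_pos, fun e => (e hc).elim⟩
    have hcl : IsClosed (squareAt N c) := isClosed_Icc
    obtain ⟨ε, hε, he⟩ := Metric.isOpen_iff.1 hcl.isOpen_compl y
      (fun e => hc (mem_squareAt.1 e))
    refine ⟨ε, hε, fun _ w h1 h2 hw => he ?_ (mem_squareAt.2 hw)⟩
    rw [Metric.mem_ball, Prod.dist_eq, Real.dist_eq, Real.dist_eq]
    exact max_lt h1 h2
  choose! ε hε he using key
  obtain ⟨δ, hδ, hd⟩ : ∃ δ > 0, ∀ c ∈ {s | s ∈ S ∧ y.1 - 2 * N ≤ s.1 ∧ s.1 ≤ y.1 + N ∧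
      y.2 - 2 * N ≤ s.2 ∧ s.2 ≤ y.2 + N}, δ ≤ ε c := by
    rcases eq_empty_or_nonempty {s | s ∈ S ∧ y.1 - 2 * N ≤ s.1 ∧ s.1 ≤ y.1 + N ∧
      y.2 - 2 * N ≤ s.2 ∧ s.2 ≤ y.2 + N} with e | hne
    · exact ⟨1, one_pos, fun c hc => by rw [e] at hc; exact hc.elim⟩
    · obtain ⟨c, hc, hm⟩ := exists_min_image _ ε hf hne
      exact ⟨ε c, hε c hc, hm⟩
  refine ⟨min δ N, lt_min hδ hN, fun c hc hcy w h1 h2 hw => ?_⟩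
  rw [lt_min_iff, abs_lt] at h1 h2
  have hw' := hw
  obtain ⟨w1, w2, w3, w4⟩ := hw'
  have hcm : c ∈ {s | s ∈ S ∧ y.1 - 2 * N ≤ s.1 ∧ s.1 ≤ y.1 + N ∧ y.2 - 2 * N ≤ s.2 ∧
      s.2 ≤ y.2 + N} := by
    obtain ⟨-, h1⟩ := h1
    obtain ⟨-, h2⟩ := h2
    rw [abs_lt] at h1 h2
    refine ⟨hc, ?_, ?_, ?_, ?_⟩ <;> linarith
  refine he c hcm hcy w ?_ ?_ hw
  · exact (abs_lt.2 h1.1).trans_le (hd c hcm)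
  · exact (abs_lt.2 h2.1).trans_le (hd c hcm)

theorem mem_closure_of_dir (h : SatPack S N) (F : Face S N A B K)
    {d1 d2 : ℝ} (hd1 : d1 = 1 ∨ d1 = -1) (hd2 : d2 = 1 ∨ d2 = -1) {δ : ℝ} (hδ : 0 < δ)
    (hbox : ∀ ε > 0, ε < δ → InBox A B (y.1 + ε * d1, y.2 + ε * d2))
    (hsq : ∀ ε > 0, ε < δ → ∀ c ∈ S, Meets N A B c → InSq N c y →
      ¬InSq N c (y.1 + ε * d1, y.2 + ε * d2)) : y ∈ closure K := by
  obtain ⟨η, hη, he⟩ := h.exists_sep y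
  rw [Metric.mem_closure_iff]
  intro ε hε
  obtain ⟨θ, θ0, θ1⟩ := exists_between (lt_min hδ (lt_min hη hε))
  rw [lt_min_iff, lt_min_iff] at θ1
  have a1 : |θ * d1| = θ := by rcases hd1 with rfl | rfl <;> simp [abs_of_pos θ0]
  have a2 : |θ * d2| = θ := by rcases hd2 with rfl | rfl <;> simp [abs_of_pos θ0]
  have hb := hbox θ θ0 θ1.1
  refine ⟨(y.1 + θ * d1, y.2 + θ * d2), (F.mem _).2 ⟨hb, fun c hc hw => ?_⟩, ?_⟩
  · by_cases hcy : InSq N c y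
    · exact hsq θ θ0 θ1.1 c hc (meets hb hw) hcy hw
    · refine he c hc hcy _ ?_ ?_ hw
      · simp only [add_sub_cancel_left, a1]; exact θ1.2.1
      · simp only [add_sub_cancel_left, a2]; exact θ1.2.1
  · rw [dist_comm, Prod.dist_eq, Real.dist_eq, Real.dist_eq]
    simp only [add_sub_cancel_left, a1, a2, max_self]
    exact θ1.2.2

/-- The closure of a cross: its bounding rectangle without the interiors of the squares. -/
theorem mem_closure (h : SatPack S N) (F : Face S N A B K) : y ∈ closure K ↔
    (A.1 ≤ y.1 ∧ y.1 ≤ B.1 ∧ A.2 ≤ y.2 ∧ y.2 ≤ B.2) ∧ ∀ c ∈ S, y ∉ openSq N c := by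
  have hN := h.pos
  constructor
  · intro hy
    refine ⟨?_, fun c hc hyc => ?_⟩
    · have : IsClosed (Icc A B) := isClosed_Icc
      have := closure_minimal
        (show K ⊆ Icc A B from fun z hz => ⟨F.glb.1 hz, F.lub.1 hz⟩) this hy
      exact ⟨this.1.1, this.2.1, this.1.2, this.2.2⟩
    · have ho : IsOpen (openSq N c) := isOpen_Ioo.prod isOpen_Ioo
      obtain ⟨w, hw, hwK⟩ := mem_closure_iff.1 hy _ ho hyc
      refine ((F.mem w).1 hwK).2 c hc ?_
      rw [mem_openSq] at hw
      exact ⟨hw.1.le, hw.2.1.le, hw.2.2.1.le, hw.2.2.2.le⟩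
  · rintro ⟨⟨y1, y2, y3, y4⟩, hy⟩
    obtain ⟨hl1, hl2⟩ := F.lt
    -- If `y` lies on the boundary of a square which covers a corner, then it is approached from the
    -- opposite diagonal direction, and otherwise from the center.
    by_cases hc : ∃ c ∈ S, Meets N A B c ∧ InSq N c y
    · obtain ⟨c, hc, hm, hcy⟩ := hc
      have hyc := hy c hc
      rw [mem_openSq] at hyc
      have hu : ∀ b ∈ S, Meets N A B b → InSq N b y → b = c := fun b hb hbm hby => by
        by_contra hne
        have := F.disj b hb c hc hbm hm hne
        unfold InSq at hby hcy
        grind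
      obtain ⟨p1, p2⟩ := F.poke c hc hm
      obtain ⟨m1, m2, m3, m4⟩ := hm
      obtain ⟨c1, c2, c3, c4⟩ := id hcy
      rcases p1 with ⟨e1, e2⟩ | ⟨e1, e2⟩ <;> rcases p2 with ⟨e3, e4⟩ | ⟨e3, e4⟩
      · refine F.mem_closure_of_dir h (Or.inl rfl) (Or.inl rfl)
          (δ := min (B.1 - (c.1 + N)) (B.2 - (c.2 + N))) (lt_min (by linarith) (by linarith)) ?_ ?_
        · intro ε h1 h2; rw [lt_min_iff] at h2; unfold InBox; dsimp only
          refine ⟨?_, ?_, ?_, ?_⟩ <;> linarith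
        · intro ε h1 h2 b hb hbm hby hbw; obtain rfl := hu b hb hbm hby; unfold InSq at hbw
          dsimp only at hbw; grind
      · refine F.mem_closure_of_dir h (Or.inl rfl) (Or.inr rfl)
          (δ := min (B.1 - (c.1 + N)) (c.2 - A.2)) (lt_min (by linarith) (by linarith)) ?_ ?_
        · intro ε h1 h2; rw [lt_min_iff] at h2; unfold InBox; dsimp only
          refine ⟨?_, ?_, ?_, ?_⟩ <;> linarith
        · intro ε h1 h2 b hb hbm hby hbw; obtain rfl := hu b hb hbm hby; unfold InSq at hbw
          dsimp only at hbw; grind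
      · refine F.mem_closure_of_dir h (Or.inr rfl) (Or.inl rfl)
          (δ := min (c.1 - A.1) (B.2 - (c.2 + N))) (lt_min (by linarith) (by linarith)) ?_ ?_
        · intro ε h1 h2; rw [lt_min_iff] at h2; unfold InBox; dsimp only
          refine ⟨?_, ?_, ?_, ?_⟩ <;> linarith
        · intro ε h1 h2 b hb hbm hby hbw; obtain rfl := hu b hb hbm hby; unfold InSq at hbw
          dsimp only at hbw; grind
      · refine F.mem_closure_of_dir h (Or.inr rfl) (Or.inr rfl)
          (δ := min (c.1 - A.1) (c.2 - A.2)) (lt_min (by linarith) (by linarith)) ?_ ?_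
        · intro ε h1 h2; rw [lt_min_iff] at h2; unfold InBox; dsimp only
          refine ⟨?_, ?_, ?_, ?_⟩ <;> linarith
        · intro ε h1 h2 b hb hbm hby hbw; obtain rfl := hu b hb hbm hby; unfold InSq at hbw
          dsimp only at hbw; grind
    · push Not at hc
      have key : ∀ {u v w : ℝ}, u < v → u ≤ w → w ≤ v → ∃ d : ℝ, (d = 1 ∨ d = -1) ∧
          ∀ ε > 0, ε < (v - u) / 2 → u < w + ε * d ∧ w + ε * d < v := by
        intro u v w h1 h2 h3
        rcases le_or_gt w ((u + v) / 2) with e | e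
        · exact ⟨1, Or.inl rfl, fun ε h4 h5 => ⟨by linarith, by linarith⟩⟩
        · exact ⟨-1, Or.inr rfl, fun ε h4 h5 => ⟨by linarith, by linarith⟩⟩
      obtain ⟨d1, hd1, k1⟩ := key hl1 y1 y2
      obtain ⟨d2, hd2, k2⟩ := key hl2 y3 y4
      refine F.mem_closure_of_dir h hd1 hd2 (δ := min ((B.1 - A.1) / 2) ((B.2 - A.2) / 2))
        (lt_min (by linarith) (by linarith)) (fun ε h1 h2 => ?_)
        fun ε _ _ c hcS hm hcy => (hc c hcS hm hcy).elim
      rw [lt_min_iff] at h2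
      obtain ⟨z1, z2⟩ := k1 ε h1 h2.1
      obtain ⟨z3, z4⟩ := k2 ε h1 h2.2
      exact ⟨z1, z2, z3, z4⟩

/-- A square which touches the bounding rectangle touches the closure of the cross. -/
theorem exists_touch (h : SatPack S N) (F : Face S N A B K) (hc : c ∈ S) (hy : InSq N c y)
    (y1 : A.1 ≤ y.1) (y2 : y.1 ≤ B.1) (y3 : A.2 ≤ y.2) (y4 : y.2 ≤ B.2) :
    ∃ w ∈ closure K, InSq N c w := by
  have hN := h.pos
  by_cases hyo : ∀ b ∈ S, y ∉ openSq N b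
  · exact ⟨y, (F.mem_closure h).2 ⟨⟨y1, y2, y3, y4⟩, hyo⟩, hy⟩
  push Not at hyo
  obtain ⟨b, hb, hyb⟩ := hyo
  obtain rfl := eq_of_openSq h hb hc hyb hy
  rw [mem_openSq] at hyb
  obtain ⟨hl1, hl2⟩ := F.lt
  have hm : Meets N A B b := ⟨by linarith, by linarith, by linarith, by linarith⟩
  have aux : ∀ w : Plane, A.1 ≤ w.1 → w.1 ≤ B.1 → A.2 ≤ w.2 → w.2 ≤ B.2 → InSq N b w →
      w ∉ openSq N b → ∃ w ∈ closure K, InSq N b w := fun w w1 w2 w3 w4 hw hwo =>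
    ⟨w, (F.mem_closure h).2 ⟨⟨w1, w2, w3, w4⟩, fun c hc hwc => by
      obtain rfl := eq_of_openSq h hc hb hwc hw; exact hwo hwc⟩, hw⟩
  obtain ⟨p1, p2⟩ := F.poke b hb hm
  obtain ⟨m1, m2, m3, m4⟩ := hm
  rcases p1 with ⟨e1, e2⟩ | ⟨e1, e2⟩ <;> rcases p2 with ⟨e3, e4⟩ | ⟨e3, e4⟩
  · refine aux (b.1 + N, b.2 + N) ?_ ?_ ?_ ?_ ⟨?_, ?_, ?_, ?_⟩ fun hw => ?_ <;>
      first | (rw [mem_openSq] at hw; dsimp only at hw; linarith) | (dsimp only; linarith)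
  · refine aux (b.1 + N, b.2) ?_ ?_ ?_ ?_ ⟨?_, ?_, ?_, ?_⟩ fun hw => ?_ <;>
      first | (rw [mem_openSq] at hw; dsimp only at hw; linarith) | (dsimp only; linarith)
  · refine aux (b.1, b.2 + N) ?_ ?_ ?_ ?_ ⟨?_, ?_, ?_, ?_⟩ fun hw => ?_ <;>
      first | (rw [mem_openSq] at hw; dsimp only at hw; linarith) | (dsimp only; linarith)
  · refine aux (b.1, b.2) ?_ ?_ ?_ ?_ ⟨?_, ?_, ?_, ?_⟩ fun hw => ?_ <;>
      first | (rw [mem_openSq] at hw; dsimp only at hw; linarith) | (dsimp only; linarith)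

/-- The interior of a prolonged vertical arm does not meet the interior of the bounding rectangle
at the level of the arm. -/
theorem varm_empty (h : SatPack S N) (F : Face S N A B K) (e : VArm S N p q) (hz : InBox A B z)
    (z1 : p.1 < z.1) (z2 : q.1 < z.1) (z3 : z.1 < p.1 + N) (z4 : z.1 < q.1 + N)
    (z5 : p.2 + N < z.2) (z6 : z.2 < q.2) : False := by
  have hN := h.pos
  by_cases hz' : ∀ c ∈ S, ¬InSq N c z
  · exact (F.free z ((F.mem z).2 ⟨hz, hz'⟩)).va _ _ e
      ⟨z1.le, z2.le, z3.le, z4.le, z5.le, z6.le⟩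
  push Not at hz'
  obtain ⟨c, hc, hcz⟩ := hz'
  unfold InSq at hcz
  have d := h.varm_disj e hc (by rintro rfl; linarith) (by rintro rfl; linarith)
  rw [le_max_iff, min_add_le] at d
  grind

/-- Interval version of `varm_empty`. -/
theorem varm_sep (h : SatPack S N) (F : Face S N A B K) (e : VArm S N p q) :
    p.1 + N ≤ A.1 ∨ q.1 + N ≤ A.1 ∨ B.1 ≤ p.1 ∨ B.1 ≤ q.1 ∨ q.2 ≤ A.2 ∨ B.2 ≤ p.2 + N ∨
      q.2 = p.2 + N := by
  have hN := h.pos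
  by_contra! hc
  obtain ⟨c1, c2, c3, c4, c5, c6, c7⟩ := hc
  obtain ⟨e0, e1, e2⟩ := id e.ab
  obtain ⟨hl1, hl2⟩ := F.lt
  have e0' := lt_of_le_of_ne e0 c7.symm
  obtain ⟨x, x1, x2⟩ : ∃ x, max A.1 (max p.1 q.1) < x ∧ x < min B.1 (min (p.1 + N) (q.1 + N)) :=
    exists_between (by
      simp only [max_lt_iff, lt_min_iff]
      refine ⟨⟨?_, ?_, ?_⟩, ⟨?_, ?_, ?_⟩, ?_, ?_, ?_⟩ <;> linarith)
  obtain ⟨y, y1, y2⟩ : ∃ y, max A.2 (p.2 + N) < y ∧ y < min B.2 q.2 :=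
    exists_between (by
      simp only [max_lt_iff, lt_min_iff]
      refine ⟨⟨?_, ?_⟩, ?_, ?_⟩ <;> linarith)
  simp only [max_lt_iff, lt_min_iff] at x1 x2 y1 y2
  exact F.varm_empty h e (z := (x, y)) ⟨x1.1, x2.1, y1.1, y2.1⟩ x1.2.1 x1.2.2 x2.2.1 x2.2.2
    y1.2 y2.2

theorem harm_sep (h : SatPack S N) (F : Face S N A B K) (e : HArm S N p q) :
    p.2 + N ≤ A.2 ∨ q.2 + N ≤ A.2 ∨ B.2 ≤ p.2 ∨ B.2 ≤ q.2 ∨ q.1 ≤ A.1 ∨ B.1 ≤ p.1 + N ∨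
      q.1 = p.1 + N :=
  F.swap.varm_sep h.swap e.swap

/-- No square touches the left side of the bounding rectangle between the levels of its corners:
its arm to the right would run into the cross. -/
theorem not_flush (h : SatPack S N) (F : Face S N A B K) (ha : a ∈ S) (h1 : a.1 + N = A.1)
    (h2 : A.2 ≤ a.2) (h3 : a.2 + N ≤ B.2) : False := by
  have hN := h.pos
  obtain ⟨t, ht, ht1, -, ht2⟩ := h.exists_right ha
  have e : HArm S N a t := ⟨ha, ht, ht1, Or.inl ht2⟩
  obtain ⟨e0, e1, e2⟩ := id ht1
  obtain ⟨hl1, hl2⟩ := F.lt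
  rcases F.harm_sep h e with d | d | d | d | d | d | d <;> try linarith
  all_goals
    have hm : Meets N A B t := ⟨by linarith, by linarith, by linarith, by linarith⟩
    obtain ⟨p1, p2⟩ := F.poke t ht hm
    rcases p1 with p1 | p1 <;> linarith

end Face

/-! ### Exit points and the sides of a cross -/

namespace Face

variable {A B a b c y z w : Plane} {K : Set Plane}

/-- An exit point of the cross, given by an arm of the packing. -/
abbrev Exit (S : Set Plane) (N : ℝ) (K : Set Plane) (e : Plane) : Prop := e ∈ allExitPoints S N K

theorem exit_of_singleton (hs : s ∈ S) {D : Set Plane} (hD : IsArm S N s t D)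
    (he : D ∩ closure K = {y}) : Exit S N K y :=
  ⟨s, hs, t, D, y, y, hD, by rw [segment_same, he], by simp⟩

theorem exit_of_touch_above (h : SatPack S N) (F : Face S N A B K) (ha : a ∈ S) (hb : b ∈ S)
    (y1 : A.1 ≤ y.1) (y2 : y.1 ≤ B.1) (y3 : A.2 ≤ y.2) (y4 : y.2 ≤ B.2) (hya : InSq N a y)
    (hyb : InSq N b y) (hyK : y ∈ closure K) (hab : a.2 + N = b.2) (h1 : a.1 < b.1 + N)
    (h2 : b.1 < a.1 + N) : Exit S N K y := by
  have hN := h.pos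
  have e : VArm S N a b := ⟨ha, hb, ⟨hab.le, h1, h2⟩, Or.inl fun u _ hu => hab ▸ hu.1⟩
  refine exit_of_singleton ha (isArm_iff.2 (Or.inl ⟨e, rfl⟩)) ?_
  unfold InSq at hya hyb
  refine Subset.antisymm ?_ ?_
  · rintro w ⟨⟨w1, w2, w3, w4, w5, w6⟩, hw⟩
    obtain ⟨⟨k1, k2, k3, k4⟩, -⟩ := (F.mem_closure h).1 hw
    have hw2 : w.2 = y.2 := by linarith
    refine Prod.ext ?_ hw2
    by_contra hne
    obtain ⟨hl1, hl2⟩ := F.lt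
    -- Both squares would stick out into the bounding rectangle between the two points.
    have ma : A.2 < y.2 → Meets N A B a := fun _ => by
      rcases lt_or_gt_of_ne hne with g | g <;>
      exact ⟨by linarith, by linarith, by linarith, by linarith⟩
    have mb : y.2 < B.2 → Meets N A B b := fun _ => by
      rcases lt_or_gt_of_ne hne with g | g <;>
      exact ⟨by linarith, by linarith, by linarith, by linarith⟩
    rcases y3.lt_or_eq with g | g <;> rcases y4.lt_or_eq with g' | g'
    · have := F.disj a ha b hb (ma g) (mb g') (h.varm_ne e)
      grind
    · have := F.poke a ha (ma g); grind
    · have := F.poke b hb (mb g'); grind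
    · linarith
  · rintro w rfl
    exact ⟨⟨by linarith, by linarith, by linarith, by linarith, by linarith, by linarith⟩, hyK⟩

theorem exit_of_corner (h : SatPack S N) (ha : a ∈ S) (hb : b ∈ S)
    (hya : InSq N a y) (hyb : InSq N b y) (hyK : y ∈ closure K) (h1 : |b.1 - a.1| = N)
    (h2 : |b.2 - a.2| = N) : Exit S N K y := by
  have hN := h.pos
  refine exit_of_singleton ha (isArm_iff.2 (Or.inr (Or.inr (Or.inr (Or.inr
    ⟨ha, hb, h1, h2, rfl⟩))))) ?_
  unfold InSq at hya hyb
  rw [abs_eq hN.le] at h1 h2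
  refine Subset.antisymm ?_ ?_
  · rintro w ⟨⟨hwa, hwb⟩, -⟩
    unfold InSq at hwa hwb
    refine Prod.ext ?_ ?_
    · rcases h1 with h1 | h1 <;> linarith
    · rcases h2 with h2 | h2 <;> linarith
  · rintro w rfl
    exact ⟨⟨hya, hyb⟩, hyK⟩

theorem exit_swap :
    Exit (swapS S) N {z | (z.2, z.1) ∈ K} (y.2, y.1) ↔ Exit S N K y := by
  have := (packSym_swap S N).allExit_iff (K := K) (e := y)
  rwa [swapL_image] at this

theorem exit_neg :
    Exit (negS S N) N {z | (-z.1, z.2) ∈ K} (-y.1, y.2) ↔ Exit S N K y := by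
  have := (packSym_neg S N).allExit_iff (K := K) (e := y)
  rwa [negL_image] at this

/-- A point of the bounding rectangle in two squares is an exit point. -/
theorem exit_of_two (h : SatPack S N) (F : Face S N A B K) (ha : a ∈ S) (hb : b ∈ S)
    (hab : a ≠ b) (y1 : A.1 ≤ y.1) (y2 : y.1 ≤ B.1) (y3 : A.2 ≤ y.2) (y4 : y.2 ≤ B.2)
    (hya : InSq N a y) (hyb : InSq N b y) : Exit S N K y := by
  have hN := h.pos
  have hyK : y ∈ closure K := (F.mem_closure h).2 ⟨⟨y1, y2, y3, y4⟩, fun c hc hyc =>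
    hab ((eq_of_openSq h hc ha hyc hya).symm.trans (eq_of_openSq h hc hb hyc hyb))⟩
  have hyK' : (y.2, y.1) ∈ closure {z : Plane | (z.2, z.1) ∈ K} := by
    rw [← swapL_image, ← PackSym.image_clos]; exact ⟨y, hyK, rfl⟩
  have hya' := hya.swap
  have hyb' := hyb.swap
  unfold InSq at hya hyb
  have hs := h.sep a ha b hb hab
  by_cases d1 : a.2 + N = b.2 ∧ a.1 < b.1 + N ∧ b.1 < a.1 + N
  · exact F.exit_of_touch_above h ha hb y1 y2 y3 y4 hya hyb hyK d1.1 d1.2.1 d1.2.2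
  by_cases d2 : b.2 + N = a.2 ∧ a.1 < b.1 + N ∧ b.1 < a.1 + N
  · exact F.exit_of_touch_above h hb ha y1 y2 y3 y4 hyb hya hyK d2.1 d2.2.2 d2.2.1
  by_cases d3 : a.1 + N = b.1 ∧ a.2 < b.2 + N ∧ b.2 < a.2 + N
  · rw [← exit_swap]
    exact F.swap.exit_of_touch_above h.swap (a := (a.2, a.1)) (b := (b.2, b.1)) ha hb y3 y4 y1 y2
      hya' hyb' hyK' d3.1 d3.2.1 d3.2.2
  by_cases d4 : b.1 + N = a.1 ∧ a.2 < b.2 + N ∧ b.2 < a.2 + N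
  · rw [← exit_swap]
    exact F.swap.exit_of_touch_above h.swap (a := (b.2, b.1)) (b := (a.2, a.1)) hb ha y3 y4 y1 y2
      hyb' hya' hyK' d4.1 d4.2.2 d4.2.1
  refine exit_of_corner h ha hb hya hyb hyK ?_ ?_
  · rw [abs_eq hN.le]; grind
  · rw [abs_eq hN.le]; grind

/-- The lower left corner of the bounding rectangle does not lie in a vertical arm outside of the
squares: otherwise the arm which limits the bottom side would cross this arm. -/
theorem corner_varm (h : SatPack S N) (F : Face S N A B K) (hsq : ∀ c ∈ S, ¬InSq N c A)
    (e : VArm S N p q) : ¬InV N p q A := by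
  rintro ⟨k1, k2, k3, k4, k5, k6⟩
  have hN := h.pos
  obtain ⟨hl1, hl2⟩ := F.lt
  obtain ⟨e0, e1, e2⟩ := id e.ab
  have np := hsq p e.ms
  have nq := hsq q e.mt
  unfold InSq at np nq
  have l5 : p.2 + N < A.2 := by grind
  have l6 : A.2 < q.2 := by grind
  obtain ⟨ε, hε, he⟩ := h.exists_sep A
  -- The arm ends at the left side of the rectangle.
  have hend : p.1 + N = A.1 ∨ q.1 + N = A.1 := by
    have := F.varm_sep h e
    grind
  obtain ⟨δ, δ0, δ1⟩ := exists_between (lt_min hε (sub_pos.2 hl1))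
  rw [lt_min_iff] at δ1
  have hout : ∀ x, |x - A.1| < ε → ∀ c ∈ S, ¬InSq N c (x, A.2) := fun x hx c hc =>
    he c hc (hsq c hc) (x, A.2) hx (by simpa using hε)
  have hx0 : |A.1 + δ - A.1| < ε := by rw [add_sub_cancel_left, abs_of_pos δ0]; exact δ1.1
  have hnf : ¬FreePt S N (A.1 + δ, A.2) := fun hf => by
    have := ((F.mem _).1 (F.wall (A.1 + δ, A.2) (by dsimp only; linarith) (by dsimp only; linarith)
      le_rfl hl2.le hf)).1
    unfold InBox at this
    dsimp only at this
    linarith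
  -- The points of the bottom side next to the corner lie in a horizontal arm.
  have : ∃ c d, HArm S N c d ∧ InH N c d (A.1 + δ, A.2) := by
    by_contra! hc
    refine hnf ⟨hout _ hx0, fun c d e' he' => ?_, hc⟩
    obtain ⟨j1, j2, j3, j4, j5, j6⟩ := he'
    have nc := hout _ hx0 c e'.ms
    have nd := hout _ hx0 d e'.mt
    have := F.varm_sep h e'
    unfold InSq at nc nd
    dsimp only at *
    grind
  obtain ⟨c, d, e', j1, j2, j3, j4, j5, j6⟩ := this
  dsimp only at j1 j2 j3 j4 j5 j6
  have hc1 : c.1 + N < A.1 := by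
    by_contra! hc
    refine hout (c.1 + N) ?_ c e'.ms ⟨by dsimp only; linarith, by dsimp only; linarith, j1, j3⟩
    rw [abs_of_nonneg (by linarith)]; linarith
  have hend' : c.2 + N = A.2 ∨ d.2 + N = A.2 := by
    have := F.harm_sep h e'
    grind
  obtain ⟨f0, f1, f2⟩ := id e'.ab
  obtain ⟨x, x1, x2⟩ : ∃ x, max (c.1 + N) (max p.1 q.1) < x ∧ x < A.1 := exists_between (by
    simp only [max_lt_iff]
    refine ⟨?_, ?_, ?_⟩ <;> grind)
  obtain ⟨y, y1, y2⟩ : ∃ y, max (p.2 + N) (max c.2 d.2) < y ∧ y < A.2 := exists_between (by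
    simp only [max_lt_iff]
    refine ⟨?_, ?_, ?_⟩ <;> grind)
  simp only [max_lt_iff] at x1 y1
  exact h.varm_harm e e' x1.2.1 x1.2.2 (by linarith) (by linarith) y1.1.le (by linarith)
    y1.2.1 y1.2.2 (by linarith) (by linarith) x1.1.le (by linarith)

theorem exists_corner (h : SatPack S N) (F : Face S N A B K) : ∃ c ∈ S, InSq N c A := by
  by_contra! hc
  obtain ⟨hl1, hl2⟩ := F.lt
  have hf : FreePt S N A := ⟨hc, fun p q e => F.corner_varm h hc e, fun p q e he =>
    F.swap.corner_varm h.swap (fun c hcS hcz => hc _ hcS hcz.swap) e.swap he⟩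
  have := ((F.mem _).1 (F.wall _ le_rfl hl1.le le_rfl hl2.le hf)).1
  exact lt_irrefl _ this.1

/-- The square at `l` (the square at `m`) contains the lower (the upper) end of the left side of
the bounding rectangle; either they coincide, or the points of the side between them lie in no
square, and the middle point of the gap is an exit point. -/
structure LeftSide (S : Set Plane) (N : ℝ) (A B : Plane) (K : Set Plane) (l m : Plane) :
    Prop where
  hl : l ∈ S
  hm : m ∈ S
  inl : InSq N l A
  inm : InSq N m (A.1, B.2)
  maxl : ∀ b ∈ S, InSq N b A → b.2 < l.2 ∨ (b.2 = l.2 ∧ l.1 ≤ b.1)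
  minm : ∀ b ∈ S, InSq N b (A.1, B.2) → m.2 < b.2 ∨ (b.2 = m.2 ∧ m.1 ≤ b.1)
  le : l ≠ m → l.2 + N ≤ m.2
  gap : l ≠ m → ∀ y, l.2 + N < y → y < m.2 → ∀ b ∈ S, ¬InSq N b (A.1, y)
  exit : l ≠ m → Exit S N K (A.1, (l.2 + N + m.2) / 2)

theorem _root_.Face.flip (F : Face S N A B K) :
    Face (flipS S N) N (A.1, -B.2) (B.1, -A.2) {z | (z.1, -z.2) ∈ K} := F.swap.neg.swap

theorem _root_.InSq.flip (hc : InSq N c z) : InSq N (c.1, -c.2 - N) (z.1, -z.2) := by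
  unfold InSq at *; dsimp only; grind

theorem exists_lower (h : SatPack S N) (F : Face S N A B K) :
    ∃ l ∈ S, InSq N l A ∧ ∀ b ∈ S, InSq N b A → b.2 < l.2 ∨ (b.2 = l.2 ∧ l.1 ≤ b.1) := by
  have hN := h.pos
  have hf : {b | b ∈ S ∧ InSq N b A}.Finite :=
    (h.finite_box (A.1 - N) A.1 (A.2 - N) A.2).subset fun b hb =>
      ⟨hb.1, by linarith [hb.2.2.1], hb.2.1, by linarith [hb.2.2.2.2], hb.2.2.2.1⟩
  obtain ⟨l, hl, hmax⟩ := exists_max_image _ (fun b : Plane => toLex (b.2, -b.1)) hf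
    (F.exists_corner h)
  refine ⟨l, hl.1, hl.2, fun b hb hbA => ?_⟩
  have := hmax b ⟨hb, hbA⟩
  rw [Prod.Lex.toLex_le_toLex] at this
  dsimp only at this
  grind

/-- Every cross has a left side of this form. -/
theorem exists_leftSide (h : SatPack S N) (F : Face S N A B K) : ∃ l m, LeftSide S N A B K l m := by
  have hN := h.pos
  obtain ⟨l, hl, inl, maxl⟩ := F.exists_lower h
  obtain ⟨m', hm', inm', minm'⟩ := F.flip.exists_lower h.flip
  obtain ⟨m, hm, inm, minm⟩ : ∃ m ∈ S, InSq N m (A.1, B.2) ∧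
      ∀ b ∈ S, InSq N b (A.1, B.2) → m.2 < b.2 ∨ (b.2 = m.2 ∧ m.1 ≤ b.1) := by
    refine ⟨(m'.1, -m'.2 - N), ?_, ?_, fun b hb hbB => ?_⟩
    · have := flipS_mk (N := N) hm'
      rwa [flipS_flipS] at this
    · simpa using inm'.flip
    · have := minm' (b.1, -b.2 - N) (flipS_mk hb) hbB.flip
      dsimp only at this ⊢
      grind
  obtain ⟨hl1, hl2⟩ := F.lt
  have pl := F.poke l hl
  have pm := F.poke m hm
  have ml := maxl m hm
  have lm := minm l hl
  have le : l ≠ m → l.2 + N ≤ m.2 := fun hne => by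
    have sp := h.sep l hl m hm hne
    unfold InSq at *
    unfold Meets at pl pm
    dsimp only at *
    grind
  have gap : l ≠ m → ∀ y, l.2 + N < y → y < m.2 → ∀ b ∈ S, ¬InSq N b (A.1, y) := by
    intro hne y y1 y2 b hb hby
    have pb := F.poke b hb
    have mb := minm b hb
    have lb := maxl b hb
    have fb := F.not_flush h hb
    have := le hne
    unfold InSq at *
    unfold Meets at pb
    dsimp only at *
    grind
  -- The points between `l` and `m` are not free, and they lie in no horizontal arm, so that a
  -- vertical arm covers the gap. Its intersection with the closure of the cross is the gap, and its
  -- middle point is an exit point.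
  refine ⟨l, m, hl, hm, inl, inm, maxl, minm, le, gap, fun hne => ?_⟩
  have hle := le hne
  have bl1 : A.2 ≤ l.2 + N := inl.2.2.2
  have bm1 : m.2 ≤ B.2 := inm.2.2.1
  rcases hle.lt_or_eq with hlt | heq
  · obtain ⟨y, y1, y2⟩ := exists_between hlt
    have gy := gap hne y y1 y2
    have hnf : ¬FreePt S N (A.1, y) := fun hf => by
      have := ((F.mem _).1 (F.wall (A.1, y) le_rfl hl1.le
        (by dsimp only; linarith) (by dsimp only; linarith) hf)).1
      exact lt_irrefl _ this.1
    obtain ⟨v, w, e, he⟩ : ∃ v w, VArm S N v w ∧ InV N v w (A.1, y) := by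
      by_contra! hc
      refine hnf ⟨gy, hc, fun c d e he => ?_⟩
      have := F.harm_sep h e
      have nc := gy c e.ms
      have nd := gy d e.mt
      have sd := F.poke d e.mt
      unfold InSq at nc nd
      unfold InH at he
      unfold Meets at sd
      dsimp only at *
      have e3 := e.ab
      unfold Rgt at e3
      grind
    have nv := gy v e.ms
    have nw := gy w e.mt
    have hsp := F.varm_sep h e
    obtain ⟨e0, e1, e2⟩ := id e.ab
    obtain ⟨k1, k2, k3, k4, k5, k6⟩ := he
    dsimp only at k1 k2 k3 k4 k5 k6
    unfold InSq at nv nw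
    dsimp only at nv nw
    have hend : v.1 + N = A.1 ∨ w.1 + N = A.1 := by grind
    have gv : v.2 + N ≤ l.2 + N := by
      by_contra! hc
      exact gap hne (v.2 + N) hc (by linarith) v e.ms
        ⟨k1, k3, by dsimp only; linarith, by dsimp only; linarith⟩
    have gw : m.2 ≤ w.2 := by
      by_contra! hc
      exact gap hne w.2 (by linarith) hc w e.mt
        ⟨k2, k4, by dsimp only; linarith, by dsimp only; linarith⟩
    refine ⟨v, e.ms, w, _, (A.1, l.2 + N), (A.1, m.2), isArm_iff.2 (Or.inl ⟨e, rfl⟩), ?_, ?_⟩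
    · ext x
      have hseg : x ∈ segment ℝ ((A.1, l.2 + N) : Plane) (A.1, m.2) ↔
          x.1 = A.1 ∧ l.2 + N ≤ x.2 ∧ x.2 ≤ m.2 := by
        rw [← Prod.image_mk_segment_right, segment_eq_Icc hle]
        constructor
        · rintro ⟨t, ht, rfl⟩; exact ⟨rfl, ht.1, ht.2⟩
        · rintro ⟨h1, h2⟩; exact ⟨x.2, h2, by rw [← h1]⟩
      rw [hseg]
      constructor
      · rintro ⟨⟨j1, j2, j3, j4, j5, j6⟩, hx⟩
        obtain ⟨⟨i1, i2, i3, i4⟩, -⟩ := (F.mem_closure h).1 hx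
        have dl := h.varm_disj e hl
        have dm := h.varm_disj e hm
        rw [le_max_iff, min_add_le] at dl dm
        unfold InSq at inl inm
        unfold Meets at pl pm
        dsimp only at *
        grind
      · rintro ⟨j1, j2, j3⟩
        refine ⟨⟨by linarith, by linarith, by linarith, by linarith, by linarith, by linarith⟩,
          (F.mem_closure h).2 ⟨⟨j1.ge, by linarith, by linarith, by linarith⟩, fun b hb hxb => ?_⟩⟩
        rw [mem_openSq] at hxb
        obtain ⟨y', z1, z2⟩ : ∃ y', max b.2 (l.2 + N) < y' ∧ y' < min (b.2 + N) m.2 :=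
          exists_between (by
            rw [max_lt_iff, lt_min_iff, lt_min_iff]
            refine ⟨⟨?_, ?_⟩, ?_, ?_⟩ <;> linarith)
        rw [max_lt_iff] at z1
        rw [lt_min_iff] at z2
        exact gap hne y' z1.2 z2.2 b hb ⟨by dsimp only; linarith, by dsimp only; linarith,
          z1.1.le, z2.1.le⟩
    · ext
      · simp [midpoint_eq_smul_add]; ring
      · simp [midpoint_eq_smul_add]; ring
  · refine F.exit_of_two h hl hm hne le_rfl hl1.le (by dsimp only; linarith)
      (by dsimp only; linarith) ?_ ?_
    · unfold InSq at *; dsimp only at *; refine ⟨?_, ?_, ?_, ?_⟩ <;> linarith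
    · unfold InSq at *; dsimp only at *; refine ⟨?_, ?_, ?_, ?_⟩ <;> linarith

end Face

/-! ### The owners of the points of the boundary of a cross -/

namespace Face

/-- A side of the bounding rectangle of a cross: `ι` parametrizes the line of the side by `ℝ`, the
ends of the side are `ι lo` and `ι hi`, and `π c` is the coordinate of the square at `c` in the
direction of this line. The squares at `l` and `m` contain the ends. Either they coincide, or the
part of the side between them meets no square and its middle point is an exit point. -/
structure Side (S : Set Plane) (N : ℝ) (K : Set Plane) (ι : ℝ → Plane) (π : Plane → ℝ)
    (lo hi : ℝ) (l m : Plane) : Prop where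
  hl : l ∈ S
  hm : m ∈ S
  coord : ∃ Q : Plane → Prop, ∀ c y, InSq N c (ι y) ↔ Q c ∧ π c ≤ y ∧ y ≤ π c + N
  inl : InSq N l (ι lo)
  inm : InSq N m (ι hi)
  maxl : ∀ b ∈ S, InSq N b (ι lo) → π b ≤ π l
  minm : ∀ b ∈ S, InSq N b (ι hi) → π m ≤ π b
  le : l ≠ m → π l + N ≤ π m
  gap : l ≠ m → ∀ y, π l + N < y → y < π m → ∀ b ∈ S, ¬InSq N b (ι y)
  exit : l ≠ m → Exit S N K (ι ((π l + N + π m) / 2))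

variable {A B a b c c' y z w l m : Plane} {K : Set Plane} {ι : ℝ → Plane} {π : Plane → ℝ}
  {lo hi v : ℝ}

/-- The point with coordinate `v` on a side is attributed to `c`, the square at the nearest end of
the side, where the gap between the squares at the ends is divided at its middle point. -/
def SideOwn (N : ℝ) (π : Plane → ℝ) (l m c : Plane) (v : ℝ) : Prop :=
  (c = l ∧ (l = m ∨ v ≤ (π l + N + π m) / 2)) ∨ (c = m ∧ (l = m ∨ (π l + N + π m) / 2 ≤ v))

theorem exists_sideOwn (N : ℝ) (π : Plane → ℝ) (l m : Plane) (v : ℝ) : ∃ c, SideOwn N π l m c v := by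
  rcases le_total v ((π l + N + π m) / 2) with e | e
  · exact ⟨l, Or.inl ⟨rfl, Or.inr e⟩⟩
  · exact ⟨m, Or.inr ⟨rfl, Or.inr e⟩⟩

theorem isClosed_sideOwn {f : Plane → ℝ} (hf : Continuous f) :
    IsClosed {y | SideOwn N π l m c (f y)} := by
  have k : ∀ (P Q : Prop) {g g' : Plane → ℝ}, Continuous g → Continuous g' →
      IsClosed {y | P ∧ (Q ∨ g y ≤ g' y)} := fun P Q g g' hg hg' => by
    by_cases hP : P <;> by_cases hQ : Q <;> simp [hP, hQ, isClosed_le hg hg']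
  exact (k _ _ hf continuous_const).union (k _ _ continuous_const hf)

namespace Side

theorem own_mem (d : Side S N K ι π lo hi l m) (o : SideOwn N π l m c v) : c = l ∨ c = m := by
  rcases o with ⟨rfl, -⟩ | ⟨rfl, -⟩ <;> simp

theorem own_lo (d : Side S N K ι π lo hi l m) (hlt : lo ≤ hi) (o : SideOwn N π l m c lo) :
    InSq N c (ι lo) := by
  obtain ⟨Q, hQ⟩ := d.coord
  have h1 := (hQ _ _).1 d.inl
  have h2 := (hQ _ _).1 d.inm
  rw [hQ]
  have := d.le
  unfold SideOwn at o
  grind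

theorem own_hi (d : Side S N K ι π lo hi l m) (hlt : lo ≤ hi) (o : SideOwn N π l m c hi) :
    InSq N c (ι hi) := by
  obtain ⟨Q, hQ⟩ := d.coord
  have h1 := (hQ _ _).1 d.inl
  have h2 := (hQ _ _).1 d.inm
  rw [hQ]
  have := d.le
  unfold SideOwn at o
  grind

theorem exit_of_own (d : Side S N K ι π lo hi l m) (o : SideOwn N π l m c v)
    (o' : SideOwn N π l m c' v) (hne : c ≠ c') : Exit S N K (ι v) := by
  have hlm : l ≠ m := by unfold SideOwn at o o'; grind
  have hv : v = (π l + N + π m) / 2 := by unfold SideOwn at o o'; grind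
  rw [hv]
  exact d.exit hlm

theorem own_inSq (d : Side S N K ι π lo hi l m) (o : SideOwn N π l m c v) (h1 : lo ≤ v)
    (h2 : v ≤ hi) (ha : a ∈ S) (hav : InSq N a (ι v)) : InSq N c (ι v) := by
  obtain ⟨Q, hQ⟩ := d.coord
  have e1 := (hQ _ _).1 d.inl
  have e2 := (hQ _ _).1 d.inm
  have e4 := d.le
  by_cases hlm : l = m
  · subst hlm
    unfold SideOwn at o
    rw [hQ]
    grind
  · have e3 := fun h1 h2 => d.gap hlm v h1 h2 a ha hav
    rw [hQ]
    unfold SideOwn at o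
    grind

/-- The owner of a point of a side reaches half of the way to the end of the side behind it. -/
theorem own_coord (d : Side S N K ι π lo hi l m) (o : SideOwn N π l m c v) (h1 : lo ≤ v)
    (h2 : v ≤ hi) : (π c ≤ v ∧ 2 * v - hi ≤ π c + N) ∨ (v ≤ π c + N ∧ π c ≤ 2 * v - lo) := by
  obtain ⟨Q, hQ⟩ := d.coord
  have e1 := (hQ _ _).1 d.inl
  have e2 := (hQ _ _).1 d.inm
  have e4 := d.le
  unfold SideOwn at o
  grind

end Side

theorem LeftSide.side (d : LeftSide S N A B K l m) :
    Side S N K (fun y => (A.1, y)) Prod.snd A.2 B.2 l m where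
  hl := d.hl
  hm := d.hm
  coord := ⟨fun c => c.1 ≤ A.1 ∧ A.1 ≤ c.1 + N, fun c y => by unfold InSq; dsimp only; tauto⟩
  inl := d.inl
  inm := d.inm
  maxl b hb hbA := by have := d.maxl b hb hbA; grind
  minm b hb hbA := by have := d.minm b hb hbA; grind
  le := d.le
  gap := d.gap
  exit := d.exit

theorem exists_rightSide (h : SatPack S N) (F : Face S N A B K) :
    ∃ l m, Side S N K (fun y => (B.1, y)) Prod.snd A.2 B.2 l m := by
  obtain ⟨l, m, d⟩ := F.neg.exists_leftSide h.neg
  have e : ∀ c y, InSq N c (-B.1, y) ↔ InSq N (-c.1 - N, c.2) (B.1, y) := fun c y => by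
    unfold InSq; dsimp only; grind
  have e' : ∀ b y, InSq N b (B.1, y) → InSq N (-b.1 - N, b.2) (-B.1, y) := fun b y hb => by
    unfold InSq at *; dsimp only at *; grind
  refine ⟨(-l.1 - N, l.2), (-m.1 - N, m.2), d.hl, d.hm,
    ⟨fun c => c.1 ≤ B.1 ∧ B.1 ≤ c.1 + N, fun c y => by unfold InSq; dsimp only; tauto⟩,
    (e _ _).1 d.inl, (e _ _).1 d.inm, fun b hb hbA => ?_, fun b hb hbA => ?_, fun hne => ?_,
    fun hne y y1 y2 b hb hby => ?_, fun hne => ?_⟩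
  · have := d.maxl _ (negS_mk hb) (e' _ _ hbA); grind
  · have := d.minm _ (negS_mk hb) (e' _ _ hbA); grind
  · exact d.le (fun e => hne (by rw [e]))
  · exact d.gap (fun e => hne (by rw [e])) y y1 y2 _ (negS_mk hb) (e' _ _ hby)
  · rw [← exit_neg]
    exact d.exit (fun e => hne (by rw [e]))

theorem exists_bottomSide (h : SatPack S N) (F : Face S N A B K) :
    ∃ l m, Side S N K (fun x => (x, A.2)) Prod.fst A.1 B.1 l m := by
  obtain ⟨l, m, d⟩ := F.swap.exists_leftSide h.swap
  refine ⟨(l.2, l.1), (m.2, m.1), d.hl, d.hm,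
    ⟨fun c => c.2 ≤ A.2 ∧ A.2 ≤ c.2 + N, fun c y => by unfold InSq; dsimp only; tauto⟩,
    d.inl.swap, d.inm.swap, fun b hb hbA => ?_, fun b hb hbA => ?_, fun hne => ?_,
    fun hne y y1 y2 b hb hby => ?_, fun hne => ?_⟩
  · have := d.maxl (b.2, b.1) hb hbA.swap; grind
  · have := d.minm (b.2, b.1) hb hbA.swap; grind
  · exact d.le (fun e => hne (by rw [e]))
  · exact d.gap (fun e => hne (by rw [e])) y y1 y2 (b.2, b.1) hb hby.swap
  · rw [← exit_swap]
    exact d.exit (fun e => hne (by rw [e]))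

theorem exists_topSide (h : SatPack S N) (F : Face S N A B K) :
    ∃ l m, Side S N K (fun x => (x, B.2)) Prod.fst A.1 B.1 l m := by
  obtain ⟨l, m, d⟩ := F.swap.exists_rightSide h.swap
  refine ⟨(l.2, l.1), (m.2, m.1), d.hl, d.hm,
    ⟨fun c => c.2 ≤ B.2 ∧ B.2 ≤ c.2 + N, fun c y => by unfold InSq; dsimp only; tauto⟩,
    d.inl.swap, d.inm.swap, fun b hb hbA => ?_, fun b hb hbA => ?_, fun hne => ?_,
    fun hne y y1 y2 b hb hby => ?_, fun hne => ?_⟩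
  · have := d.maxl (b.2, b.1) hb hbA.swap; grind
  · have := d.minm (b.2, b.1) hb hbA.swap; grind
  · exact d.le (fun e => hne (by rw [e]))
  · exact d.gap (fun e => hne (by rw [e])) y y1 y2 (b.2, b.1) hb hby.swap
  · rw [← exit_swap]
    exact d.exit (fun e => hne (by rw [e]))

/-- The squares at the ends of the four sides of the bounding rectangle of a cross. -/
structure Ring (S : Set Plane) (N : ℝ) (A B : Plane) (K : Set Plane) where
  (ll lu rl ru bl br tl tr : Plane)
  left : LeftSide S N A B K ll lu
  right : Side S N K (fun y => (B.1, y)) Prod.snd A.2 B.2 rl ru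
  bottom : Side S N K (fun x => (x, A.2)) Prod.fst A.1 B.1 bl br
  top : Side S N K (fun x => (x, B.2)) Prod.fst A.1 B.1 tl tr

theorem exists_ring (h : SatPack S N) (F : Face S N A B K) : Nonempty (Ring S N A B K) := by
  obtain ⟨_, _, d1⟩ := F.exists_leftSide h
  obtain ⟨_, _, d2⟩ := F.exists_rightSide h
  obtain ⟨_, _, d3⟩ := F.exists_bottomSide h
  obtain ⟨_, _, d4⟩ := F.exists_topSide h
  exact ⟨⟨_, _, _, _, _, _, _, _, d1, d2, d3, d4⟩⟩

namespace Ring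

variable (R : Ring S N A B K)

/-- The point `y` of the boundary of the bounding rectangle is attributed to the square at `c`. -/
def Own (c y : Plane) : Prop :=
  (A.1 ≤ y.1 ∧ y.1 ≤ B.1 ∧ A.2 ≤ y.2 ∧ y.2 ≤ B.2) ∧
  ((y.1 = A.1 ∧ SideOwn N Prod.snd R.ll R.lu c y.2) ∨
    (y.1 = B.1 ∧ SideOwn N Prod.snd R.rl R.ru c y.2) ∨
    (y.2 = A.2 ∧ SideOwn N Prod.fst R.bl R.br c y.1) ∨
    (y.2 = B.2 ∧ SideOwn N Prod.fst R.tl R.tr c y.1))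

theorem isClosed_own (c : Plane) : IsClosed {y | R.Own c y} := by
  have k : ∀ {l m : Plane} {π : Plane → ℝ} {f f' : Plane → ℝ} {x : ℝ}, Continuous f →
      Continuous f' → IsClosed {y : Plane | f y = x ∧ SideOwn N π l m c (f' y)} :=
    fun hf hf' => (isClosed_eq hf continuous_const).inter (isClosed_sideOwn hf')
  refine IsClosed.inter ?_ ((k continuous_fst continuous_snd).union
    ((k continuous_fst continuous_snd).union
      ((k continuous_snd continuous_fst).union (k continuous_snd continuous_fst))))
  exact (isClosed_le continuous_const continuous_fst).inter
    ((isClosed_le continuous_fst continuous_const).inter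
      ((isClosed_le continuous_const continuous_snd).inter
        (isClosed_le continuous_snd continuous_const)))

variable {R}

theorem own_mem (o : R.Own c y) : c ∈ ({R.ll, R.lu, R.rl, R.ru, R.bl, R.br, R.tl, R.tr} :
    Set Plane) := by
  simp only [mem_insert_iff, mem_singleton_iff]
  rcases o with ⟨-, ⟨-, o⟩ | ⟨-, o⟩ | ⟨-, o⟩ | ⟨-, o⟩⟩
  · rcases R.left.side.own_mem o with e | e <;> tauto
  · rcases R.right.own_mem o with e | e <;> tauto
  · rcases R.bottom.own_mem o with e | e <;> tauto
  · rcases R.top.own_mem o with e | e <;> tauto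

theorem own_mem_S (o : R.Own c y) : c ∈ S := by
  rcases own_mem o with e | e | e | e | e | e | e | e <;> rw [e]
  exacts [R.left.hl, R.left.hm, R.right.hl, R.right.hm, R.bottom.hl, R.bottom.hm, R.top.hl,
    R.top.hm]

theorem isClosed_own_ne (c : Plane) : IsClosed {y | ∃ c', c' ≠ c ∧ R.Own c' y} := by
  have hf : (({R.ll, R.lu, R.rl, R.ru, R.bl, R.br, R.tl, R.tr} : Set Plane) \ {c}).Finite :=
    (Set.toFinite _).subset sdiff_subset
  have e : {y | ∃ c', c' ≠ c ∧ R.Own c' y} = ⋃ c' ∈ (({R.ll, R.lu, R.rl, R.ru, R.bl, R.br, R.tl,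
      R.tr} : Set Plane) \ {c}), {y | R.Own c' y} := by
    ext y
    simp only [mem_ofPred_eq, mem_iUnion, exists_prop]
    exact exists_congr fun c' => ⟨fun hc => ⟨⟨own_mem hc.2, hc.1⟩, hc.2⟩, fun hc => ⟨hc.1.2, hc.2⟩⟩
  rw [e]
  exact hf.isClosed_biUnion fun c' _ => R.isClosed_own c'

theorem exists_own (h1 : A.1 ≤ y.1 ∧ y.1 ≤ B.1 ∧ A.2 ≤ y.2 ∧ y.2 ≤ B.2) (h2 : ¬InBox A B y) :
    ∃ c, R.Own c y := by
  have : y.1 = A.1 ∨ y.1 = B.1 ∨ y.2 = A.2 ∨ y.2 = B.2 := by unfold InBox at h2; grind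
  rcases this with e | e | e | e
  · obtain ⟨c, hc⟩ := exists_sideOwn N Prod.snd R.ll R.lu y.2
    exact ⟨c, h1, Or.inl ⟨e, hc⟩⟩
  · obtain ⟨c, hc⟩ := exists_sideOwn N Prod.snd R.rl R.ru y.2
    exact ⟨c, h1, Or.inr (Or.inl ⟨e, hc⟩)⟩
  · obtain ⟨c, hc⟩ := exists_sideOwn N Prod.fst R.bl R.br y.1
    exact ⟨c, h1, Or.inr (Or.inr (Or.inl ⟨e, hc⟩))⟩
  · obtain ⟨c, hc⟩ := exists_sideOwn N Prod.fst R.tl R.tr y.1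
    exact ⟨c, h1, Or.inr (Or.inr (Or.inr ⟨e, hc⟩))⟩

theorem own_inSq (o : R.Own c y) (ha : a ∈ S) (hay : InSq N a y) : InSq N c y := by
  obtain ⟨⟨y1, y2, y3, y4⟩, o⟩ := o
  rcases o with ⟨e, o⟩ | ⟨e, o⟩ | ⟨e, o⟩ | ⟨e, o⟩
  · have hy : y = (A.1, y.2) := Prod.ext e rfl
    rw [hy] at hay ⊢; exact R.left.side.own_inSq o y3 y4 ha hay
  · have hy : y = (B.1, y.2) := Prod.ext e rfl
    rw [hy] at hay ⊢; exact R.right.own_inSq o y3 y4 ha hay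
  · have hy : y = (y.1, A.2) := Prod.ext rfl e
    rw [hy] at hay ⊢; exact R.bottom.own_inSq o y1 y2 ha hay
  · have hy : y = (y.1, B.2) := Prod.ext rfl e
    rw [hy] at hay ⊢; exact R.top.own_inSq o y1 y2 ha hay

/-- A point of the boundary which belongs to a square other than its owner is an exit point. -/
theorem exit_of_inSq (h : SatPack S N) (F : Face S N A B K) (o : R.Own c y) (ha : a ∈ S)
    (hay : InSq N a y) (hne : a ≠ c) : Exit S N K y :=
  F.exit_of_two h ha (own_mem_S o) hne o.1.1 o.1.2.1 o.1.2.2.1 o.1.2.2.2 hay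
    (own_inSq o ha hay)

/-- A point of the boundary with two owners is an exit point. -/
theorem exit_of_own (h : SatPack S N) (F : Face S N A B K) (o : R.Own c y) (o' : R.Own c' y)
    (hne : c ≠ c') : Exit S N K y := by
  obtain ⟨hl1, hl2⟩ := F.lt
  have key : InSq N R.ll y ∨ InSq N R.lu y ∨ InSq N R.rl y ∨ InSq N R.ru y → Exit S N K y := by
    intro k
    obtain ⟨b, hb, hby⟩ : ∃ b ∈ S, InSq N b y := by
      rcases k with k | k | k | k
      exacts [⟨_, R.left.hl, k⟩, ⟨_, R.left.hm, k⟩, ⟨_, R.right.hl, k⟩, ⟨_, R.right.hm, k⟩]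
    by_cases hbc : b = c
    · exact exit_of_inSq h F o' hb hby (hbc ▸ hne)
    · exact exit_of_inSq h F o hb hby hbc
  have k1 := R.left.side.inl
  have k2 := R.left.side.inm
  have k3 := R.right.inl
  have k4 := R.right.inm
  have k : y = (A.1, A.2) ∨ y = (A.1, B.2) ∨ y = (B.1, A.2) ∨ y = (B.1, B.2) → Exit S N K y := by
    rintro (e | e | e | e)
    · rw [← e] at k1; tauto
    · rw [← e] at k2; tauto
    · rw [← e] at k3; tauto
    · rw [← e] at k4; tauto
  simp only [Prod.ext_iff] at k
  rcases o with ⟨-, ⟨e, o⟩ | ⟨e, o⟩ | ⟨e, o⟩ | ⟨e, o⟩⟩ <;>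
    rcases o' with ⟨-, ⟨e', o'⟩ | ⟨e', o'⟩ | ⟨e', o'⟩ | ⟨e', o'⟩⟩
  · have := R.left.side.exit_of_own o o' hne; rwa [← e] at this
  · linarith
  · exact k (by tauto)
  · exact k (by tauto)
  · linarith
  · have := R.right.exit_of_own o o' hne; rwa [← e] at this
  · exact k (by tauto)
  · exact k (by tauto)
  · exact k (by tauto)
  · exact k (by tauto)
  · have := R.bottom.exit_of_own o o' hne; rwa [← e] at this
  · linarith
  · exact k (by tauto)
  · exact k (by tauto)
  · linarith
  · have := R.top.exit_of_own o o' hne; rwa [← e] at this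

/-- A cross has exit points: otherwise a single square would contain the four corners of its
bounding rectangle. -/
theorem exists_exit (h : SatPack S N) (F : Face S N A B K) (R : Ring S N A B K) :
    (allExitPoints S N K).Nonempty := by
  by_contra hc
  have hc : ∀ e, ¬Exit S N K e := fun e he => hc ⟨e, he⟩
  obtain ⟨hl1, hl2⟩ := F.lt
  have e1 : R.ll = R.lu := by by_contra e; exact hc _ (R.left.exit e)
  have e2 : R.tl = R.tr := by by_contra e; exact hc _ (R.top.exit e)
  have e3 : R.lu = R.tl := by
    by_contra e
    exact hc _ (F.exit_of_two h R.left.hm R.top.hl e (y := (A.1, B.2)) le_rfl hl1.le hl2.le le_rfl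
      R.left.inm R.top.inl)
  have k1 := R.left.inl
  have k2 := R.top.inm
  rw [← e2, ← e3, ← e1] at k2
  obtain ⟨z, hz⟩ := F.nonempty
  obtain ⟨⟨z1, z2, z3, z4⟩, hz'⟩ := (F.mem z).1 hz
  refine hz' _ R.left.hl ?_
  unfold InSq at *
  dsimp only at *
  refine ⟨?_, ?_, ?_, ?_⟩ <;> linarith

end Ring

end Face

/-! ### The owner of a sector -/

namespace Face

variable {A B a b c y z w : Plane} {K : Set Plane}

/-- The gauge of the rectangle `Icc A B` with respect to its center. -/
noncomputable def gauge (A B z : Plane) : ℝ :=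
  max (|z.1 - (A.1 + B.1) / 2| / ((B.1 - A.1) / 2)) (|z.2 - (A.2 + B.2) / 2| / ((B.2 - A.2) / 2))

/-- The radial projection from the center to the boundary of the rectangle `Icc A B`. -/
noncomputable def proj (A B z : Plane) : Plane :=
  ((A.1 + B.1) / 2 + (z.1 - (A.1 + B.1) / 2) / gauge A B z,
    (A.2 + B.2) / 2 + (z.2 - (A.2 + B.2) / 2) / gauge A B z)

theorem midpoint_eq (A B : Plane) : midpoint ℝ A B = ((A.1 + B.1) / 2, (A.2 + B.2) / 2) := by
  ext <;> simp [midpoint_eq_smul_add] <;> ring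

theorem gauge_pos (h1 : A.1 < B.1) (h2 : A.2 < B.2) (hz : z ≠ midpoint ℝ A B) :
    0 < gauge A B z := by
  rw [midpoint_eq, Ne, Prod.ext_iff, not_and_or] at hz
  rw [gauge, lt_max_iff]
  refine hz.imp (fun e => ?_) fun e => ?_
  · exact div_pos (abs_pos.2 (sub_ne_zero.2 e)) (by linarith)
  · exact div_pos (abs_pos.2 (sub_ne_zero.2 e)) (by linarith)

theorem gauge_lt_one (h1 : A.1 < B.1) (h2 : A.2 < B.2) : gauge A B z < 1 ↔ InBox A B z := by
  rw [gauge, max_lt_iff, div_lt_one (by linarith), div_lt_one (by linarith), abs_lt, abs_lt]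
  unfold InBox
  grind

theorem gauge_le_one (h1 : A.1 < B.1) (h2 : A.2 < B.2) : gauge A B z ≤ 1 ↔
    A.1 ≤ z.1 ∧ z.1 ≤ B.1 ∧ A.2 ≤ z.2 ∧ z.2 ≤ B.2 := by
  rw [gauge, max_le_iff, div_le_one (by linarith), div_le_one (by linarith), abs_le, abs_le]
  grind

theorem gauge_proj (h1 : A.1 < B.1) (h2 : A.2 < B.2) (hz : z ≠ midpoint ℝ A B) :
    gauge A B (proj A B z) = 1 := by
  have hp := gauge_pos h1 h2 hz
  conv_lhs => rw [gauge]
  simp only [proj, add_sub_cancel_left, abs_div, abs_of_pos hp]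
  rw [div_right_comm, div_right_comm (|z.2 - (A.2 + B.2) / 2|), max_div_div_right hp.le]
  exact div_self hp.ne'

theorem proj_eq (hz : gauge A B z = 1) : proj A B z = z := by
  ext <;> simp [proj, hz]

theorem mem_segment_proj (hp : 0 < gauge A B z) (hz : gauge A B z ≤ 1) :
    z ∈ segment ℝ (midpoint ℝ A B) (proj A B z) := by
  refine ⟨1 - gauge A B z, gauge A B z, by linarith, hp.le, by ring, ?_⟩
  rw [midpoint_eq]
  ext <;> simp only [proj, Prod.smul_mk, Prod.fst_add, Prod.snd_add, smul_eq_mul] <;>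
    field_simp <;> ring

theorem continuous_gauge (A B : Plane) : Continuous (gauge A B) := by
  unfold gauge
  fun_prop

theorem continuousOn_proj (h1 : A.1 < B.1) (h2 : A.2 < B.2) :
    ContinuousOn (proj A B) {midpoint ℝ A B}ᶜ := by
  have hc := (continuous_gauge A B).continuousOn (s := {midpoint ℝ A B}ᶜ)
  have hne : ∀ z ∈ ({midpoint ℝ A B}ᶜ : Set Plane), gauge A B z ≠ 0 :=
    fun z hz => (gauge_pos h1 h2 hz).ne'
  unfold proj
  refine ContinuousOn.prodMk ?_ ?_
  · exact continuousOn_const.add (ContinuousOn.div (by fun_prop) hc hne)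
  · exact continuousOn_const.add (ContinuousOn.div (by fun_prop) hc hne)

theorem interior_box (A B : Plane) : interior (Icc A B) = {z | InBox A B z} := by
  rw [← Prod.mk.eta (p := A), ← Prod.mk.eta (p := B), ← Icc_prod_Icc, interior_prod_eq,
    interior_Icc, interior_Icc]
  ext z
  simp only [mem_prod, mem_Ioo, mem_ofPred_eq, InBox, and_assoc]

theorem mem_frontier_box : z ∈ frontier (Icc A B) ↔
    (A.1 ≤ z.1 ∧ z.1 ≤ B.1 ∧ A.2 ≤ z.2 ∧ z.2 ≤ B.2) ∧ ¬InBox A B z := by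
  rw [isClosed_Icc.frontier_eq, interior_box]
  simp only [mem_sdiff, mem_Icc, Prod.le_def, mem_ofPred_eq]
  tauto

theorem gauge_eq_one (h1 : A.1 < B.1) (h2 : A.2 < B.2) : gauge A B z = 1 ↔
    z ∈ frontier (Icc A B) := by
  rw [mem_frontier_box, ← gauge_le_one h1 h2, ← gauge_lt_one h1 h2, not_lt]
  exact ⟨fun e => ⟨e.le, e.ge⟩, fun e => le_antisymm e.1 e.2⟩

/-- The radial projection of a sector is a connected part of the boundary of the bounding rectangle
without exit points, so that all its points have the same owner. -/
theorem sector_own (h : SatPack S N) (F : Face S N A B K) (R : Ring S N A B K) {x : Plane}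
    (hz : z ∈ connectedComponentIn
      (interior (Icc A B) \ decoration S N K (midpoint ℝ A B)) x) :
    ∃ c, R.Own c (proj A B z) ∧ z ≠ midpoint ℝ A B ∧ ∀ y ∈ closure (connectedComponentIn
      (interior (Icc A B) \ decoration S N K (midpoint ℝ A B)) x), y ∈ frontier (Icc A B) →
        R.Own c y := by
  obtain ⟨hl1, hl2⟩ := F.lt
  set U := interior (Icc A B) \ decoration S N K (midpoint ℝ A B) with hU
  set σ := connectedComponentIn U x with hσ
  have hsub : σ ⊆ U := connectedComponentIn_subset _ _
  -- The center belongs to the decoration, since there are exit points.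
  have hm : ∀ z ∈ U, z ≠ midpoint ℝ A B := by
    rintro z ⟨-, hz⟩ rfl
    obtain ⟨e, he⟩ := Ring.exists_exit h F R
    exact hz ⟨e, he, left_mem_segment ℝ _ _⟩
  have hfr : ∀ z ∈ U, proj A B z ∈ frontier (Icc A B) := fun z hz =>
    (gauge_eq_one hl1 hl2).1 (gauge_proj hl1 hl2 (hm z hz))
  -- A point which is projected to an exit point lies on a segment of the decoration.
  have hne : ∀ z ∈ U, ¬Exit S N K (proj A B z) := fun z hz he => hz.2 ⟨_, he, by
    have hb : InBox A B z := by have := hz.1; rwa [interior_box] at this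
    exact mem_segment_proj (gauge_pos hl1 hl2 (hm z hz)) ((gauge_lt_one hl1 hl2).2 hb).le⟩
  have hcont := continuousOn_proj hl1 hl2
  have hJ : IsPreconnected (proj A B '' σ) :=
    isPreconnected_connectedComponentIn.image _ (hcont.mono fun z hz => hm z (hsub hz))
  obtain ⟨hb1, hb2⟩ := mem_frontier_box.1 (hfr z (hsub hz))
  obtain ⟨c, hc⟩ := Ring.exists_own (R := R) hb1 hb2
  refine ⟨c, hc, hm z (hsub hz), ?_⟩
  -- The sets of points with owner `c` and with another owner are closed, they cover the connected
  -- projection of the sector, and they only meet at exit points.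
  have hall : ∀ w ∈ σ, R.Own c (proj A B w) := by
    by_contra! hcon
    obtain ⟨w, hw, hwc⟩ := hcon
    obtain ⟨b1, b2⟩ := mem_frontier_box.1 (hfr w (hsub hw))
    obtain ⟨c', hc'⟩ := Ring.exists_own (R := R) b1 b2
    have hc'' : c' ≠ c := fun e => hwc (e ▸ hc')
    obtain ⟨_, ⟨v, hv, rfl⟩, hv1, c₁, hv2, hv3⟩ := (isPreconnected_closed_iff.1 hJ) _ _
      (R.isClosed_own c) (R.isClosed_own_ne c) (by
        rintro _ ⟨v, hv, rfl⟩
        obtain ⟨b1, b2⟩ := mem_frontier_box.1 (hfr v (hsub hv))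
        obtain ⟨d, hd⟩ := Ring.exists_own (R := R) b1 b2
        by_cases hdc : d = c
        · exact Or.inl (hdc ▸ hd)
        · exact Or.inr ⟨d, hdc, hd⟩) ⟨_, ⟨z, hz, rfl⟩, hc⟩ ⟨_, ⟨w, hw, rfl⟩, c', hc'', hc'⟩
    exact hne v (hsub hv) (Ring.exit_of_own h F hv1 hv3 hv2.symm)
  intro y hy hyf
  have hy1 : gauge A B y = 1 := (gauge_eq_one hl1 hl2).2 hyf
  have hym : y ≠ midpoint ℝ A B := by
    rintro rfl
    rw [midpoint_eq] at hy1
    simp [gauge] at hy1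
  have hca : ContinuousAt (proj A B) y := hcont.continuousAt (isOpen_compl_singleton.mem_nhds hym)
  have : proj A B y ∈ closure {y | R.Own c y} :=
    closure_mono (show proj A B '' σ ⊆ {y | R.Own c y} by
      rintro _ ⟨w, hw, rfl⟩; exact hall w hw)
      (hca.continuousWithinAt.mem_closure_image hy)
  rw [(R.isClosed_own c).closure_eq, proj_eq hy1] at this
  exact this

end Face

/-! ### The exit points of a square in the part of the boundary owned by another one -/

namespace Face

variable {A B a b c y z w e e' : Plane} {K : Set Plane}

/-- `e` is the exit point of the cross given by a vertical arm of the square at `a`. -/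
def VExit (S : Set Plane) (N : ℝ) (K : Set Plane) (a e : Plane) : Prop :=
  ∃ v w p q, VArm S N v w ∧ (a = v ∨ a = w) ∧ {z | InV N v w z} ∩ closure K = segment ℝ p q ∧
    e = midpoint ℝ p q

/-- `e` is the exit point of the cross given by a horizontal arm of the square at `a`. -/
def HExit (S : Set Plane) (N : ℝ) (K : Set Plane) (a e : Plane) : Prop :=
  ∃ v w p q, HArm S N v w ∧ (a = v ∨ a = w) ∧ {z | InH N v w z} ∩ closure K = segment ℝ p q ∧
    e = midpoint ℝ p q

theorem HExit.swap (d : HExit S N K a e) :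
    VExit (swapS S) N {z | (z.2, z.1) ∈ K} (a.2, a.1) (e.2, e.1) := by
  obtain ⟨v, w, p, q, d1, d2, d3, rfl⟩ := d
  refine ⟨_, _, swapL p, swapL q, d1.swap, ?_, ?_, ?_⟩
  · rcases d2 with rfl | rfl <;> simp
  · rw [← swapL_image, ← PackSym.image_clos, ← PackSym.image_seg, ← d3,
      image_inter swapL.injective, swapL_image, swapL_image]
    rfl
  · rw [← PackSym.image_midpoint]; rfl

theorem VExit.swap (d : VExit S N K a e) :
    HExit (swapS S) N {z | (z.2, z.1) ∈ K} (a.2, a.1) (e.2, e.1) := by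
  obtain ⟨v, w, p, q, d1, d2, d3, rfl⟩ := d
  refine ⟨_, _, swapL p, swapL q, d1.swap, ?_, ?_, ?_⟩
  · rcases d2 with rfl | rfl <;> simp
  · rw [← swapL_image, ← PackSym.image_clos, ← PackSym.image_seg, ← d3,
      image_inter swapL.injective, swapL_image, swapL_image]
    rfl
  · rw [← PackSym.image_midpoint]; rfl

theorem VExit.neg (d : VExit S N K a e) :
    VExit (negS S N) N {z | (-z.1, z.2) ∈ K} (-a.1 - N, a.2) (-e.1, e.2) := by
  obtain ⟨v, w, p, q, d1, d2, d3, rfl⟩ := d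
  refine ⟨_, _, negL p, negL q, d1.neg, ?_, ?_, ?_⟩
  · rcases d2 with rfl | rfl <;> simp
  · rw [← negL_image, ← PackSym.image_clos, ← PackSym.image_seg, ← d3,
      image_inter negL.injective, negL_image, negL_image]
    congr 1
    ext z; simp only [InV, mem_ofPred_eq]; grind
  · rw [← PackSym.image_midpoint]; rfl

theorem HExit.neg (d : HExit S N K a e) :
    HExit (negS S N) N {z | (-z.1, z.2) ∈ K} (-a.1 - N, a.2) (-e.1, e.2) := by
  obtain ⟨v, w, p, q, d1, d2, d3, rfl⟩ := d
  refine ⟨_, _, negL p, negL q, d1.neg, ?_, ?_, ?_⟩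
  · rcases d2 with rfl | rfl <;> simp
  · rw [← negL_image, ← PackSym.image_clos, ← PackSym.image_seg, ← d3,
      image_inter negL.injective, negL_image, negL_image]
    congr 1
    ext z; simp only [InH, mem_ofPred_eq]; grind
  · rw [← PackSym.image_midpoint]; rfl

theorem VExit.flip (d : VExit S N K a e) :
    VExit (flipS S N) N {z | (z.1, -z.2) ∈ K} (a.1, -a.2 - N) (e.1, -e.2) := d.swap.neg.swap

theorem HExit.flip (d : HExit S N K a e) :
    HExit (flipS S N) N {z | (z.1, -z.2) ∈ K} (a.1, -a.2 - N) (e.1, -e.2) := d.swap.neg.swap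

theorem VExit.exists_arm (h : SatPack S N) (F : Face S N A B K) (d : VExit S N K a e) :
    ∃ v w, VArm S N v w ∧ (a = v ∨ a = w) ∧ InV N v w e ∧
      (A.1 ≤ e.1 ∧ e.1 ≤ B.1 ∧ A.2 ≤ e.2 ∧ e.2 ≤ B.2) ∧ e ∈ closure K := by
  obtain ⟨v, w, p, q, d1, d2, d3, rfl⟩ := d
  have : midpoint ℝ p q ∈ {z | InV N v w z} ∩ closure K := d3 ▸ midpoint_mem_segment p q
  exact ⟨v, w, d1, d2, this.1, ((F.mem_closure h).1 this.2).1, this.2⟩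

theorem HExit.exists_arm (h : SatPack S N) (F : Face S N A B K) (d : HExit S N K a e) :
    ∃ v w, HArm S N v w ∧ (a = v ∨ a = w) ∧ InH N v w e ∧
      (A.1 ≤ e.1 ∧ e.1 ≤ B.1 ∧ A.2 ≤ e.2 ∧ e.2 ≤ B.2) ∧ e ∈ closure K := by
  obtain ⟨v, w, p, q, d1, d2, d3, rfl⟩ := d
  have : midpoint ℝ p q ∈ {z | InH N v w z} ∩ closure K := d3 ▸ midpoint_mem_segment p q
  exact ⟨v, w, d1, d2, this.1, ((F.mem_closure h).1 this.2).1, this.2⟩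

/-- The exit points given by vertical arms lie on the left and on the right side. -/
theorem VExit.side (h : SatPack S N) (F : Face S N A B K) (d : VExit S N K a e) :
    (e.1 = A.1 ∨ e.1 = B.1) ∧ a.1 ≤ e.1 ∧ e.1 ≤ a.1 + N ∧ (A.2 ≤ e.2 ∧ e.2 ≤ B.2) := by
  obtain ⟨v, w, d1, d2, ⟨k1, k2, k3, k4, k5, k6⟩, ⟨b1, b2, b3, b4⟩, -⟩ := d.exists_arm h F
  have hN := h.pos
  refine ⟨?_, by rcases d2 with rfl | rfl <;> assumption,
    by rcases d2 with rfl | rfl <;> assumption, b3, b4⟩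
  obtain ⟨hl1, hl2⟩ := F.lt
  have hs := F.varm_sep h d1
  have pv := F.poke v d1.ms
  have pw := F.poke w d1.mt
  have dj := F.disj v d1.ms w d1.mt
  have hne := h.varm_ne d1
  have e0 := d1.ab
  unfold Meets at pv pw dj
  unfold Abv at e0
  by_contra! hc
  have c1 : A.1 < e.1 := lt_of_le_of_ne b1 (Ne.symm hc.1)
  have c2 : e.1 < B.1 := lt_of_le_of_ne b2 hc.2
  rcases b3.lt_or_eq with g | g <;> rcases b4.lt_or_eq with g' | g' <;> grind

theorem HExit.side (h : SatPack S N) (F : Face S N A B K) (d : HExit S N K a e) :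
    (e.2 = A.2 ∨ e.2 = B.2) ∧ a.2 ≤ e.2 ∧ e.2 ≤ a.2 + N ∧ (A.1 ≤ e.1 ∧ e.1 ≤ B.1) :=
  d.swap.side h.swap F.swap

/-- The exit points given by the arms of a square. -/
theorem exit_cases (h : SatPack S N) (F : Face S N A B K) (he : e ∈ exitPoints S N K a) :
    VExit S N K a e ∨ HExit S N K a e ∨
      (InSq N a e ∧ (e.1 = A.1 ∨ e.1 = B.1) ∧ (e.2 = A.2 ∨ e.2 = B.2)) := by
  have hN := h.pos
  obtain ⟨t, D, p, q, hD, h1, h2⟩ := he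
  rcases isArm_iff.1 hD with ⟨d, rfl⟩ | ⟨d, rfl⟩ | ⟨d, rfl⟩ | ⟨d, rfl⟩ | ⟨ha, ht, k1, k2, rfl⟩
  · exact Or.inl ⟨_, _, p, q, d, Or.inl rfl, h1, h2⟩
  · exact Or.inl ⟨_, _, p, q, d, Or.inr rfl, h1, h2⟩
  · exact Or.inr (Or.inl ⟨_, _, p, q, d, Or.inl rfl, h1, h2⟩)
  · exact Or.inr (Or.inl ⟨_, _, p, q, d, Or.inr rfl, h1, h2⟩)
  · right; right
    have : midpoint ℝ p q ∈ {z | InSq N a z ∧ InSq N t z} ∩ closure K :=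
      h1 ▸ midpoint_mem_segment p q
    rw [← h2] at this
    obtain ⟨⟨i1, i2⟩, hK⟩ := this
    obtain ⟨⟨b1, b2, b3, b4⟩, -⟩ := (F.mem_closure h).1 hK
    obtain ⟨hl1, hl2⟩ := F.lt
    have pa := F.poke a ha
    have pt := F.poke t ht
    have hne : a ≠ t := by rintro rfl; simp only [sub_self, abs_zero] at k1; linarith
    have dj := F.disj a ha t ht
    rw [abs_eq hN.le] at k1 k2
    unfold Meets at pa pt dj
    refine ⟨i1, ?_⟩
    unfold InSq at i1 i2
    rcases b1.lt_or_eq with g1 | g1 <;> rcases b2.lt_or_eq with g2 | g2 <;>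
    rcases b3.lt_or_eq with g3 | g3 <;> rcases b4.lt_or_eq with g4 | g4 <;> grind

theorem midpoint_eq_of_segment {p q p' q' : Plane} (hs : segment ℝ p q = segment ℝ p' q') :
    midpoint ℝ p q = midpoint ℝ p' q' := by
  have key : ∀ a b a' b' : ℝ, uIcc a b = uIcc a' b' → a + b = a' + b' := by
    intro a b a' b' hu
    have h1 := (left_mem_uIcc : a ∈ uIcc a b)
    have h2 := (right_mem_uIcc : b ∈ uIcc a b)
    have h3 := (left_mem_uIcc : a' ∈ uIcc a' b')
    have h4 := (right_mem_uIcc : b' ∈ uIcc a' b')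
    rw [hu] at h1 h2
    rw [← hu] at h3 h4
    rw [mem_uIcc] at h1 h2 h3 h4
    grind
  have h1 := congrArg (image (LinearMap.fst ℝ ℝ ℝ).toAffineMap) hs
  have h2 := congrArg (image (LinearMap.snd ℝ ℝ ℝ).toAffineMap) hs
  rw [image_segment, image_segment, segment_eq_uIcc, segment_eq_uIcc] at h1 h2
  have k1 := key _ _ _ _ h1
  have k2 := key _ _ _ _ h2
  simp only [LinearMap.coe_toAffineMap, LinearMap.fst_apply, LinearMap.snd_apply] at k1 k2
  rw [midpoint_eq, midpoint_eq, k1, k2]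

/-- A square has at most one exit point on the left side given by an arm upwards. -/
theorem vexit_unique_up (h : SatPack S N) (F : Face S N A B K) {p' q' : Plane}
    (d : VArm S N a t) (d' : VArm S N a u)
    (k : {z | InV N a t z} ∩ closure K = segment ℝ p q)
    (k' : {z | InV N a u z} ∩ closure K = segment ℝ p' q')
    (h1 : (midpoint ℝ p q).1 = A.1) (h2 : (midpoint ℝ p' q').1 = A.1)
    (hlt : (midpoint ℝ p q).2 < (midpoint ℝ p' q').2) : False := by
  have hN := h.pos
  -- Two different arms miss the interior of the rectangle, and their upper ends do not overlap,
  -- which leaves no room for two exit points.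
  by_cases htu : t = u
  · subst htu
    rw [midpoint_eq_of_segment (k.symm.trans k')] at hlt
    exact lt_irrefl _ hlt
  have m : midpoint ℝ p q ∈ {z | InV N a t z} ∩ closure K := k ▸ midpoint_mem_segment p q
  have m' : midpoint ℝ p' q' ∈ {z | InV N a u z} ∩ closure K := k' ▸ midpoint_mem_segment p' q'
  obtain ⟨⟨i1, i2, i3, i4, i5, i6⟩, hK⟩ := m
  obtain ⟨⟨j1, j2, j3, j4, j5, j6⟩, hK'⟩ := m'
  obtain ⟨⟨-, -, b3, b4⟩, -⟩ := (F.mem_closure h).1 hK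
  obtain ⟨⟨-, -, b3', b4'⟩, -⟩ := (F.mem_closure h).1 hK'
  rw [h1] at i1 i2 i3 i4
  rw [h2] at j1 j2 j3 j4
  obtain ⟨hl1, hl2⟩ := F.lt
  have hs := F.varm_sep h d
  have hs' := F.varm_sep h d'
  have pt := F.poke t d.mt
  have pu := F.poke u d'.mt
  have ft := F.not_flush h d.mt
  have fu := F.not_flush h d'.mt
  have vt := h.varm_disj d d'.mt (h.varm_ne d').symm (Ne.symm htu)
  have vu := h.varm_disj d' d.mt (h.varm_ne d).symm htu
  rw [le_max_iff, min_add_le] at vt vu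
  have e0 := d.ab
  have e0' := d'.ab
  unfold Meets at pt pu
  unfold Abv at e0 e0'
  have st := h.sep t d.mt u d'.mt htu
  grind (splits := 20)

end Face

namespace Face

variable {A B a b c y z w e e' : Plane} {K : Set Plane}

theorem vexit_not_lt (h : SatPack S N) (F : Face S N A B K) (d : VExit S N K a e)
    (d' : VExit S N K a e') (h1 : e.1 = A.1) (h2 : e'.1 = A.1) (k : a.2 + N ≤ e.2)
    (k' : a.2 + N ≤ e'.2) : ¬e.2 < e'.2 := by
  have hN := h.pos
  obtain ⟨v, w, p, q, i1, i2, i3, rfl⟩ := d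
  obtain ⟨v', w', p', q', j1, j2, j3, rfl⟩ := d'
  have m : midpoint ℝ p q ∈ {z | InV N v w z} ∩ closure K := i3 ▸ midpoint_mem_segment p q
  have m' : midpoint ℝ p' q' ∈ {z | InV N v' w' z} ∩ closure K := j3 ▸ midpoint_mem_segment p' q'
  obtain ⟨⟨-, -, -, -, -, m1⟩, -⟩ := m
  obtain ⟨⟨-, -, -, -, -, m2⟩, -⟩ := m'
  rcases i2 with rfl | rfl
  · rcases j2 with rfl | rfl
    · exact F.vexit_unique_up h i1 j1 i3 j3 h1 h2
    · linarith
  · linarith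

/-- A square has at most one exit point on the left side given by a vertical arm. -/
theorem vexit_unique_left (h : SatPack S N) (F : Face S N A B K) (d : VExit S N K a e)
    (d' : VExit S N K a e') (h1 : e.1 = A.1) (h2 : e'.1 = A.1) : e = e' := by
  have hN := h.pos
  have key : ∀ {e e'}, VExit S N K a e → VExit S N K a e' → e.1 = A.1 → e'.1 = A.1 →
      ¬e.2 < e'.2 := by
    intro e e' d d' h1 h2 hlt
    obtain ⟨v, w, i1, i2, i3, i4, -⟩ := d.exists_arm h F
    obtain ⟨v', w', j1, j2, j3, j4, -⟩ := d'.exists_arm h F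
    have o1 : a.2 + N ≤ e.2 ∨ e.2 ≤ a.2 := by
      rcases i2 with rfl | rfl
      · exact Or.inl i3.2.2.2.2.1
      · exact Or.inr i3.2.2.2.2.2
    have o2 : a.2 + N ≤ e'.2 ∨ e'.2 ≤ a.2 := by
      rcases j2 with rfl | rfl
      · exact Or.inl j3.2.2.2.2.1
      · exact Or.inr j3.2.2.2.2.2
    rcases o1 with o1 | o1
    · exact F.vexit_not_lt h d d' h1 h2 o1 (by linarith) hlt
    rcases o2 with o2 | o2
    · have ha : a ∈ S := by rcases i2 with rfl | rfl; exacts [i1.ms, i1.mt]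
      have pa := F.poke a ha
      have fa := F.not_flush h ha
      have sd := d.side h F
      obtain ⟨hl1, hl2⟩ := F.lt
      unfold Meets at pa
      grind
    · refine F.flip.vexit_not_lt h.flip d'.flip d.flip h2 h1 ?_ ?_ ?_ <;> dsimp only <;> linarith
  refine Prod.ext (h1.trans h2.symm) ?_
  rcases lt_trichotomy e.2 e'.2 with g | g | g
  · exact (key d d' h1 h2 g).elim
  · exact g
  · exact (key d' d h2 h1 g).elim

/-- A square on the left of the owner of a part of the boundary near the lower left corner does not
have exit points on both sides of this corner. -/
theorem own_corner (h : SatPack S N) (F : Face S N A B K) (ha : a ∈ S) (hc : c ∈ S) (hne : a ≠ c)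
    (hac : a.1 < c.1) (hcA : InSq N c A)
    (he : (VExit S N K a e ∧ e.1 = A.1) ∨ (e = A ∧ InSq N a A))
    (he' : (HExit S N K a e' ∧ e'.2 = A.2) ∨ (e' = A ∧ InSq N a A)) (hee : e ≠ e')
    (hmax : e ≠ A → c.2 + N = A.2 → ∀ b ∈ S, InSq N b A →
      b.2 < c.2 ∨ (b.2 = c.2 ∧ c.1 ≤ b.1)) : False := by
  have hN := h.pos
  obtain ⟨hl1, hl2⟩ := F.lt
  have haA : InSq N a A := by
    rcases he with ⟨d, d1⟩ | ⟨-, d⟩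
    · rcases he' with ⟨d', d2⟩ | ⟨-, d'⟩
      · have s1 := d.side h F
        have s2 := d'.side h F
        unfold InSq
        refine ⟨?_, ?_, ?_, ?_⟩ <;> linarith
      · exact d'
    · exact d
  have pa := F.poke a ha
  have pc := F.poke c hc
  have fa := F.not_flush h ha
  have sp := h.sep a ha c hc hne
  have hm := fun h1 h2 => hmax h1 h2 a ha haA
  unfold Meets at pa pc
  unfold InSq at haA hcA
  -- Both squares contain the corner, which leaves two configurations; in each of them the exit
  -- points of `a` next to the corner are the corner itself.
  have cases : (a.1 + N = A.1 ∧ c.1 = A.1 ∧ c.2 + N = A.2) ∨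
      (c.2 + N = A.2 ∧ a.2 = A.2 ∧ a.1 + N = A.1 ∧ B.2 < a.2 + N) := by
    clear hm hmax he he'
    have a1 : a.1 + N = A.1 ∨ a.2 + N = A.2 ∨ a.2 = A.2 := by grind
    have c1 : c.1 = A.1 ∨ c.2 + N = A.2 ∨ c.2 = A.2 := by grind
    rcases sp with sp | sp | sp | sp <;> grind
  have heA : e = A := by
    rcases he with ⟨d, d1⟩ | ⟨d, -⟩
    · obtain ⟨v, w, i1, i2, i3, i4, -⟩ := d.exists_arm h F
      unfold InV at i3
      by_contra hcon
      have hcon' : e.2 ≠ A.2 := fun e2 => hcon (Prod.ext d1 e2)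
      rcases i2 with rfl | rfl <;> grind
    · exact d
  have heA' : e' = A := by
    rcases he' with ⟨d, d1⟩ | ⟨d, -⟩
    · obtain ⟨v, w, i1, i2, i3, i4, -⟩ := d.exists_arm h F
      have hs := F.harm_sep h i1
      have dc := fun h1 h2 => h.harm_disj i1 hc h1 h2
      have i5 := i1.ab
      unfold InH at i3
      unfold Rgt at i5
      rw [le_max_iff, min_add_le] at dc
      by_contra hcon
      have hcon' : e'.1 ≠ A.1 := fun e2 => hcon (Prod.ext e2 d1)
      rcases i2 with rfl | rfl <;> grind
    · exact d
  exact hee (heA.trans heA'.symm)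

/-- A square on the left of the owner of a part of the boundary which joins the top and the bottom
sides does not have exit points on both of these sides. -/
theorem own_opposite (h : SatPack S N) (F : Face S N A B K) (R : Ring S N A B K) (ha : a ∈ S)
    (hne : a ≠ c) (hac : a.1 < c.1) (haB : a.1 + N < B.1) (o : R.Own c e) (o' : R.Own c e')
    (he : (HExit S N K a e ∧ e.2 = A.2) ∨ (e = A ∧ InSq N a A))
    (he' : (HExit S N K a e' ∧ e'.2 = B.2) ∨ (e' = (A.1, B.2) ∧ InSq N a (A.1, B.2))) :
    False := by
  have hN := h.pos
  have hc : c ∈ S := Ring.own_mem_S o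
  obtain ⟨hl1, hl2⟩ := F.lt
  have eA : e.2 = A.2 ∧ A.1 ≤ e.1 ∧ e.1 ≤ B.1 := by
    refine ⟨?_, o.1.1, o.1.2.1⟩
    rcases he with d | d
    · exact d.2
    · rw [d.1]
  have eB : e'.2 = B.2 ∧ A.1 ≤ e'.1 ∧ e'.1 ≤ B.1 := by
    refine ⟨?_, o'.1.1, o'.1.2.1⟩
    rcases he' with d | d
    · exact d.2
    · rw [d.1]
  have r1 : a.2 ≤ A.2 ∧ A.2 ≤ a.2 + N := by
    rcases he with ⟨d, d1⟩ | ⟨-, d⟩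
    · have := d.side h F; exact ⟨by linarith, by linarith⟩
    · exact d.2.2
  have r2 : a.2 ≤ B.2 ∧ B.2 ≤ a.2 + N := by
    rcases he' with ⟨d, d1⟩ | ⟨-, d⟩
    · have := d.side h F; exact ⟨by linarith, by linarith⟩
    · exact d.2.2
  have pa := F.poke a ha
  have pc := F.poke c hc
  have fc := F.not_flush h hc
  have fc' := F.neg.not_flush h.neg (negS_mk hc)
  dsimp only at fc'
  have sp := h.sep a ha c hc hne
  have a1 : a.1 + N ≤ A.1 := by unfold Meets at pa; grind
  -- The owner contains two ends of the left side or two ends of the right side.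
  have k1 : InSq N c A ∨ InSq N c (B.1, A.2) := by
    rcases o with ⟨-, ⟨g, o⟩ | ⟨g, o⟩ | ⟨g, o⟩ | ⟨g, o⟩⟩
    · left; rw [eA.1] at o; exact R.left.side.own_lo hl2.le o
    · right; rw [eA.1] at o; exact R.right.own_lo hl2.le o
    · rcases R.bottom.own_mem o with rfl | rfl
      · exact Or.inl R.bottom.inl
      · exact Or.inr R.bottom.inm
    · linarith
  have k2 : InSq N c (A.1, B.2) ∨ InSq N c B := by
    rcases o' with ⟨-, ⟨g, o⟩ | ⟨g, o⟩ | ⟨g, o⟩ | ⟨g, o⟩⟩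
    · left; rw [eB.1] at o; exact R.left.side.own_hi hl2.le o
    · right; rw [eB.1] at o; exact R.right.own_hi hl2.le o
    · linarith
    · rcases R.top.own_mem o with rfl | rfl
      · exact Or.inl R.top.inl
      · exact Or.inr R.top.inm
  have k3 : c.1 + N = A.1 ∨ c.1 = B.1 := by
    unfold Meets at pc
    unfold InSq at k1 k2
    dsimp only at k1 k2
    grind
  have k4 : c.2 ≤ A.2 ∧ B.2 ≤ c.2 + N := by
    unfold InSq at k1 k2
    dsimp only at k1 k2
    grind
  -- The ends of the right side are reached by no square on the left of `c`.
  have m1 : c.1 = B.1 → e.1 < B.1 → ∀ b ∈ S, InSq N b (B.1, A.2) → c.1 ≤ b.1 := by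
    intro hcB hlt b hb hbB
    have hcb : c = R.br := by
      rcases o with ⟨-, ⟨g, o⟩ | ⟨g, o⟩ | ⟨g, o⟩ | ⟨g, o⟩⟩
      · rw [eA.1] at o
        have := (R.left.side.own_lo hl2.le o).1
        dsimp only at this; linarith
      · linarith
      · refine (R.bottom.own_mem o).resolve_left fun e => ?_
        have := R.bottom.inl.1
        rw [← e] at this; dsimp only at this; linarith
      · linarith
    rw [hcb]; exact R.bottom.minm b hb hbB
  have m2 : c.1 = B.1 → e'.1 < B.1 → ∀ b ∈ S, InSq N b (B.1, B.2) → c.1 ≤ b.1 := by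
    intro hcB hlt b hb hbB
    have hcb : c = R.tr := by
      rcases o' with ⟨-, ⟨g, o⟩ | ⟨g, o⟩ | ⟨g, o⟩ | ⟨g, o⟩⟩
      · rw [eB.1] at o
        have := (R.left.side.own_hi hl2.le o).1
        dsimp only at this; linarith
      · linarith
      · linarith
      · refine (R.top.own_mem o).resolve_left fun e => ?_
        have := R.top.inl.1
        rw [← e] at this; dsimp only at this; linarith
    rw [hcb]; exact R.top.minm b hb hbB
  -- The square at `c` limits the arms of `a` to the right unless its edges are those of the
  -- rectangle.
  have b1 : c.2 = A.2 := by
    rcases he with ⟨d, d1⟩ | ⟨rfl, d⟩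
    · obtain ⟨v, w, i1, i2, i3, i4, -⟩ := d.exists_arm h F
      have hs := F.harm_sep h i1
      have dc := fun h1 h2 => h.harm_disj i1 hc h1 h2
      have i5 := i1.ab
      have fw := F.swap.not_flush h.swap (a := (w.2, w.1)) i1.mt
      have mw := fun h1 h2 => m1 h1 h2 w i1.mt
      have pw := F.poke w i1.mt
      unfold Meets at pw
      unfold InH at i3
      unfold Rgt at i5
      unfold InSq at mw
      rw [le_max_iff, min_add_le] at dc
      dsimp only at fw mw
      rcases i2 with rfl | rfl
      · clear m1 m2 k1 k2 pc fc fc' he' d o o'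
        grind (splits := 20)
      · linarith
    · have := Ring.own_inSq o ha d
      unfold InSq at this d; grind
  have b2 : c.2 + N = B.2 := by
    rcases he' with ⟨d, d1⟩ | ⟨rfl, d⟩
    · obtain ⟨v, w, i1, i2, i3, i4, -⟩ := d.exists_arm h F
      have hs := F.harm_sep h i1
      have dc := fun h1 h2 => h.harm_disj i1 hc h1 h2
      have i5 := i1.ab
      have fw := F.swap.neg.not_flush h.swap.neg (a := (-w.2 - N, w.1)) (negS_mk (s := (w.2, w.1)) (show ((w.2, w.1) : Plane) ∈ swapS S from i1.mt))
      have mw := fun h1 h2 => m2 h1 h2 w i1.mt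
      have pw := F.poke w i1.mt
      unfold Meets at pw
      unfold InH at i3
      unfold Rgt at i5
      unfold InSq at mw
      rw [le_max_iff, min_add_le] at dc
      dsimp only at fw mw
      rcases i2 with rfl | rfl
      · clear m1 m2 k1 k2 pc fc fc' he d o o'
        grind (splits := 20)
      · linarith
    · have := Ring.own_inSq o' ha d
      unfold InSq at this d; grind
  rcases k3 with k3 | k3
  · exact fc k3 (by linarith) (by linarith)
  · exact fc' (by linarith) (by linarith) (by linarith)

namespace Ring

variable {R : Ring S N A B K}

theorem own_left (F : Face S N A B K) (o : R.Own c e) (he : e.1 = A.1) :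
    InSq N c A ∨ InSq N c (A.1, B.2) := by
  obtain ⟨hl1, hl2⟩ := F.lt
  rcases o with ⟨-, ⟨g, o⟩ | ⟨g, o⟩ | ⟨g, o⟩ | ⟨g, o⟩⟩
  · rcases R.left.side.own_mem o with rfl | rfl
    · exact Or.inl R.left.inl
    · exact Or.inr R.left.inm
  · linarith
  · left; rw [he] at o; exact R.bottom.own_lo hl1.le o
  · right; rw [he] at o; exact R.top.own_lo hl1.le o

theorem own_bottom (F : Face S N A B K) (o : R.Own c e) (he : e.2 = A.2) :
    InSq N c A ∨ InSq N c (B.1, A.2) := by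
  obtain ⟨hl1, hl2⟩ := F.lt
  rcases o with ⟨-, ⟨g, o⟩ | ⟨g, o⟩ | ⟨g, o⟩ | ⟨g, o⟩⟩
  · left; rw [he] at o; exact R.left.side.own_lo hl2.le o
  · right; rw [he] at o; exact R.right.own_lo hl2.le o
  · rcases R.bottom.own_mem o with rfl | rfl
    · exact Or.inl R.bottom.inl
    · exact Or.inr R.bottom.inm
  · linarith

theorem own_top (F : Face S N A B K) (o : R.Own c e) (he : e.2 = B.2) :
    InSq N c (A.1, B.2) ∨ InSq N c B := by
  obtain ⟨hl1, hl2⟩ := F.lt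
  rcases o with ⟨-, ⟨g, o⟩ | ⟨g, o⟩ | ⟨g, o⟩ | ⟨g, o⟩⟩
  · left; rw [he] at o; exact R.left.side.own_hi hl2.le o
  · right; rw [he] at o; exact R.right.own_hi hl2.le o
  · linarith
  · rcases R.top.own_mem o with rfl | rfl
    · exact Or.inl R.top.inl
    · exact Or.inr R.top.inm

theorem own_maxl (F : Face S N A B K) (o : R.Own c e) (he : e.1 = A.1) (hne : e ≠ A)
    (hcA : c.2 + N = A.2) (b : Plane) (hb : b ∈ S) (hbA : InSq N b A) :
    b.2 < c.2 ∨ (b.2 = c.2 ∧ c.1 ≤ b.1) := by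
  obtain ⟨hl1, hl2⟩ := F.lt
  have k : ¬InSq N c (A.1, B.2) := fun k => by have := k.2.2.2; dsimp only at this; linarith
  have : c = R.ll := by
    rcases o with ⟨-, ⟨g, o⟩ | ⟨g, o⟩ | ⟨g, o⟩ | ⟨g, o⟩⟩
    · refine (R.left.side.own_mem o).resolve_right fun e => k ?_
      rw [e]; exact R.left.inm
    · linarith
    · exact (hne (Prod.ext he g)).elim
    · rw [he] at o; exact (k (R.top.own_lo hl1.le o)).elim
  rw [this]
  exact R.left.maxl b hb hbA

theorem own_minm (F : Face S N A B K) (o : R.Own c e) (he : e.1 = A.1) (hne : e ≠ (A.1, B.2))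
    (hcA : c.2 = B.2) (b : Plane) (hb : b ∈ S) (hbA : InSq N b (A.1, B.2)) :
    c.2 < b.2 ∨ (b.2 = c.2 ∧ c.1 ≤ b.1) := by
  obtain ⟨hl1, hl2⟩ := F.lt
  have k : ¬InSq N c A := fun k => by have := k.2.2.1; linarith
  have : c = R.lu := by
    rcases o with ⟨-, ⟨g, o⟩ | ⟨g, o⟩ | ⟨g, o⟩ | ⟨g, o⟩⟩
    · refine (R.left.side.own_mem o).resolve_left fun e => k ?_
      rw [e]; exact R.left.inl
    · linarith
    · rw [he] at o; exact (k (R.bottom.own_lo hl1.le o)).elim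
    · exact (hne (Prod.ext he g)).elim
  rw [this]
  exact R.left.minm b hb hbA

end Ring

/-- A square on the left of the owner of a part of the boundary has at most one exit point in this
part. -/
theorem exit_unique_of_own (h : SatPack S N) (F : Face S N A B K) {R : Ring S N A B K} (ha : a ∈ S)
    (hne : a ≠ c) (hac : a.1 < c.1) (haB : a.1 + N < B.1) (o : R.Own c e) (o' : R.Own c e')
    (he : e ∈ exitPoints S N K a) (he' : e' ∈ exitPoints S N K a) : e = e' := by
  have hc : c ∈ S := Ring.own_mem_S o
  -- Since `a` does not reach the right side, its exit points lie on the other three sides. `low`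
  -- and `upp` deal with the left corners, and `opp` with the top and bottom sides.
  have low : ∀ {e e'}, R.Own c e → R.Own c e' →
      ((VExit S N K a e ∧ e.1 = A.1) ∨ (e = A ∧ InSq N a A)) →
      ((HExit S N K a e' ∧ e'.2 = A.2) ∨ (e' = A ∧ InSq N a A)) → e = e' := by
    intro e e' o o' k k'
    by_contra hee
    have e1 : e.1 = A.1 := by rcases k with k | k; exacts [k.2, by rw [k.1]]
    have e2 : e'.2 = A.2 := by rcases k' with k | k; exacts [k.2, by rw [k.1]]
    have c1 := Ring.own_left F o e1
    have c2 := Ring.own_bottom F o' e2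
    refine F.own_corner h ha hc hne hac ?_ k k' hee (Ring.own_maxl F o e1)
    unfold InSq at *; dsimp only at *; grind
  have upp : ∀ {e e'}, R.Own c e → R.Own c e' →
      ((VExit S N K a e ∧ e.1 = A.1) ∨ (e = (A.1, B.2) ∧ InSq N a (A.1, B.2))) →
      ((HExit S N K a e' ∧ e'.2 = B.2) ∨ (e' = (A.1, B.2) ∧ InSq N a (A.1, B.2))) →
      e = e' := by
    intro e e' o o' k k'
    by_contra hee
    have e1 : e.1 = A.1 := by rcases k with k | k; exacts [k.2, by rw [k.1]]
    have e2 : e'.2 = B.2 := by rcases k' with k | k; exacts [k.2, by rw [k.1]]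
    have c1 := Ring.own_left F o e1
    have c2 := Ring.own_top F o' e2
    have c3 : InSq N c (A.1, B.2) := by unfold InSq at *; dsimp only at *; grind
    refine F.flip.own_corner h.flip (flipS_mk ha) (flipS_mk hc) ?_ hac c3.flip
      (e := (e.1, -e.2)) (e' := (e'.1, -e'.2)) ?_ ?_ ?_ ?_
    · rw [Ne, Prod.mk.injEq]
      exact fun g => hne (Prod.ext g.1 (by linarith [g.2]))
    · exact k.imp (fun k => ⟨k.1.flip, k.2⟩) fun k => ⟨by rw [k.1], k.2.flip⟩
    · exact k'.imp (fun k => ⟨k.1.flip, by dsimp only; linarith [k.2]⟩)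
        fun k => ⟨by rw [k.1], k.2.flip⟩
    · rw [Ne, Prod.mk.injEq]
      exact fun g => hee (Prod.ext g.1 (by linarith [g.2]))
    · intro g1 g2 b hb hbA
      have hb' := flipS_mk (N := N) hb
      rw [flipS_flipS] at hb'
      have g3 := hbA.flip
      dsimp only at g2 g3
      rw [neg_neg] at g3
      have := Ring.own_minm F o e1 (fun g => g1 (by rw [g])) (by linarith) _ hb' g3
      grind
  have cases : ∀ {e}, e ∈ exitPoints S N K a → (VExit S N K a e ∧ e.1 = A.1) ∨
      (HExit S N K a e ∧ e.2 = A.2) ∨ (HExit S N K a e ∧ e.2 = B.2) ∨ (e = A ∧ InSq N a A) ∨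
        (e = (A.1, B.2) ∧ InSq N a (A.1, B.2)) := by
    intro e he
    rcases F.exit_cases h he with d | d | ⟨d, d1, d2⟩
    · have := d.side h F
      exact Or.inl ⟨d, this.1.resolve_right (by linarith)⟩
    · rcases (d.side h F).1 with k | k
      · exact Or.inr (Or.inl ⟨d, k⟩)
      · exact Or.inr (Or.inr (Or.inl ⟨d, k⟩))
    · have d1 := d1.resolve_right (by linarith [d.2.1])
      rcases d2 with k | k
      · have : e = A := Prod.ext d1 k
        exact Or.inr (Or.inr (Or.inr (Or.inl ⟨this, this ▸ d⟩)))
      · have : e = (A.1, B.2) := Prod.ext d1 k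
        exact Or.inr (Or.inr (Or.inr (Or.inr ⟨this, this ▸ d⟩)))
  have bot : ∀ {e e'}, HExit S N K a e → e.2 = A.2 → HExit S N K a e' → e'.2 = A.2 → e = e' := by
    intro e e' d k d' k'
    have := F.swap.vexit_unique_left h.swap d.swap d'.swap k k'
    rw [Prod.mk.injEq] at this
    exact Prod.ext this.2 this.1
  have top : ∀ {e e'}, HExit S N K a e → e.2 = B.2 → HExit S N K a e' → e'.2 = B.2 → e = e' := by
    intro e e' d k d' k'
    have := F.flip.swap.vexit_unique_left h.flip.swap d.flip.swap d'.flip.swap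
      (by dsimp only; linarith) (by dsimp only; linarith)
    rw [Prod.mk.injEq] at this
    exact Prod.ext this.2 (by linarith [this.1])
  have opp : ∀ {e e'}, R.Own c e → R.Own c e' →
      ((HExit S N K a e ∧ e.2 = A.2) ∨ (e = A ∧ InSq N a A)) →
      ((HExit S N K a e' ∧ e'.2 = B.2) ∨ (e' = (A.1, B.2) ∧ InSq N a (A.1, B.2))) → e = e' :=
    fun o o' k k' => (F.own_opposite h R ha hne hac haB o o' k k').elim
  rcases cases he with k | k | k | k | k <;> rcases cases he' with k' | k' | k' | k' | k'
  · exact F.vexit_unique_left h k.1 k'.1 k.2 k'.2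
  · exact low o o' (Or.inl k) (Or.inl k')
  · exact upp o o' (Or.inl k) (Or.inl k')
  · exact low o o' (Or.inl k) (Or.inr k')
  · exact upp o o' (Or.inl k) (Or.inr k')
  · exact (low o' o (Or.inl k') (Or.inl k)).symm
  · exact bot k.1 k.2 k'.1 k'.2
  · exact opp o o' (Or.inl k) (Or.inl k')
  · exact (low o' o (Or.inr k') (Or.inl k)).symm
  · exact opp o o' (Or.inl k) (Or.inr k')
  · exact (upp o' o (Or.inl k') (Or.inl k)).symm
  · exact (opp o' o (Or.inl k') (Or.inl k)).symm
  · exact top k.1 k.2 k'.1 k'.2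
  · exact (opp o' o (Or.inr k') (Or.inl k)).symm
  · exact (upp o' o (Or.inr k') (Or.inl k)).symm
  · exact (low o' o (Or.inl k') (Or.inr k)).symm
  · exact low o o' (Or.inr k) (Or.inl k')
  · exact opp o o' (Or.inr k) (Or.inl k')
  · exact k.1.trans k'.1.symm
  · exact opp o o' (Or.inr k) (Or.inr k')
  · exact (upp o' o (Or.inl k') (Or.inr k)).symm
  · exact (opp o' o (Or.inl k') (Or.inr k)).symm
  · exact upp o o' (Or.inr k) (Or.inl k')
  · exact (opp o' o (Or.inr k') (Or.inr k)).symm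
  · exact k.1.trans k'.1.symm

end Face

/-! ### The pieces of a tile and the curves -/

/-- `z` belongs to a piece of the tile of the square at `a`: to the square, to one of its arms, where
for the horizontal arms on its right `z` belongs to the half-arm, or to the part of a sector of `a`
inside the cross. -/
inductive Piece (S : Set Plane) (N : ℝ) (a z : Plane) : Prop
  | sq : InSq N a z → Piece S N a z
  | varm (v w : Plane) : VArm S N v w → (a = v ∨ a = w) → InV N v w z → Piece S N a z
  | left (t : Plane) : HArm S N t a → InH N t a z → Piece S N a z
  | right (t : Plane) : HArm S N a t → InH N a t z → z.1 - (a.1 + N) ≤ t.1 - z.1 → Piece S N a z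
  | cross (A B : Plane) (K : Set Plane) (x : Plane) : Face S N A B K → z ∈ K →
      z ∈ connectedComponentIn (interior (Icc A B) \ decoration S N K (midpoint ℝ A B)) x →
      ((∃ y ∈ closure (connectedComponentIn
          (interior (Icc A B) \ decoration S N K (midpoint ℝ A B)) x) ∩ frontier (Icc A B) ∩
            squareAt N a, y ∉ allExitPoints S N K) ∨
        ∃ e ∈ exitPoints S N K a ∩ closure (connectedComponentIn
          (interior (Icc A B) \ decoration S N K (midpoint ℝ A B)) x),
          ∃ e' ∈ exitPoints S N K a ∩ closure (connectedComponentIn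
          (interior (Icc A B) \ decoration S N K (midpoint ℝ A B)) x), e ≠ e') → Piece S N a z

/-- Every point of a tile is a limit of points of its pieces. -/
theorem SatPack.piece_of_mem (h : SatPack S N) {a z : Plane} (hz : z ∈ robinsonTile S N a) {ε : ℝ}
    (hε : 0 < ε) : ∃ w, |w.1 - z.1| < ε ∧ |w.2 - z.2| < ε ∧ Piece S N a w := by
  have hN := h.pos
  rcases hz with (hz | hz) | hz
  · exact ⟨z, by simpa, by simpa, .sq (mem_squareAt.1 hz)⟩
  · refine ⟨z, by simpa, by simpa, ?_⟩
    obtain ⟨t, D, hD, hz, hd⟩ := hz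
    rcases isArm_iff.1 hD with ⟨d, rfl⟩ | ⟨d, rfl⟩ | ⟨d, rfl⟩ | ⟨d, rfl⟩ | ⟨-, -, -, -, rfl⟩
    · exact .varm _ _ d (Or.inl rfl) hz
    · exact .varm _ _ d (Or.inr rfl) hz
    · refine .right _ d hz ?_
      obtain ⟨z1, z2, z3, z4, z5, z6⟩ := hz
      have k1 : Metric.infDist z (squareAt N t) ≤ t.1 - z.1 := by
        have : ((t.1, z.2) : Plane) ∈ squareAt N t := by
          rw [mem_squareAt]; unfold InSq; dsimp only; refine ⟨?_, ?_, ?_, ?_⟩ <;> linarith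
        refine (Metric.infDist_le_dist_of_mem this).trans ?_
        rw [Prod.dist_eq, Real.dist_eq, Real.dist_eq, abs_sub_comm]
        dsimp only
        rw [sub_self, abs_zero, abs_of_nonneg (by linarith)]
        exact max_le le_rfl (by linarith)
      have k2 : z.1 - (a.1 + N) ≤ Metric.infDist z (squareAt N a) := by
        refine (Metric.le_infDist ⟨a, by rw [mem_squareAt]; unfold InSq; simp [hN.le]⟩).2 ?_
        intro w hw
        rw [mem_squareAt] at hw
        refine le_trans ?_ (le_max_left _ _)
        rw [Real.dist_eq]
        exact le_trans (by linarith [hw.2.1]) (le_abs_self _)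
      exact k2.trans (hd.trans k1)
    · exact .left _ d hz
    · exact .sq hz.1
  · obtain ⟨K, σ, hK, hσ, hz⟩ := hz
    obtain ⟨A, B, F⟩ := h.exists_face hK
    obtain ⟨A', B', hA', hB', ⟨x, -, rfl⟩, o⟩ := hσ
    obtain rfl := hA'.unique F.glb
    obtain rfl := hB'.unique F.lub
    obtain ⟨w, ⟨hw, hwK⟩, hd⟩ := Metric.mem_closure_iff.1 hz ε hε
    rw [dist_comm, Prod.dist_eq, max_lt_iff, Real.dist_eq, Real.dist_eq] at hd
    exact ⟨w, hd.1, hd.2, .cross _ _ K x F hwK hw o⟩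

namespace VCurve

variable {g : ℤ → Plane} {z w a b x : Plane} {k j : ℤ} {A B : Plane} {K : Set Plane} {r : ℝ}

theorem closure_box {x₁ x₂ y₁ y₂ : ℝ} (h1 : x₁ < x₂) (h2 : y₁ < y₂) {C : Set Plane}
    (h : Ioo x₁ x₂ ×ˢ Ioo y₁ y₂ ⊆ C) : Icc x₁ x₂ ×ˢ Icc y₁ y₂ ⊆ closure C := by
  have := closure_mono h
  rwa [closure_prod_eq, closure_Ioo h1.ne, closure_Ioo h2.ne] at this

theorem sq_left (h : SatPack S N) (ha : openSq N a ⊆ LeftOf N g) (hz : InSq N a z) :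
    z ∈ closure (LeftOf N g) := by
  have hN := h.pos
  exact closure_box (by linarith) (by linarith) ha ⟨⟨hz.1, hz.2.1⟩, hz.2.2⟩

theorem arm_left (h : SatPack S N) (c : VCurve S N g) (ha : openSq N a ⊆ LeftOf N g) {D : Set Plane}
    (hD : IsArm S N a b D) (hz : z ∈ D) : z ∈ closure (LeftOf N g) := by
  have hN := h.pos
  rcases isArm_iff.1 hD with ⟨d, rfl⟩ | ⟨d, rfl⟩ | ⟨d, rfl⟩ | ⟨d, rfl⟩ | ⟨-, -, -, -, rfl⟩
  · obtain ⟨z1, z2, z3, z4, z5, z6⟩ := hz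
    obtain ⟨e1, e2, e3⟩ := d.ab
    refine closure_box ?_ (by linarith) (c.varm_left h d ha)
      ⟨⟨max_le z1 z2, ?_⟩, by linarith, z6⟩ <;> rw [← min_add_add_right] <;> simp [*]
  · obtain ⟨z1, z2, z3, z4, z5, z6⟩ := hz
    obtain ⟨e1, e2, e3⟩ := d.ab
    refine closure_box ?_ (by linarith) (c.varm_left' h d ha)
      ⟨⟨max_le z1 z2, ?_⟩, z5, by linarith⟩ <;> rw [← min_add_add_right] <;> simp [*]
  · obtain ⟨z1, z2, z3, z4, z5, z6⟩ := hz
    obtain ⟨e1, e2, e3⟩ := d.ab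
    refine closure_box (by linarith) ?_ (c.harm_left h d ha)
      ⟨⟨by linarith, z6⟩, max_le z1 z2, ?_⟩ <;> rw [← min_add_add_right] <;> simp [*]
  · obtain ⟨z1, z2, z3, z4, z5, z6⟩ := hz
    obtain ⟨e1, e2, e3⟩ := d.ab
    refine closure_box (by linarith) ?_ (c.harm_left' h d ha)
      ⟨⟨z5, by linarith⟩, max_le z1 z2, ?_⟩ <;> rw [← min_add_add_right] <;> simp [*]
  · exact sq_left h ha hz.1

/-- A cross with a sector which belongs to a square on the left of the curve is on the left of the
curve. -/
theorem cross_left (h : SatPack S N) (c : VCurve S N g) (ha : a ∈ S) (hal : openSq N a ⊆ LeftOf N g)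
    (F : Face S N A B K) {C : Set Plane}
    (o : (∃ y ∈ closure C ∩ frontier (Icc A B) ∩ squareAt N a, y ∉ allExitPoints S N K) ∨
      ∃ e ∈ exitPoints S N K a ∩ closure C, ∃ e' ∈ exitPoints S N K a ∩ closure C, e ≠ e') :
    K ⊆ LeftOf N g := by
  have hcl : ∃ w ∈ closure K, w ∈ closure (LeftOf N g) := by
    rcases o with ⟨y, ⟨⟨-, hy⟩, hya⟩, -⟩ | ⟨e, ⟨⟨t, D, p, q, hD, h1, rfl⟩, -⟩, -⟩
    · obtain ⟨y1, y2, y3, y4⟩ := (Face.mem_frontier_box.1 hy).1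
      obtain ⟨w, hw, hwa⟩ := F.exists_touch h ha (mem_squareAt.1 hya) y1 y2 y3 y4
      exact ⟨w, hw, sq_left h hal hwa⟩
    · have : midpoint ℝ p q ∈ D ∩ closure K := h1 ▸ midpoint_mem_segment p q
      exact ⟨_, this.2, c.arm_left h hal hD this.1⟩
  obtain ⟨w, hw, hwl⟩ := hcl
  refine (c.subset_or_subset h F.conn fun z hz => ?_).resolve_right fun k =>
    c.closure_disjoint h hwl (closure_mono k hw)
  rintro ⟨k, hk | hk⟩
  · exact (F.free z hz).sq _ (c.mem k) hk
  · exact (F.free z hz).va _ _ (c k) hk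

/-- The tile of a square on the left of a curve does not cross the curve. -/
theorem piece_left (h : SatPack S N) (c : VCurve S N g) (ha : a ∈ S) (hal : openSq N a ⊆ LeftOf N g)
    (hz : Piece S N a z) : z ∈ closure (LeftOf N g) := by
  rcases hz with hz | ⟨v, w, d, rfl | rfl, hz⟩ | ⟨t, d, hz⟩ | ⟨t, d, hz, -⟩ | ⟨A, B, K, x, F, hz, hx, o⟩
  · exact sq_left h hal hz
  · exact c.arm_left h hal (isArm_iff.2 (Or.inl ⟨d, rfl⟩)) hz
  · exact c.arm_left h hal (isArm_iff.2 (Or.inr (Or.inl ⟨d, rfl⟩))) hz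
  · exact c.arm_left h hal (isArm_iff.2 (Or.inr (Or.inr (Or.inr (Or.inl ⟨d, rfl⟩))))) hz
  · exact c.arm_left h hal (isArm_iff.2 (Or.inr (Or.inr (Or.inl ⟨d, rfl⟩)))) hz
  · exact subset_closure (c.cross_left h ha hal F o hz)

end VCurve

namespace Face

variable {A B a b c y z w e e' x : Plane} {K : Set Plane} {r : ℝ}

/-- The owner of a sector of `a` is `a`, or lies on the left of `a` where `a` does not reach the right
side of the cross. -/
theorem owner_le (h : SatPack S N) (F : Face S N A B K) {R : Ring S N A B K} (ha : a ∈ S)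
    {C : Set Plane} (hC : ∀ y ∈ closure C, y ∈ frontier (Icc A B) → R.Own c y)
    (o : (∃ y ∈ closure C ∩ frontier (Icc A B) ∩ squareAt N a, y ∉ allExitPoints S N K) ∨
      ∃ e ∈ exitPoints S N K a ∩ closure C, ∃ e' ∈ exitPoints S N K a ∩ closure C, e ≠ e')
    (haB : a.1 + N < B.1) : c.1 ≤ a.1 := by
  by_contra! hac
  have hne : a ≠ c := by rintro rfl; exact hac.false
  have hfr : ∀ e ∈ exitPoints S N K a, e ∈ frontier (Icc A B) := by
    intro e he
    obtain ⟨hl1, hl2⟩ := F.lt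
    rw [mem_frontier_box]
    unfold InBox
    rcases F.exit_cases h he with d | d | ⟨-, d⟩
    · have := d.side h F
      grind
    · have := d.side h F
      grind
    · grind
  rcases o with ⟨y, ⟨⟨hy, hyf⟩, hya⟩, hye⟩ | ⟨e, ⟨he, hec⟩, e', ⟨he', hec'⟩, hee⟩
  · exact hye (Ring.exit_of_inSq h F (hC y hy hyf) ha (mem_squareAt.1 hya) hne)
  · exact hee (F.exit_unique_of_own h ha hne hac haB (hC e hec (hfr e he))
      (hC e' hec' (hfr e' he')) he he')

end Face

/-! ### Tiles near a narrow arm -/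

namespace Face

variable {A B a b c y z w e e' x : Plane} {K : Set Plane} {r : ℝ}

theorem le_proj (hp : 0 < gauge A B z) (hp' : gauge A B z ≤ 1) (hm : (A.1 + B.1) / 2 ≤ z.1) :
    z.1 ≤ (proj A B z).1 := by
  have : z.1 - (A.1 + B.1) / 2 ≤ (z.1 - (A.1 + B.1) / 2) / gauge A B z :=
    le_div_self (by linarith) hp hp'
  simp only [proj]
  linarith

/-- A point close to the lower side is not displaced much by the radial projection. -/
theorem proj_ge (h1 : A.1 < B.1) (hb : A.1 ≤ z.1) (hr : 0 < r) (hN : 200 * r ≤ N)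
    (h2 : z.2 - A.2 ≤ 4 * r) (h3 : 49 / 100 * N ≤ (B.2 - A.2) / 2) (h4 : B.1 - A.1 ≤ 3 * N)
    (hp : 0 < gauge A B z) (hp' : gauge A B z ≤ 1) :
    z.1 - 13 * r ≤ (proj A B z).1 ∧ (proj A B z).2 < B.2 := by
  set δ := 4 * r / ((B.2 - A.2) / 2) with hδ
  have hδ0 : 0 ≤ δ := div_nonneg (by linarith) (by linarith)
  have hg : 1 - δ ≤ gauge A B z := by
    refine le_trans ?_ (le_max_right _ _)
    rw [abs_of_neg (by linarith), le_div_iff₀ (by linarith), hδ, sub_mul,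
      div_mul_cancel₀ _ (by linarith)]
    linarith
  have hδ1 : δ * (49 / 100 * N) ≤ 4 * r := by
    calc δ * (49 / 100 * N) ≤ δ * ((B.2 - A.2) / 2) := mul_le_mul_of_nonneg_left h3 hδ0
      _ = 4 * r := div_mul_cancel₀ _ (by linarith)
  have hδ2 : δ ≤ 4 / 98 := by
    rw [hδ, div_le_div_iff₀ (by linarith) (by norm_num)]
    linarith
  constructor
  · rcases le_total ((A.1 + B.1) / 2) z.1 with k | k
    · linarith [le_proj hp hp' k]
    · simp only [proj]
      have : (z.1 - (A.1 + B.1) / 2) / gauge A B z ≥ z.1 - (A.1 + B.1) / 2 - 13 * r := by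
        rw [ge_iff_le, le_div_iff₀ hp]
        have e1 : ((A.1 + B.1) / 2 - z.1) * (1 - gauge A B z) ≤ 3 / 2 * N * δ :=
          mul_le_mul (by linarith) (by linarith) (by linarith) (by linarith)
        have e2 : 13 * r * (94 / 98) ≤ 13 * r * gauge A B z :=
          mul_le_mul_of_nonneg_left (by linarith) (by linarith)
        linarith
      linarith
  · simp only [proj]
    have : (z.2 - (A.2 + B.2) / 2) / gauge A B z < 0 := div_neg_of_neg_of_pos (by linarith) hp
    linarith

end Face

namespace VCurve

variable {g : ℤ → Plane} {z w a b x : Plane} {k j : ℤ} {A B : Plane} {K : Set Plane} {r : ℝ}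

/-- If `z` is a point of a cross on the left of a narrow arm and close to it, then the owner of the
radial projection of `z` reaches close to this arm. -/
theorem reach_cross (h : SatPack S N) (F : Face S N A B K) (R : Face.Ring S N A B K)
    (e : VArm S N p q) (hr : 0 < r) (hrN : 200 * r ≤ N)
    (k0 : p.1 < q.1) (k1 : x.1 - r < q.1) (k2 : p.1 + N < x.1 + r) (k4 : x.2 ≤ q.2 + 3 * r)
    (hz : InBox A B z) (z1 : x.1 - r < z.1) (z2 : z.2 < x.2 + r)
    (l1 : p.2 + N < z.2) (l2 : z.1 < q.1) (hzm : z ≠ midpoint ℝ A B)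
    (hw : R.Own w (Face.proj A B z)) : x.1 - 41 * r ≤ w.1 + N := by
  have hN := h.pos
  obtain ⟨hl1, hl2⟩ := F.lt
  have hp := Face.gauge_pos hl1 hl2 hzm
  have hp' := ((Face.gauge_lt_one hl1 hl2).2 hz).le
  obtain ⟨b1, b2, b3, b4⟩ := hz
  obtain ⟨e1, e2, e3⟩ := e.ab
  obtain ⟨s1, s2⟩ := F.size
  set y := Face.proj A B z with hy
  have hw0 := hw
  obtain ⟨⟨y1, y2, y3, y4⟩, o⟩ := hw
  by_cases hB : B.1 ≤ x.1 + 5 * r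
  · -- The right side of the rectangle is close to the arm.
    have hy1 : x.1 - 13 * r ≤ y.1 := by
      rcases le_total ((A.1 + B.1) / 2) z.1 with k | k
      · have := Face.le_proj hp hp' k; rw [← hy] at this; linarith
      · linarith
    rcases o with ⟨g, o⟩ | ⟨g, o⟩ | ⟨g, o⟩ | ⟨g, o⟩
    · rcases R.left.side.own_mem o with k | k
      · have := R.left.inl.2.1; rw [← k] at this; linarith
      · have := R.left.inm.2.1; rw [← k] at this; dsimp only at this; linarith
    · rcases R.right.own_mem o with k | k
      · have := R.right.inl.2.1; rw [← k] at this; dsimp only at this; linarith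
      · have := R.right.inm.2.1; rw [← k] at this; dsimp only at this; linarith
    · rcases R.bottom.own_coord o y1 y2 with k | k <;> linarith
    · rcases R.top.own_coord o y1 y2 with k | k <;> linarith
  · -- The upper square of the arm cuts out the lower right corner of the rectangle.
    push Not at hB
    have hq : A.1 < q.1 ∧ B.1 < q.1 + N ∧ q.2 < A.2 ∧ q.2 + N < B.2 := by
      have sp := F.varm_sep h e
      have pq := F.poke q e.mt
      have pp := F.poke p e.ms
      have dj := F.disj p e.ms q e.mt
      have hne : p ≠ q := fun e => by rw [e] at k0; exact k0.false
      unfold Meets at pq pp dj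
      have mq : q.1 < B.1 ∧ A.1 < q.1 + N ∧ A.2 < q.2 + N := ⟨by linarith, by linarith, by linarith⟩
      have hqA : q.2 ≤ A.2 := by
        by_contra! hc
        have hpq : q.2 = p.2 + N := by
          rcases sp with k | k | k | k | k | k | k <;> linarith
        have := dj ⟨by linarith, by linarith, by linarith, by linarith⟩
          ⟨by linarith, by linarith, by linarith, by linarith⟩ hne
        rcases this with k | k | k | k <;> linarith
      obtain ⟨m1, m2⟩ := pq ⟨mq.1, mq.2.1, by linarith, mq.2.2⟩
      rcases m1 with m1 | m1
      · linarith
      rcases m2 with m2 | m2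
      · exact ⟨m1.1, m1.2, m2.1, m2.2⟩
      · linarith
    obtain ⟨q1, q2, q3, q4⟩ := hq
    have hyp := Face.proj_ge (A := A) (B := B) (z := z) hl1 b1.le hr hrN (by linarith) (by linarith)
      (by linarith) hp hp'
    rw [← hy] at hyp
    obtain ⟨hy1, hy2⟩ := hyp
    have hqc : q ∈ S := e.mt
    rcases o with ⟨g, o⟩ | ⟨g, o⟩ | ⟨g, o⟩ | ⟨g, o⟩
    · rcases R.left.side.own_mem o with k | k
      · have := R.left.inl.2.1; rw [← k] at this; linarith
      · have := R.left.inm.2.1; rw [← k] at this; dsimp only at this; linarith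
    · rcases R.right.own_mem o with k | k
      · have := R.right.inl.2.1; rw [← k] at this; dsimp only at this; linarith
      · have := R.right.inm.2.1; rw [← k] at this; dsimp only at this; linarith
    · have hbr : q = R.br := Face.eq_of_openSq h e.mt R.bottom.hm (Face.mem_openSq.2
        ⟨by dsimp only; linarith, by dsimp only; linarith, by dsimp only; linarith,
          by dsimp only; linarith⟩) R.bottom.inm
      unfold Face.SideOwn at o
      rw [← hbr] at o
      rcases o with ⟨k, o | o⟩ | ⟨k, -⟩
      · rw [k, o]; linarith
      · rw [k]; linarith
      · rw [k]; linarith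
    · linarith

/-- Close to a narrow arm of a curve, the tiles of the squares on the left of the curve are those of
squares which reach close to this arm. -/
theorem reach_up (h : SatPack S N) (c : VCurve S N g) (ha : a ∈ S) (hal : openSq N a ⊆ LeftOf N g)
    (hr : 0 < r) (hrN : 200 * r ≤ N) (k0 : (g k).1 < (g (k + 1)).1) (k1 : x.1 - r < (g (k + 1)).1)
    (k2 : (g k).1 + N < x.1 + r) (k3 : (g k).2 + N - 3 * r ≤ x.2)
    (k4 : x.2 ≤ (g (k + 1)).2 + 3 * r) (hz : Piece S N a z) (z1 : |z.1 - x.1| < r)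
    (z2 : |z.2 - x.2| < r) : x.1 - N / 4 ≤ a.1 + N := by
  have hN := h.pos
  rw [abs_lt] at z1 z2
  obtain ⟨e1, e2, e3⟩ := (c k).ab
  rcases hz with hz | ⟨v, w, d, rfl | rfl, hz⟩ | ⟨t, d, hz⟩ | ⟨t, d, hz, hh⟩ |
    ⟨A, B, K, x', F, hz, hx, o⟩
  · linarith [hz.2.1]
  · linarith [hz.2.2.1]
  · linarith [hz.2.2.2.1]
  · linarith [hz.2.2.2.2.2]
  -- A point of the half-arm close to `x` would be far from `a`. Then the whole arm would extend
  -- beyond the narrow arm of the curve, which it cannot cross.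
  · by_contra! hcon
    obtain ⟨d1, d2, d3⟩ := d.ab
    obtain ⟨w1, w2, w3, w4, w5, w6⟩ := hz
    have hlt : max (max a.2 t.2) (z.2 - r) < min (min (a.2 + N) (t.2 + N)) (z.2 + r) := by
      rw [max_lt_iff, max_lt_iff, lt_min_iff, lt_min_iff, lt_min_iff, lt_min_iff, lt_min_iff,
        lt_min_iff]
      refine ⟨⟨⟨⟨?_, ?_⟩, ?_⟩, ⟨?_, ?_⟩, ?_⟩, ⟨?_, ?_⟩, ?_⟩ <;> linarith
    obtain ⟨y, y1, y2⟩ := exists_between hlt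
    rw [max_lt_iff, max_lt_iff] at y1
    rw [lt_min_iff, lt_min_iff] at y2
    have hon : ((((g k).1 + N + (g (k + 1)).1) / 2, y) : Plane) ∈ OnCurve N g := by
      by_cases m1 : y ≤ (g k).2 + N
      · refine ⟨k, Or.inl ?_⟩
        unfold InSq; dsimp only
        refine ⟨?_, ?_, ?_, ?_⟩ <;> linarith
      by_cases m2 : (g (k + 1)).2 ≤ y
      · refine ⟨k + 1, Or.inl ?_⟩
        unfold InSq; dsimp only
        refine ⟨?_, ?_, ?_, ?_⟩ <;> linarith
      · refine ⟨k, Or.inr ?_⟩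
        unfold InV; dsimp only
        refine ⟨?_, ?_, ?_, ?_, ?_, ?_⟩ <;> linarith
    have := c.harm_disj h d (z := (((g k).1 + N + (g (k + 1)).1) / 2, y)) y1.1.1 y1.1.2 y2.1.1
      y2.1.2 (by dsimp only; linarith) (by dsimp only; linarith) hon
    dsimp only at this
    rcases this with ⟨m, -⟩ | ⟨-, m⟩
    · exact c.notMem_of_left h hal m
    · linarith
  -- The owner of the sector, which reaches close to `x`, would lie on the right of `a`.
  · by_contra! hcon
    obtain ⟨R⟩ := F.exists_ring h
    have hK := c.cross_left h ha hal F o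
    obtain ⟨hbox, -⟩ := (F.mem z).1 hz
    obtain ⟨w, hw, hzm, hC⟩ := F.sector_own h R hx
    have hl := c.leftAt_of_mem h (hK hz) (k := k) (by linarith) (by linarith)
    have l1 : (g k).2 + N < z.2 := hl.2.2.1.resolve_right (by linarith)
    have l2 : z.1 < (g (k + 1)).1 := hl.2.2.2.2.resolve_left (by linarith)
    have := reach_cross h F R (c k) hr hrN k0 k1 k2 k4 hbox (by linarith) (by linarith) l1 l2 hzm hw
    have := F.owner_le h ha hC o (by linarith [hbox.2.1])
    linarith

end VCurve

/-! ### At most four tiles near a point -/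

/-- The tile of the square at `a` meets the open square with center `x` and side `2 * r`. -/
def Near (S : Set Plane) (N r : ℝ) (x a : Plane) : Prop :=
  ∃ z ∈ robinsonTile S N a, |z.1 - x.1| < r ∧ |z.2 - x.2| < r

/-- The vertical arm joining `p` to the square `q` above is narrow, and `x` is close to it. -/
def Narrow (N r : ℝ) (x p q : Plane) : Prop :=
  x.1 - r < max p.1 q.1 ∧ min p.1 q.1 + N < x.1 + r ∧ p.2 + N - 3 * r ≤ x.2 ∧ x.2 ≤ q.2 + 3 * r

variable {r : ℝ} {x a b c : Plane} {g : ℤ → Plane} {k : ℤ}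

theorem Near.swap (h : Near S N r x a) : Near (swapS S) N r (x.2, x.1) (a.2, a.1) := by
  obtain ⟨z, hz, h1, h2⟩ := h
  exact ⟨_, (packSym_swap S N).robinsonTile hz, h2, h1⟩

theorem Near.neg (h : Near S N r x a) : Near (negS S N) N r (-x.1, x.2) (-a.1 - N, a.2) := by
  obtain ⟨z, hz, h1, h2⟩ := h
  refine ⟨_, (packSym_neg S N).robinsonTile hz, ?_, h2⟩
  rw [abs_lt] at *
  simp only [negL_apply]
  constructor <;> linarith

theorem Near.flip (h : Near S N r x a) : Near (flipS S N) N r (x.1, -x.2) (a.1, -a.2 - N) :=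
  h.swap.neg.swap

theorem Near.exists_piece (hn : Near S N r x a) (h : SatPack S N) :
    ∃ z, |z.1 - x.1| < r ∧ |z.2 - x.2| < r ∧ Piece S N a z := by
  obtain ⟨z, hz, h1, h2⟩ := hn
  have hε : 0 < min (r - |z.1 - x.1|) (r - |z.2 - x.2|) := lt_min (by linarith) (by linarith)
  obtain ⟨w, w1, w2, hw⟩ := h.piece_of_mem hz hε
  rw [lt_min_iff] at w1 w2
  refine ⟨w, ?_, ?_, hw⟩
  · linarith [abs_sub_le w.1 z.1 x.1]
  · linarith [abs_sub_le w.2 z.2 x.2]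

theorem Narrow.neg (h : Narrow N r x p q) :
    Narrow N r (-x.1, x.2) (-p.1 - N, p.2) (-q.1 - N, q.2) := by
  unfold Narrow at *
  rw [lt_max_iff, ← min_add_add_right, min_lt_iff] at *
  dsimp only
  grind

theorem Narrow.flip (h : Narrow N r x p q) :
    Narrow N r (x.1, -x.2) (q.1, -q.2 - N) (p.1, -p.2 - N) := by
  obtain ⟨h1, h2, h3, h4⟩ := h
  refine ⟨by dsimp only; rwa [max_comm], by dsimp only; rwa [min_comm], ?_, ?_⟩ <;>
    dsimp only <;> linarith

/-- The curve reflected in the horizontal axis, with the reversed numbering. -/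
def flipC (N : ℝ) (g : ℤ → Plane) (k : ℤ) : Plane := ((g (-k)).1, -(g (-k)).2 - N)

theorem leftOf_flipC {z : Plane} (hz : z ∈ LeftOf N g) : (z.1, -z.2) ∈ LeftOf N (flipC N g) := by
  obtain ⟨k, hk⟩ := hz
  refine ⟨-k - 1, ?_⟩
  unfold LeftAt flipC at *
  rw [show -(-k - 1) = k + 1 by ring, show -(-k - 1 + 1) = k by ring]
  grind

namespace VCurve

theorem flip (c : VCurve S N g) : VCurve (flipS S N) N (flipC N g) := fun k => by
  have := (c (-k - 1)).flip
  rwa [show -k - 1 + 1 = -k by ring, show -k - 1 = -(k + 1) by ring] at this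

theorem left_flip (ha : openSq N a ⊆ LeftOf N g) :
    openSq N (a.1, -a.2 - N) ⊆ LeftOf N (flipC N g) := by
  rintro ⟨z1, z2⟩ ⟨h1, h2, h3⟩
  have := leftOf_flipC (ha (show (z1, -z2) ∈ openSq N a from
    ⟨h1, by dsimp only at *; linarith, by dsimp only at *; linarith⟩))
  simpa using this

theorem reach_left (h : SatPack S N) (c : VCurve S N g) (ha : a ∈ S)
    (hal : openSq N a ⊆ LeftOf N g) (hr : 0 < r) (hrN : 200 * r ≤ N)
    (hn : Narrow N r x (g k) (g (k + 1))) (han : Near S N r x a) : x.1 - N / 4 ≤ a.1 + N := by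
  have hN := h.pos
  rcases lt_trichotomy (g k).1 (g (k + 1)).1 with e | e | e
  · obtain ⟨z, z1, z2, hz⟩ := han.exists_piece h
    obtain ⟨n1, n2, n3, n4⟩ := hn
    rw [max_eq_right e.le] at n1
    rw [min_eq_left e.le] at n2
    exact c.reach_up h ha hal hr hrN e n1 n2 n3 n4 hz z1 z2
  · obtain ⟨n1, n2, -, -⟩ := hn
    rw [e, max_self] at n1
    rw [e, min_self] at n2
    linarith
  · obtain ⟨z, z1, z2, hz⟩ := han.flip.exists_piece h.flip
    obtain ⟨n1, n2, n3, n4⟩ := hn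
    rw [max_eq_left e.le] at n1
    rw [min_eq_right e.le] at n2
    have e1 : flipC N g (-k - 1) = ((g (k + 1)).1, -(g (k + 1)).2 - N) := by
      unfold flipC; rw [show -(-k - 1) = k + 1 by ring]
    have e2 : flipC N g (-k - 1 + 1) = ((g k).1, -(g k).2 - N) := by
      unfold flipC; rw [show -(-k - 1 + 1) = k by ring]
    refine c.flip.reach_up h.flip (a := (a.1, -a.2 - N)) (x := (x.1, -x.2)) (flipS_mk ha)
      (left_flip hal) hr hrN (k := -k - 1) ?_ ?_ ?_ ?_ ?_ hz
      z1 z2 <;> (try rw [e1]) <;> (try rw [e2]) <;> dsimp only <;> linarith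

theorem reach_right (h : SatPack S N) (c : VCurve S N g) (ha : a ∈ S)
    (hal : openSq N a ⊆ RightOf N g) (hr : 0 < r) (hrN : 200 * r ≤ N)
    (hn : Narrow N r x (g k) (g (k + 1))) (han : Near S N r x a) : a.1 ≤ x.1 + N / 4 := by
  have := c.neg.reach_left h.neg (negS_mk ha) (right_neg hal) hr hrN (k := k) hn.neg han.neg
  dsimp only at this
  linarith

theorem near_left (h : SatPack S N) (c : VCurve S N g) (ha : a ∈ S)
    (hal : openSq N a ⊆ LeftOf N g) (han : Near S N r x a) :
    ∃ z ∈ LeftOf N g, |z.1 - x.1| < r ∧ |z.2 - x.2| < r := by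
  obtain ⟨z, z1, z2, hz⟩ := han.exists_piece h
  have hε : 0 < min (r - |z.1 - x.1|) (r - |z.2 - x.2|) := lt_min (by linarith) (by linarith)
  obtain ⟨w, hw, hd⟩ := Metric.mem_closure_iff.1 (c.piece_left h ha hal hz) _ hε
  rw [dist_comm, Prod.dist_eq, max_lt_iff, Real.dist_eq, Real.dist_eq, lt_min_iff, lt_min_iff] at hd
  refine ⟨w, hw, ?_, ?_⟩
  · linarith [abs_sub_le w.1 z.1 x.1]
  · linarith [abs_sub_le w.2 z.2 x.2]

theorem near_right (h : SatPack S N) (c : VCurve S N g) (ha : a ∈ S)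
    (hal : openSq N a ⊆ RightOf N g) (han : Near S N r x a) :
    ∃ z ∈ RightOf N g, |z.1 - x.1| < r ∧ |z.2 - x.2| < r := by
  obtain ⟨z, hz, z1, z2⟩ := c.neg.near_left h.neg (negS_mk ha) (right_neg hal) han.neg
  refine ⟨(-z.1, z.2), ?_, ?_, z2⟩
  · rw [← leftOf_negC]; simpa using hz
  · dsimp only at *; rw [abs_lt] at *; constructor <;> linarith

/-- Tiles on both sides of a curve come close to each other only near a narrow arm. -/
theorem exists_narrow (h : SatPack S N) (c : VCurve S N g) (ha : a ∈ S)
    (hal : openSq N a ⊆ LeftOf N g) (hb : b ∈ S) (hbr : openSq N b ⊆ RightOf N g) (hr : 0 < r)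
    (hrN : 200 * r ≤ N) (han : Near S N r x a) (hbn : Near S N r x b) :
    ∃ k, Narrow N r x (g k) (g (k + 1)) := by
  obtain ⟨z, hz, z1, z2⟩ := c.near_left h ha hal han
  obtain ⟨w, hw, w1, w2⟩ := c.near_right h hb hbr hbn
  rw [abs_lt] at z1 z2 w1 w2
  obtain ⟨k, k1, k2, k3, k4⟩ := c.narrow h hz hw (r := r) (by linarith)
    (by rw [abs_le]; constructor <;> linarith) (by rw [abs_le]; constructor <;> linarith)
  refine ⟨k, ?_, ?_, by linarith, by linarith⟩
  · rw [lt_max_iff]; exact k1.imp (fun k => by linarith) fun k => by linarith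
  · rw [← min_add_add_right, min_lt_iff]
    exact k2.imp (fun k => by linarith) fun k => by linarith

/-- There are no three tiles near a point in a row. -/
theorem _root_.SatPack.not_chain (h : SatPack S N) (hr : 0 < r) (hrN : 200 * r ≤ N)
    (ha : a ∈ S) (hb : b ∈ S) (hc : c ∈ S) (han : Near S N r x a) (hcn : Near S N r x c)
    (hab : HLt S N a b) (hbc : HLt S N b c) : False := by
  have hN := h.pos
  obtain ⟨t, ht, h1, -, h2⟩ := h.exists_up hb
  obtain ⟨g, hg, g0, -⟩ := h.exists_vcurve ⟨hb, ht, h1, Or.inl h2⟩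
  have hbg : b ∈ range g := ⟨0, g0⟩
  have hal := hg.left_of_hlt h hab hbg
  have hcr := hg.right_of_hlt h hbc hbg
  obtain ⟨k, hk⟩ := hg.exists_narrow h ha hal hc hcr hr hrN han hcn
  have e1 := hg.reach_left h ha hal hr hrN hk han
  have e2 := hg.reach_right h hc hcr hr hrN hk hcn
  linarith [hab.le, hbc.le]

theorem mono (c : VCurve S N g) {i j : ℤ} (hij : i ≤ j) :
    (g j).1 - (g i).1 ≤ (g j).2 - (g i).2 ∧ (g i).1 - (g j).1 ≤ (g j).2 - (g i).2 := by
  rcases hij.eq_or_lt with rfl | e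
  · simp
  · have := (c.vlt e).lt
    exact ⟨this.1.le, this.2.le⟩

theorem exists_overlap (h : SatPack S N) (c : VCurve S N g) (y : ℝ) :
    ∃ j, (g j).2 < y + N ∧ y < (g j).2 + N := by
  have hN := h.pos
  obtain ⟨j, j1, j2⟩ := c.exists_level h (y + N / 2)
  have := h.varm_gap (c j)
  rcases lt_or_ge y ((g j).2 + N) with e | e
  · exact ⟨j, by linarith, e⟩
  · exact ⟨j + 1, by linarith, by linarith⟩

theorem exists_beside_left (h : SatPack S N) (c : VCurve S N g)
    (ha : a ∈ range g ∨ openSq N a ⊆ LeftOf N g) :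
    ∃ j, ((g j).2 < a.2 + N ∧ a.2 < (g j).2 + N) ∧ (a = g j ∨ a.1 + N ≤ (g j).1) := by
  have hN := h.pos
  rcases ha with ⟨j, rfl⟩ | ha
  · exact ⟨j, ⟨by linarith, by linarith⟩, Or.inl rfl⟩
  · obtain ⟨j, j1, j2⟩ := c.exists_overlap h a.2
    exact ⟨j, ⟨j1, j2⟩, Or.inr (c.le_of_left h ha j2 j1)⟩

theorem exists_beside_right (h : SatPack S N) (c : VCurve S N g)
    (ha : a ∈ range g ∨ openSq N a ⊆ RightOf N g) :
    ∃ j, ((g j).2 < a.2 + N ∧ a.2 < (g j).2 + N) ∧ (a = g j ∨ (g j).1 + N ≤ a.1) := by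
  have hN := h.pos
  rcases ha with ⟨j, rfl⟩ | ha
  · exact ⟨j, ⟨by linarith, by linarith⟩, Or.inl rfl⟩
  · obtain ⟨j, j1, j2⟩ := c.exists_overlap h a.2
    exact ⟨j, ⟨j1, j2⟩, Or.inr (c.ge_of_right h ha j2 j1)⟩

end VCurve

theorem SatPack.exists_vcurve_through (h : SatPack S N) (hb : b ∈ S) :
    ∃ g, VCurve S N g ∧ g 0 = b := by
  obtain ⟨t, ht, h1, -, h2⟩ := h.exists_up hb
  obtain ⟨g, hg, g0, -⟩ := h.exists_vcurve ⟨hb, ht, h1, Or.inl h2⟩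
  exact ⟨g, hg, g0⟩

/-- Near narrow arms of both directions there are only the tiles of squares which reach close to the
crossing. -/
theorem SatPack.le_of_narrow (h : SatPack S N) (hr : 0 < r) (hrN : 200 * r ≤ N) (ha : a ∈ S)
    (han : Near S N r x a) (v : VArm S N p q) (hv : Narrow N r x p q) (v' : VArm (swapS S) N s t)
    (hv' : Narrow N r (x.2, x.1) s t) : a.1 ≤ x.1 + N / 4 := by
  have hN := h.pos
  by_contra! hcon
  obtain ⟨g, hg, rfl, rfl⟩ := h.exists_vcurve v
  obtain ⟨f, hf, rfl, rfl⟩ := h.swap.exists_vcurve v'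
  have e := v.ab
  have e' := v'.ab
  have l1 : a ∈ range g ∨ openSq N a ⊆ LeftOf N g := by
    by_cases hag : a ∈ range g
    · exact Or.inl hag
    · refine Or.inr ((hg.sq_left_or_right h ha hag).resolve_right fun k => ?_)
      linarith [hg.reach_right h ha k hr hrN (k := 0) hv han]
  obtain ⟨j, ⟨j1, j2⟩, j3⟩ := hg.exists_beside_left h l1
  have low := fun k => hf.reach_left h.swap (a := (a.2, a.1)) ha k hr hrN (k := 0) hv' han.swap
  have upp := fun k => hf.reach_right h.swap (a := (a.2, a.1)) ha k hr hrN (k := 0) hv' han.swap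
  have side := fun k => hf.sq_left_or_right h.swap (a := (a.2, a.1)) ha k
  dsimp only at low upp
  unfold Narrow at hv hv'
  rw [lt_max_iff, ← min_add_add_right, min_lt_iff] at hv hv'
  unfold Abv at e e'
  dsimp only at hv'
  obtain ⟨n1, n2, n3, n4⟩ := hv
  obtain ⟨n1', n2', n3', n4'⟩ := hv'
  have c0 : (g 0).1 < x.1 + r := by rcases n2 with k | k <;> linarith [e.2.1]
  have c1 : (g 1).1 < x.1 + r := by rcases n2 with k | k <;> linarith [e.2.2]
  have hrow : a.2 + N ≤ (g 0).2 ∨ (g 1).2 + N ≤ a.2 := by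
    rcases l1 with ⟨i, rfl⟩ | l1
    · rcases lt_trichotomy i 0 with i0 | rfl | i0
      · exact Or.inl (hg.row_le h i0)
      · linarith
      · rcases (show 1 ≤ i by omega).eq_or_lt with rfl | i1
        · linarith
        · exact Or.inr (hg.row_le h i1)
    · by_contra! hc
      have g0 := fun k1 k2 => hg.le_of_left h l1 (k := 0) k1 k2
      have g1 := fun k1 k2 => hg.le_of_left h l1 (k := 1) k1 k2
      have := h.varm_gap v
      rcases lt_or_ge a.2 ((g 0).2 + N) with k | k
      · linarith [g0 k hc.1]
      · linarith [g1 hc.2 (by linarith)]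
  have hg0 : g 0 ∈ S := v.ms
  have hg1 : g 1 ∈ S := v.mt
  have hf1 : ((f 1).2, (f 1).1) ∈ S := v'.mt
  -- Following the curves from `a` to the crossing bounds `a.1 + a.2`, respectively `a.1 - a.2`, from
  -- above and from below, so that the two arms have a common square there.
  rcases hrow with hrow | hrow
  · have j0 : j ≤ 0 := by
      by_contra! k
      linarith [hg.row_le h k]
    have d1 : a.1 + a.2 < (g 0).1 + (g 0).2 := by
      rcases j3 with rfl | j3
      · have : j ≠ 0 := by rintro rfl; linarith
        linarith [(hg.vlt (lt_of_le_of_ne j0 this)).lt.2]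
      · linarith [(hg.mono j0).2, (hg.mono j0).1]
    have l2 : (a.2, a.1) ∈ range f ∨ openSq N (a.2, a.1) ⊆ RightOf N f := by
      by_cases haf : (a.2, a.1) ∈ range f
      · exact Or.inl haf
      · refine Or.inr ((side haf).resolve_left fun k => ?_)
        linarith [low k]
    obtain ⟨i, ⟨i1, i2⟩, i3⟩ := hf.exists_beside_right h.swap l2
    dsimp only at i1 i2 i3
    have i0 : 1 ≤ i := by
      by_contra! k
      have := hf.mono (show i ≤ 0 by omega)
      linarith
    have d2 : (f 1).1 + (f 1).2 ≤ a.1 + a.2 := by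
      rcases i3 with i3 | i3
      · have := hf.mono i0
        rw [← i3] at this
        dsimp only at this
        linarith
      · linarith [(hf.mono i0).1, (hf.mono i0).2]
    have hpq : g 0 = ((f 1).2, (f 1).1) := by
      refine h.eq_of_lt hg0 hf1 ?_ ?_ ?_ ?_ <;> dsimp only <;> grind
    rw [hpq] at d1
    dsimp only at d1
    linarith
  · have j0 : 1 ≤ j := by
      by_contra! k
      linarith [hg.row_le h k]
    have d1 : a.1 - a.2 < (g 1).1 - (g 1).2 := by
      rcases j3 with rfl | j3
      · have : 1 ≠ j := by rintro rfl; linarith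
        linarith [(hg.vlt (lt_of_le_of_ne j0 this)).lt.1]
      · linarith [(hg.mono j0).2, (hg.mono j0).1]
    have l2 : (a.2, a.1) ∈ range f ∨ openSq N (a.2, a.1) ⊆ LeftOf N f := by
      by_cases haf : (a.2, a.1) ∈ range f
      · exact Or.inl haf
      · refine Or.inr ((side haf).resolve_right fun k => ?_)
        linarith [upp k]
    obtain ⟨i, ⟨i1, i2⟩, i3⟩ := hf.exists_beside_left h.swap l2
    dsimp only at i1 i2 i3
    have i0 : 1 ≤ i := by
      by_contra! k
      have := hf.mono (show i ≤ 0 by omega)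
      linarith
    have d2 : (f 1).2 - (f 1).1 ≤ a.1 - a.2 := by
      rcases i3 with i3 | i3
      · have := hf.mono i0
        rw [← i3] at this
        dsimp only at this
        linarith
      · linarith [(hf.mono i0).1, (hf.mono i0).2]
    have hpq : g 1 = ((f 1).2, (f 1).1) := by
      refine h.eq_of_lt hg1 hf1 ?_ ?_ ?_ ?_ <;> dsimp only <;> grind
    rw [hpq] at d1
    dsimp only at d1
    linarith

/-- The bound of `le_of_narrow` in all four directions. -/
theorem SatPack.bounds_of_narrow (h : SatPack S N) (hr : 0 < r) (hrN : 200 * r ≤ N) (ha : a ∈ S)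
    (han : Near S N r x a) (v : VArm S N p q) (hv : Narrow N r x p q) (v' : VArm (swapS S) N s t)
    (hv' : Narrow N r (x.2, x.1) s t) :
    (a.1 ≤ x.1 + N / 4 ∧ x.1 - N / 4 ≤ a.1 + N) ∧ (a.2 ≤ x.2 + N / 4 ∧ x.2 - N / 4 ≤ a.2 + N) := by
  have key : ∀ {S : Set Plane} {a x p q s t : Plane}, SatPack S N → a ∈ S → Near S N r x a →
      VArm S N p q → Narrow N r x p q → VArm (swapS S) N s t → Narrow N r (x.2, x.1) s t →
      a.1 ≤ x.1 + N / 4 ∧ x.1 - N / 4 ≤ a.1 + N := by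
    intro S a x p q s t h ha han v hv v' hv'
    refine ⟨h.le_of_narrow hr hrN ha han v hv v' hv', ?_⟩
    have v2 : VArm (swapS (negS S N)) N (t.1, -t.2 - N) (s.1, -s.2 - N) := v'.flip
    have := h.neg.le_of_narrow hr hrN (negS_mk ha) han.neg v.neg hv.neg v2 hv'.flip
    dsimp only at this
    linarith
  exact ⟨key h ha han v hv v' hv', key h.swap (a := (a.2, a.1)) ha han.swap v' hv' v hv⟩

/-- A total relation on three elements contains a chain. -/
theorem exists_chain {α : Type*} {R : α → α → Prop} {a b c : α} (hab : R a b ∨ R b a)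
    (hbc : R b c ∨ R c b) (hac : R a c ∨ R c a) :
    ∃ x y z, (x = a ∨ x = b ∨ x = c) ∧ (y = a ∨ y = b ∨ y = c) ∧ (z = a ∨ z = b ∨ z = c) ∧
      R x y ∧ R y z := by
  rcases hab with k1 | k1 <;> rcases hbc with k2 | k2
  · exact ⟨a, b, c, by simp, by simp, by simp, k1, k2⟩
  · rcases hac with k3 | k3
    · exact ⟨a, c, b, by simp, by simp, by simp, k3, k2⟩
    · exact ⟨c, a, b, by simp, by simp, by simp, k3, k1⟩
  · rcases hac with k3 | k3
    · exact ⟨b, a, c, by simp, by simp, by simp, k1, k3⟩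
    · exact ⟨b, c, a, by simp, by simp, by simp, k2, k3⟩
  · exact ⟨c, b, a, by simp, by simp, by simp, k2, k1⟩

/-- Without narrow arms, the tiles near `x` lie on one side of the curve through each one of their
squares. Three squares for which this is the same side form a chain of the other direction. -/
theorem SatPack.card_near_le_of_not_narrow (h : SatPack S N) (hr : 0 < r) (hrN : 200 * r ≤ N)
    (hn : ∀ p q, HArm S N p q → ¬Narrow N r (x.2, x.1) (p.2, p.1) (q.2, q.1))
    (T : Finset Plane) (hT : ∀ a ∈ T, a ∈ S ∧ Near S N r x a) : T.card ≤ 4 := by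
  classical
  have hcv : ∀ b : Plane, ∃ g, b ∈ T → VCurve (swapS S) N g ∧ g 0 = (b.2, b.1) := by
    intro b
    by_cases hb : b ∈ T
    · obtain ⟨g, hg⟩ := h.swap.exists_vcurve_through (b := (b.2, b.1)) (hT b hb).1
      exact ⟨g, fun _ => hg⟩
    · exact ⟨fun _ => 0, fun hb' => (hb hb').elim⟩
  choose G hG using hcv
  -- The tiles near `x` lie on the lower side, or on the upper side, of the horizontal curve through
  -- `b`.
  set L : Plane → Prop := fun b =>
    ∀ a ∈ T, (a.2, a.1) ∈ range (G b) ∨ openSq N (a.2, a.1) ⊆ LeftOf N (G b) with hL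
  set U : Plane → Prop := fun b =>
    ∀ a ∈ T, (a.2, a.1) ∈ range (G b) ∨ openSq N (a.2, a.1) ⊆ RightOf N (G b) with hU
  have hLU : ∀ b ∈ T, ¬L b → U b := by
    intro b hb hLb a ha
    obtain ⟨hc, -⟩ := hG b hb
    simp only [hL] at hLb
    push Not at hLb
    obtain ⟨d, hd, hd1, hd2⟩ := hLb
    have hd3 := (hc.sq_left_or_right h.swap (a := (d.2, d.1)) (hT d hd).1 hd1).resolve_left hd2
    by_cases hag : (a.2, a.1) ∈ range (G b)
    · exact Or.inl hag
    refine Or.inr ((hc.sq_left_or_right h.swap (a := (a.2, a.1)) (hT a ha).1 hag).resolve_left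
      fun hal => ?_)
    obtain ⟨k, hk⟩ := hc.exists_narrow h.swap (a := (a.2, a.1)) (hT a ha).1 hal
      (b := (d.2, d.1)) (hT d hd).1 hd3 hr hrN (hT a ha).2.swap (hT d hd).2.swap
    exact hn _ _ (hc k).swap hk
  have hcomp : ∀ a b : Plane, VLt (swapS S) N (a.2, a.1) (b.2, b.1) → HLt S N a b :=
    fun a b hab => hab.swap
  -- Squares of the same kind are pairwise comparable, and there is no chain of three.
  have tri : ∀ T' : Finset Plane, T' ⊆ T → 2 < T'.card →
      (∀ a ∈ T', ∀ b ∈ T', a ≠ b → HLt S N a b ∨ HLt S N b a) → False := by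
    intro T' hTT hT' hc
    obtain ⟨a, ha, b, hb, c, hc', hab, hac, hbc⟩ := Finset.two_lt_card.1 hT'
    obtain ⟨x1, x2, x3, e1, e2, e3, r1, r2⟩ := exists_chain (hc a ha b hb hab) (hc b hb c hc' hbc)
      (hc a ha c hc' hac)
    have hm : ∀ {y}, (y = a ∨ y = b ∨ y = c) → y ∈ T := by
      rintro y (rfl | rfl | rfl) <;> apply hTT <;> assumption
    exact h.not_chain hr hrN (hT _ (hm e1)).1 (hT _ (hm e2)).1 (hT _ (hm e3)).1 (hT _ (hm e1)).2
      (hT _ (hm e3)).2 r1 r2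
  have hne : ∀ {a b : Plane}, a ≠ b → ((a.2, a.1) : Plane) ≠ (b.2, b.1) := fun hab => swap_ne hab
  by_contra! hcard
  have hsum := Finset.card_filter_add_card_filter_not (s := T) L
  have : 2 < (T.filter L).card ∨ 2 < (T.filter fun b => ¬L b).card := by omega
  rcases this with k | k
  · refine tri _ (Finset.filter_subset _ _) k fun a ha b hb hab => ?_
    rw [Finset.mem_filter] at ha hb
    obtain ⟨ca, ea⟩ := hG a ha.1
    obtain ⟨cb, eb⟩ := hG b hb.1
    have := ca.vlt_of_left h.swap cb (by rw [eb]; exact ha.2 b hb.1) (by rw [ea]; exact hb.2 a ha.1)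
    rw [ea, eb] at this
    exact (this.resolve_left (hne hab)).imp (hcomp _ _) (hcomp _ _)
  · refine tri _ (Finset.filter_subset _ _) k fun a ha b hb hab => ?_
    rw [Finset.mem_filter] at ha hb
    obtain ⟨ca, ea⟩ := hG a ha.1
    obtain ⟨cb, eb⟩ := hG b hb.1
    have := ca.vlt_of_right h.swap cb (by rw [eb]; exact hLU a ha.1 ha.2 b hb.1)
      (by rw [ea]; exact hLU b hb.1 hb.2 a ha.1)
    rw [ea, eb] at this
    exact (this.resolve_left (hne hab)).imp (hcomp _ _) (hcomp _ _)

/-- At most four tiles meet a small square. -/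
theorem SatPack.card_near_le (h : SatPack S N) (hr : 0 < r) (hrN : 200 * r ≤ N)
    (T : Finset Plane) (hT : ∀ a ∈ T, a ∈ S ∧ Near S N r x a) : T.card ≤ 4 := by
  classical
  have hN := h.pos
  by_cases hH : ∀ p q, HArm S N p q → ¬Narrow N r (x.2, x.1) (p.2, p.1) (q.2, q.1)
  · exact h.card_near_le_of_not_narrow hr hrN hH T hT
  by_cases hV : ∀ p q, VArm S N p q → ¬Narrow N r x p q
  · have := h.swap.card_near_le_of_not_narrow hr hrN (x := (x.2, x.1))
      (fun p q a => hV _ _ a.swap) (T.image fun a => (a.2, a.1)) (by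
        intro a ha
        obtain ⟨b, hb, rfl⟩ := Finset.mem_image.1 ha
        exact ⟨(hT b hb).1, (hT b hb).2.swap⟩)
    rwa [Finset.card_image_of_injective T (f := fun a : Plane => ((a.2, a.1) : Plane))
      fun a b hab => Prod.swap_injective hab] at this
  push Not at hH hV
  obtain ⟨s, t, v', hv'⟩ := hH
  obtain ⟨p, q, v, hv⟩ := hV
  have hb := fun a ha => h.bounds_of_narrow hr hrN (hT a ha).1 (hT a ha).2 v hv v'.swap hv'
  -- The corners lie in a square of side `3 * N / 2`, and each quarter of it contains at most one.
  have hinj : Set.InjOn (fun a : Plane => (decide (a.1 ≤ x.1 - N / 2), decide (a.2 ≤ x.2 - N / 2)))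
      (T : Set Plane) := by
    intro a ha b hb' hab
    simp only [Prod.mk.injEq, decide_eq_decide] at hab
    have h1 := hb a ha
    have h2 := hb b hb'
    obtain ⟨e1, e2⟩ := hab
    refine h.eq_of_lt (hT a ha).1 (hT b hb').1 ?_ ?_ ?_ ?_ <;> grind
  calc T.card = (T.image fun a : Plane =>
        (decide (a.1 ≤ x.1 - N / 2), decide (a.2 ≤ x.2 - N / 2))).card :=
        (Finset.card_image_of_injOn hinj).symm
    _ ≤ (Finset.univ : Finset (Bool × Bool)).card := Finset.card_le_univ _
    _ = 4 := rfl

/-! ### Size of the tiles -/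

/-- The point `z` has sup-distance at most `d` to the corner `a`. -/
def Within (d : ℝ) (a z : Plane) : Prop := |z.1 - a.1| ≤ d ∧ |z.2 - a.2| ≤ d

variable {a b z : Plane}

theorem SatPack.arm_within (h : SatPack S N) {D : Set Plane} (hD : IsArm S N a b D) (hz : z ∈ D) :
    Within (2 * N) a z := by
  have hN := h.pos
  unfold Within
  rw [abs_le, abs_le]
  rcases isArm_iff.1 hD with ⟨d, rfl⟩ | ⟨d, rfl⟩ | ⟨d, rfl⟩ | ⟨d, rfl⟩ | ⟨-, -, -, -, rfl⟩
  · obtain ⟨z1, z2, z3, z4, z5, z6⟩ := hz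
    have := h.varm_gap d
    refine ⟨⟨?_, ?_⟩, ?_, ?_⟩ <;> linarith
  · obtain ⟨z1, z2, z3, z4, z5, z6⟩ := hz
    have := h.varm_gap d
    refine ⟨⟨?_, ?_⟩, ?_, ?_⟩ <;> linarith
  · obtain ⟨z1, z2, z3, z4, z5, z6⟩ := hz
    have := h.harm_gap d
    refine ⟨⟨?_, ?_⟩, ?_, ?_⟩ <;> linarith
  · obtain ⟨z1, z2, z3, z4, z5, z6⟩ := hz
    have := h.harm_gap d
    refine ⟨⟨?_, ?_⟩, ?_, ?_⟩ <;> linarith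
  · obtain ⟨⟨z1, z2, z3, z4⟩, -⟩ := hz
    refine ⟨⟨?_, ?_⟩, ?_, ?_⟩ <;> linarith

theorem SatPack.piece_within (h : SatPack S N) (hz : Piece S N a z) : Within (5 * N) a z := by
  have hN := h.pos
  have mono : Within (2 * N) a z → Within (5 * N) a z := fun k =>
    ⟨k.1.trans (by linarith), k.2.trans (by linarith)⟩
  rcases hz with hz | ⟨v, w, d, rfl | rfl, hz⟩ | ⟨t, d, hz⟩ | ⟨t, d, hz, -⟩ | ⟨A, B, K, x, F, hz, hx, o⟩
  · obtain ⟨z1, z2, z3, z4⟩ := hz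
    unfold Within
    rw [abs_le, abs_le]
    refine ⟨⟨?_, ?_⟩, ?_, ?_⟩ <;> linarith
  · exact mono (h.arm_within (isArm_iff.2 (Or.inl ⟨d, rfl⟩)) hz)
  · exact mono (h.arm_within (isArm_iff.2 (Or.inr (Or.inl ⟨d, rfl⟩))) hz)
  · exact mono (h.arm_within (isArm_iff.2 (Or.inr (Or.inr (Or.inr (Or.inl ⟨d, rfl⟩))))) hz)
  · exact mono (h.arm_within (isArm_iff.2 (Or.inr (Or.inr (Or.inl ⟨d, rfl⟩)))) hz)
  -- A cross with a sector of `a` touches the square at `a` or one of its arms, and its size is at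
  -- most `3 * N`.
  · obtain ⟨y, ⟨y1, y2, y3, y4⟩, hy⟩ : ∃ y : Plane,
        (A.1 ≤ y.1 ∧ y.1 ≤ B.1 ∧ A.2 ≤ y.2 ∧ y.2 ≤ B.2) ∧ Within (2 * N) a y := by
      rcases o with ⟨y, ⟨⟨-, hy⟩, hya⟩, -⟩ | ⟨e, ⟨⟨t, D, p, q, hD, h1, rfl⟩, -⟩, -⟩
      · refine ⟨y, (Face.mem_frontier_box.1 hy).1, ?_⟩
        obtain ⟨z1, z2, z3, z4⟩ := mem_squareAt.1 hya
        unfold Within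
        rw [abs_le, abs_le]
        refine ⟨⟨?_, ?_⟩, ?_, ?_⟩ <;> linarith
      · have : midpoint ℝ p q ∈ D ∩ closure K := h1 ▸ midpoint_mem_segment p q
        exact ⟨_, ((F.mem_closure h).1 this.2).1, h.arm_within hD this.1⟩
    obtain ⟨⟨b1, b2, b3, b4⟩, -⟩ := (F.mem z).1 hz
    obtain ⟨s1, s2⟩ := F.size
    unfold Within at *
    rw [abs_le, abs_le] at *
    obtain ⟨⟨h1, h2⟩, h3, h4⟩ := hy
    refine ⟨⟨?_, ?_⟩, ?_, ?_⟩ <;> linarith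

theorem SatPack.tile_within (h : SatPack S N) (hz : z ∈ robinsonTile S N a) :
    Within (6 * N) a z := by
  obtain ⟨w, w1, w2, hw⟩ := h.piece_of_mem hz h.pos
  obtain ⟨k1, k2⟩ := h.piece_within hw
  constructor
  · rw [abs_sub_comm] at w1
    linarith [abs_sub_le z.1 w.1 a.1]
  · rw [abs_sub_comm] at w2
    linarith [abs_sub_le z.2 w.2 a.2]

/-- The tile of a square does not overlap the other squares. -/
theorem SatPack.eq_of_mem_openSq (h : SatPack S N) (ha : a ∈ S) (hb : b ∈ S)
    (hz : z ∈ robinsonTile S N a) (hzb : z ∈ openSq N b) : a = b := by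
  have hN := h.pos
  rw [Face.mem_openSq] at hzb
  have hε : 0 < min (min (z.1 - b.1) (b.1 + N - z.1)) (min (z.2 - b.2) (b.2 + N - z.2)) := by
    simp only [lt_min_iff]
    refine ⟨⟨?_, ?_⟩, ?_, ?_⟩ <;> linarith
  -- A point of a piece in the interior of the square at `b`.
  obtain ⟨w, w1, w2, hw⟩ := h.piece_of_mem hz hε
  simp only [lt_min_iff, abs_lt] at w1 w2
  have hwb : w ∈ openSq N b := Face.mem_openSq.2
    ⟨by linarith, by linarith, by linarith, by linarith⟩
  have hwo := Face.mem_openSq.1 hwb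
  have arm : ∀ {v w'}, VArm S N v w' → ¬InV N v w' w := by
    rintro v w' d ⟨z1, z2, z3, z4, z5, z6⟩
    by_cases e1 : b = v
    · subst e1; linarith
    by_cases e2 : b = w'
    · subst e2; linarith
    have := h.varm_disj d hb e1 e2
    rw [le_max_iff, min_add_le] at this
    grind
  have arm' : ∀ {v w'}, HArm S N v w' → ¬InH N v w' w := by
    rintro v w' d ⟨z1, z2, z3, z4, z5, z6⟩
    by_cases e1 : b = v
    · subst e1; linarith
    by_cases e2 : b = w'
    · subst e2; linarith
    have := h.harm_disj d hb e1 e2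
    rw [le_max_iff, min_add_le] at this
    grind
  rcases hw with hw | ⟨v, w, d, -, hw⟩ | ⟨t, d, hw⟩ | ⟨t, d, hw, -⟩ | ⟨A, B, K, x, F, hw, hx, o⟩
  · exact (Face.eq_of_openSq h hb ha hwb hw).symm
  · exact (arm d hw).elim
  · exact (arm' d hw).elim
  · exact (arm' d hw).elim
  · exact (((F.mem w).1 hw).2 b hb ⟨by linarith, by linarith, by linarith, by linarith⟩).elim

/-- The interior of the tile of a square does not meet the other squares. -/
theorem SatPack.eq_of_mem_interior (h : SatPack S N) (ha : a ∈ S) (hb : b ∈ S)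
    (hz : z ∈ interior (robinsonTile S N a)) (hzb : InSq N b z) : a = b := by
  have hN := h.pos
  have hcl : z ∈ closure (openSq N b) :=
    VCurve.closure_box (by linarith) (by linarith) (subset_refl (openSq N b))
      ⟨⟨hzb.1, hzb.2.1⟩, hzb.2.2⟩
  obtain ⟨w, hw, hwb⟩ := mem_closure_iff.1 hcl _ isOpen_interior hz
  exact h.eq_of_mem_openSq ha hb (interior_subset hw) hwb

/-! ### The lattice of the corners of a tiling -/

/-- The unit squares with corners in `D` cover the plane, and the corners of those which meet differ
by integer vectors. -/
structure Grid (D : Set Plane) : Prop where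
  cov : ∀ x, ∃ p ∈ D, InSq 1 p x
  int : ∀ p ∈ D, ∀ q ∈ D, |q.1 - p.1| ≤ 1 → |q.2 - p.2| ≤ 1 →
    ∃ i j : ℤ, q.1 - p.1 = i ∧ q.2 - p.2 = j

namespace Grid

variable {D : Set Plane}

theorem swap (h : Grid D) : Grid (swapS D) where
  cov x := by
    obtain ⟨p, hp, k⟩ := h.cov (x.2, x.1)
    exact ⟨(p.2, p.1), hp, k.swap⟩
  int p hp q hq h1 h2 := by
    obtain ⟨i, j, h3, h4⟩ := h.int _ hp _ hq h2 h1
    exact ⟨j, i, h4, h3⟩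

theorem neg (h : Grid D) : Grid (negS D 1) where
  cov x := by
    obtain ⟨p, hp, k⟩ := h.cov (-x.1, x.2)
    refine ⟨(-p.1 - 1, p.2), negS_mk hp, ?_⟩
    unfold InSq at *; dsimp only at *; grind
  int p hp q hq h1 h2 := by
    obtain ⟨i, j, h3, h4⟩ := h.int _ hp _ hq
      (by dsimp only; rw [abs_sub_comm]; ring_nf at *; exact h1) h2
    refine ⟨-i, j, ?_, h4⟩
    push_cast
    dsimp only at h3
    linarith

theorem right (h : Grid D) (hp : p ∈ D) : (p.1 + 1, p.2) ∈ D := by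
  obtain ⟨q, hq, q1, q2, q3, q4⟩ := h.cov (p.1 + 3 / 2, p.2 + 1 / 2)
  dsimp only at q1 q2 q3 q4
  rcases le_or_gt q.1 (p.1 + 1) with k | k
  · obtain ⟨i, j, h1, h2⟩ := h.int p hp q hq (by rw [abs_le]; constructor <;> linarith)
      (by rw [abs_le]; constructor <;> linarith)
    have i1 : (0 : ℝ) < i := by linarith
    have i2 : (i : ℝ) < 2 := by linarith
    have j1 : (-1 : ℝ) < j := by linarith
    have j2 : (j : ℝ) < 1 := by linarith
    norm_cast at i1 i2 j1 j2
    obtain rfl : i = 1 := by omega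
    obtain rfl : j = 0 := by omega
    have : q = (p.1 + 1, p.2) := Prod.ext (by push_cast at h1; linarith)
      (by push_cast at h2; linarith)
    rwa [← this]
  exfalso
  obtain ⟨q', hq', r1, r2, r3, r4⟩ := h.cov ((p.1 + 1 + q.1) / 2, p.2 + 1 / 2)
  dsimp only at r1 r2 r3 r4
  have key : q'.1 < q.1 → q.1 < q'.1 + 1 → False := by
    intro k1 k2
    obtain ⟨i, -, h1, -⟩ := h.int q' hq' q hq (by rw [abs_le]; constructor <;> linarith)
      (by rw [abs_le]; constructor <;> linarith)
    have i1 : (0 : ℝ) < i := by linarith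
    have i2 : (i : ℝ) < 1 := by linarith
    norm_cast at i1 i2
    omega
  rcases le_or_gt q'.1 (p.1 + 1) with k' | k'
  · obtain ⟨i, j, h1, h2⟩ := h.int p hp q' hq' (by rw [abs_le]; constructor <;> linarith)
      (by rw [abs_le]; constructor <;> linarith)
    have i1 : (0 : ℝ) < i := by linarith
    have i2 : (i : ℝ) < 2 := by linarith
    norm_cast at i1 i2
    obtain rfl : i = 1 := by omega
    push_cast at h1
    exact key (by linarith) (by linarith)
  · exact key (by linarith) (by linarith)

theorem left (h : Grid D) (hp : p ∈ D) : (p.1 - 1, p.2) ∈ D := by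
  have := h.neg.right (negS_mk hp)
  have := negS_mk (N := 1) this
  rw [negS_negS] at this
  convert! this using 2
  dsimp only; ring

theorem add_fst (h : Grid D) (hp : p ∈ D) (i : ℤ) : (p.1 + i, p.2) ∈ D := by
  induction i with
  | zero => simpa using hp
  | succ i ih => have := h.right ih; push_cast at *; rwa [← add_assoc]
  | pred i ih => have := h.left ih; push_cast at *; rwa [← add_sub_assoc]

theorem add (h : Grid D) (hp : p ∈ D) (i j : ℤ) : (p.1 + i, p.2 + j) ∈ D :=
  h.swap.add_fst (p := (p.2, p.1 + i)) (h.add_fst hp i) j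

theorem sub_int (h : Grid D) (hp : p ∈ D) (hq : q ∈ D) : ∃ i j : ℤ, q = (p.1 + i, p.2 + j) := by
  have h1 := Int.floor_le (q.1 - p.1)
  have h2 := Int.lt_floor_add_one (q.1 - p.1)
  have h3 := Int.floor_le (q.2 - p.2)
  have h4 := Int.lt_floor_add_one (q.2 - p.2)
  obtain ⟨i, j, h5, h6⟩ := h.int _ (h.add hp ⌊q.1 - p.1⌋ ⌊q.2 - p.2⌋) q hq
    (by dsimp only; rw [abs_le]; constructor <;> linarith)
    (by dsimp only; rw [abs_le]; constructor <;> linarith)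
  refine ⟨⌊q.1 - p.1⌋ + i, ⌊q.2 - p.2⌋ + j, Prod.ext ?_ ?_⟩ <;> push_cast <;> dsimp only at * <;>
    linarith

end Grid

namespace SquareTiling

variable {P : Type*} {T T' T'' : SquareTiling P} {τ τ' : Plane × P} {v w : Plane} {R R' : ℝ}

theorem inSq_meet {p q : Plane} (h1 : |q.1 - p.1| ≤ 1) (h2 : |q.2 - p.2| ≤ 1) :
    (squareAt 1 p ∩ squareAt 1 q).Nonempty := by
  rw [abs_le] at h1 h2
  refine ⟨(max p.1 q.1, max p.2 q.2), ?_, ?_⟩ <;> rw [mem_squareAt] <;> unfold InSq <;>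
    simp only [le_max_left, le_max_right, max_le_iff, true_and]
  · refine ⟨⟨?_, ?_⟩, ?_, ?_⟩ <;> linarith
  · refine ⟨⟨?_, ?_⟩, ?_, ?_⟩ <;> linarith

theorem grid (T : SquareTiling P) : Grid (Prod.fst '' T.tiles) where
  cov x := by
    obtain ⟨τ, hτ, hx⟩ := T.covers x
    exact ⟨τ.1, mem_image_of_mem _ hτ, mem_squareAt.1 hx⟩
  int := by
    rintro _ ⟨τ, hτ, rfl⟩ _ ⟨τ', hτ', rfl⟩ h1 h2
    by_cases e : τ = τ'
    · subst e; exact ⟨0, 0, by simp, by simp⟩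
    · obtain ⟨-, i, j, h⟩ := T.face_to_face τ hτ τ' hτ' e (inSq_meet h1 h2)
      rw [Prod.ext_iff] at h
      exact ⟨i, j, h.1, h.2⟩

theorem eq_of_fst (hτ : τ ∈ T.tiles) (hτ' : τ' ∈ T.tiles) (h : τ.1 = τ'.1) : τ = τ' := by
  by_contra e
  exact (T.face_to_face τ hτ τ' hτ' e (inSq_meet (by simp [h]) (by simp [h]))).1 h

theorem exists_tile (hτ : τ ∈ T.tiles) (i j : ℤ) : ∃ m, ((τ.1.1 + i, τ.1.2 + j), m) ∈ T.tiles := by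
  obtain ⟨⟨q, m⟩, hm, e⟩ := T.grid.add (mem_image_of_mem _ hτ) i j
  exact ⟨m, by rw [← e]; exact hm⟩

theorem exists_int (hτ : τ ∈ T.tiles) (hτ' : τ' ∈ T.tiles) :
    ∃ i j : ℤ, τ'.1 = (τ.1.1 + i, τ.1.2 + j) :=
  T.grid.sub_int (mem_image_of_mem _ hτ) (mem_image_of_mem _ hτ')

theorem mem_translate : τ ∈ (T.translate v).tiles ↔ (τ.1 - v, τ.2) ∈ T.tiles := by
  constructor
  · rintro ⟨σ, hσ, rfl⟩
    simpa using hσ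
  · exact fun h => ⟨_, h, by simp⟩

theorem translate_zero : T.translate 0 = T := by
  ext τ; simp [mem_translate]

theorem translate_translate : (T.translate v).translate w = T.translate (v + w) := by
  ext τ; simp only [mem_translate]; rw [show τ.1 - w - v = τ.1 - (v + w) by abel]

/-- The tilings `T` and `T'` coincide on the ball `B(0, R)`. -/
def Agree (R : ℝ) (T T' : SquareTiling P) : Prop :=
  ∀ τ : Plane × P, (squareAt 1 τ.1 ∩ Metric.ball 0 R).Nonempty → (τ ∈ T.tiles ↔ τ ∈ T'.tiles)

theorem agree_iff : T.tilesMeetingBall R = T'.tilesMeetingBall R ↔ Agree R T T' := by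
  rw [Set.ext_iff]
  simp only [tilesMeetingBall, mem_ofPred_eq, Agree]
  exact forall_congr' fun τ => by tauto

theorem Agree.symm (h : Agree R T T') : Agree R T' T := fun τ hτ => (h τ hτ).symm

theorem Agree.trans (h : Agree R T T') (h' : Agree R T' T'') : Agree R T T'' :=
  fun τ hτ => (h τ hτ).trans (h' τ hτ)

theorem Agree.mono (h : Agree R T T') (hR : R' ≤ R) : Agree R' T T' := fun τ hτ =>
  h τ (hτ.mono (inter_subset_inter_right _ (Metric.ball_subset_ball hR)))

theorem Agree.translate (h : Agree R T T') (hR : R' + ‖v‖ ≤ R) :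
    Agree R' (T.translate v) (T'.translate v) := by
  rintro τ ⟨x, hx, hxR⟩
  rw [mem_translate, mem_translate]
  refine h _ ⟨x - v, (squareAt_add_iff 1 (τ.1 - v) v x).1 (by simpa using hx), ?_⟩
  rw [mem_ball_zero_iff] at *
  linarith [norm_sub_le x v]

theorem mem_squareAt_self (p : Plane) : p ∈ squareAt 1 p := by
  rw [mem_squareAt]; unfold InSq; simp

theorem Agree.mem (h : Agree R T T') (hτ : ‖τ.1‖ < R) : τ ∈ T.tiles ↔ τ ∈ T'.tiles :=
  h τ ⟨τ.1, mem_squareAt_self _, by simpa using hτ⟩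

theorem norm_lt_of_meets (h : (squareAt 1 p ∩ Metric.ball 0 R).Nonempty) : ‖p‖ < R + 1 := by
  obtain ⟨x, hx, hxR⟩ := h
  rw [mem_squareAt] at hx
  unfold InSq at hx
  rw [mem_ball_zero_iff, Prod.norm_def, max_lt_iff, Real.norm_eq_abs, Real.norm_eq_abs, abs_lt,
    abs_lt] at hxR
  rw [Prod.norm_def, max_lt_iff, Real.norm_eq_abs, Real.norm_eq_abs, abs_lt, abs_lt]
  refine ⟨⟨?_, ?_⟩, ?_, ?_⟩ <;> linarith

/-- Tilings coincide on a ball if the tiles of the first one which meet the ball are tiles of the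
second one. -/
theorem agree_of_subset (hR : 0 < R) (h : ∀ τ ∈ T.tiles, ‖τ.1‖ < R + 1 → τ ∈ T'.tiles) :
    Agree R T T' := by
  intro τ hτ
  refine ⟨fun k => h τ k (norm_lt_of_meets hτ), fun k => ?_⟩
  obtain ⟨σ, hσ, hσ0⟩ := T.covers 0
  have hσ' := h σ hσ (norm_lt_of_meets ⟨0, hσ0, by simpa using hR⟩)
  obtain ⟨i, j, e⟩ := exists_int hσ' k
  obtain ⟨m, hm⟩ := exists_tile hσ i j
  rw [← e] at hm
  have hm' := h _ hm (norm_lt_of_meets hτ)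
  have := eq_of_fst k hm' rfl
  rwa [this]

/-! ### The topology of the hull -/

theorem exists_agree_of_mem_basicNhd {r ε ε' : ℝ} {T₁ : SquareTiling P} (h : T ∈ T₁.basicNhd r ε ε') :
    ∃ R, ∀ T', Agree R T T' → T' ∈ T₁.basicNhd r ε ε' := by
  obtain ⟨v, v', hv, hv', R, hR, e⟩ := h
  refine ⟨R + ‖v'‖, fun T' hT' => ⟨v, v', hv, hv', R, hR, e.trans ?_⟩⟩
  exact agree_iff.2 (hT'.translate le_rfl)

/-- An open set contains with each tiling those which coincide with it on a large ball. -/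
theorem exists_agree_of_isOpen {U : Set (SquareTiling P)} (hU : IsOpen U) (hT : T ∈ U) :
    ∃ R, ∀ T', Agree R T T' → T' ∈ U := by
  induction hU with
  | basic U hU =>
    obtain ⟨T₁, r, ε, ε', -, -, -, rfl⟩ := hU
    exact exists_agree_of_mem_basicNhd hT
  | univ => exact ⟨0, fun _ _ => trivial⟩
  | inter U V _ _ h1 h2 =>
    obtain ⟨R1, k1⟩ := h1 hT.1
    obtain ⟨R2, k2⟩ := h2 hT.2
    exact ⟨max R1 R2, fun T' h => ⟨k1 T' (h.mono (le_max_left _ _)),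
      k2 T' (h.mono (le_max_right _ _))⟩⟩
  | sUnion C _ h =>
    obtain ⟨U, hU, hTU⟩ := hT
    obtain ⟨R, k⟩ := h U hU hTU
    exact ⟨R, fun T' h => ⟨U, hU, k T' h⟩⟩

theorem isOpen_basicNhd {r ε ε' : ℝ} (hr : 0 < r) (hε : 0 < ε) (hε' : 0 < ε') :
    IsOpen (T.basicNhd r ε ε') :=
  TopologicalSpace.isOpen_generateFrom_of_mem ⟨T, r, ε, ε', hr, hε, hε', rfl⟩

theorem mem_basicNhd_self {r ε ε' : ℝ} (hε : 0 < ε) (hε' : 0 < ε') : T ∈ T.basicNhd r ε ε' :=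
  ⟨0, 0, by simpa, by simpa, r + 1, by linarith, rfl⟩

theorem mem_hull_iff {T₀ : SquareTiling P} : T ∈ T₀.hull ↔ ∀ R, ∃ v, Agree R T (T₀.translate v) := by
  unfold hull
  rw [mem_closure_iff]
  constructor
  · intro h R
    obtain ⟨_, ⟨v, v', hv, -, R', hR', e⟩, u, rfl⟩ := h (T.basicNhd (|R| + 1) 1 1)
      (isOpen_basicNhd (by positivity) one_pos one_pos) (mem_basicNhd_self one_pos one_pos)
    refine ⟨u + v' - v, ?_⟩
    have := (agree_iff.1 e).translate (v := -v) (R' := R)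
      (by rw [norm_neg]; linarith [le_abs_self R])
    rwa [translate_translate, translate_translate, translate_translate, add_neg_cancel,
      translate_zero, ← add_assoc, ← sub_eq_add_neg] at this
  · intro h U hU hT
    obtain ⟨R, hR⟩ := exists_agree_of_isOpen hU hT
    obtain ⟨v, hv⟩ := h R
    exact ⟨_, hR _ hv, v, rfl⟩

theorem translate_mem_hull {T₀ : SquareTiling P} (h : T ∈ T₀.hull) : T.translate v ∈ T₀.hull := by
  rw [mem_hull_iff] at *
  intro R
  obtain ⟨u, hu⟩ := h (R + ‖v‖)
  exact ⟨u + v, by rw [← translate_translate]; exact hu.translate le_rfl⟩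

theorem finite_tiles [Finite P] (T : SquareTiling P) (R : ℝ) : {τ ∈ T.tiles | ‖τ.1‖ < R}.Finite := by
  obtain ⟨σ, hσ, -⟩ := T.covers 0
  have hf : ((Icc (⌊-R - σ.1.1⌋) ⌈R - σ.1.1⌉ ×ˢ Icc (⌊-R - σ.1.2⌋) ⌈R - σ.1.2⌉) ×ˢ
      (univ : Set P)).Finite := ((finite_Icc _ _).prod (finite_Icc _ _)).prod finite_univ
  refine (hf.image fun k : (ℤ × ℤ) × P => (((σ.1.1 + k.1.1, σ.1.2 + k.1.2) : Plane), k.2)).subset ?_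
  rintro ⟨q, m⟩ ⟨hq, hn⟩
  obtain ⟨i, j, e⟩ := exists_int hσ hq
  dsimp only at e hn
  subst e
  rw [Prod.norm_def, max_lt_iff, Real.norm_eq_abs, Real.norm_eq_abs, abs_lt, abs_lt] at hn
  obtain ⟨⟨h1, h2⟩, h3, h4⟩ := hn
  dsimp only at h1 h2 h3 h4
  refine ⟨((i, j), m), ⟨⟨⟨?_, ?_⟩, ?_, ?_⟩, mem_univ _⟩, rfl⟩
  · exact Int.floor_le_iff.2 (by linarith)
  · exact Int.le_ceil_iff.2 (by linarith)
  · exact Int.floor_le_iff.2 (by linarith)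
  · exact Int.le_ceil_iff.2 (by linarith)

/-- Every patch of the tiling `T'` of the hull occurs in every large ball of any other one. -/
theorem exists_agree_translate [Finite P] {T₀ : SquareTiling P} (hrep : T₀.Repetitive)
    (hT' : T' ∈ T₀.hull) (hR : 0 < R) :
    ∃ D > 0, ∀ T ∈ T₀.hull, ∀ x : Plane, ∃ v : Plane, ‖v - x‖ ≤ D ∧
      Agree R T' (T.translate (-v)) := by
  obtain ⟨u, hu⟩ := mem_hull_iff.1 hT' (R + 1)
  -- A patch of `T₀` which is a translate of the patch of `T'`.
  set M : Set (Plane × P) := {τ ∈ T₀.tiles | ‖τ.1 + u‖ < R + 1} with hM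
  have hMf : M.Finite := by
    have := ((T₀.translate u).finite_tiles (R + 1)).image fun τ : Plane × P => (τ.1 - u, τ.2)
    refine this.subset fun τ hτ => ⟨(τ.1 + u, τ.2), ⟨?_, hτ.2⟩, by simp⟩
    rw [mem_translate]; simpa using hτ.1
  obtain ⟨D, hD, h⟩ := hrep M hMf fun τ hτ => hτ.1
  have hT'M : ∀ τ ∈ T'.tiles, ‖τ.1‖ < R + 1 → (τ.1 - u, τ.2) ∈ M := by
    intro τ hτ hn
    have := (hu.mem hn).1 hτ
    rw [mem_translate] at this
    exact ⟨this, by simpa using hn⟩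
  obtain ⟨σ, hσ, hσ0⟩ := T'.covers 0
  have hσn := norm_lt_of_meets ⟨0, hσ0, by simpa using hR⟩
  refine ⟨D + (R + 1), by linarith, fun T hT x => ?_⟩
  obtain ⟨w, hw⟩ := mem_hull_iff.1 hT (‖x‖ + D)
  obtain ⟨v, hv⟩ := h (x - w)
  have hd : ∀ τ ∈ M, ‖τ.1 + v + w - x‖ < D := by
    intro τ hτ
    have := (hv τ hτ).2 (mem_squareAt_self _)
    rw [Metric.mem_ball, dist_eq_norm] at this
    rwa [show τ.1 + v + w - x = τ.1 + v - (x - w) by abel]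
  refine ⟨v + w - u, ?_, agree_of_subset hR fun τ hτ hn => ?_⟩
  · have k1 := hd _ (hT'M σ hσ hσn)
    dsimp only at k1
    rw [show v + w - u - x = (σ.1 - u + v + w - x) - σ.1 by abel]
    linarith [norm_sub_le (σ.1 - u + v + w - x) σ.1]
  · have k1 := hT'M τ hτ hn
    have k2 := hd _ k1
    have k3 := (hv _ k1).1
    rw [mem_translate]
    refine (hw.mem ?_).2 ?_
    · dsimp only at k2 ⊢
      rw [show τ.1 - -(v + w - u) = (τ.1 - u + v + w - x) + x by abel]
      linarith [norm_add_le (τ.1 - u + v + w - x) x]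
    · rw [mem_translate]
      dsimp only at k3 ⊢
      rwa [show τ.1 - -(v + w - u) - w = τ.1 - u + v by abel]

theorem eq_of_agree (h : ∀ R, Agree R T T') : T = T' := by
  ext τ
  exact (h (‖τ.1‖ + 1)).mem (by linarith)

/-- The tilings of the hull of an aperiodic repetitive tiling are aperiodic. -/
theorem Aperiodic.of_mem_hull [Finite P] {T₀ : SquareTiling P} (haper : T₀.Aperiodic)
    (hrep : T₀.Repetitive) (hT : T ∈ T₀.hull) : T.Aperiodic := by
  intro w hw
  refine haper w (eq_of_agree fun R => ?_)
  have h0 : T₀ ∈ T₀.hull := mem_hull_iff.2 fun R => ⟨0, by rw [translate_zero]; exact fun _ _ => Iff.rfl⟩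
  obtain ⟨D, -, h⟩ := exists_agree_translate hrep h0 (R := |R| + ‖w‖ + 1) (by positivity)
  obtain ⟨v, -, hv⟩ := h T hT 0
  have h1 := hv.translate (v := w) (R' := R) (by linarith [le_abs_self R])
  rw [translate_translate, add_comm, ← translate_translate, hw] at h1
  exact h1.trans (hv.symm.mono (by linarith [le_abs_self R, norm_nonneg w]))

end SquareTiling

/-! ### The topology of the transversal and of its relations -/

namespace SquareTiling

variable {P : Type*} {base : P → Plane} {T₀ : SquareTiling P} {T : SquareTiling P}
  {τ τ' : Plane × P} {v w : Plane} {R R' : ℝ}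

/-- The base points lie in the interiors of the tiles. -/
def InnerBase (base : P → Plane) : Prop :=
  ∀ m, 0 < (base m).1 ∧ (base m).1 < 1 ∧ 0 < (base m).2 ∧ (base m).2 < 1

theorem innerBase_of_interior (h : ∀ m, base m ∈ interior (squareAt 1 0)) : InnerBase base := by
  intro m
  have := h m
  rw [squareAt, Face.interior_box] at this
  obtain ⟨h1, h2, h3, h4⟩ := this
  simp only [Prod.fst_zero, Prod.snd_zero, Prod.fst_add, Prod.snd_add, zero_add] at h1 h2 h3 h4
  exact ⟨h1, h2, h3, h4⟩

theorem eq_of_tileBase (hb : InnerBase base) (hτ : τ ∈ T.tiles) (hτ' : τ' ∈ T.tiles)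
    (h : tileBase base τ = tileBase base τ') : τ = τ' := by
  obtain ⟨i, j, e⟩ := exists_int hτ hτ'
  have h1 := hb τ.2
  have h2 := hb τ'.2
  unfold tileBase at h
  rw [e, Prod.ext_iff] at h
  simp only [Prod.fst_add, Prod.snd_add] at h
  have i1 : (-1 : ℝ) < i := by linarith [h.1]
  have i2 : (i : ℝ) < 1 := by linarith [h.1]
  have j1 : (-1 : ℝ) < j := by linarith [h.2]
  have j2 : (j : ℝ) < 1 := by linarith [h.2]
  norm_cast at i1 i2 j1 j2
  obtain rfl : i = 0 := by omega
  obtain rfl : j = 0 := by omega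
  exact eq_of_fst hτ hτ' (by rw [e]; simp)

theorem InnerBase.norm_lt (hb : InnerBase base) (m : P) : ‖base m‖ < 1 := by
  obtain ⟨h1, h2, h3, h4⟩ := hb m
  rw [Prod.norm_def, max_lt_iff, Real.norm_eq_abs, Real.norm_eq_abs, abs_of_pos h1, abs_of_pos h3]
  exact ⟨h2, h4⟩

theorem norm_fst_lt (hb : InnerBase base) (τ : Plane × P) : ‖τ.1‖ < ‖tileBase base τ‖ + 1 := by
  have : τ.1 = tileBase base τ - base τ.2 := by simp [tileBase]
  rw [this]
  linarith [norm_sub_le (tileBase base τ) (base τ.2), hb.norm_lt τ.2]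

theorem exists_gap (δ : ℝ) : ∃ η > 0, ∀ w, |w| < η → ∀ i : ℤ, δ + w = i → w = 0 := by
  have h1 := Int.floor_le δ
  have h2 := Int.lt_floor_add_one δ
  rcases h1.eq_or_lt with e | e
  · refine ⟨1, one_pos, fun w hw i hi => ?_⟩
    rw [abs_lt] at hw
    have i1 : (i : ℝ) < (⌊δ⌋ + 1 : ℤ) := by push_cast; linarith
    have i2 : ((⌊δ⌋ - 1 : ℤ) : ℝ) < i := by push_cast; linarith
    rw [Int.cast_lt] at i1 i2
    obtain rfl : i = ⌊δ⌋ := by omega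
    linarith
  · refine ⟨min (δ - ⌊δ⌋) (⌊δ⌋ + 1 - δ), lt_min (by linarith) (by linarith), fun w hw i hi => ?_⟩
    rw [lt_min_iff, abs_lt, abs_lt] at hw
    have i1 : (i : ℝ) < (⌊δ⌋ + 1 : ℤ) := by push_cast; linarith
    have i2 : (⌊δ⌋ : ℝ) < i := by linarith
    rw [Int.cast_lt] at i1 i2
    omega

/-- Small translations do not map the lattice of a tiling of the transversal to another one. -/
theorem exists_gap_base [Finite P] (base : P → Plane) : ∃ η > 0, ∀ m m' : P, ∀ w : Plane, ‖w‖ < η →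
    ∀ i j : ℤ, base m' - base m + w = ((i : ℝ), (j : ℝ)) → w = 0 := by
  have key : ∀ k : P × P, ∀ᶠ η in 𝓝[>] (0 : ℝ), ∀ w : Plane, ‖w‖ < η →
      ∀ i j : ℤ, base k.2 - base k.1 + w = ((i : ℝ), (j : ℝ)) → w = 0 := by
    intro k
    obtain ⟨η₁, h1, k1⟩ := exists_gap (base k.2 - base k.1).1
    obtain ⟨η₂, h2, k2⟩ := exists_gap (base k.2 - base k.1).2
    filter_upwards [Ioo_mem_nhdsGT (lt_min h1 h2)] with η hη w hw i j e
    rw [mem_Ioo, lt_min_iff] at hη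
    rw [Prod.norm_def, max_lt_iff, Real.norm_eq_abs, Real.norm_eq_abs] at hw
    rw [Prod.ext_iff] at e
    exact Prod.ext (k1 w.1 (by linarith) i e.1) (k2 w.2 (by linarith) j e.2)
  have := (Filter.eventually_all.2 key).and self_mem_nhdsWithin
  obtain ⟨η, h1, h2⟩ := this.exists
  exact ⟨η, h2, fun m m' => h1 (m, m')⟩

theorem exists_isOpen_agree [Finite P] (hb : InnerBase base) (T : transversal base T₀) (R : ℝ) :
    ∃ V : Set (SquareTiling P), IsOpen V ∧ T.1 ∈ V ∧
      ∀ T' : transversal base T₀, T'.1 ∈ V → Agree R T.1 T'.1 := by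
  obtain ⟨η, hη, h⟩ := exists_gap_base base
  set ε := min (η / 2) 1 with hε
  have hε0 : 0 < ε := lt_min (by linarith) one_pos
  have hε1 : ε ≤ 1 := min_le_right _ _
  have hε2 : ε ≤ η / 2 := min_le_left _ _
  refine ⟨T.1.basicNhd (|R| + 3) ε ε, isOpen_basicNhd (by positivity) hε0 hε0,
    mem_basicNhd_self hε0 hε0, ?_⟩
  rintro T' ⟨v, v', hv, hv', R', hR', e⟩
  rw [agree_iff] at e
  obtain ⟨σ, hσ, hσ0⟩ := T.2.2
  obtain ⟨σ', hσ', hσ0'⟩ := T'.2.2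
  have hn := norm_fst_lt hb σ
  rw [hσ0, norm_zero, zero_add] at hn
  have hmem : (σ.1 + v, σ.2) ∈ (T'.1.translate v').tiles := by
    refine (e.mem ?_).1 ?_
    · linarith [norm_add_le σ.1 v, abs_nonneg R]
    · rw [mem_translate]; simpa using hσ
  rw [mem_translate] at hmem
  obtain ⟨i, j, hij⟩ := exists_int hσ' hmem
  have hvv : v - v' = 0 := by
    refine h σ.2 σ'.2 (v - v') ?_ i j ?_
    · linarith [norm_sub_le v v']
    · unfold tileBase at hσ0 hσ0'
      have e1 : base σ.2 = -σ.1 := eq_neg_of_add_eq_zero_right hσ0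
      have e2 : base σ'.2 = -σ'.1 := eq_neg_of_add_eq_zero_right hσ0'
      rw [e1, e2]
      rw [Prod.ext_iff] at hij ⊢
      obtain ⟨h1, h2⟩ := hij
      simp only [Prod.fst_add, Prod.snd_add, Prod.fst_sub, Prod.snd_sub, Prod.fst_neg,
        Prod.snd_neg] at *
      constructor <;> linarith
  rw [sub_eq_zero] at hvv
  subst hvv
  have := e.translate (v := -v) (R' := R) (by rw [norm_neg]; linarith [le_abs_self R])
  rwa [translate_translate, translate_translate, add_neg_cancel, translate_zero,
    translate_zero] at this

/-- The topology of the transversal is given by the coincidence of tilings on balls. -/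
theorem isOpen_transversal_iff [Finite P] (hb : InnerBase base) {U : Set (transversal base T₀)} :
    IsOpen U ↔ ∀ T ∈ U, ∃ R, ∀ T', Agree R T.1 T'.1 → T' ∈ U := by
  constructor
  · rintro ⟨V, hV, rfl⟩ T hT
    obtain ⟨R, hR⟩ := exists_agree_of_isOpen hV hT
    exact ⟨R, fun T' h => hR _ h⟩
  · intro h
    rw [isOpen_iff_forall_mem_open]
    intro T hT
    obtain ⟨R, hR⟩ := h T hT
    obtain ⟨V, hV, hTV, k⟩ := exists_isOpen_agree hb T R
    exact ⟨Subtype.val ⁻¹' V, fun T' h' => hR T' (k T' h'), hV.preimage continuous_subtype_val, hTV⟩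

theorem exists_agree_of_isOpen' [Finite P] (hb : InnerBase base) {U : Set (transversal base T₀)}
    (hU : IsOpen U) {T : transversal base T₀} (hT : T ∈ U) :
    ∃ R, ∀ T', Agree R T.1 T'.1 → T' ∈ U := (isOpen_transversal_iff hb).1 hU T hT

theorem Agree.mem_delone (hb : InnerBase base) {T T' : SquareTiling P} (h : Agree R T T')
    (hR : ‖v‖ + 1 ≤ R) : v ∈ delone base T ↔ v ∈ delone base T' := by
  have key : ∀ {T T' : SquareTiling P}, Agree R T T' → v ∈ delone base T → v ∈ delone base T' := by
    rintro T T' h ⟨τ, hτ, rfl⟩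
    exact ⟨τ, (h.mem ((norm_fst_lt hb τ).trans_le hR)).1 hτ, rfl⟩
  exact ⟨key h, key h.symm⟩

theorem translate_mem_transversal {T : SquareTiling P} (hT : T ∈ T₀.hull) (hv : v ∈ delone base T) :
    T.translate (-v) ∈ transversal base T₀ := by
  refine ⟨translate_mem_hull hT, ?_⟩
  obtain ⟨τ, hτ, rfl⟩ := hv
  refine ⟨(τ.1 - tileBase base τ, τ.2), ?_, ?_⟩
  · rw [mem_translate]; simpa using hτ
  · simp [tileBase]

open scoped Classical in
/-- The partial transformation `T ↦ T - v` of the transversal, extended by the identity. -/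
noncomputable def shift (v : Plane) (T : transversal base T₀) : transversal base T₀ :=
  if h : v ∈ delone base T.1 then ⟨T.1.translate (-v), translate_mem_transversal T.2.1 h⟩ else T

theorem shift_val {T : transversal base T₀} (h : v ∈ delone base T.1) :
    (shift v T).1 = T.1.translate (-v) := by
  rw [shift, dif_pos h]

theorem continuous_shift [Finite P] (hb : InnerBase base) (v : Plane) :
    Continuous (shift v : transversal base T₀ → transversal base T₀) := by
  refine continuous_def.2 fun U hU => (isOpen_transversal_iff hb).2 fun T hT => ?_
  obtain ⟨R, hR⟩ := exists_agree_of_isOpen' hb hU hT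
  refine ⟨max (R + ‖v‖) (‖v‖ + 1), fun T' h => ?_⟩
  have hd := h.mem_delone hb (le_max_right (R + ‖v‖) (‖v‖ + 1))
  refine hR _ ?_
  by_cases hv : v ∈ delone base T.1
  · rw [shift_val hv, shift_val (hd.1 hv)]
    exact h.translate (by rw [norm_neg]; exact le_max_left _ _)
  · rw [shift, dif_neg hv, shift, dif_neg (fun k => hv (hd.2 k))]
    exact h.mono (le_trans (by linarith [norm_nonneg v]) (le_max_left _ _))

theorem neg_mem_delone {T : transversal base T₀} (h : v ∈ delone base T.1) :
    -v ∈ delone base (shift v T).1 := by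
  obtain ⟨σ, hσ, h0⟩ := T.2.2
  rw [shift_val h]
  refine ⟨(σ.1 - v, σ.2), by rw [mem_translate]; simpa using hσ, ?_⟩
  unfold tileBase at *
  rw [show σ.1 - v + base σ.2 = σ.1 + base σ.2 - v by abel, h0, zero_sub]

theorem shift_neg_shift {T : transversal base T₀} (h : v ∈ delone base T.1) :
    shift (-v) (shift v T) = T := by
  refine Subtype.ext ?_
  rw [shift_val (neg_mem_delone h), shift_val h, translate_translate, neg_neg, neg_add_cancel,
    translate_zero]

theorem orbitRel_iff {T T' : transversal base T₀} :
    orbitRel base T₀ T T' ↔ ∃ v ∈ delone base T.1, T' = shift v T :=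
  exists_congr fun v => and_congr_right fun h => by rw [Subtype.ext_iff, shift_val h]

/-- The return vectors of all tilings of the transversal form a countable set. -/
theorem exists_countable_delone [Finite P] (base : P → Plane) : ∃ V : Set Plane, V.Countable ∧
    ∀ T : SquareTiling P, (0 : Plane) ∈ delone base T → delone base T ⊆ V := by
  refine ⟨range fun k : (P × P) × (ℤ × ℤ) =>
    (-base k.1.1 + base k.1.2 + ((k.2.1 : ℝ), (k.2.2 : ℝ)) : Plane), countable_range _, ?_⟩
  rintro T ⟨σ, hσ, h0⟩ _ ⟨τ, hτ, rfl⟩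
  obtain ⟨i, j, e⟩ := exists_int hσ hτ
  refine ⟨((σ.2, τ.2), (i, j)), ?_⟩
  unfold tileBase at *
  have e1 : base σ.2 = -σ.1 := eq_neg_of_add_eq_zero_right h0
  dsimp only
  rw [e, e1]
  ext <;> simp <;> ring

variable {E : transversal base T₀ → transversal base T₀ → Prop}

/-- The openness of a subrelation in the étale topology: an equivalence `(T, T - v)` persists for the
tilings which coincide with `T` on a large ball. -/
theorem exists_agree_of_isOpenSubrelation [Finite P] (hb : InnerBase base) (haper : T₀.Aperiodic)
    (hrep : T₀.Repetitive) (hE : IsOpenSubrelation E) {T : transversal base T₀}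
    (hv : v ∈ delone base T.1) (h : E T (shift v T)) :
    ∃ R, ∀ T' : transversal base T₀, Agree R T.1 T'.1 → v ∈ delone base T'.1 ∧ E T' (shift v T') := by
  have key : ∀ O : Set (OrbitPairs base T₀), IsOpen O →
      (∃ k : orbitRel base T₀ T (shift v T), (⟨(T, shift v T), k⟩ : OrbitPairs base T₀) ∈ O) →
      ∃ R, ∀ T' : transversal base T₀, Agree R T.1 T'.1 → v ∈ delone base T'.1 ∧
        ∃ k : orbitRel base T₀ T' (shift v T'), (⟨(T', shift v T'), k⟩ : OrbitPairs base T₀) ∈ O := by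
    intro O hO
    induction hO with
    | basic O hO =>
      obtain ⟨w, A, hA, rfl⟩ := hO
      rintro ⟨k, h1, h2, h3⟩
      dsimp only at h1 h2 h3
      rw [shift_val hv] at h3
      have hvw : v = w := by
        have := haper.of_mem_hull hrep T.2.1 (w - v) (by
          have := congrArg (fun T => T.translate w) h3
          simpa [translate_translate, translate_zero, neg_add_eq_sub] using this)
        exact (sub_eq_zero.1 this).symm
      subst hvw
      obtain ⟨R, hR⟩ := exists_agree_of_isOpen' hb hA h1
      refine ⟨max R (‖v‖ + 1), fun T' h' => ?_⟩
      have hv' := (h'.mem_delone hb (le_max_right _ _)).1 hv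
      exact ⟨hv', orbitRel_iff.2 ⟨v, hv', rfl⟩, hR T' (h'.mono (le_max_left _ _)), hv',
        shift_val hv'⟩
    | univ =>
      rintro -
      refine ⟨‖v‖ + 1, fun T' h' => ?_⟩
      have hv' := (h'.mem_delone hb le_rfl).1 hv
      exact ⟨hv', orbitRel_iff.2 ⟨v, hv', rfl⟩, trivial⟩
    | inter O O' _ _ h1 h2 =>
      rintro ⟨k, k1, k2⟩
      obtain ⟨R1, r1⟩ := h1 ⟨k, k1⟩
      obtain ⟨R2, r2⟩ := h2 ⟨k, k2⟩
      refine ⟨max R1 R2, fun T' h' => ?_⟩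
      obtain ⟨hv', l, l1⟩ := r1 T' (h'.mono (le_max_left _ _))
      obtain ⟨-, l', l2⟩ := r2 T' (h'.mono (le_max_right _ _))
      exact ⟨hv', l, l1, l2⟩
    | sUnion C _ h =>
      rintro ⟨k, O, hO, k1⟩
      obtain ⟨R, r⟩ := h O hO ⟨k, k1⟩
      refine ⟨R, fun T' h' => ?_⟩
      obtain ⟨hv', l, l1⟩ := r T' h'
      exact ⟨hv', l, O, hO, l1⟩
  obtain ⟨R, hR⟩ := key _ hE.2.2 ⟨orbitRel_iff.2 ⟨v, hv, rfl⟩, h⟩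
  exact ⟨R, fun T' h' => ⟨(hR T' h').1, (hR T' h').2.2⟩⟩

theorem tileRel_iff {T : transversal base T₀} (hτ : τ ∈ T.1.tiles) (hτ' : τ' ∈ T.1.tiles) :
    tileRel E T.1 τ τ' ↔ E (shift (tileBase base τ) T) (shift (tileBase base τ') T) := by
  have e1 := shift_val (T := T) (mem_image_of_mem (tileBase base) hτ)
  have e2 := shift_val (T := T) (mem_image_of_mem (tileBase base) hτ')
  constructor
  · rintro ⟨U, U', h1, h2, h⟩
    rw [← e1, ← Subtype.ext_iff] at h1
    rw [← e2, ← Subtype.ext_iff] at h2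
    rwa [← h1, ← h2]
  · exact fun h => ⟨_, _, e1, e2, h⟩

theorem tileRel_translate : tileRel E (T.translate (-v)) (τ.1 - v, τ.2) (τ'.1 - v, τ'.2) ↔
    tileRel E T τ τ' := by
  have e : ∀ τ : Plane × P, (T.translate (-v)).translate (-tileBase base (τ.1 - v, τ.2)) =
      T.translate (-tileBase base τ) := fun τ => by
    rw [translate_translate]
    congr 1
    simp only [tileBase]
    abel
  unfold tileRel
  rw [e τ, e τ']

theorem tileRel_refl (hE : Equivalence E) {T : transversal base T₀} (hτ : τ ∈ T.1.tiles) :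
    tileRel E T.1 τ τ := (tileRel_iff hτ hτ).2 (hE.refl _)

/-- The tiles at `p` and `q` touch or coincide. -/
def Touch (p q : Plane) : Prop := |q.1 - p.1| ≤ 1 ∧ |q.2 - p.2| ≤ 1

theorem mem_relBoundary_iff (hE : Equivalence E) {T : transversal base T₀} : T ∈ relBoundary E ↔
    ∃ τ ∈ T.1.tiles, tileBase base τ = 0 ∧ ∃ τ' ∈ T.1.tiles, Touch τ.1 τ'.1 ∧
      ¬tileRel E T.1 τ τ' := by
  refine exists_congr fun τ => and_congr_right fun hτ => and_congr_right fun _ => ?_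
  constructor
  · rintro ⟨x, hx, hf⟩
    by_contra! h
    refine hf.2 (mem_interior_iff_mem_nhds.2 ?_)
    filter_upwards [Metric.ball_mem_nhds x (by norm_num : (0 : ℝ) < 1 / 2)] with y hy
    obtain ⟨τ', hτ', hy'⟩ := T.1.covers y
    have ht : Touch τ.1 τ'.1 := by
      obtain ⟨i, j, e⟩ := exists_int hτ hτ'
      rw [mem_squareAt] at hx hy'
      rw [Metric.mem_ball, Prod.dist_eq, max_lt_iff, Real.dist_eq, Real.dist_eq, abs_lt,
        abs_lt] at hy
      unfold InSq at hx hy'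
      rw [e] at hy'
      dsimp only at hy'
      have i1 : (-2 : ℝ) < i := by linarith
      have i2 : (i : ℝ) < 2 := by linarith
      have j1 : (-2 : ℝ) < j := by linarith
      have j2 : (j : ℝ) < 2 := by linarith
      norm_cast at i1 i2 j1 j2
      have i3 : ((-1 : ℤ) : ℝ) ≤ i := Int.cast_le.2 (by omega)
      have i4 : (i : ℝ) ≤ (1 : ℤ) := Int.cast_le.2 (by omega)
      have j3 : ((-1 : ℤ) : ℝ) ≤ j := Int.cast_le.2 (by omega)
      have j4 : (j : ℝ) ≤ (1 : ℤ) := Int.cast_le.2 (by omega)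
      push_cast at i3 i4 j3 j4
      unfold Touch
      rw [e, add_sub_cancel_left, add_sub_cancel_left, abs_le, abs_le]
      exact ⟨⟨i3, i4⟩, j3, j4⟩
    exact mem_biUnion (show τ' ∈ {τ' ∈ T.1.tiles | tileRel E T.1 τ τ'} from ⟨hτ', h τ' hτ' ht⟩) hy'
  · rintro ⟨τ', hτ', ⟨t1, t2⟩, hn⟩
    obtain ⟨x, hx, hx'⟩ := inSq_meet t1 t2
    refine ⟨x, hx, subset_closure ?_, fun hi => hn ?_⟩
    · exact mem_biUnion (show τ ∈ {τ' ∈ T.1.tiles | tileRel E T.1 τ τ'} from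
        ⟨hτ, tileRel_refl hE hτ⟩) hx
    · rw [mem_squareAt] at hx'
      have hcl : x ∈ closure (openSq 1 τ'.1) :=
        VCurve.closure_box (by linarith) (by linarith) (subset_refl (openSq 1 τ'.1))
          ⟨⟨hx'.1, hx'.2.1⟩, hx'.2.2⟩
      obtain ⟨y, hy, hyo⟩ := mem_closure_iff.1 hcl _ isOpen_interior hi
      obtain ⟨σ, hσ⟩ := mem_iUnion.1 (interior_subset hy)
      obtain ⟨⟨hσ1, hσ2⟩, hσy⟩ := mem_iUnion.1 hσ
      obtain ⟨i, j, e⟩ := exists_int hτ' hσ1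
      rw [mem_squareAt] at hσy
      rw [Face.mem_openSq] at hyo
      unfold InSq at hσy
      rw [e] at hσy
      dsimp only at hσy
      have i1 : (-1 : ℝ) < i := by linarith
      have i2 : (i : ℝ) < 1 := by linarith
      have j1 : (-1 : ℝ) < j := by linarith
      have j2 : (j : ℝ) < 1 := by linarith
      norm_cast at i1 i2 j1 j2
      obtain rfl : i = 0 := by omega
      obtain rfl : j = 0 := by omega
      obtain rfl : τ' = σ := eq_of_fst hτ' hσ1 (by rw [e]; simp)
      exact hσ2

/-- The boundary of an open equivalence subrelation is closed. -/
theorem isClosed_relBoundary [Finite P] (hb : InnerBase base) (haper : T₀.Aperiodic)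
    (hrep : T₀.Repetitive) (hE : IsOpenSubrelation E) : IsClosed (relBoundary E) := by
  refine ⟨(isOpen_transversal_iff hb).2 fun T hT => ?_⟩
  obtain ⟨τ, hτ, h0⟩ := T.2.2
  have hT' : ∀ τ' ∈ T.1.tiles, Touch τ.1 τ'.1 → tileRel E T.1 τ τ' := by
    by_contra! hc
    exact hT ((mem_relBoundary_iff hE.1).2 ⟨τ, hτ, h0, hc⟩)
  have hn := norm_fst_lt hb τ
  rw [h0, norm_zero, zero_add] at hn
  have hn' : ∀ {p : Plane}, Touch τ.1 p → ‖p‖ < 2 := by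
    intro p hp
    unfold Touch at hp
    rw [Prod.norm_def, max_lt_iff, Real.norm_eq_abs, Real.norm_eq_abs, abs_lt, abs_lt] at hn ⊢
    rw [abs_le, abs_le] at hp
    refine ⟨⟨?_, ?_⟩, ?_, ?_⟩ <;> linarith
  have hs : ∀ {T : transversal base T₀}, τ ∈ T.1.tiles → shift (tileBase base τ) T = T := by
    intro T hτ
    refine Subtype.ext ?_
    rw [shift_val (mem_image_of_mem _ hτ), h0, neg_zero, translate_zero]
  have hex : ∀ τ' : Plane × P, ∃ R, τ' ∈ T.1.tiles → Touch τ.1 τ'.1 →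
      ∀ T' : transversal base T₀, Agree R T.1 T'.1 → E T' (shift (tileBase base τ') T') := by
    intro τ'
    by_cases h' : τ' ∈ T.1.tiles ∧ Touch τ.1 τ'.1
    · have := (tileRel_iff hτ h'.1).1 (hT' τ' h'.1 h'.2)
      rw [hs hτ] at this
      obtain ⟨R, hR⟩ := exists_agree_of_isOpenSubrelation hb haper hrep hE
        (mem_image_of_mem _ h'.1) this
      exact ⟨R, fun _ _ T' hT => (hR T' hT).2⟩
    · exact ⟨0, fun h1 h2 => (h' ⟨h1, h2⟩).elim⟩
  choose R hR using hex
  obtain ⟨R', hR'⟩ := ((T.1.finite_tiles 2).image R).bddAbove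
  refine ⟨max R' 2, fun T' h hT'b => ?_⟩
  obtain ⟨σ, hσ, hσ0, τ', hτ', ht, hne⟩ := (mem_relBoundary_iff hE.1).1 hT'b
  have hτT' : τ ∈ T'.1.tiles := (h.mem (by linarith [le_max_right R' 2])).1 hτ
  obtain rfl : σ = τ := eq_of_tileBase hb hσ hτT' (by rw [hσ0, h0])
  have hlt := hn' ht
  have hτ'T : τ' ∈ T.1.tiles := (h.mem (hlt.trans_le (le_max_right _ _))).2 hτ'
  refine hne ((tileRel_iff hσ hτ').2 ?_)
  rw [hs hτT']
  refine hR τ' hτ'T ht T' (h.mono (le_trans ?_ (le_max_left _ _)))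
  exact hR' (mem_image_of_mem R ⟨hτ'T, hlt⟩)

end SquareTiling

/-! ### Robinson inflation -/

namespace RobinsonInflation

open SquareTiling

variable {P : Type*} {base : P → Plane} {T₀ : SquareTiling P} (I : RobinsonInflation base T₀)
  {n m : ℕ} {T T' : transversal base T₀} {τ τ' σ : Plane × P} {v : Plane}

/-- The corners of the squares of level `n + 1` in `T`. -/
def pack (n : ℕ) (T : transversal base T₀) : Set Plane := packingOf (I.marker (n + 1)) T.1

theorem one_le_side (n : ℕ) : 1 ≤ I.side n := by
  rw [← I.side_zero]
  exact I.side_strictMono.monotone n.zero_le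

theorem lt_side (n : ℕ) : n + 1 ≤ I.side n := by
  induction n with
  | zero => exact I.one_le_side 0
  | succ n ih =>
    have : I.side n < I.side (n + 1) := I.side_strictMono (by omega)
    omega

/-- The cubic growth of the sides beats every constant factor. -/
theorem exists_mul_side_le (K : ℕ) : ∃ n₀, ∀ n ≥ n₀, K * I.side n ≤ I.side (n + 1) := by
  refine ⟨K, fun n hn => ?_⟩
  have h1 := I.lt_side n
  -- Eventually `K ≤ N_n ≤ N_n ^ 2`.
  calc K * I.side n ≤ I.side n ^ 2 * I.side n := by
        refine Nat.mul_le_mul_right _ ?_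
        nlinarith
    _ = I.side n ^ 3 := by ring
    _ ≤ I.side (n + 1) := I.side_growth n

/-- The squares of a maximal packing leave no space at all, since their corners belong to the
lattice of the tiles. -/
theorem satPack (n : ℕ) (T : transversal base T₀) : SatPack (I.pack n T) (I.side (n + 1)) := by
  obtain ⟨h1, h2⟩ := I.isMaximalPacking (n + 1) (by omega) T
  have hside : (1 : ℝ) ≤ I.side (n + 1) := by exact_mod_cast I.one_le_side (n + 1)
  refine ⟨by linarith, fun s hs t ht hne => ?_, fun x y => ?_⟩
  · have := h1 s hs t ht hne
    rw [Prod.dist_eq, le_max_iff, Real.dist_eq, Real.dist_eq, le_abs, le_abs] at this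
    rcases this with (k | k) | k | k
    · right; left; linarith
    · left; linarith
    · right; right; right; linarith
    · right; right; left; linarith
  · obtain ⟨σ, hσ, h0⟩ := T.2.2
    have f1 := Int.floor_le (x - σ.1.1)
    have f2 := Int.lt_floor_add_one (x - σ.1.1)
    have f3 := Int.floor_le (y - σ.1.2)
    have f4 := Int.lt_floor_add_one (y - σ.1.2)
    obtain ⟨m, hm⟩ := exists_tile hσ ⌊x - σ.1.1⌋ ⌊y - σ.1.2⌋
    obtain ⟨s, hs, hd⟩ := h2 _ hm
    obtain ⟨m', hm', -⟩ := id hs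
    obtain ⟨i, j, e⟩ := exists_int hm hm'
    dsimp only at e hd
    refine ⟨s, hs, ?_⟩
    rw [Prod.dist_eq, max_lt_iff, Real.dist_eq, Real.dist_eq, abs_lt, abs_lt, e] at hd
    dsimp only at hd
    obtain ⟨⟨d1, d2⟩, d3, d4⟩ := hd
    have i1 : (i : ℝ) < (I.side (n + 1) : ℤ) := by push_cast; linarith
    have i2 : ((-I.side (n + 1) : ℤ) : ℝ) < i := by push_cast; linarith
    have j1 : (j : ℝ) < (I.side (n + 1) : ℤ) := by push_cast; linarith
    have j2 : ((-I.side (n + 1) : ℤ) : ℝ) < j := by push_cast; linarith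
    rw [Int.cast_lt] at i1 i2 j1 j2
    have i3 : (i : ℝ) ≤ (I.side (n + 1) - 1 : ℤ) := Int.cast_le.2 (by omega)
    have i4 : ((1 - I.side (n + 1) : ℤ) : ℝ) ≤ i := Int.cast_le.2 (by omega)
    have j3 : (j : ℝ) ≤ (I.side (n + 1) - 1 : ℤ) := Int.cast_le.2 (by omega)
    have j4 : ((1 - I.side (n + 1) : ℤ) : ℝ) ≤ j := Int.cast_le.2 (by omega)
    push_cast at i3 i4 j3 j4
    rw [e]
    dsimp only
    refine ⟨?_, ?_, ?_, ?_⟩ <;> linarith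

/-- The corner of the square of level `n + 1` to which a tile is attributed. -/
noncomputable def att (n : ℕ) (T : transversal base T₀) : Plane × P → Plane :=
  (I.inflation n T).choose

theorem att_mem (hτ : τ ∈ T.1.tiles) : I.att n T τ ∈ I.pack n T :=
  ((I.inflation n T).choose_spec τ hτ).1

theorem att_eq (hτ : τ ∈ T.1.tiles) (hτ' : τ' ∈ T.1.tiles) (h : tileRel (I.rel n) T.1 τ τ') :
    I.att n T τ = I.att n T τ' :=
  (((I.inflation n T).choose_spec τ hτ).2.2 τ' hτ').1 h

theorem tileRel_succ (hτ : τ ∈ T.1.tiles) (hτ' : τ' ∈ T.1.tiles) :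
    tileRel (I.rel (n + 1)) T.1 τ τ' ↔ I.att n T τ = I.att n T τ' :=
  (((I.inflation n T).choose_spec τ hτ).2.2 τ' hτ').2

theorem exists_meet (n : ℕ) (hτ : τ ∈ T.1.tiles) : ∃ σ ∈ T.1.tiles, tileRel (I.rel n) T.1 τ σ ∧
    ∃ z, InSq 1 σ.1 z ∧
      z ∈ interior (robinsonTile (I.pack n T) (I.side (n + 1)) (I.att n T τ)) := by
  obtain ⟨z, hz, hz'⟩ := ((I.inflation n T).choose_spec τ hτ).2.1
  obtain ⟨σ, hσ⟩ := mem_iUnion.1 hz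
  obtain ⟨⟨h1, h2⟩, h3⟩ := mem_iUnion.1 hσ
  exact ⟨σ, h1, h2, z, mem_squareAt.1 h3, hz'⟩

theorem rel_succ (h : I.rel n T T') : I.rel (n + 1) T T' := by
  obtain ⟨v, ⟨τ', hτ', rfl⟩, hv⟩ := (I.isCEER_rel n).1.2.1 T T' h
  obtain ⟨τ, hτ, h0⟩ := T.2.2
  have e1 : T.1 = T.1.translate (-tileBase base τ) := by rw [h0, neg_zero, translate_zero]
  obtain ⟨U, U', h1, h2, h3⟩ := (I.tileRel_succ (n := n) hτ hτ').2
    (I.att_eq hτ hτ' ⟨T, T', e1, hv, h⟩)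
  rw [← e1, ← Subtype.ext_iff] at h1
  rw [← hv, ← Subtype.ext_iff] at h2
  rwa [h1, h2] at h3

theorem rel_mono (hnm : n ≤ m) (h : I.rel n T T') : I.rel m T T' := by
  induction hnm with
  | refl => exact h
  | step _ ih => exact I.rel_succ ih

theorem equivalence_limitRel : Equivalence I.limitRel where
  refl T := ⟨0, (I.isCEER_rel 0).1.1.refl T⟩
  symm := fun ⟨n, h⟩ => ⟨n, (I.isCEER_rel n).1.1.symm h⟩
  trans := fun ⟨n, h⟩ ⟨m, h'⟩ => ⟨max n m, (I.isCEER_rel _).1.1.trans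
    (I.rel_mono (le_max_left n m) h) (I.rel_mono (le_max_right n m) h')⟩

theorem isOpenSubrelation_limitRel : IsOpenSubrelation I.limitRel := by
  refine ⟨I.equivalence_limitRel, fun T T' ⟨n, h⟩ => (I.isCEER_rel n).1.2.1 T T' h, ?_⟩
  have : {p : OrbitPairs base T₀ | I.limitRel p.1.1 p.1.2} =
      ⋃ n, {p : OrbitPairs base T₀ | I.rel n p.1.1 p.1.2} := by
    ext p; simp [limitRel]
  rw [this]
  exact isOpen_iUnion fun n => (I.isCEER_rel n).1.2.2

theorem isAF_limitRel : IsAF I.limitRel :=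
  ⟨I.rel, I.isCEER_rel, fun _ _ _ h => I.rel_succ h, fun _ _ => Iff.rfl⟩

/-- A bound for the distance of the corners of two tiles of the same plaque. -/
def diam : ℕ → ℝ
  | 0 => 0
  | n + 1 => 12 * I.side (n + 1) + 2 + 2 * diam n

theorem diam_nonneg (n : ℕ) : 0 ≤ I.diam n := by
  induction n with
  | zero => exact le_rfl
  | succ n ih => unfold diam; positivity

theorem diam_le (n : ℕ) : I.diam n ≤ 30 * I.side n := by
  induction n with
  | zero => unfold diam; positivity
  | succ n ih =>
    have h1 : (1 : ℝ) ≤ I.side (n + 1) := by exact_mod_cast I.one_le_side (n + 1)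
    rcases n.eq_zero_or_pos with rfl | hn
    · simp only [diam]; linarith
    · have h2 : (2 : ℝ) ≤ I.side n := by
        have := I.lt_side n
        exact_mod_cast (by omega : 2 ≤ I.side n)
      have h3 : (I.side n : ℝ) ^ 3 ≤ I.side (n + 1) := by exact_mod_cast I.side_growth n
      have h4 : 4 * (I.side n : ℝ) ≤ I.side (n + 1) := by
        refine le_trans ?_ h3
        have h5 : (4 : ℝ) ≤ (I.side n : ℝ) ^ 2 := by nlinarith
        calc 4 * (I.side n : ℝ) ≤ (I.side n : ℝ) ^ 2 * I.side n := by gcongr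
          _ = (I.side n : ℝ) ^ 3 := by ring
      simp only [diam]
      linarith

/-- The plaques of one level are small compared with the squares of the next one. -/
theorem exists_side_ge (K C : ℝ) : ∃ n₀, ∀ n ≥ n₀, K * I.diam n + C ≤ I.side (n + 1) := by
  obtain ⟨k, hk⟩ := exists_nat_ge (30 * |K| + |C|)
  obtain ⟨n₀, h⟩ := I.exists_mul_side_le k
  refine ⟨n₀, fun n hn => ?_⟩
  have h1 : (k : ℝ) * I.side n ≤ I.side (n + 1) := by exact_mod_cast h n hn
  have h2 := I.diam_le n
  have h3 : (1 : ℝ) ≤ I.side n := by exact_mod_cast I.one_le_side n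
  have h4 : (30 * |K| + |C|) * I.side n ≤ k * I.side n :=
    mul_le_mul_of_nonneg_right hk (by linarith)
  have h5 : K * I.diam n ≤ |K| * (30 * I.side n) :=
    (mul_le_mul_of_nonneg_right (le_abs_self K) (I.diam_nonneg n)).trans
      (mul_le_mul_of_nonneg_left h2 (abs_nonneg K))
  have h6 : C ≤ |C| * I.side n := (le_abs_self C).trans
    (le_mul_of_one_le_right (abs_nonneg C) h3)
  linarith

section

variable [Finite P] (hb : InnerBase base) (haper : T₀.Aperiodic) (hrep : T₀.Repetitive)
include hb haper hrep

theorem eq_of_tileRel_zero (hτ : τ ∈ T.1.tiles) (hτ' : τ' ∈ T.1.tiles)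
    (h : tileRel (I.rel 0) T.1 τ τ') : τ = τ' := by
  rw [tileRel_iff hτ hτ', I.rel_zero, Subtype.ext_iff, shift_val (mem_image_of_mem _ hτ),
    shift_val (mem_image_of_mem _ hτ')] at h
  have := haper.of_mem_hull hrep T.2.1 (tileBase base τ' - tileBase base τ) (by
    have := congrArg (fun T => T.translate (tileBase base τ')) h
    simpa [translate_translate, translate_zero, neg_add_eq_sub] using this)
  exact eq_of_tileBase hb hτ hτ' (sub_eq_zero.1 this).symm

/-- The plaques of level `n` have bounded size: a plaque of level `n + 1` is made of plaques of
level `n` which meet the same tile. -/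
theorem within_diam (hτ : τ ∈ T.1.tiles) (hτ' : τ' ∈ T.1.tiles)
    (h : tileRel (I.rel n) T.1 τ τ') : Within (I.diam n) τ.1 τ'.1 := by
  induction n generalizing τ τ' with
  | zero =>
    rw [I.eq_of_tileRel_zero hb haper hrep hτ hτ' h]
    simp [Within, diam]
  | succ n ih =>
    have key : ∀ {τ}, τ ∈ T.1.tiles →
        Within (6 * I.side (n + 1) + 1 + I.diam n) (I.att n T τ) τ.1 := by
      intro τ hτ
      obtain ⟨σ, hσ, h1, z, hz, hz'⟩ := I.exists_meet n hτ
      have k1 := ih hτ hσ h1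
      have k2 := (I.satPack n T).tile_within (interior_subset hz')
      unfold Within InSq at *
      simp only [abs_le] at *
      refine ⟨⟨?_, ?_⟩, ?_, ?_⟩ <;> linarith
    have k1 := key hτ
    have k2 := key hτ'
    rw [← (I.tileRel_succ hτ hτ').1 h] at k2
    unfold Within at *
    simp only [abs_le, diam] at *
    refine ⟨⟨?_, ?_⟩, ?_, ?_⟩ <;> linarith

theorem within_att (hτ : τ ∈ T.1.tiles) :
    Within (6 * I.side (n + 1) + 1 + I.diam n) (I.att n T τ) τ.1 := by
  obtain ⟨σ, hσ, h1, z, hz, hz'⟩ := I.exists_meet n hτ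
  have k1 := I.within_diam hb haper hrep hτ hσ h1
  have k2 := (I.satPack n T).tile_within (interior_subset hz')
  unfold Within InSq at *
  simp only [abs_le] at *
  refine ⟨⟨?_, ?_⟩, ?_, ?_⟩ <;> linarith

/-- The tiles whose plaques are contained in a square are attributed to it. -/
theorem att_eq_of_core {s : Plane} (hs : s ∈ I.pack n T) (hτ : τ ∈ T.1.tiles)
    (h1 : s.1 + I.diam n ≤ τ.1.1) (h2 : τ.1.1 + I.diam n + 1 ≤ s.1 + I.side (n + 1))
    (h3 : s.2 + I.diam n ≤ τ.1.2) (h4 : τ.1.2 + I.diam n + 1 ≤ s.2 + I.side (n + 1)) :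
    I.att n T τ = s := by
  obtain ⟨σ, hσ, k, z, hz, hz'⟩ := I.exists_meet n hτ
  have k1 := I.within_diam hb haper hrep hτ hσ k
  refine (I.satPack n T).eq_of_mem_interior (I.att_mem hτ) hs hz' ?_
  unfold Within InSq at *
  simp only [abs_le] at *
  refine ⟨?_, ?_, ?_, ?_⟩ <;> linarith

/-- A tile all of whose neighbours are attributed to the same square does not meet the boundary. -/
theorem notMem_relBoundary (hτ : τ ∈ T.1.tiles)
    (h : ∀ σ ∈ T.1.tiles, Touch τ.1 σ.1 → I.att n T τ = I.att n T σ) :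
    shift (tileBase base τ) T ∉ relBoundary (I.rel (n + 1)) := by
  rw [mem_relBoundary_iff (I.isCEER_rel _).1.1]
  rintro ⟨ρ, hρ, h0, σ, hσ, ht, hn⟩
  set v := tileBase base τ with hv
  have hvd : v ∈ delone base T.1 := mem_image_of_mem _ hτ
  rw [shift_val hvd] at hρ hσ hn
  have e0 : tileBase base (τ.1 - v, τ.2) = 0 := by
    rw [hv]; simp only [tileBase]; abel
  obtain rfl : ρ = (τ.1 - v, τ.2) := eq_of_tileBase hb hρ
    (by rw [mem_translate]; simpa using hτ) (by rw [h0, e0])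
  rw [mem_translate, sub_neg_eq_add] at hσ
  have e : σ = ((σ.1 + v, σ.2).1 - v, (σ.1 + v, σ.2).2) := by simp
  rw [e, tileRel_translate, I.tileRel_succ hτ hσ] at hn
  refine hn (h _ hσ ?_)
  unfold Touch at *
  dsimp only [Prod.fst_sub, Prod.snd_sub, Prod.fst_add, Prod.snd_add] at ht ⊢
  constructor
  · convert ht.1 using 2; ring
  · convert ht.2 using 2; ring

theorem notMem_relBoundary_of_core {s : Plane} (hs : s ∈ I.pack n T) (hτ : τ ∈ T.1.tiles)
    (h1 : s.1 + I.diam n + 1 ≤ τ.1.1) (h2 : τ.1.1 + I.diam n + 2 ≤ s.1 + I.side (n + 1))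
    (h3 : s.2 + I.diam n + 1 ≤ τ.1.2) (h4 : τ.1.2 + I.diam n + 2 ≤ s.2 + I.side (n + 1)) :
    shift (tileBase base τ) T ∉ relBoundary (I.rel (n + 1)) := by
  refine I.notMem_relBoundary hb haper hrep hτ fun σ hσ ht => ?_
  unfold Touch at ht
  rw [abs_le, abs_le] at ht
  rw [I.att_eq_of_core hb haper hrep hs hτ (by linarith) (by linarith) (by linarith) (by linarith),
    I.att_eq_of_core hb haper hrep hs hσ (by linarith) (by linarith) (by linarith) (by linarith)]

/-- Every patch occurs deep inside of the squares of high level. -/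
theorem exists_rel_agree (T T' : transversal base T₀) (R : ℝ) :
    ∃ n, ∃ v ∈ delone base T.1, I.rel (n + 1) T (shift v T) ∧
      shift v T ∉ relBoundary (I.rel (n + 1)) ∧ Agree R T'.1 (shift v T).1 := by
  obtain ⟨D, hD, h⟩ := exists_agree_translate hrep T'.2.1 (R := max R 1) (by positivity)
  obtain ⟨n, hn⟩ := I.exists_side_ge 4 (2 * D + 20)
  have hn := hn n le_rfl
  obtain ⟨τ₀, hτ₀, h0⟩ := T.2.2
  set s := I.att n T τ₀ with hs
  have hsm : s ∈ I.pack n T := I.att_mem hτ₀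
  obtain ⟨v, hv, hag⟩ := h T.1 T.2.1 (s.1 + I.side (n + 1) / 2, s.2 + I.side (n + 1) / 2)
  obtain ⟨ρ, hρ, hρ0⟩ := (hag.mem_delone hb (v := 0)
    (by rw [norm_zero, zero_add]; exact le_max_right _ _)).1 T'.2.2
  rw [mem_translate, sub_neg_eq_add] at hρ
  have e : tileBase base (ρ.1 + v, ρ.2) = v := by
    unfold tileBase at *
    dsimp only
    rw [add_right_comm, hρ0, zero_add]
  have hvd : v ∈ delone base T.1 := ⟨_, hρ, e⟩
  have hρn := norm_fst_lt hb ρ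
  rw [hρ0, norm_zero, zero_add] at hρn
  rw [Prod.norm_def, max_lt_iff, Real.norm_eq_abs, Real.norm_eq_abs, abs_lt, abs_lt] at hρn
  rw [Prod.norm_def, max_le_iff, Real.norm_eq_abs, Real.norm_eq_abs, abs_le, abs_le] at hv
  simp only [Prod.fst_sub, Prod.snd_sub] at hv
  obtain ⟨⟨v1, v2⟩, v3, v4⟩ := hv
  obtain ⟨⟨r1, r2⟩, r3, r4⟩ := hρn
  have hd := I.diam_nonneg n
  refine ⟨n, v, hvd, ?_, ?_, ?_⟩
  · have hat : I.att n T (ρ.1 + v, ρ.2) = s := by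
      refine I.att_eq_of_core hb haper hrep hsm hρ ?_ ?_ ?_ ?_ <;>
        simp only [Prod.fst_add, Prod.snd_add] <;> linarith
    have := (tileRel_iff hτ₀ hρ).1 ((I.tileRel_succ hτ₀ hρ).2 (hs.symm.trans hat.symm))
    have e0 : shift (tileBase base τ₀) T = T := Subtype.ext (by
      rw [shift_val (mem_image_of_mem _ hτ₀), h0, neg_zero, translate_zero])
    rwa [e, e0] at this
  · have := I.notMem_relBoundary_of_core hb haper hrep hsm hρ (by
      simp only [Prod.fst_add]; linarith) (by simp only [Prod.fst_add]; linarith) (by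
      simp only [Prod.snd_add]; linarith) (by simp only [Prod.snd_add]; linarith)
    rwa [e] at this
  · rw [shift_val hvd]
    exact hag.mono (le_max_left _ _)

theorem isMinimal_limitRel : IsMinimalRel I.limitRel := by
  intro T
  rw [dense_iff_inter_open]
  rintro U hU ⟨T', hT'⟩
  obtain ⟨R, hR⟩ := exists_agree_of_isOpen' hb hU hT'
  obtain ⟨n, v, -, h1, -, h2⟩ := I.exists_rel_agree hb haper hrep T T' R
  exact ⟨_, hR _ h2, n + 1, h1⟩

theorem isClosed_boundary : IsClosed I.boundary :=
  isClosed_iInter fun n => isClosed_relBoundary hb haper hrep (I.isCEER_rel n).1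

/-- A neighbourhood of a point of the boundary would contain all tilings which agree with it on a
ball; but its patch occurs deep inside of a square. -/
theorem isMeagre_boundary : IsMeagre I.boundary := by
  refine IsNowhereDense.isMeagre ?_
  rw [(I.isClosed_boundary hb haper hrep).isNowhereDense_iff, eq_empty_iff_forall_notMem]
  intro T hT
  obtain ⟨R, hR⟩ := exists_agree_of_isOpen' hb isOpen_interior hT
  obtain ⟨n, v, -, -, h1, h2⟩ := I.exists_rel_agree hb haper hrep T T R
  exact h1 (mem_iInter.1 (interior_subset (hR _ h2)) (n + 1))

/-- The orbit class of `T` contains at most four classes of the limit relation: five of them would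
be represented by tiles close to the origin, which at a high level would be attributed to five
different tiles of the packing that come close to the origin. -/
theorem encard_classes_le (T : transversal base T₀) :
    {c : Set (transversal base T₀) | ∃ T', orbitRel base T₀ T T' ∧
      c = {T'' | I.limitRel T' T''}}.encard ≤ 4 := by
  classical
  by_contra! hc
  obtain ⟨C, hC, hCc⟩ := exists_subset_encard_eq (Order.add_one_le_of_lt hc)
  have hCf : C.Finite := finite_of_encard_eq_coe (k := 5) (hCc.trans (by norm_num))
  have hex : ∀ c : Set (transversal base T₀), ∃ τ : Plane × P, c ∈ C →
      τ ∈ T.1.tiles ∧ c = {T'' | I.limitRel (shift (tileBase base τ) T) T''} := by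
    intro c
    by_cases hcC : c ∈ C
    · obtain ⟨T', h1, h2⟩ := hC hcC
      obtain ⟨v, ⟨τ, hτ, rfl⟩, rfl⟩ := orbitRel_iff.1 h1
      exact ⟨τ, fun _ => ⟨hτ, h2⟩⟩
    · obtain ⟨τ, -⟩ := T.2.2
      exact ⟨τ, fun h => (hcC h).elim⟩
  choose f hf using hex
  obtain ⟨D, hD⟩ := (hCf.image fun c => ‖(f c).1‖).bddAbove
  have hD' : ∀ c ∈ C, ‖(f c).1‖ ≤ |D| := fun c hc =>
    (hD (mem_image_of_mem (fun c => ‖(f c).1‖) hc)).trans (le_abs_self D)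
  -- The plaques of level `n` and the distance `D` are small compared with the squares of level `n +
  -- 1`.
  obtain ⟨n, hn⟩ := I.exists_side_ge 200 (200 * (|D| + 2))
  have hn := hn n le_rfl
  have hd := I.diam_nonneg n
  have hinj : InjOn (fun c => I.att n T (f c)) C := by
    intro c hc c' hc' h
    obtain ⟨h1, h2⟩ := hf c hc
    obtain ⟨h3, h4⟩ := hf c' hc'
    have hr := (tileRel_iff h1 h3).1 ((I.tileRel_succ h1 h3).2 h)
    rw [h2, h4]
    ext T''
    have heq := I.equivalence_limitRel
    exact ⟨fun k => heq.trans (heq.symm ⟨_, hr⟩) k, fun k => heq.trans ⟨_, hr⟩ k⟩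
  have hcard := (I.satPack n T).card_near_le (x := 0) (r := I.diam n + (|D| + 2)) (by positivity)
    (by linarith) (hCf.toFinset.image fun c => I.att n T (f c)) (by
      intro a ha
      obtain ⟨c, hc, rfl⟩ := Finset.mem_image.1 ha
      rw [Finite.mem_toFinset] at hc
      have h1 := (hf c hc).1
      refine ⟨I.att_mem h1, ?_⟩
      obtain ⟨σ, hσ, k, z, hz, hz'⟩ := I.exists_meet n h1
      have k1 := I.within_diam hb haper hrep h1 hσ k
      have k2 := hD' c hc
      rw [Prod.norm_def, max_le_iff, Real.norm_eq_abs, Real.norm_eq_abs, abs_le, abs_le] at k2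
      refine ⟨z, interior_subset hz', ?_⟩
      unfold Within InSq at *
      simp only [abs_le, abs_lt, Prod.fst_zero, Prod.snd_zero, sub_zero] at *
      refine ⟨⟨?_, ?_⟩, ?_, ?_⟩ <;> linarith)
  rw [Finset.card_image_of_injOn (by simpa using hinj)] at hcard
  rw [hCf.encard_eq_coe_toFinset_card] at hCc
  have : (hCf.toFinset.card : ℕ∞) ≤ 4 := by exact_mod_cast hcard
  rw [hCc] at this
  exact absurd this (by decide)

end

end RobinsonInflation

/-! ### Invariant measures -/

section Invariant

open SquareTiling

variable {P : Type*} {base : P → Plane} {T₀ : SquareTiling P}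
  {E : transversal base T₀ → transversal base T₀ → Prop} {v w : Plane}
  {μ : Measure (transversal base T₀)}

/-- By aperiodicity, the elements of an orbit class are labelled by their return vectors. -/
theorem eq_of_shift_eq [Finite P] (haper : T₀.Aperiodic) (hrep : T₀.Repetitive) {T : transversal base T₀}
    (hv : v ∈ delone base T.1) (hw : w ∈ delone base T.1) (h : shift v T = shift w T) :
    v = w := by
  have h := congrArg Subtype.val h
  rw [shift_val hv, shift_val hw] at h
  have := haper.of_mem_hull hrep T.2.1 (w - v) (by
    have := congrArg (fun T => T.translate w) h
    simpa [SquareTiling.translate_translate, SquareTiling.translate_zero, neg_add_eq_sub] using this)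
  exact (sub_eq_zero.1 this).symm

/-- The domain of the partial transformation `shift v` of `E`. -/
def shiftDomain (E : transversal base T₀ → transversal base T₀ → Prop) (v : Plane) :
    Set (transversal base T₀) := {T | v ∈ delone base T.1 ∧ E T (shift v T)}

theorem shift_mem_shiftDomain (hE : Equivalence E) {T : transversal base T₀}
    (h : T ∈ shiftDomain E v) : shift v T ∈ shiftDomain E (-v) := by
  refine ⟨neg_mem_delone h.1, ?_⟩
  rw [shift_neg_shift h.1]
  exact hE.symm h.2

/-- A sum over the return vectors in the relation is a sum over the class. -/
theorem tsum_shiftDomain [Finite P] (haper : T₀.Aperiodic) (hrep : T₀.Repetitive)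
    (hE : IsOpenSubrelation E) {W : Set Plane} {T : transversal base T₀} (hW : delone base T.1 ⊆ W)
    (g : transversal base T₀ → ENNReal) :
    ∑' v : W, (shiftDomain E v).indicator (fun T => g (shift v T)) T =
      ∑' T' : {T' | E T T'}, g T' := by
  let e : {v : W | T ∈ shiftDomain E v} ≃ {T' | E T T'} :=
    Equiv.ofBijective (fun v => ⟨shift v.1.1 T, v.2.2⟩) ⟨fun v w h =>
      Subtype.ext (Subtype.ext (eq_of_shift_eq haper hrep v.2.1 w.2.1 (congrArg Subtype.val h))),
      fun T' => by
        obtain ⟨v, hv, h⟩ := orbitRel_iff.1 (hE.2.1 _ _ T'.2)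
        have h' := T'.2
        rw [mem_ofPred_eq, h] at h'
        exact ⟨⟨⟨v, hW hv⟩, hv, h'⟩, Subtype.ext h.symm⟩⟩
  rw [← e.tsum_eq]
  exact (tsum_subtype {v : W | T ∈ shiftDomain E v} fun v : W => g (shift v T)).symm

section

variable [Finite P] (hb : InnerBase base) (haper : T₀.Aperiodic) (hrep : T₀.Repetitive)
  (hE : IsOpenSubrelation E)

include hb haper hrep hE

theorem isOpen_shiftDomain (v : Plane) : IsOpen (shiftDomain E v) :=
  (isOpen_transversal_iff hb).2 fun _ hT =>
    exists_agree_of_isOpenSubrelation hb haper hrep hE hT.1 hT.2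

/-- The partial transformation `shift v` of `E` preserves an invariant measure. -/
theorem map_restrict_shiftDomain (hμ : IsInvariantMeasure E μ) (v : Plane) :
    Measure.map (shift v) (μ.restrict (shiftDomain E v)) = μ.restrict (shiftDomain E (-v)) := by
  have hm : ∀ v, Measurable (shift v : transversal base T₀ → _) :=
    fun v => (continuous_shift hb v).measurable
  have hd : ∀ v, MeasurableSet (shiftDomain E v) :=
    fun v => (isOpen_shiftDomain hb haper hrep hE v).measurableSet
  ext B hB
  rw [Measure.map_apply (hm v) hB, Measure.restrict_apply (hm v hB), Measure.restrict_apply hB]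
  have hs : ∀ {T}, T ∈ shiftDomain E (-v) →
      shift (-v) T ∈ shiftDomain E v ∧ shift v (shift (-v) T) = T := by
    intro T hT
    have h1 := shift_mem_shiftDomain hE.1 hT
    have h2 := shift_neg_shift hT.1
    rw [neg_neg] at h1 h2
    exact ⟨h1, h2⟩
  refine hμ _ _ ((hm v hB).inter (hd v)) (hB.inter (hd (-v)))
    { toFun := fun x => ⟨shift v x.1, x.2.1, shift_mem_shiftDomain hE.1 x.2.2⟩
      invFun := fun x => ⟨shift (-v) x.1, by
        rw [mem_preimage, (hs x.2.2).2]; exact x.2.1, (hs x.2.2).1⟩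
      left_inv := fun x => Subtype.ext (shift_neg_shift x.2.2.1)
      right_inv := fun x => Subtype.ext (hs x.2.2).2
      measurable_toFun := ((hm v).comp measurable_subtype_coe).subtype_mk
      measurable_invFun := ((hm (-v)).comp measurable_subtype_coe).subtype_mk } fun x => x.2.2.2

/-- The mass transport principle: a weight `g` may be spread over the classes of `E`. -/
theorem lintegral_tsum_class (hμ : IsInvariantMeasure E μ) {g : transversal base T₀ → ENNReal}
    (hg : Measurable g) :
    ∫⁻ T, ∑' _ : {T' | E T T'}, g T ∂μ = ∫⁻ T, ∑' T' : {T' | E T T'}, g T' ∂μ := by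
  obtain ⟨V, hV, hVd⟩ := exists_countable_delone base
  set W : Set Plane := V ∪ -V
  have : Countable W := (hV.union (by
    rw [← image_neg_eq_neg]
    exact hV.image _)).to_subtype
  have hW : ∀ T : transversal base T₀, delone base T.1 ⊆ W :=
    fun T => (hVd T.1 T.2.2).trans subset_union_left
  have hd := fun v => (isOpen_shiftDomain hb haper hrep hE v).measurableSet
  have hm := fun v => (continuous_shift (T₀ := T₀) hb v).measurable
  -- The sum over the vectors `v` is compared with the sum over the vectors `-v`.
  let ι : W ≃ W := ⟨fun v => ⟨-v.1, by rcases v.2 with h | h <;> simp_all [W]⟩,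
    fun v => ⟨-v.1, by rcases v.2 with h | h <;> simp_all [W]⟩,
    fun v => by simp, fun v => by simp⟩
  have h1 : ∀ T, ∑' _ : {T' | E T T'}, g T =
      ∑' v : W, (shiftDomain E v).indicator g T := by
    intro T
    rw [← tsum_shiftDomain haper hrep hE (hW T) fun _ => g T]
    rfl
  simp only [h1, ← tsum_shiftDomain haper hrep hE (hW _)]
  rw [lintegral_tsum fun v : W => (hg.indicator (hd v)).aemeasurable,
    lintegral_tsum (f := fun (v : W) T => (shiftDomain E v).indicator (fun T => g (shift v T)) T)
      fun v => ((hg.comp (hm v)).indicator (hd v)).aemeasurable, ← ι.tsum_eq]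
  refine tsum_congr fun v => ?_
  change ∫⁻ T, (shiftDomain E (-v.1)).indicator g T ∂μ = _
  rw [lintegral_indicator (hd _), lintegral_indicator (hd _),
    ← map_restrict_shiftDomain hb haper hrep hE hμ, lintegral_map hg (hm _)]

/-- An invariant measure is at least as large on a set `G` as the proportion of `G` in the
classes of `E` imposes. -/
theorem measure_le_mul_measure_inter (hμ : IsInvariantMeasure E μ)
    (hfin : ∀ T, {T' | E T T'}.Finite) {G Z : Set (transversal base T₀)} (hG : MeasurableSet G)
    (hZ : MeasurableSet Z) (hinv : ∀ T T', E T T' → T ∈ Z → T' ∈ Z) {M : ℕ}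
    (h : ∀ T, {T' | E T T'}.ncard ≤ M * ({T' | E T T'} ∩ G).ncard) :
    μ Z ≤ M * μ (Z ∩ G) := by
  classical
  have hcount : ∀ T (B : Set (transversal base T₀)),
      ∑' T' : {T' | E T T'}, B.indicator (fun _ => (1 : ENNReal)) T' =
        (({T' | E T T'} ∩ B).ncard : ENNReal) := by
    intro T B
    rw [tsum_subtype {T' | E T T'} (B.indicator fun _ => (1 : ENNReal)), indicator_indicator,
      ← tsum_subtype ({T' | E T T'} ∩ B) (fun _ => (1 : ENNReal)), ENNReal.tsum_set_one,
      ((hfin T).inter_of_left B).cast_ncard_eq.symm]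
    rfl
  set c : transversal base T₀ → ENNReal := fun T => ({T' | E T T'}.ncard : ENNReal) with hc
  have hc1 : ∀ T, ∑' _ : {T' | E T T'}, (1 : ENNReal) = c T := by
    intro T
    have := hcount T univ
    simpa using this
  have hcE : ∀ {T T'}, E T T' → c T' = c T := by
    intro T T' k
    have : {U | E T' U} = {U | E T U} :=
      ext fun U => ⟨fun k' => hE.1.trans k k', fun k' => hE.1.trans (hE.1.symm k) k'⟩
    simp only [hc, this]
  have hc0 : ∀ T, c T ≠ 0 := by
    intro T
    simp only [hc, ne_eq, Nat.cast_eq_zero]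
    rw [ncard_eq_zero (hfin T)]
    exact (nonempty_of_mem (show T ∈ {T' | E T T'} from hE.1.refl T)).ne_empty
  have hct : ∀ T, c T ≠ ⊤ := fun T => ENNReal.natCast_ne_top _
  obtain ⟨V, hV, hVd⟩ := exists_countable_delone base
  have : Countable V := hV.to_subtype
  have hcm : Measurable c := by
    have : c = fun T => ∑' v : V, (shiftDomain E v).indicator (fun _ => (1 : ENNReal)) T := by
      funext T
      rw [← hc1]
      exact (tsum_shiftDomain haper hrep hE (hVd T.1 T.2.2) fun _ => 1).symm
    rw [this]
    exact Measurable.tsum fun v : V => measurable_const.indicator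
      (isOpen_shiftDomain hb haper hrep hE v).measurableSet
  -- The mass of each point of `Z ∩ G` is shared out equally among its class.
  have key := lintegral_tsum_class hb haper hrep hE hμ
    (g := fun T => (Z ∩ G).indicator (fun _ => 1) T * (c T)⁻¹)
    ((measurable_const.indicator (hZ.inter hG)).mul hcm.inv)
  have e1 : ∀ T, ∑' _ : {T' | E T T'}, (Z ∩ G).indicator (fun _ => (1 : ENNReal)) T * (c T)⁻¹ =
      (Z ∩ G).indicator (fun _ => 1) T := by
    intro T
    have : (Z ∩ G).indicator (fun _ => (1 : ENNReal)) T * (c T)⁻¹ =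
      (Z ∩ G).indicator (fun _ => (1 : ENNReal)) T * (c T)⁻¹ * 1 := (mul_one _).symm
    rw [this, ENNReal.tsum_mul_left, hc1, mul_assoc, ENNReal.inv_mul_cancel (hc0 T) (hct T),
      mul_one]
  rw [lintegral_congr e1, lintegral_indicator_const (hZ.inter hG), one_mul] at key
  rw [key, ← lintegral_const_mul' _ _ (ENNReal.natCast_ne_top M), ← one_mul (μ Z),
    ← lintegral_indicator_const hZ]
  refine lintegral_mono fun T => ?_
  by_cases hT : T ∈ Z
  · rw [indicator_of_mem hT]
    have e2 : ∑' T' : {T' | E T T'}, (Z ∩ G).indicator (fun _ => (1 : ENNReal)) T'.1 * (c T'.1)⁻¹ =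
        ∑' T' : {T' | E T T'}, G.indicator (fun _ => (1 : ENNReal)) T'.1 * (c T)⁻¹ := by
      refine tsum_congr fun T' => ?_
      rw [hcE T'.2, inter_comm, ← indicator_indicator]
      simp only [indicator, hinv _ _ T'.2 hT, if_true]
    rw [e2, ENNReal.tsum_mul_right, hcount, ← mul_assoc, ← ENNReal.mul_inv_cancel (hc0 T) (hct T)]
    gcongr
    simp only [hc]
    exact_mod_cast h T
  · rw [indicator_of_notMem hT]
    exact zero_le

end

end Invariant

/-! ### The boundary is thin -/

namespace RobinsonInflation

open SquareTiling

variable {P : Type*} {base : P → Plane} {T₀ : SquareTiling P} (I : RobinsonInflation base T₀)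
  {n m : ℕ} {T T' : transversal base T₀} {τ τ' σ : Plane × P} {v : Plane}

/-- The union of the classes of level `n` which do not meet the boundary of level `n + 1`. -/
def deep (n : ℕ) : Set (transversal base T₀) :=
  {T | ∀ T', I.rel n T T' → T' ∉ relBoundary (I.rel (n + 1))}

theorem mem_deep_of_rel (h : I.rel n T T') (hT : T ∈ I.deep n) : T' ∈ I.deep n :=
  fun _ h' => hT _ ((I.isCEER_rel n).1.1.trans h h')

theorem disjoint_boundary_deep (n : ℕ) : Disjoint I.boundary (I.deep n) :=
  disjoint_left.2 fun T h h' =>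
    h' T ((I.isCEER_rel n).1.1.refl T) (mem_iInter.1 h (n + 1))

section

variable [Finite P] (hb : InnerBase base) (haper : T₀.Aperiodic) (hrep : T₀.Repetitive)

include hb haper hrep

theorem measurableSet_deep (n : ℕ) : MeasurableSet (I.deep n) := by
  obtain ⟨V, hV, hVd⟩ := exists_countable_delone base
  have : I.deep n = (⋃ v ∈ V, shiftDomain (I.rel n) v ∩
      shift v ⁻¹' relBoundary (I.rel (n + 1)))ᶜ := by
    ext T
    simp only [deep, mem_ofPred_eq, mem_compl_iff, mem_iUnion, not_exists, mem_inter_iff,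
      mem_preimage, not_and, shiftDomain]
    constructor
    · exact fun h v _ h1 => h _ h1.2
    · intro h T' h'
      obtain ⟨v, hv, rfl⟩ := orbitRel_iff.1 ((I.isCEER_rel n).1.2.1 _ _ h')
      exact h v (hVd T.1 T.2.2 hv) ⟨hv, h'⟩
  rw [this]
  refine (MeasurableSet.biUnion hV fun v _ => ?_).compl
  exact (isOpen_shiftDomain hb haper hrep (I.isCEER_rel n).1 v).measurableSet.inter
    ((continuous_shift hb v).measurable
      (isClosed_relBoundary hb haper hrep (I.isCEER_rel (n + 1)).1).measurableSet)

/-- Tiles whose class of level `n` stays inside of a square of level `n + 1`. -/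
theorem shift_mem_deep {s : Plane} (hs : s ∈ I.pack n T) (hτ : τ ∈ T.1.tiles)
    (h1 : s.1 + 2 * I.diam n + 1 ≤ τ.1.1) (h2 : τ.1.1 + 2 * I.diam n + 2 ≤ s.1 + I.side (n + 1))
    (h3 : s.2 + 2 * I.diam n + 1 ≤ τ.1.2)
    (h4 : τ.1.2 + 2 * I.diam n + 2 ≤ s.2 + I.side (n + 1)) :
    shift (tileBase base τ) T ∈ I.deep n := by
  intro T' h
  have hor : orbitRel base T₀ T T' := by
    obtain ⟨_, ⟨ρ, hρ, rfl⟩, e⟩ := (I.isCEER_rel n).1.2.1 _ _ h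
    rw [shift_val (mem_image_of_mem _ hτ)] at hρ e
    rw [SquareTiling.translate_translate, ← neg_add] at e
    rw [mem_translate, sub_neg_eq_add] at hρ
    exact ⟨_, ⟨_, hρ, rfl⟩, by rw [e]; simp only [tileBase]; congr 2; abel⟩
  obtain ⟨_, ⟨τ', hτ', rfl⟩, rfl⟩ := orbitRel_iff.1 hor
  have hd := I.within_diam hb haper hrep hτ hτ' ((tileRel_iff hτ hτ').2 h)
  unfold Within at hd
  rw [abs_le, abs_le] at hd
  refine I.notMem_relBoundary_of_core hb haper hrep hs hτ' ?_ ?_ ?_ ?_ <;> linarith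

/-- The classes of level `n + 1` consist of at most `(120 k) ^ 2` tiles, for the integer part `k` of
`N_{n + 1} / 4`, and at least `k ^ 2` of them are in the middle of a square. -/
theorem class_finite_and_ncard_le (hn : 8 * I.diam n + 8 ≤ I.side (n + 1))
    (T : transversal base T₀) :
    {T' | I.rel (n + 1) T T'}.Finite ∧ {T' | I.rel (n + 1) T T'}.ncard ≤
      14400 * ({T' | I.rel (n + 1) T T'} ∩ I.deep n).ncard := by
  classical
  obtain ⟨τ₀, hτ₀, h0⟩ := T.2.2
  have e0 : shift (tileBase base τ₀) T = T := Subtype.ext (by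
    rw [shift_val (mem_image_of_mem _ hτ₀), h0, neg_zero, SquareTiling.translate_zero])
  set s := I.att n T τ₀ with hs
  have hsm : s ∈ I.pack n T := I.att_mem hτ₀
  have hrel : ∀ {τ}, τ ∈ T.1.tiles →
      (I.rel (n + 1) T (shift (tileBase base τ) T) ↔ I.att n T τ = s) := by
    intro τ hτ
    have := (tileRel_iff hτ₀ hτ).symm.trans (I.tileRel_succ (n := n) hτ₀ hτ)
    rw [e0] at this
    rw [this, eq_comm]
  obtain ⟨m₀, hm₀, -⟩ := id hsm
  choose m hm using fun i j => exists_tile hm₀ i j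
  dsimp only at hm
  -- The element of the orbit of `T` which belongs to the tile at `s + (i, j)`.
  set f : ℤ × ℤ → transversal base T₀ := fun k =>
    shift (tileBase base ((s.1 + k.1, s.2 + k.2), m k.1 k.2)) T with hf
  have hinj : Function.Injective f := by
    rintro ⟨i, j⟩ ⟨i', j'⟩ h
    have h1 := eq_of_tileBase hb (hm i j) (hm i' j') (eq_of_shift_eq haper hrep
      (mem_image_of_mem _ (hm i j)) (mem_image_of_mem _ (hm i' j')) h)
    simp only [Prod.mk.injEq, add_right_inj, Int.cast_inj] at h1
    exact Prod.ext h1.1.1 h1.1.2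
  have hd := I.diam_nonneg n
  obtain ⟨k, hk, hk1⟩ : ∃ k : ℕ, k = I.side (n + 1) / 4 ∧ 1 ≤ k := by
    have : (8 : ℝ) ≤ I.side (n + 1) := by linarith
    have : 8 ≤ I.side (n + 1) := by exact_mod_cast this
    exact ⟨_, rfl, by omega⟩
  have hN1 : (4 * k : ℝ) ≤ I.side (n + 1) := by
    exact_mod_cast (by omega : 4 * k ≤ I.side (n + 1))
  have hN2 : (I.side (n + 1) : ℝ) ≤ 4 * k + 3 := by
    exact_mod_cast (by omega : I.side (n + 1) ≤ 4 * k + 3)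
  have hk1' : (1 : ℝ) ≤ k := by exact_mod_cast hk1
  set b : Finset (ℤ × ℤ) := Finset.Icc (-(49 * k : ℤ)) (49 * k) ×ˢ Finset.Icc (-(49 * k : ℤ)) (49 * k)
  set c : Finset (ℤ × ℤ) := Finset.Ico (k : ℤ) (2 * k) ×ˢ Finset.Ico (k : ℤ) (2 * k)
  -- The plaque attributed to `s` has radius less than `7 N ≤ 49 k` around `s`.
  have hupper : {T' | I.rel (n + 1) T T'} ⊆ (b.image f : Finset _) := by
    intro T' h
    obtain ⟨_, ⟨τ, hτ, rfl⟩, rfl⟩ := orbitRel_iff.1 ((I.isCEER_rel _).1.2.1 _ _ h)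
    have hw := I.within_att hb haper hrep hτ (n := n)
    rw [(hrel hτ).1 h] at hw
    obtain ⟨i, j, e⟩ := exists_int hm₀ hτ
    dsimp only at e
    have e' : τ = ((s.1 + i, s.2 + j), m i j) := eq_of_fst hτ (hm i j) e
    unfold Within at hw
    rw [e] at hw
    simp only [add_sub_cancel_left, abs_le] at hw
    obtain ⟨⟨w1, w2⟩, w3, w4⟩ := hw
    have key : ∀ i : ℤ, -(6 * (I.side (n + 1) : ℝ) + 1 + I.diam n) ≤ i →
        (i : ℝ) ≤ 6 * I.side (n + 1) + 1 + I.diam n → i ∈ Finset.Icc (-(49 * k : ℤ)) (49 * k) := by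
      intro i h1 h2
      rw [Finset.mem_Icc]
      have h3 : (((-(49 * k : ℤ)) : ℤ) : ℝ) ≤ i := by push_cast; linarith
      have h4 : (i : ℝ) ≤ ((49 * k : ℤ) : ℝ) := by push_cast; linarith
      exact ⟨Int.cast_le.1 h3, Int.cast_le.1 h4⟩
    rw [Finset.coe_image]
    refine ⟨(i, j), Finset.mem_coe.2 (Finset.mem_product.2 ⟨key i w1 w2, key j w3 w4⟩), ?_⟩
    rw [hf, e']
  have hfin : {T' | I.rel (n + 1) T T'}.Finite := (Finset.finite_toSet _).subset hupper
  -- The tiles at `s + (i, j)` with `k ≤ i, j < 2 k` keep a distance of two diameters of plaques of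
  -- level `n` from the boundary of the square.
  have hlower : ((c.image f : Finset _) : Set (transversal base T₀)) ⊆
      {T' | I.rel (n + 1) T T'} ∩ I.deep n := by
    rw [Finset.coe_image]
    rintro _ ⟨⟨i, j⟩, hij, rfl⟩
    rw [Finset.mem_coe, Finset.mem_product, Finset.mem_Ico, Finset.mem_Ico] at hij
    obtain ⟨⟨i1, i2⟩, j1, j2⟩ := hij
    have i1' : (k : ℝ) ≤ i := by exact_mod_cast i1
    have j1' : (k : ℝ) ≤ j := by exact_mod_cast j1
    have i2' : (i : ℝ) + 1 ≤ 2 * k := by exact_mod_cast i2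
    have j2' : (j : ℝ) + 1 ≤ 2 * k := by exact_mod_cast j2
    refine ⟨(hrel (hm i j)).2 (I.att_eq_of_core hb haper hrep hsm (hm i j) ?_ ?_ ?_ ?_),
      I.shift_mem_deep hb haper hrep hsm (hm i j) ?_ ?_ ?_ ?_⟩ <;> dsimp only <;> linarith
  refine ⟨hfin, ?_⟩
  have h1 := ncard_le_ncard hupper (Finset.finite_toSet _)
  have h2 := ncard_le_ncard hlower (hfin.inter_of_left _)
  rw [ncard_coe_finset] at h1 h2
  rw [Finset.card_image_of_injective _ hinj, Finset.card_product, Int.card_Ico,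
    show ((2 * k - k : ℤ)).toNat = k by omega] at h2
  have h3 := h1.trans Finset.card_image_le
  rw [Finset.card_product, Int.card_Icc,
    show ((49 * k + 1 - -(49 * k) : ℤ)).toNat = 98 * k + 1 by omega] at h3
  nlinarith

/-- The boundary misses the deep part of each level, which has a fixed proportion of the mass of any
set of classes of the next level. The part of such a set outside of the deep part is a union of
classes of the level below, so that the estimate may be iterated. -/
theorem measure_boundary_inter_le {μ : Measure (transversal base T₀)} [IsProbabilityMeasure μ]
    (hμ : IsInvariantMeasure I.limitRel μ) {n₀ : ℕ}
    (hn₀ : ∀ n ≥ n₀, 8 * I.diam n + 8 ≤ I.side (n + 1)) (k : ℕ)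
    {Z : Set (transversal base T₀)} (hZ : MeasurableSet Z)
    (hinv : ∀ T T', I.rel (n₀ + k) T T' → T ∈ Z → T' ∈ Z) :
    μ.real (I.boundary ∩ Z) ≤ (1 - 1 / 14400) ^ k * μ.real Z := by
  induction k generalizing Z with
  | zero => rw [pow_zero, one_mul]; exact measureReal_mono inter_subset_right
  | succ k ih =>
    have hG := I.measurableSet_deep hb haper hrep (n₀ + k)
    have h1 : I.boundary ∩ Z = I.boundary ∩ (Z \ I.deep (n₀ + k)) := by
      ext T
      exact ⟨fun h => ⟨h.1, h.2, disjoint_left.1 (I.disjoint_boundary_deep _) h.1⟩,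
        fun h => ⟨h.1, h.2.1⟩⟩
    have h2 := ih (hZ.diff hG) fun T T' h hT => ⟨hinv _ _ (I.rel_succ h) hT.1, fun h' =>
      hT.2 (I.mem_deep_of_rel ((I.isCEER_rel _).1.1.symm h) h')⟩
    have hn := hn₀ (n₀ + k) (Nat.le_add_right _ _)
    have h3 : μ Z ≤ (14400 : ℕ) * μ (Z ∩ I.deep (n₀ + k)) :=
      measure_le_mul_measure_inter hb haper hrep (I.isCEER_rel (n₀ + k + 1)).1
        (fun A B hA hB φ h => hμ A B hA hB φ fun x => ⟨_, h x⟩)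
        (fun T => (I.class_finite_and_ncard_le hb haper hrep hn T).1) hG hZ hinv
        (fun T => (I.class_finite_and_ncard_le hb haper hrep hn T).2)
    have h4 : μ.real Z ≤ 14400 * μ.real (Z ∩ I.deep (n₀ + k)) := by
      have := ENNReal.toReal_mono (by finiteness) h3
      rw [ENNReal.toReal_mul] at this
      exact_mod_cast this
    have h5 := measureReal_inter_add_sdiff (μ := μ) (s := Z) hG
    rw [h1, pow_succ, mul_assoc]
    refine h2.trans (mul_le_mul_of_nonneg_left ?_ (by positivity))
    linarith

theorem isThin_boundary : IsThin I.limitRel I.boundary := by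
  intro μ _ hμ
  obtain ⟨n₀, hn₀⟩ := I.exists_side_ge 8 8
  have h : ∀ k : ℕ, μ.real I.boundary ≤ (1 - 1 / 14400) ^ k := by
    intro k
    have := I.measure_boundary_inter_le hb haper hrep hμ hn₀ k MeasurableSet.univ
      fun _ _ _ _ => mem_univ _
    simpa using this
  have h' : μ.real I.boundary ≤ 0 := ge_of_tendsto'
    (tendsto_pow_atTop_nhds_zero_of_lt_one (r := (1 - 1 / 14400 : ℝ)) (by norm_num) (by norm_num)) h
  exact (measureReal_eq_zero_iff).1 (le_antisymm h' measureReal_nonneg)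

end

end RobinsonInflation

theorem mainTheorem2 {P : Type*} [Finite P] (base : P → Plane)
    (hbase : ∀ m, base m ∈ interior (squareAt 1 0))
    (T₀ : SquareTiling P) (haper : T₀.Aperiodic) (hrep : T₀.Repetitive)
    (I : RobinsonInflation base T₀) :
    (IsOpenSubrelation I.limitRel ∧ IsAF I.limitRel ∧ IsMinimalRel I.limitRel) ∧
    IsThin I.limitRel I.boundary ∧ IsMeagre I.boundary ∧ IsClosed I.boundary ∧
    ∀ T ∈ I.boundary,
      {c : Set (transversal base T₀) |
        ∃ T', orbitRel base T₀ T T' ∧ c = {T'' | I.limitRel T' T''}}.encard ≤ 4 := by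
  have hb := SquareTiling.innerBase_of_interior hbase
  exact ⟨⟨I.isOpenSubrelation_limitRel, I.isAF_limitRel, I.isMinimal_limitRel hb haper hrep⟩,
    I.isThin_boundary hb haper hrep, I.isMeagre_boundary hb haper hrep,
    I.isClosed_boundary hb haper hrep, fun T _ => I.encard_classes_le hb haper hrep T⟩
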